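/- **Setting.** Fix an even $\eta_0\in C^\infty(\mathbb R;[0,1])$ supported in $[-8/5,8/5]$ with $\eta_0=1$ on $[-5/4,5/4]$; put $\eta_k(\xi)=\eta_0(2^{-k}\xi)-\eta_0(2^{-(k-1)}\xi)$ for $k\ge1$, $P_kf=\mathcal F_x^{-1}(\eta_k\mathcal F_xf)$ for $k\ge 0$, and $P_{\le K}=\sum_{k=0}^{K}P_k$. Let $w(\xi)=\xi^5$, let $\mathcal F$ be the space-time Fourier transform, and for $\phi=\phi(\xi,\tau)$ let $$\|\phi\|_{X}=\sum_{j\ge0}2^{j/2}\|\eta_j(\tau-w(\xi))\phi\|_{L^2_{\xi,\tau}} .$$ For $k\ge 0$ and a tempered distribution $f=f(x,t)$ on $\mathbb R^2$ let (with $\alpha=2$) $$\|f\|_{F_k}=\sup_{\tilde t\in\mathbb R}\big\|\mathcal F\big(\eta_0(2^{2k}(\cdot-\tilde t))f\big)\big\|_{X},\qquad \|f\|_{N_k}=\sup_{\tilde t\in\mathbb R}\big\|(\tau-w(\xi)+i2^{2k})^{-1}\mathcal F\big(\eta_0(2^{2k}(\cdot-\tilde t))f\big)\big\|_{X},$$ $$\|f\|_{F^s}=\Big(\sum_{k\ge0}2^{2ks}\|P_kf\|_{F_k}^2\Big)^{1/2},\qquad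 \|f\|_{N^s}=\Big(\sum_{k\ge0}2^{2ks}\|P_kf\|_{N_k}^2\Big)^{1/2}$$ (an $L^2$ norm being $+\infty$ if the distribution is not an $L^2$ function). For $T>0$ and $u\in L^\infty([-T,T];L^2(\mathbb R))$, $\|u\|_{F^s(T)}$ is the infimum of $\|\tilde u\|_{F^s}$ over all extensions $\tilde u\in L^\infty(\mathbb R;L^2(\mathbb R))$ of $u$, and $u\in F^s(T)$ if it is finite. For a distribution $f$ on $\mathbb R\times(-T,T)$, $\|f\|_{N^s(T)}$ is the infimum of $\|\tilde f\|_{N^s}$ over all tempered distributions $\tilde f$ on $\mathbb R^2$ that extend $f$ (and $+\infty$ if there is none). **Proposition.** Let $s>1$. There is a constant $C$, depending only on $s$ and $\eta_0$, such that for all $T\in(0,1]$ and all $u,v\in F^s(T)$ the products $$\partial_x(u\,\partial_x^2v):=\lim_{K\to\infty}\partial_x\big(P_{\le K}u\;\partial_x^2P_{\le K}v\big),\qquad \partial_xu\,\partial_x^2v:=\lim_{K\to\infty}\partial_xP_{\le K}u\;\partial_x^2P_{\le K}v$$ exist in the sense of distributions on $\mathbb R\times(-T,T)$, and $$\|\partial_x(u\,\partial_x^2v)\|_{N^s(T)}\le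 C\big(\|u\|_{F^s(T)}\|v\|_{F^1(T)}+\|u\|_{F^1(T)}\|v\|_{F^s(T)}\big),$$ $$\|\partial_xu\,\partial_x^2v\|_{N^s(T)}\le C\big(\|u\|_{F^s(T)}\|v\|_{F^1(T)}+\|u\|_{F^1(T)}\|v\|_{F^s(T)}\big).$$ If moreover $u,v\in F^2(T)$ (which is automatic when $s\ge2$), the same two bounds, with the same $C$, hold when the infimum defining the $N^s(T)$ norm is restricted to extensions $\tilde f\in L^\infty(\mathbb R;H^{-1}(\mathbb R))$. -/

import Mathlib

open MeasureTheory Filter Topology SchwartzMap FourierTransform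
open scoped NNReal ENNReal ContDiff

noncomputable section

namespace ShortTime

/-- The space-time plane. A point is `!₂[x, t]`; on the Fourier side it is `!₂[ξ, τ]`. -/
abbrev Plane : Type := EuclideanSpace ℝ (Fin 2)

/-- The space `L²(ℝ)` of complex-valued functions of the space variable. -/
abbrev L2 : Type := Lp ℂ 2 (volume : Measure ℝ)

/-! ### Cutoffs and frequency projections -/

/-- The even smooth cutoff `η₀ : ℝ → [0,1]`, supported in `[-8/5, 8/5]`, equal to one on
`[-5/4, 5/4]`. -/
structure IsCutoff (η : ℝ → ℝ) : Prop where
  smooth : ContDiff ℝ ∞ η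
  even : ∀ r, η (-r) = η r
  mem_Icc : ∀ r, η r ∈ Set.Icc (0 : ℝ) 1
  support_subset : Function.support η ⊆ Set.Icc (-(8 / 5)) (8 / 5)
  eq_one : ∀ r ∈ Set.Icc (-(5 / 4) : ℝ) (5 / 4), η r = 1

/-- The dyadic partition of unity: `η₀` for `k = 0` and `η₀(2⁻ᵏ r) - η₀(2⁻⁽ᵏ⁻¹⁾ r)` for `k ≥ 1`. -/
def etaK (η : ℝ → ℝ) : ℕ → ℝ → ℝ
  | 0, r => η r
  | k + 1, r => η (r / 2 ^ (k + 1)) - η (r / 2 ^ k)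

/-- `η_{≤ K} = ∑_{k ≤ K} η_k`. -/
def etaLe (η : ℝ → ℝ) (K : ℕ) (r : ℝ) : ℝ :=
  ∑ k ∈ Finset.range (K + 1), etaK η k r

/-- The modulation `τ - w(ξ)`, `w(ξ) = ξ⁵`. Mathlib's Fourier transform has the kernel
`exp(-2πi ⟪z, ζ⟫)`, so that the frequencies are `ξ = 2π ζ₀` and `τ = 2π ζ₁`. With the unitary
normalization of the Fourier transform with kernel `exp(-i(xξ + tτ))`, this substitution does not
change any `L²` norm. -/
def modulation (ζ : Plane) : ℝ :=
  2 * Real.pi * ζ 1 - (2 * Real.pi * ζ 0) ^ 5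

/-- The Littlewood-Paley projection `P_k` in the space variable, on tempered distributions of
`(x, t)`. -/
def projK (η : ℝ → ℝ) (k : ℕ) (f : 𝓢'(Plane, ℂ)) : 𝓢'(Plane, ℂ) :=
  TemperedDistribution.fourierMultiplierCLM ℂ (fun ζ : Plane ↦ ((etaK η k (2 * Real.pi * ζ 0) : ℝ) : ℂ)) f

/-- Multiplication by `η₀(2^{α k}(t - t₀))`. -/
def timeLocalize (η : ℝ → ℝ) (α : ℝ) (k : ℕ) (t₀ : ℝ) (f : 𝓢'(Plane, ℂ)) : 𝓢'(Plane, ℂ) :=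
  TemperedDistribution.smulLeftCLM ℂ (fun z : Plane ↦ ((η ((2 : ℝ) ^ (α * k) * (z 1 - t₀)) : ℝ) : ℂ)) f

/-! ### The spaces `X_k`, `F_k`, `N_k`, `F^s`, `N^s` -/

/-- The `L²(ℝ²)` norm of a tempered distribution, `∞` if it is not given by an `L²` function. -/
def l2Norm (φ : 𝓢'(Plane, ℂ)) : ℝ≥0∞ :=
  ⨅ (g : Lp ℂ 2 (volume : Measure Plane)) (_ : (g : 𝓢'(Plane, ℂ)) = φ), ‖g‖ₑ

theorem l2Norm_coe (g : Lp ℂ 2 (volume : Measure Plane)) :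
    l2Norm (g : 𝓢'(Plane, ℂ)) = ‖g‖ₑ := by
  unfold l2Norm
  refine le_antisymm (iInf₂_le_of_le g rfl le_rfl) (le_iInf₂ fun h hh ↦ ?_)
  have : h = g := by
    have hk := Lp.ker_toTemperedDistributionCLM_eq_bot (F := ℂ) (p := 2)
      (μ := (volume : Measure Plane))
    exact LinearMap.ker_eq_bot.mp hk hh
  rw [this]

/-- `‖φ‖_{X_k} = ∑_j 2^{j/2} ‖η_j(τ - w(ξ)) φ‖_{L²}`. It is used below only for `φ` supported in
`I_k × ℝ`. -/
def xNorm (η : ℝ → ℝ) (φ : 𝓢'(Plane, ℂ)) : ℝ≥0∞ :=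
  ∑' j : ℕ, (2 : ℝ≥0∞) ^ ((j : ℝ) / 2) *
    l2Norm (TemperedDistribution.smulLeftCLM ℂ (fun ζ : Plane ↦ ((etaK η j (modulation ζ) : ℝ) : ℂ)) φ)

/-- `‖f‖_{F_{k,α}} = sup_{t₀} ‖ℱ(η₀(2^{α k}(· - t₀)) f)‖_{X_k}`. -/
def fkNorm (η : ℝ → ℝ) (α : ℝ) (k : ℕ) (f : 𝓢'(Plane, ℂ)) : ℝ≥0∞ :=
  ⨆ t₀ : ℝ, xNorm η (𝓕 (timeLocalize η α k t₀ f))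

/-- `‖f‖_{N_{k,α}} = sup_{t₀} ‖(τ - w(ξ) + i 2^{α k})⁻¹ ℱ(η₀(2^{α k}(· - t₀)) f)‖_{X_k}`. -/
def nkNorm (η : ℝ → ℝ) (α : ℝ) (k : ℕ) (f : 𝓢'(Plane, ℂ)) : ℝ≥0∞ :=
  ⨆ t₀ : ℝ, xNorm η (TemperedDistribution.smulLeftCLM ℂ
    (fun ζ : Plane ↦ ((modulation ζ : ℂ) + Complex.I * (((2 : ℝ) ^ (α * k) : ℝ) : ℂ))⁻¹)
    (𝓕 (timeLocalize η α k t₀ f)))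

/-- `‖f‖_{F^s_α} = (∑_k 2^{2ks} ‖P_k f‖²_{F_{k,α}})^{1/2}`. -/
def fNorm (η : ℝ → ℝ) (α s : ℝ) (f : 𝓢'(Plane, ℂ)) : ℝ≥0∞ :=
  (∑' k : ℕ, (2 : ℝ≥0∞) ^ (2 * (k : ℝ) * s) * fkNorm η α k (projK η k f) ^ 2) ^ (1 / 2 : ℝ)

/-- `‖f‖_{N^s_α} = (∑_k 2^{2ks} ‖P_k f‖²_{N_{k,α}})^{1/2}`. -/
def nNorm (η : ℝ → ℝ) (α s : ℝ) (f : 𝓢'(Plane, ℂ)) : ℝ≥0∞ :=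
  (∑' k : ℕ, (2 : ℝ≥0∞) ^ (2 * (k : ℝ) * s) * nkNorm η α k (projK η k f) ^ 2) ^ (1 / 2 : ℝ)

/-! ### Localization in time -/

/-- The tempered distribution `f` is the element `U` of `L^∞(ℝ; L²(ℝ))`. -/
def Represents (f : 𝓢'(Plane, ℂ)) (U : ℝ → L2) : Prop :=
  MemLp U ⊤ volume ∧ ∀ φ : 𝓢(Plane, ℂ), f φ = ∫ t : ℝ, ∫ x : ℝ, U t x * φ !₂[x, t]

/-- The norm of `F^s_α(T)`: the infimum of `‖f‖_{F^s_α}` over the `f` in `L^∞(ℝ; L²(ℝ))` that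
extend `u`. Only the values of `u` on `[-T, T]` matter. -/
def fNormT (η : ℝ → ℝ) (α s T : ℝ) (u : ℝ → L2) : ℝ≥0∞ :=
  ⨅ (f : 𝓢'(Plane, ℂ))
    (_ : ∃ U : ℝ → L2, Represents f U ∧ U =ᵐ[volume.restrict (Set.Icc (-T) T)] u),
    fNorm η α s f

/-- `u ∈ F^s_α(T)`. -/
def MemFT (η : ℝ → ℝ) (α s T : ℝ) (u : ℝ → L2) : Prop :=
  MemLp u ⊤ (volume.restrict (Set.Icc (-T) T)) ∧ fNormT η α s T u < ⊤

/-- The set `L^∞(ℝ; H^{-1}(ℝ))` of the tempered distributions `f` with `J_x^{-1} f` in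
`L^∞(ℝ; L²(ℝ))`. -/
def LinftyHm1 : Set 𝓢'(Plane, ℂ) :=
  {f | ∃ U : ℝ → L2, Represents
    (TemperedDistribution.fourierMultiplierCLM ℂ
      (fun ζ : Plane ↦ (((1 + (2 * Real.pi * ζ 0) ^ 2) ^ (-(1 / 2) : ℝ) : ℝ) : ℂ)) f) U}

/-- On `ℝ × (-T, T)`, the tempered distribution `f` is the limit in the sense of distributions of
the functions `(x, t) ↦ g K t x` as `K → ∞`. -/
def IsSlabLimit (T : ℝ) (g : ℕ → ℝ → ℝ → ℂ) (f : 𝓢'(Plane, ℂ)) : Prop :=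
  ∀ φ : 𝓢(Plane, ℂ), HasCompactSupport φ → tsupport φ ⊆ {z : Plane | z 1 ∈ Set.Ioo (-T) T} →
    Tendsto (fun K ↦ ∫ t in Set.Icc (-T) T, ∫ x : ℝ, g K t x * φ !₂[x, t]) atTop (𝓝 (f φ))

/-- The norm in `N^s_α(T)` of the distributional limit on `ℝ × (-T, T)` of the functions `g K`:
the infimum of `‖f‖_{N^s_α}` over the `f` in the class `A` of distributions on the plane that
extend this limit. It is `∞` if the limit does not exist. -/
def nNormT (η : ℝ → ℝ) (α s T : ℝ) (A : Set 𝓢'(Plane, ℂ)) (g : ℕ → ℝ → ℝ → ℂ) : ℝ≥0∞ :=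
  ⨅ (f : 𝓢'(Plane, ℂ)) (_ : f ∈ A ∧ IsSlabLimit T g f), nNorm η α s f

/-! ### The nonlinear terms -/

/-- The smooth function `P_{≤ K} h` for `h ∈ L²(ℝ)`. -/
def projLe (η : ℝ → ℝ) (K : ℕ) (h : L2) : ℝ → ℂ :=
  𝓕⁻ (fun ξ : ℝ ↦ ((etaLe η K (2 * Real.pi * ξ) : ℝ) : ℂ) * (𝓕 h : L2) ξ)

/-- `∂_x(P_{≤ K} u · ∂_x² P_{≤ K} v)`, whose limit as `K → ∞` is `∂_x(u ∂_x² v)`. -/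
def prodDiv (η : ℝ → ℝ) (u v : ℝ → L2) (K : ℕ) (t x : ℝ) : ℂ :=
  deriv (fun y ↦ projLe η K (u t) y * iteratedDeriv 2 (projLe η K (v t)) y) x

/-- `∂_x P_{≤ K} u · ∂_x² P_{≤ K} v`, whose limit as `K → ∞` is `∂_x u ∂_x² v`. -/
def prodNonDiv (η : ℝ → ℝ) (u v : ℝ → L2) (K : ℕ) (t x : ℝ) : ℂ :=
  deriv (projLe η K (u t)) x * iteratedDeriv 2 (projLe η K (v t)) x

/-! ### The symbols have temperate growth

`TemperedDistribution.smulLeftCLM` and `TemperedDistribution.fourierMultiplierCLM` are the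
multiplication operator and the Fourier multiplier for symbols of temperate growth. All symbols
used above are of this kind. -/

theorem coord_hasTemperateGrowth (i : Fin 2) :
    (fun ζ : Plane ↦ ζ i).HasTemperateGrowth :=
  (EuclideanSpace.proj (𝕜 := ℝ) i : Plane →L[ℝ] ℝ).hasTemperateGrowth

theorem ofReal_hasTemperateGrowth : (fun r : ℝ ↦ (r : ℂ)).HasTemperateGrowth :=
  Function.Complex.hasTemperateGrowth_ofReal

theorem modulation_hasTemperateGrowth : modulation.HasTemperateGrowth := by
  have h0 := coord_hasTemperateGrowth 0
  have h1 := coord_hasTemperateGrowth 1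
  have c : (fun _ : Plane ↦ 2 * Real.pi).HasTemperateGrowth :=
    Function.HasTemperateGrowth.const _
  exact (c.mul h1).sub ((c.mul h0).pow 5)

theorem IsCutoff.comp_mul_hasTemperateGrowth {η : ℝ → ℝ} (hη : IsCutoff η) (c t₀ : ℝ) :
    (fun r : ℝ ↦ η (c * (r - t₀))).HasTemperateGrowth := by
  have h : η.HasTemperateGrowth := by
    refine HasCompactSupport.hasTemperateGrowth ?_ hη.smooth
    exact HasCompactSupport.of_support_subset_isCompact isCompact_Icc hη.support_subset
  have hc : (fun _ : ℝ ↦ c).HasTemperateGrowth := Function.HasTemperateGrowth.const _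
  have ht : (fun _ : ℝ ↦ t₀).HasTemperateGrowth := Function.HasTemperateGrowth.const _
  exact h.comp (hc.mul (Function.HasTemperateGrowth.id'.sub ht))

theorem IsCutoff.etaK_hasTemperateGrowth {η : ℝ → ℝ} (hη : IsCutoff η) (k : ℕ) :
    (etaK η k).HasTemperateGrowth := by
  have h : ∀ j : ℕ, (fun r : ℝ ↦ η (r / 2 ^ j)).HasTemperateGrowth := fun j ↦ by
    simpa [div_eq_inv_mul] using hη.comp_mul_hasTemperateGrowth ((2 : ℝ) ^ j)⁻¹ 0
  cases k with
  | zero =>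
    have h0 := h 0
    simp only [pow_zero, div_one] at h0
    exact h0
  | succ k => exact (h (k + 1)).sub (h k)

theorem projK_symbol_hasTemperateGrowth {η : ℝ → ℝ} (hη : IsCutoff η) (k : ℕ) :
    (fun ζ : Plane ↦ ((etaK η k (2 * Real.pi * ζ 0) : ℝ) : ℂ)).HasTemperateGrowth := by
  have c : (fun _ : Plane ↦ 2 * Real.pi).HasTemperateGrowth :=
    Function.HasTemperateGrowth.const _
  exact ofReal_hasTemperateGrowth.comp
    ((hη.etaK_hasTemperateGrowth k).comp (c.mul (coord_hasTemperateGrowth 0)))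

theorem timeLocalize_symbol_hasTemperateGrowth {η : ℝ → ℝ} (hη : IsCutoff η) (c t₀ : ℝ) :
    (fun z : Plane ↦ ((η (c * (z 1 - t₀)) : ℝ) : ℂ)).HasTemperateGrowth :=
  ofReal_hasTemperateGrowth.comp
    ((hη.comp_mul_hasTemperateGrowth c t₀).comp (coord_hasTemperateGrowth 1))

theorem xNorm_symbol_hasTemperateGrowth {η : ℝ → ℝ} (hη : IsCutoff η) (j : ℕ) :
    (fun ζ : Plane ↦ ((etaK η j (modulation ζ) : ℝ) : ℂ)).HasTemperateGrowth :=
  ofReal_hasTemperateGrowth.comp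
    ((hη.etaK_hasTemperateGrowth j).comp modulation_hasTemperateGrowth)

theorem resolvent_symbol_hasTemperateGrowth {c : ℝ} (hc : 0 < c) :
    (fun ζ : Plane ↦ ((modulation ζ : ℂ) + Complex.I * (c : ℂ))⁻¹).HasTemperateGrowth := by
  have h1 : (fun r : ℝ ↦ (1 + ‖r‖ ^ 2) ^ (-1 : ℝ)).HasTemperateGrowth :=
    Function.hasTemperateGrowth_one_add_norm_sq_rpow ℝ (-1)
  have hm : (fun ζ : Plane ↦ c⁻¹ * modulation ζ).HasTemperateGrowth :=
    (Function.HasTemperateGrowth.const c⁻¹).mul modulation_hasTemperateGrowth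
  have h2 := ofReal_hasTemperateGrowth.comp (h1.comp hm)
  have h3 : (fun ζ : Plane ↦ ((modulation ζ : ℂ) - Complex.I * (c : ℂ)) * ((c : ℂ) ^ 2)⁻¹)
      |>.HasTemperateGrowth :=
    ((ofReal_hasTemperateGrowth.comp modulation_hasTemperateGrowth).sub
      (Function.HasTemperateGrowth.const (Complex.I * (c : ℂ)))).mul
      (Function.HasTemperateGrowth.const (((c : ℂ) ^ 2)⁻¹))
  suffices h : (fun ζ : Plane ↦ ((modulation ζ : ℂ) + Complex.I * (c : ℂ))⁻¹) =
      fun ζ ↦ ((modulation ζ : ℂ) - Complex.I * (c : ℂ)) * ((c : ℂ) ^ 2)⁻¹ *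
        (((1 + ‖c⁻¹ * modulation ζ‖ ^ 2) ^ (-1 : ℝ) : ℝ) : ℂ) by
    rw [h]
    exact h3.mul h2
  funext ζ
  have hc' : (c : ℂ) ≠ 0 := by exact_mod_cast hc.ne'
  have hpos : 0 < modulation ζ ^ 2 + c ^ 2 := by positivity
  have hne : (modulation ζ : ℂ) ^ 2 + (c : ℂ) ^ 2 ≠ 0 := by exact_mod_cast hpos.ne'
  have hfac : ((modulation ζ : ℂ) + Complex.I * c) * ((modulation ζ : ℂ) - Complex.I * c)
      = (modulation ζ : ℂ) ^ 2 + (c : ℂ) ^ 2 := by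
    linear_combination (-(c : ℂ) ^ 2) * Complex.I_sq
  have hne' : (modulation ζ : ℂ) + Complex.I * c ≠ 0 := by
    intro h
    rw [h, zero_mul] at hfac
    exact hne hfac.symm
  have hne'' : (modulation ζ : ℂ) - Complex.I * c ≠ 0 := by
    intro h
    rw [h, mul_zero] at hfac
    exact hne hfac.symm
  have e : (((1 + ‖c⁻¹ * modulation ζ‖ ^ 2) ^ (-1 : ℝ) : ℝ) : ℂ)
      = (c : ℂ) ^ 2 * ((modulation ζ : ℂ) ^ 2 + (c : ℂ) ^ 2)⁻¹ := by
    rw [Real.rpow_neg_one, Real.norm_eq_abs, sq_abs]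
    push_cast
    rw [add_comm] at hne
    field_simp
    rw [add_comm ((modulation ζ : ℂ) ^ 2), div_self hne]
  rw [e, ← hfac]
  field_simp

theorem LinftyHm1_symbol_hasTemperateGrowth :
    (fun ζ : Plane ↦
      (((1 + (2 * Real.pi * ζ 0) ^ 2) ^ (-(1 / 2) : ℝ) : ℝ) : ℂ)).HasTemperateGrowth := by
  have c : (fun _ : Plane ↦ 2 * Real.pi).HasTemperateGrowth :=
    Function.HasTemperateGrowth.const _
  have h := ofReal_hasTemperateGrowth.comp
    ((Function.hasTemperateGrowth_one_add_norm_sq_rpow ℝ (-(1 / 2))).comp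
      (c.mul (coord_hasTemperateGrowth 0)))
  convert h using 1
  funext ζ
  simp [sq_abs]

end ShortTime

end

noncomputable section

namespace ShortTime

/-! ### Elementary properties of the dyadic cutoffs -/

/-! The extensions of `u` and `v` are cut into blocks of frequency `2^k₁` and `2^k₂`. Put `n = max
k₁ k₂` and let `2^k` be the output frequency. The `N_k` norm looks at the product on time intervals
of length about `4^(-k)`, while the factors are controlled on intervals of length about `4^(-k₁)`
and `4^(-k₂)`. A partition of unity in time (`block_sum`) therefore splits the interval into
`O(4^(n-k))` cells of length about `4^(-n)` (boundedly many if `k ≥ n`). On each cell both factors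
coincide with space-time functions whose `X` norms are bounded by the `F_k` norms. The three
derivatives cost at most `2^(3n)`.

If `k₁` and `k₂` differ by at least three, the curves `τ = ξ⁵` are transversal: the derivative of
`P⁵ + (X - P)⁵` is comparable to `2^(4n)`. This gives an `L²` bilinear bound with gain `2^(-2n)`
(`n2_conv_transversal`). The output has `|n - k| ≤ 2`, the resolvent gains `2^(-k)` (`tsum_res_le`),
and the total is bounded.

If `k₁` and `k₂` are comparable, the factorization `(P+Q)⁵ - P⁵ - Q⁵ = 5PQ(P²+PQ+Q²)(P+Q)` forces
one modulation to be at least of order `2^(4n)|ξ|` (`resonance_le_max`). A power `θ < 1/2` of this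
gains `2^(-4θn)|ξ|^(-θ)`, which is square integrable on the output band. The time cutoffs of length
`4^(-n)` gain another `2^(-2θn)` (`n2_conv_resonant`). The outcome is the weight `2^((5-6θ)n -
(3/2+θ)k)`, close to `2^(2n-2k)` for `θ` close to `1/2`. Against `2^(ks) 2^(-ns) 2^(-n)` it can be
summed precisely because `s > 1`; the choice is `θ = 1/2 - σ/14` with `0 < σ ≤ min (s-1) 1`
(`exists_seqNorm_para_le`).

To connect this with distributions, a finite `F_k` norm is shown to yield an actual function on the
Fourier side, whose slices in time are the slices of the extension (`exists_slice_eq`, `locRep`).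
Each product of two blocks, multiplied by `η(t)²`, is the inverse transform of an integrable
function. A crude growth bound for a single block makes the double series converge in the tempered
distributions (`exists_isDistSum`). Since `η = 1` on `[-1, 1]`, its sum extends the limit of the
truncated products on the slab (`isSlabLimit`).

The right-hand side contains infima for two different norms, and these need not be approached by the
same extension. All extensions agree on the slab, so the extension may be chosen separately for each
pair of blocks (`pick`): a nearly optimal one in `F^s` for the dominating factor, a nearly optimal
one in `F^1` for the other. Beyond a large frequency `K` a third, fixed pair of extensions is used,
whose contribution is at most `ε`. The result then differs from the product of two fixed extensions
by finitely many blocks only. If these two lie in `F^2`, their slices are bounded in `H²`, and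
`J⁻¹(∂u ∂²v)` and `J⁻¹∂(u ∂²v)` are bounded in `L²` (`mem_LinftyHm1_of_blocks`). -/

theorem etaLe_eq (η : ℝ → ℝ) (K : ℕ) (r : ℝ) : etaLe η K r = η (r / 2 ^ K) := by
  unfold etaLe
  induction K with
  | zero => simp [etaK]
  | succ K ih => rw [Finset.sum_range_succ, ih]; simp [etaK]

theorem IsCutoff.eq_zero {η : ℝ → ℝ} (hη : IsCutoff η) {r : ℝ} (hr : 8 / 5 < |r|) : η r = 0 := by
  by_contra h
  have := hη.support_subset (Function.mem_support.mpr h)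
  rw [Set.mem_Icc, ← abs_le] at this
  linarith

theorem IsCutoff.eq_one' {η : ℝ → ℝ} (hη : IsCutoff η) {r : ℝ} (hr : |r| ≤ 5 / 4) : η r = 1 :=
  hη.eq_one r (abs_le.mp hr)

theorem abs_div_two_pow (r : ℝ) (k : ℕ) : |r / 2 ^ k| = |r| / 2 ^ k := by
  rw [abs_div, abs_of_pos (by positivity : (0 : ℝ) < 2 ^ k)]

/-- Either `|r| / 2^k > 8/5` and the subtracted term vanishes, or `|r| / 2^(k+1) ≤ 4/5` and the
first term is one. This gives `0 ≤ η_k ≤ 1` without any monotonicity of `η`. -/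
theorem IsCutoff.etaK_succ_cases {η : ℝ → ℝ} (hη : IsCutoff η) (k : ℕ) (r : ℝ) :
    (etaK η (k + 1) r = 1 - η (r / 2 ^ k)) ∨ (etaK η (k + 1) r = η (r / 2 ^ (k + 1))) := by
  by_cases h : 8 / 5 < |r / 2 ^ k|
  · right
    simp [etaK, hη.eq_zero h]
  · left
    have : |r / 2 ^ (k + 1)| ≤ 5 / 4 := by
      rw [pow_succ, ← div_div, abs_div, abs_of_pos (by norm_num : (0 : ℝ) < 2)]
      linarith
    simp [etaK, hη.eq_one' this]

theorem IsCutoff.etaK_nonneg {η : ℝ → ℝ} (hη : IsCutoff η) (k : ℕ) (r : ℝ) : 0 ≤ etaK η k r := by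
  cases k with
  | zero => exact (hη.mem_Icc r).1
  | succ k =>
    rcases hη.etaK_succ_cases k r with h | h <;> rw [h]
    · linarith [(hη.mem_Icc (r / 2 ^ k)).2]
    · exact (hη.mem_Icc _).1

theorem IsCutoff.etaK_le_one {η : ℝ → ℝ} (hη : IsCutoff η) (k : ℕ) (r : ℝ) : etaK η k r ≤ 1 := by
  cases k with
  | zero => exact (hη.mem_Icc r).2
  | succ k =>
    rcases hη.etaK_succ_cases k r with h | h <;> rw [h]
    · linarith [(hη.mem_Icc (r / 2 ^ k)).1]
    · exact (hη.mem_Icc _).2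

theorem IsCutoff.etaK_upper {η : ℝ → ℝ} (hη : IsCutoff η) {k : ℕ} {r : ℝ}
    (h : etaK η k r ≠ 0) : |r| ≤ 8 / 5 * 2 ^ k := by
  by_contra hr
  push Not at hr
  apply h
  cases k with
  | zero => simpa [etaK] using hη.eq_zero (by simpa using hr)
  | succ k =>
    have h2 : (0 : ℝ) < 2 ^ k := by positivity
    have h1 : 8 / 5 < |r / 2 ^ (k + 1)| := by
      rw [abs_div_two_pow, lt_div_iff₀ (by positivity)]; exact hr
    have h3 : 8 / 5 < |r / 2 ^ k| := by
      rw [abs_div_two_pow, lt_div_iff₀ (by positivity)]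
      rw [pow_succ] at hr
      linarith
    simp [etaK, hη.eq_zero h1, hη.eq_zero h3]

theorem IsCutoff.etaK_lower {η : ℝ → ℝ} (hη : IsCutoff η) {k : ℕ} (hk : 1 ≤ k) {r : ℝ}
    (h : etaK η k r ≠ 0) : 5 / 8 * 2 ^ k ≤ |r| := by
  by_contra hr
  push Not at hr
  apply h
  obtain ⟨k, rfl⟩ : ∃ j, k = j + 1 := ⟨k - 1, by omega⟩
  have h2 : (0 : ℝ) < 2 ^ k := by positivity
  rw [pow_succ] at hr
  have h1 : |r / 2 ^ (k + 1)| ≤ 5 / 4 := by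
    rw [abs_div_two_pow, div_le_iff₀ (by positivity), pow_succ]
    linarith
  have h3 : |r / 2 ^ k| ≤ 5 / 4 := by
    rw [abs_div_two_pow, div_le_iff₀ (by positivity)]
    linarith
  simp [etaK, hη.eq_one' h1, hη.eq_one' h3]

theorem IsCutoff.etaK_mul_eq_zero {η : ℝ → ℝ} (hη : IsCutoff η) {j k : ℕ} (h : j + 2 ≤ k)
    (r : ℝ) : etaK η j r * etaK η k r = 0 := by
  by_contra hne
  have hj := hη.etaK_upper (left_ne_zero_of_mul hne)
  have hk := hη.etaK_lower (by omega) (right_ne_zero_of_mul hne)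
  have : (2 : ℝ) ^ (j + 2) ≤ 2 ^ k := pow_le_pow_right₀ (by norm_num) h
  rw [pow_add] at this
  have h2 : (0 : ℝ) < 2 ^ j := by positivity
  linarith

theorem IsCutoff.etaLe_eventually {η : ℝ → ℝ} (hη : IsCutoff η) (r : ℝ) :
    ∀ᶠ K in atTop, etaLe η K r = 1 := by
  have h : Tendsto (fun K : ℕ ↦ |r| / 2 ^ K) atTop (𝓝 0) := by
    have := (tendsto_pow_atTop_nhds_zero_of_lt_one (r := (1 / 2 : ℝ)) (by norm_num)
      (by norm_num)).const_mul |r|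
    simp only [mul_zero] at this
    refine this.congr fun K ↦ ?_
    simp [div_eq_mul_inv]
  filter_upwards [h.eventually_lt_const (by norm_num : (0 : ℝ) < 5 / 4)] with K hK
  rw [etaLe_eq]
  apply hη.eq_one'
  rw [abs_div_two_pow]
  exact hK.le

theorem IsCutoff.etaLe_mem {η : ℝ → ℝ} (hη : IsCutoff η) (K : ℕ) (r : ℝ) :
    etaLe η K r ∈ Set.Icc (0 : ℝ) 1 := by
  rw [etaLe_eq]; exact hη.mem_Icc _

theorem IsCutoff.hasSum_etaK {η : ℝ → ℝ} (hη : IsCutoff η) (r : ℝ) :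
    HasSum (fun k ↦ etaK η k r) 1 := by
  rw [hasSum_iff_tendsto_nat_of_nonneg (fun k ↦ hη.etaK_nonneg k r)]
  rw [← tendsto_add_atTop_iff_nat 1]
  exact tendsto_const_nhds.congr' ((hη.etaLe_eventually r).mono fun K hK ↦ hK.symm)

theorem IsCutoff.tsum_ofReal_etaK {η : ℝ → ℝ} (hη : IsCutoff η) (r : ℝ) :
    ∑' k, ENNReal.ofReal (etaK η k r) = 1 := by
  rw [← ENNReal.ofReal_tsum_of_nonneg (fun k ↦ hη.etaK_nonneg k r) (hη.hasSum_etaK r).summable,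
    (hη.hasSum_etaK r).tsum_eq, ENNReal.ofReal_one]

theorem IsCutoff.continuous_etaK {η : ℝ → ℝ} (hη : IsCutoff η) (k : ℕ) :
    Continuous (etaK η k) := by
  have h := hη.smooth.continuous
  cases k with
  | zero => exact h
  | succ k => exact (h.comp (by fun_prop)).sub (h.comp (by fun_prop))

/-- At most two consecutive cutoffs overlap. -/
theorem IsCutoff.etaLe_sq_le {η : ℝ → ℝ} (hη : IsCutoff η) (K : ℕ) (r : ℝ) :
    etaLe η K r ^ 2 ≤ 3 * ∑ k ∈ Finset.range (K + 1), etaK η k r ^ 2 := by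
  -- The subtracted square pays for the cross term with the next cutoff: `2ab ≤ a² + b²`, and by
  -- disjointness of supports only the last cutoff meets the new one.
  suffices h : etaLe η K r ^ 2 ≤ 3 * ∑ k ∈ Finset.range (K + 1), etaK η k r ^ 2 - etaK η K r ^ 2 by
    nlinarith [sq_nonneg (etaK η K r)]
  unfold etaLe
  induction K with
  | zero => simp; nlinarith [sq_nonneg (etaK η 0 r)]
  | succ K ih =>
    rw [Finset.sum_range_succ, Finset.sum_range_succ _ (K + 1)]
    have h : (∑ k ∈ Finset.range (K + 1), etaK η k r) * etaK η (K + 1) r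
        = etaK η K r * etaK η (K + 1) r := by
      rw [Finset.sum_mul, Finset.sum_range_succ, Finset.sum_eq_zero, zero_add]
      intro k hk
      exact hη.etaK_mul_eq_zero (by simp at hk; omega) r
    nlinarith [sq_nonneg (etaK η K r - etaK η (K + 1) r)]

/-! ### `L²` norms of nonnegative functions -/

section N2

variable {α β : Type*} [MeasureSpace α] [MeasureSpace β]

/-- The `L²` norm of a nonnegative function. -/
def n2 (F : α → ℝ≥0∞) : ℝ≥0∞ := (∫⁻ x, F x ^ 2) ^ (1 / 2 : ℝ)

theorem sq_rpow_half (a : ℝ≥0∞) : (a ^ 2) ^ (1 / 2 : ℝ) = a := by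
  rw [← ENNReal.rpow_natCast, ← ENNReal.rpow_mul]; norm_num

theorem rpow_half_sq (a : ℝ≥0∞) : (a ^ (1 / 2 : ℝ)) ^ 2 = a := by
  rw [← ENNReal.rpow_natCast, ← ENNReal.rpow_mul]; norm_num

theorem n2_sq (F : α → ℝ≥0∞) : n2 F ^ 2 = ∫⁻ x, F x ^ 2 := rpow_half_sq _

theorem le_of_sq_le {a b : ℝ≥0∞} (h : a ^ 2 ≤ b ^ 2) : a ≤ b :=
  (ENNReal.pow_le_pow_left_iff two_ne_zero).mp h

theorem n2_le_iff {F : α → ℝ≥0∞} {a : ℝ≥0∞} : n2 F ≤ a ↔ ∫⁻ x, F x ^ 2 ≤ a ^ 2 := by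
  rw [← n2_sq]
  exact (ENNReal.pow_le_pow_left_iff two_ne_zero).symm

theorem n2_mono_ae {F G : α → ℝ≥0∞} (h : ∀ᵐ x, F x ≤ G x) : n2 F ≤ n2 G := by
  rw [n2_le_iff, n2_sq]
  exact lintegral_mono_ae (h.mono fun x hx ↦ pow_le_pow_left' hx 2)

theorem n2_mono {F G : α → ℝ≥0∞} (h : ∀ x, F x ≤ G x) : n2 F ≤ n2 G :=
  n2_mono_ae (ae_of_all _ h)

theorem n2_congr_ae {F G : α → ℝ≥0∞} (h : F =ᵐ[volume] G) : n2 F = n2 G :=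
  le_antisymm (n2_mono_ae (h.mono fun _ hx ↦ hx.le)) (n2_mono_ae (h.mono fun _ hx ↦ hx.ge))

theorem n2_zero : n2 (fun _ : α ↦ (0 : ℝ≥0∞)) = 0 := by
  simp [n2]

theorem n2_const_mul (c : ℝ≥0∞) (F : α → ℝ≥0∞) (hF : Measurable F) :
    n2 (fun x ↦ c * F x) = c * n2 F := by
  unfold n2
  simp_rw [mul_pow]
  rw [lintegral_const_mul _ (hF.pow_const 2), ENNReal.mul_rpow_of_nonneg _ _ (by norm_num),
    sq_rpow_half]

theorem lintegral_mul_le_n2 {F G : α → ℝ≥0∞} (hF : AEMeasurable F) (hG : AEMeasurable G) :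
    ∫⁻ x, F x * G x ≤ n2 F * n2 G := by
  have := ENNReal.lintegral_mul_le_Lp_mul_Lq volume Real.HolderConjugate.two_two hF hG
  simpa [n2] using this

/-- Minkowski's integral inequality. The square of the inner integral is a double integral over `ν`;
Tonelli moves the `x` integral inside, where Cauchy–Schwarz applies. -/
theorem n2_lintegral_le {γ : Type*} [MeasurableSpace γ] {ν : Measure γ} [SFinite ν]
    [SFinite (volume : Measure α)] {f : α → γ → ℝ≥0∞} (hf : Measurable (Function.uncurry f)) :
    n2 (fun x ↦ ∫⁻ y, f x y ∂ν) ≤ ∫⁻ y, n2 (fun x ↦ f x y) ∂ν := by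
  rw [n2_le_iff]
  have h1 : ∀ x, (∫⁻ y, f x y ∂ν) ^ 2 = ∫⁻ y, ∫⁻ y', f x y * f x y' ∂ν ∂ν := fun x ↦ by
    have hx : Measurable (f x) := hf.comp measurable_prodMk_left
    rw [sq, ← lintegral_mul_const _ hx]
    exact lintegral_congr fun y ↦ (lintegral_const_mul _ hx).symm
  have hm : Measurable fun p : (α × γ) × γ ↦ f p.1.1 p.1.2 * f p.1.1 p.2 :=
    (hf.comp (measurable_fst : Measurable fun p : (α × γ) × γ ↦ p.1)).mul
      (hf.comp (measurable_fst.fst.prodMk measurable_snd :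
        Measurable fun p : (α × γ) × γ ↦ (p.1.1, p.2)))
  have hy : ∀ y, Measurable fun x ↦ f x y := fun y ↦ hf.comp measurable_prodMk_right
  have hn : Measurable fun y ↦ n2 (fun x ↦ f x y) := by
    unfold n2
    exact (Measurable.lintegral_prod_left' (f := fun p : α × γ ↦ f p.1 p.2 ^ 2)
      (hf.pow_const 2)).pow_const _
  calc ∫⁻ x, (∫⁻ y, f x y ∂ν) ^ 2
      = ∫⁻ x, ∫⁻ y, ∫⁻ y', f x y * f x y' ∂ν ∂ν := lintegral_congr h1
    _ = ∫⁻ y, ∫⁻ x, ∫⁻ y', f x y * f x y' ∂ν ∂volume ∂ν := by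
        refine lintegral_lintegral_swap ?_
        exact (Measurable.lintegral_prod_right' (ν := ν) hm).aemeasurable
    _ = ∫⁻ y, ∫⁻ y', ∫⁻ x, f x y * f x y' ∂volume ∂ν ∂ν := by
        refine lintegral_congr fun y ↦ ?_
        refine lintegral_lintegral_swap ?_
        exact (hm.comp (((measurable_fst.prodMk measurable_const).prodMk measurable_snd) :
            Measurable fun p : α × γ ↦ ((p.1, y), p.2))).aemeasurable
    _ ≤ ∫⁻ y, ∫⁻ y', n2 (fun x ↦ f x y) * n2 (fun x ↦ f x y') ∂ν ∂ν :=
        lintegral_mono fun y ↦ lintegral_mono fun y' ↦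
          lintegral_mul_le_n2 (hy y).aemeasurable (hy y').aemeasurable
    _ = (∫⁻ y, n2 (fun x ↦ f x y) ∂ν) ^ 2 := by
        rw [sq, ← lintegral_mul_const _ hn]
        exact lintegral_congr fun y ↦ lintegral_const_mul _ hn

theorem n2_tsum_le [SFinite (volume : Measure α)] {f : ℕ → α → ℝ≥0∞}
    (hf : ∀ j, Measurable (f j)) : n2 (fun x ↦ ∑' j, f j x) ≤ ∑' j, n2 (f j) := by
  have := n2_lintegral_le (ν := Measure.count) (f := fun x j ↦ f j x)
    (measurable_from_prod_countable_left hf)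
  simpa [lintegral_count] using this

theorem n2_add_le {F G : α → ℝ≥0∞} (hF : Measurable F) (hG : Measurable G) :
    n2 (fun x ↦ F x + G x) ≤ n2 F + n2 G := by
  have := ENNReal.lintegral_Lp_add_le hF.aemeasurable hG.aemeasurable (μ := volume)
    (by norm_num : (1 : ℝ) ≤ 2)
  simpa [n2] using this

theorem n2_sum_le {ι : Type*} (s : Finset ι) {f : ι → α → ℝ≥0∞}
    (hf : ∀ j, Measurable (f j)) : n2 (fun x ↦ ∑ j ∈ s, f j x) ≤ ∑ j ∈ s, n2 (f j) := by
  classical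
  induction s using Finset.induction_on with
  | empty => simp [n2_zero]
  | insert a s ha ih =>
    simp_rw [Finset.sum_insert ha]
    exact (n2_add_le (hf a) (Finset.measurable_sum s fun j _ ↦ hf j)).trans (by gcongr)

theorem n2_comp {f : α → β} (hf : MeasurePreserving f volume volume) {F : β → ℝ≥0∞}
    (hF : Measurable F) : n2 (fun x ↦ F (f x)) = n2 F := by
  unfold n2
  rw [hf.lintegral_comp (hF.pow_const 2)]

theorem measurable_n2_right [SFinite (volume : Measure β)] {F : α × β → ℝ≥0∞} (hF : Measurable F) :
    Measurable fun x ↦ n2 fun y ↦ F (x, y) :=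
  (hF.pow_const 2).lintegral_prod_right'.pow_const _

theorem n2_prod [SFinite (volume : Measure β)] {F : α × β → ℝ≥0∞}
    (hF : Measurable F) : n2 F = n2 fun x ↦ n2 fun y ↦ F (x, y) := by
  conv_rhs => unfold n2
  simp_rw [rpow_half_sq]
  unfold n2
  rw [Measure.volume_eq_prod, lintegral_prod _ (hF.pow_const 2).aemeasurable]

end N2

/-! ### Convolutions of nonnegative functions on the plane -/

/-- The norm of `L²_ξ L¹_τ`. -/
def n21 (F : ℝ × ℝ → ℝ≥0∞) : ℝ≥0∞ := n2 fun ξ : ℝ ↦ ∫⁻ τ, F (ξ, τ)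

/-- Convolution of nonnegative functions. -/
def conv (F G : ℝ × ℝ → ℝ≥0∞) (z : ℝ × ℝ) : ℝ≥0∞ := ∫⁻ w, F w * G (z - w)

/-- Convolution in the second variable. -/
def tconv (ρ : ℝ → ℝ≥0∞) (G : ℝ × ℝ → ℝ≥0∞) (z : ℝ × ℝ) : ℝ≥0∞ := ∫⁻ s, ρ s * G (z.1, z.2 - s)

theorem measurable_conv {F G : ℝ × ℝ → ℝ≥0∞} (hF : Measurable F) (hG : Measurable G) :
    Measurable (conv F G) := by
  unfold conv
  exact Measurable.lintegral_prod_right' (f := fun p : (ℝ × ℝ) × (ℝ × ℝ) ↦ F p.2 * G (p.1 - p.2))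
    ((hF.comp measurable_snd).mul (hG.comp (measurable_fst.sub measurable_snd)))

theorem measurable_tconv {ρ : ℝ → ℝ≥0∞} {G : ℝ × ℝ → ℝ≥0∞} (hρ : Measurable ρ)
    (hG : Measurable G) : Measurable (tconv ρ G) := by
  unfold tconv
  exact Measurable.lintegral_prod_right' (f := fun p : (ℝ × ℝ) × ℝ ↦ ρ p.2 * G (p.1.1, p.1.2 - p.2))
    ((hρ.comp measurable_snd).mul (hG.comp (by fun_prop)))

theorem conv_comm (F G : ℝ × ℝ → ℝ≥0∞) : conv F G = conv G F := by
  funext z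
  unfold conv
  rw [← lintegral_sub_left_eq_self _ z]
  simp only [sub_sub_cancel]
  exact lintegral_congr fun w ↦ mul_comm _ _

theorem conv_le_n2 {F G : ℝ × ℝ → ℝ≥0∞} (hF : Measurable F) (hG : Measurable G) (z : ℝ × ℝ) :
    conv F G z ≤ n2 F * n2 G := by
  refine (lintegral_mul_le_n2 hF.aemeasurable
    (hG.comp (measurable_const.sub measurable_id)).aemeasurable).trans (le_of_eq ?_)
  congr 1
  unfold n2
  congr 1
  exact lintegral_sub_left_eq_self (fun w ↦ G w ^ 2) z

/-- Minkowski in `w` and invariance under translations in `τ` leave a convolution in `ξ` of the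
`L¹_τ` norms of `F` with the `L²_τ` norms of `G`. Cauchy–Schwarz in `ξ` makes the bound uniform in
`ξ`, which is needed when a singular factor in `ξ` is multiplied on later. -/
theorem n2_conv_slice_le {F G : ℝ × ℝ → ℝ≥0∞} (hF : Measurable F) (hG : Measurable G) (ξ : ℝ) :
    n2 (fun τ ↦ conv F G (ξ, τ)) ≤ n21 F * n2 G := by
  have hb : Measurable fun ξ : ℝ ↦ n2 fun τ : ℝ ↦ G (ξ, τ) := measurable_n2_right hG
  calc n2 (fun τ ↦ conv F G (ξ, τ))
      ≤ ∫⁻ w, n2 fun τ ↦ F w * G ((ξ, τ) - w) :=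
        n2_lintegral_le (f := fun (τ : ℝ) w ↦ F w * G ((ξ, τ) - w))
          ((hF.comp measurable_snd).mul (hG.comp (by fun_prop)))
    _ = ∫⁻ w : ℝ × ℝ, F w * n2 fun τ ↦ G (ξ - w.1, τ) := by
        refine lintegral_congr fun w ↦ ?_
        refine (n2_const_mul _ (fun τ ↦ G (ξ - w.1, τ - w.2)) (by fun_prop)).trans ?_
        congr 1
        unfold n2
        congr 1
        exact lintegral_sub_right_eq_self (fun τ ↦ G (ξ - w.1, τ) ^ 2) w.2
    _ = ∫⁻ ξ', (∫⁻ τ', F (ξ', τ')) * n2 fun τ ↦ G (ξ - ξ', τ) := by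
        rw [Measure.volume_eq_prod, lintegral_prod]
        · refine lintegral_congr fun ξ' ↦ ?_
          change ∫⁻ τ', F (ξ', τ') * n2 (fun τ ↦ G (ξ - ξ', τ)) = _
          exact lintegral_mul_const _ (by fun_prop)
        · exact (hF.mul (hb.comp (measurable_const.sub measurable_fst))).aemeasurable
    _ ≤ n21 F * n2 (fun ξ' ↦ n2 fun τ ↦ G (ξ - ξ', τ)) :=
        lintegral_mul_le_n2 hF.lintegral_prod_right'.aemeasurable
          (hb.comp (measurable_const.sub measurable_id)).aemeasurable
    _ = n21 F * n2 G := by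
        rw [n2_prod hG]
        congr 1
        conv_lhs => unfold n2
        conv_rhs => unfold n2
        congr 1
        exact lintegral_sub_left_eq_self (fun ξ' ↦ (n2 fun τ ↦ G (ξ', τ)) ^ 2) ξ

theorem lintegral_tconv {ρ : ℝ → ℝ≥0∞} {G : ℝ × ℝ → ℝ≥0∞} (hρ : Measurable ρ)
    (hG : Measurable G) (ξ : ℝ) :
    ∫⁻ τ, tconv ρ G (ξ, τ) = (∫⁻ s, ρ s) * ∫⁻ τ, G (ξ, τ) := by
  unfold tconv
  rw [lintegral_lintegral_swap]
  · rw [← lintegral_mul_const _ hρ]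
    refine lintegral_congr fun s ↦ ?_
    dsimp only
    rw [lintegral_const_mul _ (by fun_prop : Measurable fun τ ↦ G (ξ, τ - s)),
      lintegral_sub_right_eq_self (fun τ ↦ G (ξ, τ)) s]
  · exact ((hρ.comp measurable_snd).mul (hG.comp (by fun_prop))).aemeasurable

theorem n21_tconv {ρ : ℝ → ℝ≥0∞} {G : ℝ × ℝ → ℝ≥0∞} (hρ : Measurable ρ) (hG : Measurable G) :
    n21 (tconv ρ G) = (∫⁻ s, ρ s) * n21 G := by
  unfold n21
  simp_rw [lintegral_tconv hρ hG]
  exact n2_const_mul _ _ hG.lintegral_prod_right'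

theorem n2_tconv_le {ρ : ℝ → ℝ≥0∞} {G : ℝ × ℝ → ℝ≥0∞} (hρ : Measurable ρ) (hG : Measurable G) :
    n2 (tconv ρ G) ≤ (∫⁻ s, ρ s) * n2 G := by
  refine (n2_lintegral_le (f := fun (z : ℝ × ℝ) s ↦ ρ s * G (z.1, z.2 - s))
    ((hρ.comp measurable_snd).mul (hG.comp (by fun_prop)))).trans (le_of_eq ?_)
  rw [← lintegral_mul_const _ hρ]
  refine lintegral_congr fun s ↦ ?_
  rw [n2_const_mul _ (fun z : ℝ × ℝ ↦ G (z.1, z.2 - s)) (by fun_prop)]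
  congr 1
  exact n2_comp (f := fun z : ℝ × ℝ ↦ (z.1, z.2 - s))
    ((MeasurePreserving.id volume).prod (measurePreserving_sub_right volume s)) hG

/-- Young's inequality in `τ` with the `L²` norm on `ρ` instead of `G`. For the transform of a
cutoff to times of length `1/c` this norm is of order `c^(-1/2)`, the source of the gain from
localization. -/
theorem n2_tconv_le' {ρ : ℝ → ℝ≥0∞} {G : ℝ × ℝ → ℝ≥0∞} (hρ : Measurable ρ) (hG : Measurable G) :
    n2 (tconv ρ G) ≤ n2 ρ * n21 G := by
  rw [n2_prod (measurable_tconv hρ hG)]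
  calc n2 (fun ξ ↦ n2 fun τ ↦ tconv ρ G (ξ, τ))
      ≤ n2 fun ξ ↦ n2 ρ * ∫⁻ τ, G (ξ, τ) := n2_mono fun ξ ↦ by
        have h : ∀ τ, tconv ρ G (ξ, τ) = ∫⁻ s, G (ξ, s) * ρ (τ - s) := fun τ ↦ by
          unfold tconv
          rw [← lintegral_sub_left_eq_self _ τ]
          simp only [sub_sub_cancel]
          exact lintegral_congr fun w ↦ mul_comm _ _
        simp_rw [h]
        refine (n2_lintegral_le (f := fun (τ : ℝ) s ↦ G (ξ, s) * ρ (τ - s))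
          ((hG.comp (by fun_prop)).mul (hρ.comp (by fun_prop)))).trans (le_of_eq ?_)
        rw [mul_comm, ← lintegral_mul_const _ (by fun_prop : Measurable fun τ ↦ G (ξ, τ))]
        refine lintegral_congr fun s ↦ ?_
        rw [n2_const_mul _ (fun τ ↦ ρ (τ - s)) (by fun_prop)]
        congr 1
        unfold n2
        congr 1
        exact lintegral_sub_right_eq_self (fun τ ↦ ρ τ ^ 2) s
    _ = n2 ρ * n21 G := n2_const_mul _ _ hG.lintegral_prod_right'

/-! ### Powers of two -/

/-- The real power `2 ^ x` in `ℝ≥0∞`. -/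
def e2 (x : ℝ) : ℝ≥0∞ := (2 : ℝ≥0∞) ^ x

theorem e2_add (x y : ℝ) : e2 (x + y) = e2 x * e2 y :=
  ENNReal.rpow_add _ _ two_ne_zero ENNReal.ofNat_ne_top

theorem e2_zero : e2 0 = 1 := ENNReal.rpow_zero

theorem e2_neg_mul (x : ℝ) : e2 (-x) * e2 x = 1 := by
  rw [← e2_add, neg_add_cancel, e2_zero]

theorem e2_ne_top (x : ℝ) : e2 x ≠ ⊤ :=
  ENNReal.rpow_ne_top_of_ne_zero two_ne_zero ENNReal.ofNat_ne_top

theorem e2_mono {x y : ℝ} (h : x ≤ y) : e2 x ≤ e2 y :=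
  ENNReal.rpow_le_rpow_of_exponent_le (by norm_num) h

theorem ofReal_rpow_two (x : ℝ) : ENNReal.ofReal ((2 : ℝ) ^ x) = e2 x := by
  unfold e2
  rw [← ENNReal.ofReal_rpow_of_pos (by norm_num)]
  simp

theorem e2_rpow (x y : ℝ) : e2 x ^ y = e2 (x * y) := (ENNReal.rpow_mul _ _ _).symm

theorem e2_natCast (n : ℕ) : e2 n = 2 ^ n := ENNReal.rpow_natCast _ _

theorem e2_pow (x : ℝ) (n : ℕ) : e2 x ^ n = e2 (x * n) := by
  rw [← ENNReal.rpow_natCast, e2_rpow]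

theorem ofReal_two_pow (n : ℕ) : ENNReal.ofReal ((2 : ℝ) ^ n) = e2 n := by
  rw [← ofReal_rpow_two, Real.rpow_natCast]

theorem tsum_e2_lt_top {a : ℝ} (ha : 0 < a) : ∑' j : ℕ, e2 (-(a * j)) < ⊤ := by
  have h : ∀ j : ℕ, e2 (-(a * j)) = e2 (-a) ^ j := fun j ↦ by rw [e2_pow]; congr 1; ring
  simp_rw [h]
  rw [ENNReal.tsum_geometric, ENNReal.inv_lt_top, tsub_pos_iff_lt]
  unfold e2
  exact ENNReal.rpow_lt_one_of_one_lt_of_neg (by norm_num) (by linarith)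

/-! ### Modulation and the space `X` on the Fourier side -/

/-- The modulation in product coordinates. -/
def mu (z : ℝ × ℝ) : ℝ := 2 * Real.pi * z.2 - (2 * Real.pi * z.1) ^ 5

theorem continuous_mu : Continuous mu := by unfold mu; fun_prop

/-- The `X` norm of a nonnegative function. -/
def xn (η : ℝ → ℝ) (F : ℝ × ℝ → ℝ≥0∞) : ℝ≥0∞ :=
  ∑' j : ℕ, e2 (j / 2) * n2 fun z ↦ ENNReal.ofReal (etaK η j (mu z)) * F z

/-- The weight `(1 + |μ|)^θ`. -/
def wt (θ : ℝ) (z : ℝ × ℝ) : ℝ≥0∞ := ENNReal.ofReal ((1 + |mu z|) ^ θ)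

/-- The `L²` norm with the weight `(1 + |μ|)^θ`. -/
def dn (θ : ℝ) (F : ℝ × ℝ → ℝ≥0∞) : ℝ≥0∞ := n2 fun z ↦ wt θ z * F z

/-- The frequencies in the support of `η_k`. -/
def band (k : ℕ) : Set ℝ :=
  {ξ | |2 * Real.pi * ξ| ≤ 8 / 5 * 2 ^ k ∧ (1 ≤ k → 5 / 8 * 2 ^ k ≤ |2 * Real.pi * ξ|)}

theorem IsCutoff.mem_band {η : ℝ → ℝ} (hη : IsCutoff η) {k : ℕ} {ξ : ℝ}
    (h : etaK η k (2 * Real.pi * ξ) ≠ 0) : ξ ∈ band k :=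
  ⟨hη.etaK_upper h, fun hk ↦ hη.etaK_lower hk h⟩

theorem measurable_wt (θ : ℝ) : Measurable (wt θ) := by
  have := continuous_mu.measurable
  unfold wt
  fun_prop

theorem IsCutoff.measurable_eta_mu {η : ℝ → ℝ} (hη : IsCutoff η) (j : ℕ) :
    Measurable fun z : ℝ × ℝ ↦ ENNReal.ofReal (etaK η j (mu z)) :=
  ((hη.continuous_etaK j).comp continuous_mu).measurable.ennreal_ofReal

theorem IsCutoff.eta_sum_mul {η : ℝ → ℝ} (hη : IsCutoff η) (F : ℝ × ℝ → ℝ≥0∞) (z : ℝ × ℝ) :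
    ∑' j, ENNReal.ofReal (etaK η j (mu z)) * F z = F z := by
  rw [ENNReal.tsum_mul_right, hη.tsum_ofReal_etaK, one_mul]

theorem two_pow_rpow (j : ℕ) (θ : ℝ) : ((2 : ℝ) ^ j) ^ θ = 2 ^ (j * θ) := by
  rw [← Real.rpow_natCast, ← Real.rpow_mul (by norm_num)]

theorem IsCutoff.wt_mul_eta_le {η : ℝ → ℝ} (hη : IsCutoff η) {θ : ℝ} (h0 : 0 ≤ θ)
    (h1 : θ ≤ 1 / 2) (j : ℕ) (z : ℝ × ℝ) :
    wt θ z * ENNReal.ofReal (etaK η j (mu z)) ≤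
      2 * e2 (j * θ) * ENNReal.ofReal (etaK η j (mu z)) := by
  by_cases h : etaK η j (mu z) = 0
  · simp [h]
  gcongr
  have hu := hη.etaK_upper h
  have hj : (1 : ℝ) ≤ 2 ^ j := one_le_pow₀ (by norm_num)
  have : (1 + |mu z|) ^ θ ≤ 2 * 2 ^ (j * θ) := by
    calc (1 + |mu z|) ^ θ ≤ (4 * 2 ^ j) ^ θ :=
          Real.rpow_le_rpow (by positivity) (by linarith) h0
      _ = 4 ^ θ * 2 ^ (j * θ) := by rw [Real.mul_rpow (by norm_num) (by positivity), two_pow_rpow]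
      _ ≤ 2 * 2 ^ (j * θ) := by
          gcongr
          calc (4 : ℝ) ^ θ ≤ 4 ^ (1 / 2 : ℝ) :=
                Real.rpow_le_rpow_of_exponent_le (by norm_num) h1
            _ = 2 := by
                rw [show (4 : ℝ) = 2 ^ (2 : ℝ) by norm_num, ← Real.rpow_mul (by norm_num)]
                norm_num
  unfold wt
  refine (ENNReal.ofReal_le_ofReal this).trans (le_of_eq ?_)
  rw [ENNReal.ofReal_mul (by norm_num), ofReal_rpow_two]
  simp

/-- The `X` norm is an `ℓ¹` sum over dyadic modulations with weight exponent `1/2`, so the triangle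
inequality bounds every weighted `L²` norm of exponent at most `1/2`. -/
theorem IsCutoff.dn_le_xn {η : ℝ → ℝ} (hη : IsCutoff η) {θ : ℝ} (h0 : 0 ≤ θ) (h1 : θ ≤ 1 / 2)
    {F : ℝ × ℝ → ℝ≥0∞} (hF : Measurable F) : dn θ F ≤ 2 * xn η F := by
  have hm : ∀ j : ℕ, Measurable fun z ↦ ENNReal.ofReal (etaK η j (mu z)) * F z :=
    fun j ↦ (hη.measurable_eta_mu j).mul hF
  calc dn θ F = n2 fun z ↦ ∑' j, wt θ z * (ENNReal.ofReal (etaK η j (mu z)) * F z) := by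
        unfold dn
        congr 1
        funext z
        rw [ENNReal.tsum_mul_left, hη.eta_sum_mul]
    _ ≤ ∑' j, n2 fun z ↦ wt θ z * (ENNReal.ofReal (etaK η j (mu z)) * F z) :=
        n2_tsum_le fun j ↦ (measurable_wt θ).mul (hm j)
    _ ≤ ∑' j : ℕ, 2 * (e2 (j / 2) * n2 fun z ↦ ENNReal.ofReal (etaK η j (mu z)) * F z) := by
        refine ENNReal.tsum_le_tsum fun j ↦ ?_
        rw [← mul_assoc, ← n2_const_mul _ _ (hm j)]
        refine n2_mono fun z ↦ ?_
        rw [← mul_assoc, ← mul_assoc]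
        refine mul_le_mul_left ((hη.wt_mul_eta_le h0 h1 j z).trans ?_) _
        gcongr
        refine e2_mono ?_
        have : (0 : ℝ) ≤ j := by positivity
        nlinarith
    _ = 2 * xn η F := ENNReal.tsum_mul_left

theorem volume_abs_le (c a : ℝ) :
    volume {τ : ℝ | |2 * Real.pi * τ - c| ≤ a} ≤ ENNReal.ofReal (a / 3) := by
  have hp := Real.pi_gt_three
  have : {τ : ℝ | |2 * Real.pi * τ - c| ≤ a} =
      Set.Icc ((c - a) / (2 * Real.pi)) ((c + a) / (2 * Real.pi)) := by
    ext τ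
    simp only [Set.mem_ofPred_eq, abs_le, Set.mem_Icc]
    rw [div_le_iff₀ (by positivity), le_div_iff₀ (by positivity)]
    constructor <;> rintro ⟨h1, h2⟩ <;> constructor <;> linarith
  rw [this, Real.volume_Icc]
  by_cases ha : 0 ≤ a
  · refine ENNReal.ofReal_le_ofReal ?_
    rw [← sub_div, div_le_div_iff₀ (by positivity) (by norm_num)]
    nlinarith
  · rw [ENNReal.ofReal_of_nonpos]
    · positivity
    · rw [← sub_div]
      exact div_nonpos_of_nonpos_of_nonneg (by linarith) (by positivity)

/-- On a slice of bounded modulation the `L¹` norm is controlled by the `L²` norm, and the `L²` norm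
by the supremum. -/
theorem IsCutoff.volume_eta_slice {η : ℝ → ℝ} (hη : IsCutoff η) (j : ℕ) (ξ : ℝ) :
    n2 (fun τ ↦ (Function.support fun τ ↦ etaK η j (mu (ξ, τ))).indicator 1 τ) ≤ e2 (j / 2) := by
  have hm : MeasurableSet (Function.support fun τ ↦ etaK η j (mu (ξ, τ))) :=
    ((hη.continuous_etaK j).comp (continuous_mu.comp (by fun_prop))).measurable
      (measurableSet_singleton 0).compl
  rw [n2_le_iff, e2_pow]
  have h : ∀ τ, ((Function.support fun τ ↦ etaK η j (mu (ξ, τ))).indicator (1 : ℝ → ℝ≥0∞) τ) ^ 2 =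
      (Function.support fun τ ↦ etaK η j (mu (ξ, τ))).indicator 1 τ := fun τ ↦ by
    by_cases hτ : τ ∈ Function.support fun τ ↦ etaK η j (mu (ξ, τ)) <;> simp [hτ]
  simp_rw [h]
  rw [lintegral_indicator_one hm]
  calc volume (Function.support fun τ ↦ etaK η j (mu (ξ, τ)))
      ≤ volume {τ : ℝ | |2 * Real.pi * τ - (2 * Real.pi * ξ) ^ 5| ≤ 8 / 5 * 2 ^ j} :=
        measure_mono fun τ hτ ↦ by
          rw [Set.mem_ofPred_eq]
          exact hη.etaK_upper (Function.mem_support.mp hτ)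
    _ ≤ ENNReal.ofReal (8 / 5 * 2 ^ j / 3) := volume_abs_le _ _
    _ ≤ ENNReal.ofReal (2 ^ j) := ENNReal.ofReal_le_ofReal (by
        have : (0 : ℝ) < 2 ^ j := by positivity
        linarith)
    _ = e2 (j / 2 * (2 : ℕ)) := by rw [ofReal_two_pow]; congr 1; push_cast; ring

/-- At modulation `2^j` each slice in `τ` has length at most `2^j`. Cauchy–Schwarz in `τ` costs
`2^(j/2)`, which is the weight in the `X` norm. On the physical side this is the embedding into
functions bounded in time with values in `L²`. -/
theorem IsCutoff.n21_le_xn {η : ℝ → ℝ} (hη : IsCutoff η)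
    {F : ℝ × ℝ → ℝ≥0∞} (hF : Measurable F) : n21 F ≤ xn η F := by
  have hm : ∀ j : ℕ, Measurable fun z ↦ ENNReal.ofReal (etaK η j (mu z)) * F z :=
    fun j ↦ (hη.measurable_eta_mu j).mul hF
  calc n21 F = n2 fun ξ ↦ ∑' j, ∫⁻ τ, ENNReal.ofReal (etaK η j (mu (ξ, τ))) * F (ξ, τ) := by
        unfold n21
        congr 1
        funext ξ
        rw [← lintegral_tsum (f := fun j τ ↦ ENNReal.ofReal (etaK η j (mu (ξ, τ))) * F (ξ, τ))
          fun j ↦ ((hm j).comp measurable_prodMk_left).aemeasurable]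
        exact lintegral_congr fun τ ↦ (hη.eta_sum_mul F _).symm
    _ ≤ ∑' j, n2 fun ξ ↦ ∫⁻ τ, ENNReal.ofReal (etaK η j (mu (ξ, τ))) * F (ξ, τ) :=
        n2_tsum_le fun j ↦ (hm j).lintegral_prod_right'
    _ ≤ xn η F := by
        refine ENNReal.tsum_le_tsum fun j ↦ ?_
        rw [n2_prod (hm j), ← n2_const_mul _ _ (measurable_n2_right (hm j))]
        refine n2_mono fun ξ ↦ ?_
        calc ∫⁻ τ, ENNReal.ofReal (etaK η j (mu (ξ, τ))) * F (ξ, τ)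
            = ∫⁻ τ, (Function.support fun τ ↦ etaK η j (mu (ξ, τ))).indicator 1 τ *
                (ENNReal.ofReal (etaK η j (mu (ξ, τ))) * F (ξ, τ)) := by
              refine lintegral_congr fun τ ↦ ?_
              by_cases hτ : etaK η j (mu (ξ, τ)) = 0 <;> simp [hτ]
          _ ≤ _ := by
              refine (lintegral_mul_le_n2 ?_
                ((hm j).comp measurable_prodMk_left).aemeasurable).trans
                (mul_le_mul_left (hη.volume_eta_slice j ξ) _)
              refine (measurable_one.indicator ?_).aemeasurable
              exact ((hη.continuous_etaK j).comp (continuous_mu.comp (by fun_prop))).measurable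
                (measurableSet_singleton 0).compl

/-- A shift of `τ` by `s` changes the modulation by `2πs`, and `r ↦ r^θ` is subadditive for `θ ≤ 1`.
-/
theorem wt_le_add {θ : ℝ} (h0 : 0 ≤ θ) (h1 : θ ≤ 1) (z : ℝ × ℝ) (s : ℝ) :
    wt θ z ≤ wt θ (z.1, z.2 - s) + ENNReal.ofReal (|2 * Real.pi * s| ^ θ) := by
  unfold wt
  rw [← ENNReal.ofReal_add (by positivity) (by positivity)]
  refine ENNReal.ofReal_le_ofReal ?_
  refine le_trans ?_ (Real.rpow_add_le_add_rpow (by positivity) (abs_nonneg _) h0 h1)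
  refine Real.rpow_le_rpow (by positivity) ?_ h0
  have : mu z = mu (z.1, z.2 - s) + 2 * Real.pi * s := by unfold mu; ring
  rw [this, add_assoc]
  gcongr
  exact abs_add_le _ _

/-- The weight falls either on `G`, where `ρ` enters through its `L¹` norm, or on `ρ`, where `G`
enters through `L²_ξ L¹_τ`. Both are uniform in the time scale of a cutoff as long as `θ ≤ 1/2`. -/
theorem dn_tconv_le {θ : ℝ} (h0 : 0 ≤ θ) (h1 : θ ≤ 1) {ρ : ℝ → ℝ≥0∞} {G : ℝ × ℝ → ℝ≥0∞}
    (hρ : Measurable ρ) (hG : Measurable G) :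
    dn θ (tconv ρ G) ≤ (∫⁻ s, ρ s) * dn θ G +
      n2 (fun s ↦ ENNReal.ofReal (|2 * Real.pi * s| ^ θ) * ρ s) * n21 G := by
  have hρ' : Measurable fun s ↦ ENNReal.ofReal (|2 * Real.pi * s| ^ θ) * ρ s := by fun_prop
  have hG' : Measurable fun z ↦ wt θ z * G z := (measurable_wt θ).mul hG
  calc dn θ (tconv ρ G) ≤ n2 fun z ↦ tconv ρ (fun z ↦ wt θ z * G z) z +
        tconv (fun s ↦ ENNReal.ofReal (|2 * Real.pi * s| ^ θ) * ρ s) G z := by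
        refine n2_mono fun z ↦ ?_
        unfold tconv
        rw [← lintegral_add_left (by have := measurable_wt θ; fun_prop),
          ← lintegral_const_mul _ (by fun_prop)]
        refine lintegral_mono fun s ↦ ?_
        calc wt θ z * (ρ s * G (z.1, z.2 - s)) ≤ (wt θ (z.1, z.2 - s) +
              ENNReal.ofReal (|2 * Real.pi * s| ^ θ)) * (ρ s * G (z.1, z.2 - s)) :=
              mul_le_mul_left (wt_le_add h0 h1 z s) _
          _ = _ := by ring
    _ ≤ _ := (n2_add_le (measurable_tconv hρ hG') (measurable_tconv hρ' hG)).trans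
        (add_le_add (n2_tconv_le hρ hG') (n2_tconv_le' hρ' hG))

/-! ### The transversal bilinear estimate -/

/-- Both differences of fifth powers contain the factor `Q - P`. The remaining factor of the first
is a sum of five monomials in `P`, `Q`, each at least `m⁴`; that of the second is a sum of five
monomials in `X - P`, `X - Q`, each at most `d⁴`. -/
theorem quintic_separation {m d P Q X : ℝ} (hm : 0 ≤ m) (hP : m ≤ P) (hPQ : P ≤ Q)
    (hXP : |X - P| ≤ d) (hXQ : |X - Q| ≤ d) :
    (5 * m ^ 4 - 5 * d ^ 4) * (Q - P) ≤ (Q ^ 5 + (X - Q) ^ 5) - (P ^ 5 + (X - P) ^ 5) := by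
  have hQ : m ≤ Q := hP.trans hPQ
  have hd : 0 ≤ d := (abs_nonneg _).trans hXP
  have hP0 : 0 ≤ P := hm.trans hP
  have h1 : ∀ i j : ℕ, m ^ i * m ^ j ≤ P ^ i * Q ^ j := fun i j ↦ by gcongr
  have h2 : ∀ i j : ℕ, (X - P) ^ i * (X - Q) ^ j ≤ d ^ i * d ^ j := fun i j ↦ by
    refine (le_abs_self _).trans ?_
    rw [abs_mul, abs_pow, abs_pow]
    gcongr
  have e1 := h1 4 0
  have e2 := h1 3 1
  have e3 := h1 2 2
  have e4 := h1 1 3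
  have e5 := h1 0 4
  have f1 := h2 4 0
  have f2 := h2 3 1
  have f3 := h2 2 2
  have f4 := h2 1 3
  have f5 := h2 0 4
  have key : 5 * m ^ 4 - 5 * d ^ 4 ≤
      (P ^ 4 + P ^ 3 * Q + P ^ 2 * Q ^ 2 + P * Q ^ 3 + Q ^ 4) -
      ((X - P) ^ 4 + (X - P) ^ 3 * (X - Q) + (X - P) ^ 2 * (X - Q) ^ 2 + (X - P) * (X - Q) ^ 3 +
        (X - Q) ^ 4) := by
    ring_nf at e1 e2 e3 e4 e5 f1 f2 f3 f4 f5 ⊢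
    linarith
  have := mul_le_mul_of_nonneg_right key (sub_nonneg.mpr hPQ)
  refine this.trans (le_of_eq ?_)
  ring

/-- Two points of the high frequency curve at the same height are close. -/
theorem abs_sub_le_of_quintic {N P Q X T R : ℝ} (hN : 0 < N)
    (hP : 5 / 8 * N ≤ |P|) (hQ : 5 / 8 * N ≤ |Q|) (hXP : |X - P| ≤ 1 / 5 * N)
    (hXQ : |X - Q| ≤ 1 / 5 * N) (hTP : |T - P ^ 5 - (X - P) ^ 5| ≤ R)
    (hTQ : |T - Q ^ 5 - (X - Q) ^ 5| ≤ R) : |P - Q| ≤ 4 * R / N ^ 4 := by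
  wlog h : P ≤ Q generalizing P Q
  · rw [abs_sub_comm]
    exact this hQ hP hXQ hXP hTQ hTP (le_of_not_ge h)
  -- If `P < 0` then `Q ≤ 0` as well: frequencies of opposite sign are at distance at least `5/4 ·
  -- N`, but both lie within `N/5` of `X`. The reflection `(P, Q) ↦ (-Q, -P)` keeps the order.
  wlog hpos : 0 ≤ P generalizing P Q X T
  · have hQ0 : Q ≤ 0 := by
      by_contra hq
      push Not at hq hpos
      rw [abs_of_neg hpos] at hP
      rw [abs_of_pos hq] at hQ
      rw [abs_le] at hXP hXQ
      linarith
    have := this (P := -Q) (Q := -P) (X := -X) (T := -T) (by rwa [abs_neg]) (by rwa [abs_neg])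
      (by rw [← abs_neg]; convert hXQ using 2; ring)
      (by rw [← abs_neg]; convert hXP using 2; ring)
      (by rw [← abs_neg]; convert hTQ using 2; ring)
      (by rw [← abs_neg]; convert hTP using 2; ring) (by linarith) (by linarith)
    convert this using 2
    ring
  rw [abs_of_nonneg hpos] at hP
  have key := quintic_separation (by positivity : (0 : ℝ) ≤ 5 / 8 * N) hP h hXP hXQ
  rw [abs_sub_comm, abs_of_nonneg (by linarith), le_div_iff₀ (by positivity)]
  rw [abs_le] at hTP hTQ
  have h4 : 0 ≤ N ^ 4 * (Q - P) := mul_nonneg (by positivity) (by linarith)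
  -- The numerical constant `5((5/8)⁴ - (1/5)⁴)` exceeds `1/2`, and the two height conditions differ
  -- by at most `2R`; hence the factor `4`.
  have h5 : (5 * (5 / 8 * N) ^ 4 - 5 * (1 / 5 * N) ^ 4) * (Q - P)
      = (5 * (5 / 8) ^ 4 - 5 * (1 / 5) ^ 4) * (N ^ 4 * (Q - P)) := by ring
  rw [h5] at key
  norm_num at key
  linarith

/-- The set of pairs of frequencies of prescribed modulations. -/
def modSet (n : ℕ) (a b : ℝ) (z : ℝ × ℝ) : Set (ℝ × ℝ) :=
  {w | 5 / 8 * 2 ^ n ≤ |2 * Real.pi * w.1| ∧ |2 * Real.pi * (z.1 - w.1)| ≤ 1 / 5 * 2 ^ n ∧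
    |mu w| ≤ a ∧ |mu (z - w)| ≤ b}

theorem measurableSet_modSet (n : ℕ) (a b : ℝ) (z : ℝ × ℝ) : MeasurableSet (modSet n a b z) := by
  have h1 : Measurable fun w : ℝ × ℝ ↦ |2 * Real.pi * w.1| := by fun_prop
  have h2 : Measurable fun w : ℝ × ℝ ↦ |2 * Real.pi * (z.1 - w.1)| := by fun_prop
  have h3 : Measurable fun w : ℝ × ℝ ↦ |mu w| := continuous_mu.abs.measurable
  have h4 : Measurable fun w : ℝ × ℝ ↦ |mu (z - w)| :=
    (continuous_mu.comp (continuous_const.sub continuous_id)).abs.measurable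
  exact (measurableSet_le measurable_const h1).inter ((measurableSet_le h2 measurable_const).inter
    ((measurableSet_le h3 measurable_const).inter (measurableSet_le h4 measurable_const)))

/-- Adding the two modulations eliminates `τ`, and transversality confines `ξ` to an interval of
half-length `D = (a+b)/N⁴`. For fixed `ξ` the `τ` slice has length at most `min a b`. Finally `min a
b · (a + b) ≤ 2ab`. -/
theorem volume_modSet_le (n : ℕ) {a b : ℝ} (ha : 0 ≤ a) (hb : 0 ≤ b) (z : ℝ × ℝ) :
    volume (modSet n a b z) ≤ ENNReal.ofReal (4 * a * b / (2 ^ n) ^ 4) := by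
  rcases Set.eq_empty_or_nonempty (modSet n a b z) with he | ⟨p, hp⟩
  · simp [he]
  have hpi := Real.pi_gt_three
  set N : ℝ := 2 ^ n with hN
  have hN0 : 0 < N := by positivity
  set D : ℝ := (a + b) / N ^ 4 with hD
  have hD0 : 0 ≤ D := by positivity
  have hsum : ∀ w ∈ modSet n a b z, |2 * Real.pi * z.2 - (2 * Real.pi * w.1) ^ 5 -
      (2 * Real.pi * z.1 - 2 * Real.pi * w.1) ^ 5| ≤ a + b := fun w hw ↦ by
    obtain ⟨-, -, h3, h4⟩ := hw
    have : 2 * Real.pi * z.2 - (2 * Real.pi * w.1) ^ 5 -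
      (2 * Real.pi * z.1 - 2 * Real.pi * w.1) ^ 5 = mu w + mu (z - w) := by
      simp only [mu, Prod.fst_sub, Prod.snd_sub]; ring
    rw [this]
    exact (abs_add_le _ _).trans (add_le_add h3 h4)
  have hclose : ∀ w ∈ modSet n a b z, w.1 ∈ Set.Icc (p.1 - D) (p.1 + D) := fun w hw ↦ by
    have h := abs_sub_le_of_quintic hN0 hp.1 hw.1 (X := 2 * Real.pi * z.1)
      (by rw [← mul_sub]; exact hp.2.1) (by rw [← mul_sub]; exact hw.2.1) (hsum p hp) (hsum w hw)
    rw [← mul_sub, abs_mul, abs_of_pos (by positivity : 0 < 2 * Real.pi), mul_div_assoc] at h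
    have : |p.1 - w.1| ≤ D := by nlinarith [abs_nonneg (p.1 - w.1)]
    rw [abs_le] at this
    constructor <;> linarith
  have hslice : ∀ ξ, volume (Prod.mk ξ ⁻¹' modSet n a b z) ≤ ENNReal.ofReal (min a b) := fun ξ ↦ by
    rcases min_choice a b with h | h <;> rw [h]
    · refine (measure_mono ?_).trans ((volume_abs_le ((2 * Real.pi * ξ) ^ 5) a).trans
        (ENNReal.ofReal_le_ofReal (by linarith)))
      intro τ hτ
      exact hτ.2.2.1
    · refine (measure_mono ?_).trans ((volume_abs_le (2 * Real.pi * z.2 -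
        (2 * Real.pi * (z.1 - ξ)) ^ 5) b).trans (ENNReal.ofReal_le_ofReal (by linarith)))
      intro τ hτ
      have h4 := hτ.2.2.2
      rw [Set.mem_ofPred_eq, ← abs_neg]
      convert h4 using 2
      simp only [mu, Prod.fst_sub, Prod.snd_sub]
      ring
  calc volume (modSet n a b z)
      = ∫⁻ ξ, volume (Prod.mk ξ ⁻¹' modSet n a b z) := by
        rw [Measure.volume_eq_prod, Measure.prod_apply (measurableSet_modSet n a b z)]
    _ ≤ ∫⁻ ξ, (Set.Icc (p.1 - D) (p.1 + D)).indicator (fun _ ↦ ENNReal.ofReal (min a b)) ξ := by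
        refine lintegral_mono fun ξ ↦ ?_
        by_cases hξ : ξ ∈ Set.Icc (p.1 - D) (p.1 + D)
        · rw [Set.indicator_of_mem hξ]
          exact hslice ξ
        · rw [Set.indicator_of_notMem hξ, nonpos_iff_eq_zero]
          have : Prod.mk ξ ⁻¹' modSet n a b z = ∅ := by
            ext τ
            simp only [Set.mem_preimage, Set.mem_empty_iff_false, iff_false]
            exact fun hτ ↦ hξ (hclose _ hτ)
          rw [this, measure_empty]
    _ = ENNReal.ofReal (min a b * (2 * D)) := by
        rw [lintegral_indicator_const measurableSet_Icc, Real.volume_Icc,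
          ← ENNReal.ofReal_mul (le_min ha hb)]
        congr 2
        ring
    _ ≤ _ := by
        refine ENNReal.ofReal_le_ofReal ?_
        rw [hD, mul_div_assoc', mul_div_assoc', div_le_div_iff_of_pos_right (by positivity)]
        have h1 : min a b * a ≤ b * a := by gcongr; exact min_le_right _ _
        have h2 : min a b * b ≤ a * b := by gcongr; exact min_le_left _ _
        linarith

/-! ### From measures of interaction sets to bilinear `L²` bounds. -/

theorem lintegral_conv {F G : ℝ × ℝ → ℝ≥0∞} (hF : Measurable F) (hG : Measurable G) :
    ∫⁻ z, conv F G z = (∫⁻ z, F z) * ∫⁻ z, G z := by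
  unfold conv
  rw [lintegral_lintegral_swap]
  · rw [← lintegral_mul_const _ hF]
    refine lintegral_congr fun w ↦ ?_
    rw [lintegral_const_mul _ (by fun_prop : Measurable fun z ↦ G (z - w)),
      lintegral_sub_right_eq_self G w]
  · exact ((hF.comp measurable_snd).mul (hG.comp (measurable_fst.sub measurable_snd))).aemeasurable

/-- Cauchy–Schwarz on `S z` bounds the square of the convolution of `F` and `G` pointwise by `V²`
times the convolution of `F²` and `G²`, and the integral of the latter factorizes. -/
theorem n2_conv_le_of_volume {F G : ℝ × ℝ → ℝ≥0∞} (hF : Measurable F) (hG : Measurable G)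
    (V : ℝ≥0∞) (S : ℝ × ℝ → Set (ℝ × ℝ)) (hS : ∀ z, MeasurableSet (S z))
    (hV : ∀ z, volume (S z) ≤ V ^ 2)
    (hsupp : ∀ z w, F w ≠ 0 → G (z - w) ≠ 0 → w ∈ S z) : n2 (conv F G) ≤ V * (n2 F * n2 G) := by
  rw [n2_le_iff, mul_pow, mul_pow, n2_sq, n2_sq,
    ← lintegral_conv (hF.pow_const 2) (hG.pow_const 2),
    ← lintegral_const_mul _ (measurable_conv (hF.pow_const 2) (hG.pow_const 2))]
  refine lintegral_mono fun z ↦ ?_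
  have hprod : Measurable fun w ↦ F w * G (z - w) :=
    hF.mul (hG.comp (measurable_const.sub measurable_id))
  have h1 : conv F G z = ∫⁻ w, (S z).indicator 1 w * (F w * G (z - w)) := by
    refine lintegral_congr fun w ↦ ?_
    by_cases hw : w ∈ S z
    · simp [hw]
    · have : F w * G (z - w) = 0 := by
        by_contra h
        exact hw (hsupp z w (left_ne_zero_of_mul h) (right_ne_zero_of_mul h))
      simp [this]
  have h2 : n2 ((S z).indicator (1 : ℝ × ℝ → ℝ≥0∞)) ^ 2 ≤ V ^ 2 := by
    rw [n2_sq]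
    refine le_trans (le_of_eq ?_) (hV z)
    rw [← lintegral_indicator_one (hS z)]
    refine lintegral_congr fun w ↦ ?_
    by_cases hw : w ∈ S z <;> simp [hw]
  dsimp only
  rw [h1]
  calc _ ≤ (n2 ((S z).indicator (1 : ℝ × ℝ → ℝ≥0∞)) * n2 fun w ↦ F w * G (z - w)) ^ 2 :=
        pow_le_pow_left' (lintegral_mul_le_n2 (measurable_one.indicator (hS z)).aemeasurable
          hprod.aemeasurable) 2
    _ ≤ V ^ 2 * ∫⁻ w, (F w * G (z - w)) ^ 2 := by
        rw [mul_pow, n2_sq (fun w ↦ F w * G (z - w))]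
        gcongr
    _ = _ := by simp_rw [mul_pow]; rfl

/-- Both functions are split by modulation. For the pair `(i, j)` the square root of the measure of
the interaction set is of order `2^(i/2) 2^(j/2) 2^(-2n)`, so the weights of the two `X` norms
appear and the sums over `i` and `j` close without loss. -/
theorem IsCutoff.n2_conv_transversal {η : ℝ → ℝ} (hη : IsCutoff η) (n : ℕ)
    {F G : ℝ × ℝ → ℝ≥0∞} (hF : Measurable F) (hG : Measurable G)
    (hFs : ∀ z, F z ≠ 0 → 5 / 8 * 2 ^ n ≤ |2 * Real.pi * z.1|)
    (hGs : ∀ z, G z ≠ 0 → |2 * Real.pi * z.1| ≤ 1 / 5 * 2 ^ n) :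
    n2 (conv F G) ≤ 4 * e2 (-2 * n) * (xn η F * xn η G) := by
  set f : ℕ → ℝ × ℝ → ℝ≥0∞ := fun j z ↦ ENNReal.ofReal (etaK η j (mu z)) * F z with hf
  set g : ℕ → ℝ × ℝ → ℝ≥0∞ := fun j z ↦ ENNReal.ofReal (etaK η j (mu z)) * G z with hg
  have hfm : ∀ j, Measurable (f j) := fun j ↦ (hη.measurable_eta_mu j).mul hF
  have hgm : ∀ j, Measurable (g j) := fun j ↦ (hη.measurable_eta_mu j).mul hG
  have hsum : conv F G = fun z ↦ ∑' i, ∑' j, conv (f i) (g j) z := by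
    funext z
    have hgm' : ∀ j, Measurable fun w ↦ g j (z - w) := fun j ↦
      (hgm j).comp (measurable_const.sub measurable_id)
    have h1 : ∀ i, ∑' j, conv (f i) (g j) z = ∫⁻ w, f i w * G (z - w) := fun i ↦ by
      unfold conv
      rw [← lintegral_tsum (f := fun j w ↦ f i w * g j (z - w))
        fun j ↦ ((hfm i).mul (hgm' j)).aemeasurable]
      refine lintegral_congr fun w ↦ ?_
      rw [ENNReal.tsum_mul_left]
      congr 1
      exact hη.eta_sum_mul G (z - w)
    simp_rw [h1]
    rw [← lintegral_tsum (f := fun i w ↦ f i w * G (z - w)) fun i ↦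
      ((hfm i).mul (hG.comp (measurable_const.sub measurable_id))).aemeasurable]
    refine lintegral_congr fun w ↦ ?_
    rw [ENNReal.tsum_mul_right]
    congr 1
    exact (hη.eta_sum_mul F w).symm
  have hblock : ∀ i j : ℕ, n2 (conv (f i) (g j)) ≤
      4 * e2 (-2 * n) * ((e2 (i / 2) * n2 (f i)) * (e2 (j / 2) * n2 (g j))) := fun i j ↦ by
    refine (n2_conv_le_of_volume (hfm i) (hgm j) (4 * e2 (-2 * n) * e2 (i / 2) * e2 (j / 2))
      (modSet n (8 / 5 * 2 ^ i) (8 / 5 * 2 ^ j)) (fun z ↦ measurableSet_modSet _ _ _ z)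
      (fun z ↦ ?_) fun z w hw hzw ↦ ?_).trans (le_of_eq (by ring))
    · refine (volume_modSet_le n (by positivity) (by positivity) z).trans ?_
      -- The numerical factor `4 · (8/5)²` is below `16`, the square of the `4` in the constant.
      have : 4 * (8 / 5 * 2 ^ i) * (8 / 5 * 2 ^ j) / (2 ^ n) ^ 4 ≤
          16 * ((2 : ℝ) ^ (-4 * n : ℝ) * 2 ^ (i : ℝ) * 2 ^ (j : ℝ)) := by
        have hn : (2 : ℝ) ^ (-4 * n : ℝ) = ((2 ^ n) ^ 4)⁻¹ := by
          rw [neg_mul, Real.rpow_neg (by norm_num), ← pow_mul, ← Real.rpow_natCast]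
          push_cast
          ring_nf
        rw [hn, Real.rpow_natCast, Real.rpow_natCast, div_eq_mul_inv]
        have : (0 : ℝ) ≤ ((2 ^ n) ^ 4)⁻¹ * 2 ^ i * 2 ^ j := by positivity
        nlinarith
      refine (ENNReal.ofReal_le_ofReal this).trans (le_of_eq ?_)
      rw [ENNReal.ofReal_mul (by norm_num), ENNReal.ofReal_mul (by positivity),
        ENNReal.ofReal_mul (by positivity), ofReal_rpow_two, ofReal_rpow_two, ofReal_rpow_two,
        mul_pow, mul_pow, mul_pow, e2_pow, e2_pow, e2_pow]
      have e1 : (-2 * n * (2 : ℕ) : ℝ) = -4 * n := by push_cast; ring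
      have e3 : ∀ i : ℕ, (i / 2 * (2 : ℕ) : ℝ) = i := fun i ↦ by push_cast; ring
      rw [e1, e3, e3]
      norm_num
      ring
    · have h1 : etaK η i (mu w) ≠ 0 := fun h ↦ hw (by simp [hf, h])
      have h2 : etaK η j (mu (z - w)) ≠ 0 := fun h ↦ hzw (by simp [hg, h])
      exact ⟨hFs w (right_ne_zero_of_mul hw), hGs (z - w) (right_ne_zero_of_mul hzw),
        hη.etaK_upper h1, hη.etaK_upper h2⟩
  rw [hsum]
  calc _ ≤ ∑' i, ∑' j, n2 (conv (f i) (g j)) :=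
        (n2_tsum_le fun i ↦ Measurable.tsum fun j ↦ measurable_conv (hfm i) (hgm j)).trans
          (ENNReal.tsum_le_tsum fun i ↦ n2_tsum_le fun j ↦ measurable_conv (hfm i) (hgm j))
    _ ≤ ∑' i : ℕ, ∑' j : ℕ, 4 * e2 (-2 * n) *
          ((e2 (i / 2) * n2 (f i)) * (e2 (j / 2) * n2 (g j))) :=
        ENNReal.tsum_le_tsum fun i ↦ ENNReal.tsum_le_tsum fun j ↦ hblock i j
    _ = _ := by
        simp_rw [ENNReal.tsum_mul_left, ENNReal.tsum_mul_right]
        rfl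

/-! ### The resonant bilinear estimate -/

/-- The quintic resonance function has the explicit factorization `h1`. Its quadratic factor is at
least `(P² + Q²)/2`, so for large `P`, `Q` it can be small only through `P + Q`, the output
frequency. -/
theorem abs_quintic_resonance {m P Q : ℝ} (hm : 0 ≤ m) (hP : m ≤ |P|) (hQ : m ≤ |Q|) :
    5 * m ^ 4 * |P + Q| ≤ |(P + Q) ^ 5 - P ^ 5 - Q ^ 5| := by
  have h1 : (P + Q) ^ 5 - P ^ 5 - Q ^ 5 = 5 * (P * Q) * (P ^ 2 + P * Q + Q ^ 2) * (P + Q) := by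
    ring
  have hP2 : m ^ 2 ≤ P ^ 2 := by rw [← sq_abs P]; gcongr
  have hQ2 : m ^ 2 ≤ Q ^ 2 := by rw [← sq_abs Q]; gcongr
  have h2 : m ^ 2 ≤ P ^ 2 + P * Q + Q ^ 2 := by nlinarith [sq_nonneg (P + Q)]
  have h3 : m * m ≤ |P * Q| := by rw [abs_mul]; gcongr
  rw [h1, abs_mul, abs_mul, abs_mul, abs_of_nonneg ((sq_nonneg m).trans h2),
    abs_of_pos (by norm_num : (0 : ℝ) < 5)]
  have h4 : 5 * m ^ 4 ≤ 5 * |P * Q| * (P ^ 2 + P * Q + Q ^ 2) := by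
    calc 5 * m ^ 4 = 5 * (m * m) * m ^ 2 := by ring
      _ ≤ _ := by gcongr
  exact mul_le_mul_of_nonneg_right h4 (abs_nonneg _)

/-- The modulations of the factors minus that of the output equal the resonance function, so one of
the three is large. The `1 +` absorbs the lowest frequencies, where a band may reach zero and the
factorization yields nothing. -/
theorem resonance_le_max {n k₁ k₂ : ℕ} (hk₁ : n ≤ k₁ + 2) (hk₂ : n ≤ k₂ + 2) (h₁ : k₁ ≤ n)
    (h₂ : k₂ ≤ n) {z w : ℝ × ℝ} (hw : w.1 ∈ band k₁) (hzw : (z - w).1 ∈ band k₂) :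
    (2 ^ n) ^ 4 * |2 * Real.pi * z.1| / 4000 ≤ 1 + |mu z| ∨
    (2 ^ n) ^ 4 * |2 * Real.pi * z.1| / 4000 ≤ 1 + |mu w| ∨
    (2 ^ n) ^ 4 * |2 * Real.pi * z.1| / 4000 ≤ 1 + |mu (z - w)| := by
  set P := 2 * Real.pi * w.1 with hPdef
  set Q := 2 * Real.pi * (z - w).1 with hQdef
  have hsum : 2 * Real.pi * z.1 = P + Q := by
    rw [hPdef, hQdef, Prod.fst_sub]; ring
  have hN : (0 : ℝ) < 2 ^ n := by positivity
  by_cases hk : 1 ≤ k₁ ∧ 1 ≤ k₂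
  · have hlow : ∀ k, n ≤ k + 2 → 5 / 32 * (2 : ℝ) ^ n ≤ 5 / 8 * 2 ^ k := fun k hk ↦ by
      have : (2 : ℝ) ^ n ≤ 2 ^ (k + 2) := pow_le_pow_right₀ (by norm_num) hk
      rw [pow_add] at this
      linarith
    have key := abs_quintic_resonance (by positivity : (0 : ℝ) ≤ 5 / 32 * 2 ^ n)
      ((hlow k₁ hk₁).trans (hw.2 hk.1)) ((hlow k₂ hk₂).trans (hzw.2 hk.2))
    rw [← hPdef, ← hQdef] at key
    have hmod : (P + Q) ^ 5 - P ^ 5 - Q ^ 5 = mu w + mu (z - w) - mu z := by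
      rw [← hsum]
      simp only [hPdef, hQdef, mu, Prod.fst_sub, Prod.snd_sub]
      ring
    have h4 : |mu w + mu (z - w) - mu z| ≤ |mu w| + |mu (z - w)| + |mu z| :=
      (abs_sub _ _).trans (add_le_add (abs_add_le _ _) le_rfl)
    rw [hsum]
    rw [hmod] at key
    have h5 : 5 * (5 / 32 * (2 : ℝ) ^ n) ^ 4 * |P + Q| =
        5 * (5 / 32) ^ 4 * ((2 ^ n) ^ 4 * |P + Q|) := by ring
    rw [h5] at key
    have h6 : 0 ≤ ((2 : ℝ) ^ n) ^ 4 * |P + Q| := by positivity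
    norm_num at key
    by_contra hcon
    push Not at hcon
    linarith [hcon.1, hcon.2.1, hcon.2.2]
  -- One of the bands has index zero, so `n ≤ 2`, and the quantity in question is at most `4⁴ ·
  -- (64/5) / 4000 < 1`.
  · left
    have hn : n ≤ 2 := by omega
    have hN4 : (2 : ℝ) ^ n ≤ 4 :=
      (pow_le_pow_right₀ (by norm_num) hn).trans (by norm_num)
    have hP : |P| ≤ 8 / 5 * 2 ^ k₁ := hw.1
    have hQ : |Q| ≤ 8 / 5 * 2 ^ k₂ := hzw.1
    have hk1 : (2 : ℝ) ^ k₁ ≤ 2 ^ n := pow_le_pow_right₀ (by norm_num) h₁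
    have hk2 : (2 : ℝ) ^ k₂ ≤ 2 ^ n := pow_le_pow_right₀ (by norm_num) h₂
    have habs : |P + Q| ≤ 64 / 5 := (abs_add_le _ _).trans (by linarith)
    rw [hsum]
    have : ((2 : ℝ) ^ n) ^ 4 ≤ 4 ^ 4 := by gcongr
    have h7 : ((2 : ℝ) ^ n) ^ 4 * |P + Q| ≤ 4 ^ 4 * (64 / 5) := by gcongr
    have := abs_nonneg (mu z)
    linarith

theorem rpow_le_sum_of_le {θ t a b c : ℝ} (hθ : 0 ≤ θ) (ht : 0 ≤ t) (ha : 0 ≤ a) (hb : 0 ≤ b)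
    (hc : 0 ≤ c) (h : t ≤ a ∨ t ≤ b ∨ t ≤ c) : t ^ θ ≤ a ^ θ + b ^ θ + c ^ θ := by
  have h1 := Real.rpow_nonneg ha θ
  have h2 := Real.rpow_nonneg hb θ
  have h3 := Real.rpow_nonneg hc θ
  rcases h with h | h | h <;> have := Real.rpow_le_rpow ht h hθ <;> linarith

/-- Indicator function of the frequencies `|2πξ| ≤ R`. -/
def lowpass (R : ℝ) (ξ : ℝ) : ℝ≥0∞ := {ξ : ℝ | |2 * Real.pi * ξ| ≤ R}.indicator 1 ξ

theorem measurable_lowpass (R : ℝ) : Measurable (lowpass R) := by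
  refine measurable_one.indicator (measurableSet_le ?_ measurable_const)
  fun_prop

theorem lowpass_eq_one {R ξ : ℝ} (h : |2 * Real.pi * ξ| ≤ R) : lowpass R ξ = 1 :=
  Set.indicator_of_mem (s := {ξ : ℝ | |2 * Real.pi * ξ| ≤ R}) h _

theorem lintegral_lowpass_rpow_le {a R : ℝ} (ha : a < 1) (hR : 0 < R) :
    ∫⁻ ξ, lowpass R ξ * ENNReal.ofReal (|2 * Real.pi * ξ| ^ (-a)) ≤
      ENNReal.ofReal (2 / (1 - a) * R ^ (1 - a)) := by
  have hpi := Real.pi_gt_three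
  have hpos : (0 : ℝ) < 2 * Real.pi := by positivity
  have hint : IntegrableOn (fun x : ℝ ↦ x ^ (-a)) (Set.Ioc 0 R) := by
    rw [← intervalIntegrable_iff_integrableOn_Ioc_of_le hR.le]
    exact intervalIntegral.intervalIntegrable_rpow' (by linarith)
  have hhalf : ∫⁻ x in Set.Ioc 0 R, ENNReal.ofReal (|x| ^ (-a)) =
      ENNReal.ofReal (R ^ (1 - a) / (1 - a)) := by
    rw [setLIntegral_congr_fun (g := fun x ↦ ENNReal.ofReal (x ^ (-a))) measurableSet_Ioc
      fun x hx ↦ by simp only [abs_of_pos hx.1]]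
    rw [← ofReal_integral_eq_lintegral_ofReal hint
      ((ae_restrict_mem measurableSet_Ioc).mono fun x hx ↦ Real.rpow_nonneg hx.1.le _),
      ← intervalIntegral.integral_of_le hR.le, integral_rpow (Or.inl (by linarith))]
    rw [show -a + 1 = 1 - a by ring, Real.zero_rpow (by linarith), sub_zero]
  have hmeas : Measurable fun x : ℝ ↦ ENNReal.ofReal (|x| ^ (-a)) := by fun_prop
  have hneg : ∫⁻ x in Set.Ico (-R) 0, ENNReal.ofReal (|x| ^ (-a)) =
      ENNReal.ofReal (R ^ (1 - a) / (1 - a)) := by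
    rw [← hhalf, ← lintegral_indicator measurableSet_Ico, ← lintegral_indicator measurableSet_Ioc,
      ← lintegral_neg_eq_self]
    refine lintegral_congr fun x ↦ ?_
    by_cases hx : x ∈ Set.Ioc 0 R
    · have : -x ∈ Set.Ico (-R) 0 := ⟨by linarith [hx.2], by linarith [hx.1]⟩
      simp [hx, this]
    · have : -x ∉ Set.Ico (-R) 0 := fun h ↦ hx ⟨by linarith [h.2], by linarith [h.1]⟩
      simp [hx, this]
  have hfull : ∫⁻ x in Set.Icc (-R) R, ENNReal.ofReal (|x| ^ (-a)) ≤
      ENNReal.ofReal (2 / (1 - a) * R ^ (1 - a)) := by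
    calc ∫⁻ x in Set.Icc (-R) R, ENNReal.ofReal (|x| ^ (-a))
        ≤ ∫⁻ x in Set.Ico (-R) 0 ∪ ({0} ∪ Set.Ioc 0 R), ENNReal.ofReal (|x| ^ (-a)) := by
          refine lintegral_mono_set fun x hx ↦ ?_
          rcases lt_trichotomy x 0 with h | h | h
          · exact Or.inl ⟨hx.1, h⟩
          · exact Or.inr (Or.inl h)
          · exact Or.inr (Or.inr ⟨h, hx.2⟩)
      _ ≤ ENNReal.ofReal (R ^ (1 - a) / (1 - a)) +
          (0 + ENNReal.ofReal (R ^ (1 - a) / (1 - a))) := by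
          refine (lintegral_union_le _ _ _).trans (add_le_add hneg.le
            ((lintegral_union_le _ _ _).trans (add_le_add ?_ hhalf.le)))
          simp
      _ = _ := by
          have : 0 ≤ R ^ (1 - a) / (1 - a) :=
            div_nonneg (Real.rpow_nonneg hR.le _) (by linarith)
          rw [zero_add, ← ENNReal.ofReal_add this this]
          congr 1
          ring
  have hscale : ∫⁻ ξ, lowpass R ξ * ENNReal.ofReal (|2 * Real.pi * ξ| ^ (-a)) ≤
      ∫⁻ x in Set.Icc (-R) R, ENNReal.ofReal (|x| ^ (-a)) := by
    have h1 : ∀ ξ : ℝ, lowpass R ξ * ENNReal.ofReal (|2 * Real.pi * ξ| ^ (-a)) =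
        (Set.Icc (-R) R).indicator (fun x ↦ ENNReal.ofReal (|x| ^ (-a))) (2 * Real.pi * ξ) := by
      intro ξ
      by_cases h : |2 * Real.pi * ξ| ≤ R
      · rw [lowpass_eq_one h, Set.indicator_of_mem (by rw [Set.mem_Icc, ← abs_le]; exact h),
          one_mul]
      · have h' : ξ ∉ {ξ : ℝ | |2 * Real.pi * ξ| ≤ R} := h
        rw [lowpass, Set.indicator_of_notMem h', zero_mul,
          Set.indicator_of_notMem (by rw [Set.mem_Icc, ← abs_le]; exact h)]
    simp_rw [h1]
    rw [← lintegral_indicator measurableSet_Icc]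
    set g := (Set.Icc (-R) R).indicator fun x : ℝ ↦ ENNReal.ofReal (|x| ^ (-a)) with hg
    have hgm : Measurable g := hmeas.indicator measurableSet_Icc
    have h3 := Real.map_volume_mul_left hpos.ne'
    rw [← lintegral_map hgm (measurable_const_mul _), h3, lintegral_smul_measure, smul_eq_mul]
    refine mul_le_of_le_one_left' ?_
    rw [ENNReal.ofReal_le_one, abs_of_pos (by positivity)]
    exact inv_le_one_of_one_le₀ (by linarith)
  exact hscale.trans hfull

/-- This is where `θ < 1/2` is needed: the resonance degenerates at output frequency zero, and the
inverse factor `|ξ|^(-θ)` has to be square integrable there. -/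
theorem n2_lowpass_inv_le {θ : ℝ} (h1 : θ < 1 / 2) (n : ℕ) {R : ℝ} (hR : 0 < R) :
    n2 (fun ξ ↦ lowpass R ξ * ENNReal.ofReal (((2 ^ n) ^ 4 * |2 * Real.pi * ξ| / 4000) ^ (-θ))) ≤
      ENNReal.ofReal (√(4000 ^ (2 * θ) * (2 / (1 - 2 * θ)))) *
        (e2 (-4 * θ * n) * ENNReal.ofReal (R ^ (1 / 2 - θ))) := by
  rw [n2_le_iff]
  have hc : 0 ≤ (4000 : ℝ) ^ (2 * θ) * (2 / (1 - 2 * θ)) := by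
    have : 0 < 1 - 2 * θ := by linarith
    positivity
  have h : ∀ ξ : ℝ, (lowpass R ξ *
      ENNReal.ofReal (((2 ^ n) ^ 4 * |2 * Real.pi * ξ| / 4000) ^ (-θ))) ^ 2 =
      ENNReal.ofReal (4000 ^ (2 * θ) * 2 ^ (-8 * θ * n)) *
        (lowpass R ξ * ENNReal.ofReal (|2 * Real.pi * ξ| ^ (-(2 * θ)))) := fun ξ ↦ by
    have hl : lowpass R ξ ^ 2 = lowpass R ξ := by
      unfold lowpass
      by_cases h : ξ ∈ {ξ : ℝ | |2 * Real.pi * ξ| ≤ R}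
      · rw [Set.indicator_of_mem h]; simp
      · rw [Set.indicator_of_notMem h]; simp
    rw [mul_pow, hl, mul_left_comm, ← ENNReal.ofReal_pow (by positivity),
      ← ENNReal.ofReal_mul (by positivity)]
    congr 2
    rw [← Real.rpow_natCast, ← Real.rpow_mul (by positivity),
      Real.div_rpow (by positivity) (by norm_num), Real.mul_rpow (by positivity) (by positivity),
      ← pow_mul, ← Real.rpow_natCast, ← Real.rpow_mul (by norm_num), div_eq_mul_inv,
      ← Real.rpow_neg (by norm_num)]
    push_cast
    ring_nf
  simp_rw [h]
  rw [lintegral_const_mul]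
  swap
  · have := measurable_lowpass R
    fun_prop
  refine (mul_le_mul_right (lintegral_lowpass_rpow_le (by linarith) hR) _).trans (le_of_eq ?_)
  rw [mul_pow, mul_pow, ← ENNReal.ofReal_pow (Real.sqrt_nonneg _), Real.sq_sqrt hc,
    ← ofReal_rpow_two, ← ENNReal.ofReal_pow (by positivity), ← ENNReal.ofReal_pow (by positivity),
    ← ENNReal.ofReal_mul (by positivity), ← ENNReal.ofReal_mul (by positivity),
    ← ENNReal.ofReal_mul (by positivity)]
  congr 1
  rw [← Real.rpow_natCast, ← Real.rpow_mul (by norm_num), ← Real.rpow_natCast,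
    ← Real.rpow_mul hR.le]
  push_cast
  ring_nf

theorem IsCutoff.ofReal_etaK_le_one {η : ℝ → ℝ} (hη : IsCutoff η) (j : ℕ) (r : ℝ) :
    ENNReal.ofReal (etaK η j r) ≤ 1 := by
  rw [ENNReal.ofReal_le_one]; exact hη.etaK_le_one j r

theorem measurable_wt_mul (θ : ℝ) {F : ℝ × ℝ → ℝ≥0∞} (hF : Measurable F) :
    Measurable fun z ↦ wt θ z * F z := (measurable_wt θ).mul hF

/-- Two bounds are interpolated. The pointwise Cauchy–Schwarz bound on a slice of length `2^j` gives
`2^(j/2 - n) XY`, Young's inequality gives `XY`, and `min(2^(j/2 - n), 1) ≤ 2^(2θ(j/2 - n))` because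
`0 ≤ 2θ ≤ 1`. The case distinction compares `j/2` with `n`. -/
theorem IsCutoff.n2_eta_conv_slice_le {η : ℝ → ℝ} (hη : IsCutoff η) {θ : ℝ} (h0 : 0 ≤ θ)
    (h1 : θ ≤ 1 / 2) (n j : ℕ) {F G : ℝ × ℝ → ℝ≥0∞} (hF : Measurable F) (hG : Measurable G)
    {X Y : ℝ≥0∞} (hX : n2 F ≤ X) (hY : n21 G ≤ Y) (hY' : n2 G ≤ e2 (-n) * Y) (ξ : ℝ) :
    n2 (fun τ ↦ ENNReal.ofReal (etaK η j (mu (ξ, τ))) * conv F G (ξ, τ)) ≤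
      e2 (j * θ + -(2 * θ * n)) * (X * Y) := by
  by_cases hj : (j : ℝ) / 2 ≤ n
  · have hm : Measurable ((Function.support fun τ ↦ etaK η j (mu (ξ, τ))).indicator
        (1 : ℝ → ℝ≥0∞)) := measurable_one.indicator
      (((hη.continuous_etaK j).comp (continuous_mu.comp (by fun_prop))).measurable
        (measurableSet_singleton 0).compl)
    calc _ ≤ n2 (fun τ ↦ (n2 F * n2 G) *
          (Function.support fun τ ↦ etaK η j (mu (ξ, τ))).indicator 1 τ) := by
          refine n2_mono fun τ ↦ ?_
          by_cases hτ : etaK η j (mu (ξ, τ)) = 0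
          · simp [hτ]
          · have hτ' : τ ∈ Function.support fun τ ↦ etaK η j (mu (ξ, τ)) := hτ
            rw [Set.indicator_of_mem hτ', Pi.one_apply, mul_one]
            exact (mul_le_of_le_one_left' (hη.ofReal_etaK_le_one j _)).trans (conv_le_n2 hF hG _)
      _ ≤ (X * (e2 (-n) * Y)) * e2 (j / 2) := by
          rw [n2_const_mul _ _ hm]
          gcongr
          exact hη.volume_eta_slice j ξ
      _ = e2 (j / 2 + -n) * (X * Y) := by rw [e2_add]; ring
      _ ≤ _ := by
          gcongr
          refine e2_mono ?_
          nlinarith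
  · push Not at hj
    calc _ ≤ n2 (fun τ ↦ conv G F (ξ, τ)) := n2_mono fun τ ↦ by
          rw [conv_comm G F]
          exact mul_le_of_le_one_left' (hη.ofReal_etaK_le_one j _)
      _ ≤ Y * X := (n2_conv_slice_le hG hF ξ).trans (by gcongr)
      _ = 1 * (X * Y) := by ring
      _ ≤ _ := by
          gcongr
          rw [← e2_zero]
          refine e2_mono ?_
          nlinarith

/-- By the resonance the convolution is at most `Li ξ` times three convolutions in which the weight
of exponent `θ` sits on the output or on one of the factors. Each has slices in `τ` bounded
uniformly in `ξ`, so `Li` only enters through its `L²` norm. This yields `2^(-4θn)`, and the small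
`L²` norms of the factors yield `2^(-2θn)`. The sum over `j` of `2^(-j/2) 2^(jθ)` is finite since `θ
< 1/2`. -/
theorem IsCutoff.n2_conv_resonant {η : ℝ → ℝ} (hη : IsCutoff η) {θ : ℝ} (h0 : 0 < θ)
    (h1 : θ < 1 / 2) : ∃ C : ℝ≥0, ∀ n k₁ k₂ : ℕ, n ≤ k₁ + 2 → n ≤ k₂ + 2 → k₁ ≤ n → k₂ ≤ n →
      ∀ F G : ℝ × ℝ → ℝ≥0∞, Measurable F → Measurable G → (∀ z, F z ≠ 0 → z.1 ∈ band k₁) →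
      (∀ z, G z ≠ 0 → z.1 ∈ band k₂) → ∀ X Y : ℝ≥0∞, n21 F ≤ X → n21 G ≤ Y → dn θ F ≤ X →
      dn θ G ≤ Y → n2 F ≤ e2 (-n) * X → n2 G ≤ e2 (-n) * Y → ∀ R : ℝ, 0 < R →
      ∑' j : ℕ, e2 (-(j / 2)) *
        n2 (fun z ↦ lowpass R z.1 * (ENNReal.ofReal (etaK η j (mu z)) * conv F G z)) ≤
      C * (e2 (-6 * θ * n) * ENNReal.ofReal (R ^ (1 / 2 - θ)) * (X * Y)) := by
  set c := ENNReal.ofReal (√(4000 ^ (2 * θ) * (2 / (1 - 2 * θ)))) with hc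
  set S := ∑' j : ℕ, e2 (-((1 / 2 - θ) * j)) with hS
  have hS' : S < ⊤ := tsum_e2_lt_top (by linarith)
  refine ⟨(4 * c * S).toNNReal, ?_⟩
  have hC : ((4 * c * S).toNNReal : ℝ≥0∞) = 4 * c * S := ENNReal.coe_toNNReal
    (ENNReal.mul_ne_top (ENNReal.mul_ne_top (by norm_num) ENNReal.ofReal_ne_top) hS'.ne)
  rw [hC]
  intro n k₁ k₂ hk₁ hk₂ hn₁ hn₂ F G hF hG hFs hGs X Y hFX hGY hFX' hGY' hFX2 hGY2 R hR
  have hwF := measurable_wt_mul θ hF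
  have hwG := measurable_wt_mul θ hG
  have hcm := measurable_conv hF hG
  set Li : ℝ → ℝ≥0∞ := fun ξ ↦
    ENNReal.ofReal (((2 ^ n) ^ 4 * |2 * Real.pi * ξ| / 4000) ^ (-θ)) with hLi
  have hLim : Measurable fun ξ ↦ lowpass R ξ * Li ξ := by
    have := measurable_lowpass R
    fun_prop
  -- At `z.1 = 0` the real power in `Li` takes the default value `0`, so the inequality is claimed
  -- only off this null set.
  have hpt : ∀ z : ℝ × ℝ, z.1 ≠ 0 → conv F G z ≤ Li z.1 * (wt θ z * conv F G z +
      conv (fun z ↦ wt θ z * F z) G z + conv F (fun z ↦ wt θ z * G z) z) := fun z hz ↦ by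
    have hpos : 0 < ((2 : ℝ) ^ n) ^ 4 * |2 * Real.pi * z.1| / 4000 := by
      have := Real.pi_pos
      have : 0 < |2 * Real.pi * z.1| := by positivity
      positivity
    have hGz : Measurable fun w ↦ G (z - w) := hG.comp (measurable_const.sub measurable_id)
    have hwGz : Measurable fun w ↦ wt θ (z - w) * G (z - w) :=
      hwG.comp (measurable_const.sub measurable_id)
    have hw1 := measurable_wt θ
    have hm1 : Measurable fun w ↦ F w * G (z - w) := by fun_prop
    have hm2 : Measurable fun w ↦ wt θ w * F w * G (z - w) := by fun_prop
    have hm3 : Measurable fun w ↦ F w * (wt θ (z - w) * G (z - w)) := by fun_prop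
    unfold conv
    rw [← lintegral_const_mul _ hm1, ← lintegral_add_left (hm1.const_mul _),
      ← lintegral_add_left (by fun_prop), ← lintegral_const_mul _ (by fun_prop)]
    refine lintegral_mono fun w ↦ ?_
    by_cases hw : F w * G (z - w) = 0
    · rw [hw]; exact zero_le
    have hres := resonance_le_max hk₁ hk₂ hn₁ hn₂ (hFs w (left_ne_zero_of_mul hw))
      (hGs (z - w) (right_ne_zero_of_mul hw))
    have hr := rpow_le_sum_of_le h0.le hpos.le (by positivity) (by positivity) (by positivity) hres
    have hone : 1 ≤ Li z.1 * (wt θ z + wt θ w + wt θ (z - w)) := by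
      unfold wt
      rw [← ENNReal.ofReal_add (by positivity) (by positivity),
        ← ENNReal.ofReal_add (by positivity) (by positivity), hLi,
        ← ENNReal.ofReal_mul (by positivity), ENNReal.one_le_ofReal, Real.rpow_neg hpos.le,
        inv_mul_eq_div, le_div_iff₀ (Real.rpow_pos_of_pos hpos _), one_mul]
      exact hr
    calc F w * G (z - w) ≤ Li z.1 * (wt θ z + wt θ w + wt θ (z - w)) * (F w * G (z - w)) :=
          le_mul_of_one_le_left' hone
      _ = _ := by ring
  have hblock : ∀ j : ℕ,
      n2 (fun z ↦ lowpass R z.1 * (ENNReal.ofReal (etaK η j (mu z)) * conv F G z)) ≤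
      (c * (e2 (-4 * θ * n) * ENNReal.ofReal (R ^ (1 / 2 - θ)))) *
        (4 * e2 (j * θ + -(2 * θ * n)) * (X * Y)) := fun j ↦ by
    have hηm := hη.measurable_eta_mu j
    have hlm : Measurable fun z : ℝ × ℝ ↦ lowpass R z.1 := (measurable_lowpass R).comp measurable_fst
    have hm1 : Measurable fun z ↦
        lowpass R z.1 * (ENNReal.ofReal (etaK η j (mu z)) * conv F G z) := hlm.mul (hηm.mul hcm)
    rw [n2_prod hm1]
    calc _ ≤ n2 fun ξ ↦ (4 * e2 (j * θ + -(2 * θ * n)) * (X * Y)) * (lowpass R ξ * Li ξ) := by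
          refine n2_mono_ae ?_
          have : ∀ᵐ ξ : ℝ, ξ ≠ 0 := by simp [ae_iff]
          filter_upwards [this] with ξ hξ
          have hc1 : Measurable fun τ ↦ conv F G (ξ, τ) := hcm.comp measurable_prodMk_left
          have hc2 : Measurable fun τ ↦ ENNReal.ofReal (etaK η j (mu (ξ, τ))) *
              conv (fun z ↦ wt θ z * F z) G (ξ, τ) :=
            (hηm.mul (measurable_conv hwF hG)).comp measurable_prodMk_left
          have hc3 : Measurable fun τ ↦ ENNReal.ofReal (etaK η j (mu (ξ, τ))) *
              conv F (fun z ↦ wt θ z * G z) (ξ, τ) :=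
            (hηm.mul (measurable_conv hF hwG)).comp measurable_prodMk_left
          calc _ ≤ n2 fun τ ↦ (lowpass R ξ * Li ξ) * ((2 * e2 (j * θ)) * conv F G (ξ, τ) +
                ENNReal.ofReal (etaK η j (mu (ξ, τ))) * conv (fun z ↦ wt θ z * F z) G (ξ, τ) +
                ENNReal.ofReal (etaK η j (mu (ξ, τ))) *
                  conv F (fun z ↦ wt θ z * G z) (ξ, τ)) := n2_mono fun τ ↦ by
                refine (mul_le_mul_right (mul_le_mul_right (hpt (ξ, τ) hξ) _) _).trans ?_
                have hw := (hη.wt_mul_eta_le h0.le h1.le j (ξ, τ)).trans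
                  (mul_le_of_le_one_right' (hη.ofReal_etaK_le_one j _))
                calc _ = (lowpass R ξ * Li ξ) * ((wt θ (ξ, τ) *
                      ENNReal.ofReal (etaK η j (mu (ξ, τ)))) * conv F G (ξ, τ) +
                      ENNReal.ofReal (etaK η j (mu (ξ, τ))) *
                        conv (fun z ↦ wt θ z * F z) G (ξ, τ) +
                      ENNReal.ofReal (etaK η j (mu (ξ, τ))) *
                        conv F (fun z ↦ wt θ z * G z) (ξ, τ)) := by ring
                  _ ≤ _ := by gcongr
            _ ≤ (lowpass R ξ * Li ξ) * ((2 * e2 (j * θ)) * (X * (e2 (-n) * Y)) +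
                e2 (j * θ + -(2 * θ * n)) * (X * Y) + e2 (j * θ + -(2 * θ * n)) * (X * Y)) := by
                rw [n2_const_mul _ _ (by fun_prop)]
                gcongr
                refine (n2_add_le (by fun_prop) hc3).trans (add_le_add ((n2_add_le (by fun_prop)
                  hc2).trans (add_le_add ?_ ?_)) ?_)
                · rw [n2_const_mul _ _ hc1]
                  gcongr
                  exact (n2_conv_slice_le hF hG ξ).trans (by gcongr)
                · exact hη.n2_eta_conv_slice_le h0.le h1.le n j hwF hG hFX' hGY hGY2 ξ
                · have := hη.n2_eta_conv_slice_le h0.le h1.le n j hwG hF hGY' hFX hFX2 ξ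
                  rw [conv_comm, mul_comm Y X] at this
                  exact this
            _ ≤ (lowpass R ξ * Li ξ) * (2 * (e2 (j * θ + -(2 * θ * n)) * (X * Y)) +
                e2 (j * θ + -(2 * θ * n)) * (X * Y) + e2 (j * θ + -(2 * θ * n)) * (X * Y)) := by
                gcongr _ * (?_ + _ + _)
                calc (2 * e2 (j * θ)) * (X * (e2 (-n) * Y))
                    = 2 * (e2 (j * θ + -n) * (X * Y)) := by rw [e2_add]; ring
                  _ ≤ _ := by
                    gcongr
                    refine e2_mono ?_
                    have : (0 : ℝ) ≤ n := by positivity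
                    nlinarith
            _ = _ := by ring
      _ ≤ _ := by
          rw [n2_const_mul _ _ hLim, mul_comm]
          gcongr
          exact n2_lowpass_inv_le h1 n hR
  calc _ ≤ ∑' j : ℕ, e2 (-(j / 2)) * ((c * (e2 (-4 * θ * n) * ENNReal.ofReal (R ^ (1 / 2 - θ)))) *
        (4 * e2 (j * θ + -(2 * θ * n)) * (X * Y))) :=
        ENNReal.tsum_le_tsum fun j ↦ mul_le_mul_right (hblock j) _
    _ = ∑' j : ℕ, (4 * c * (e2 (-6 * θ * n) * ENNReal.ofReal (R ^ (1 / 2 - θ)) * (X * Y))) *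
          e2 (-((1 / 2 - θ) * j)) := by
        refine tsum_congr fun j ↦ ?_
        have e : e2 (-(j / 2)) * (e2 (-4 * θ * n) * e2 (j * θ + -(2 * θ * n))) =
            e2 (-6 * θ * n) * e2 (-((1 / 2 - θ) * j)) := by
          simp only [← e2_add]
          congr 1
          ring
        calc _ = (e2 (-(j / 2)) * (e2 (-4 * θ * n) * e2 (j * θ + -(2 * θ * n)))) *
              (4 * c * (ENNReal.ofReal (R ^ (1 / 2 - θ)) * (X * Y))) := by ring
          _ = _ := by rw [e]; ring
    _ = _ := by rw [ENNReal.tsum_mul_left]; ring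

/-! ### Fourier integrals on the plane in product coordinates -/

/-- The character `exp(2πi r)`. -/
def ch (r : ℝ) : ℂ := ((Real.fourierChar r : Circle) : ℂ)

theorem continuous_ch : Continuous ch :=
  continuous_subtype_val.comp Real.continuous_fourierChar

theorem ch_add (a b : ℝ) : ch (a + b) = ch a * ch b := by
  simp [ch, AddChar.map_add_eq_mul]

theorem norm_ch (r : ℝ) : ‖ch r‖ = 1 := Circle.norm_coe _

theorem enorm_ch_mul (r : ℝ) (z : ℂ) : ‖ch r * z‖ₑ = ‖z‖ₑ := by
  rw [← ofReal_norm, ← ofReal_norm, norm_mul, norm_ch, one_mul]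

/-- The inverse Fourier integral on `ℝ × ℝ`. -/
def ift (g : ℝ × ℝ → ℂ) (z : ℝ × ℝ) : ℂ := ∫ w, ch (z.1 * w.1 + z.2 * w.2) * g w

/-- The inverse Fourier integral in the second variable. -/
def slice (g : ℝ × ℝ → ℂ) (t ξ : ℝ) : ℂ := ∫ τ, ch (t * τ) * g (ξ, τ)

theorem fourierInv_eq_ch (f : ℝ → ℂ) (x : ℝ) : 𝓕⁻ f x = ∫ ξ, ch (x * ξ) * f ξ := by
  rw [Real.fourierInv_eq]
  refine integral_congr_ae (ae_of_all _ fun ξ ↦ ?_)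
  simp [ch, Circle.smul_def]

theorem fourier_eq_ch (f : ℝ → ℂ) (x : ℝ) : 𝓕 f x = ∫ ξ, ch (-(x * ξ)) * f ξ := by
  rw [Real.fourier_eq]
  refine integral_congr_ae (ae_of_all _ fun ξ ↦ ?_)
  simp [ch, Circle.smul_def]

theorem integrable_ch_mul {α : Type*} [TopologicalSpace α] [MeasurableSpace α]
    [OpensMeasurableSpace α] {μ : Measure α} {u : α → ℝ} (hu : Continuous u) {g : α → ℂ}
    (hg : Integrable g μ) : Integrable (fun w ↦ ch (u w) * g w) μ :=
  hg.bdd_mul (continuous_ch.comp hu).aestronglyMeasurable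
    (ae_of_all _ fun _ ↦ (norm_ch _).le)

theorem ift_eq_fourierInv_slice {g : ℝ × ℝ → ℂ} (hg : Integrable g) (x t : ℝ) :
    ift g (x, t) = 𝓕⁻ (slice g t) x := by
  rw [fourierInv_eq_ch]
  unfold ift slice
  have h := integrable_ch_mul (u := fun w : ℝ × ℝ ↦ x * w.1 + t * w.2) (by fun_prop) hg
  rw [Measure.volume_eq_prod] at h ⊢
  rw [integral_prod _ h]
  refine integral_congr_ae (ae_of_all _ fun ξ ↦ ?_)
  dsimp only
  rw [← integral_const_mul]
  refine integral_congr_ae (ae_of_all _ fun τ ↦ ?_)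
  dsimp only
  rw [ch_add, mul_assoc]

theorem integrable_slice {g : ℝ × ℝ → ℂ} (hg : Integrable g) (t : ℝ) :
    Integrable (slice g t) := by
  have h := integrable_ch_mul (u := fun w : ℝ × ℝ ↦ t * w.2) (by fun_prop) hg
  rw [Measure.volume_eq_prod] at h
  exact h.integral_prod_left

theorem norm_ift_le (g : ℝ × ℝ → ℂ) (z : ℝ × ℝ) : ‖ift g z‖ ≤ ∫ w, ‖g w‖ := by
  refine (norm_integral_le_integral_norm _).trans (le_of_eq ?_)
  refine integral_congr_ae (ae_of_all _ fun w ↦ ?_)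
  simp [norm_ch]

theorem continuous_ift {g : ℝ × ℝ → ℂ} (hg : Integrable g) : Continuous (ift g) := by
  refine continuous_of_dominated (bound := fun w ↦ ‖g w‖) (fun z ↦ ?_)
    (fun z ↦ ae_of_all _ fun w ↦ by simp [norm_ch]) hg.norm (ae_of_all _ fun w ↦ ?_)
  · exact (integrable_ch_mul (by fun_prop) hg).aestronglyMeasurable
  · have := continuous_ch
    fun_prop

theorem ift_sum {ι : Type*} (s : Finset ι) {g : ι → ℝ × ℝ → ℂ} (hg : ∀ i, Integrable (g i))
    (z : ℝ × ℝ) : ift (fun w ↦ ∑ i ∈ s, g i w) z = ∑ i ∈ s, ift (g i) z := by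
  unfold ift
  simp_rw [Finset.mul_sum]
  exact integral_finsetSum s fun i _ ↦ integrable_ch_mul (by fun_prop) (hg i)

/-- Convolution on the plane. -/
def cconv (f g : ℝ × ℝ → ℂ) (z : ℝ × ℝ) : ℂ := ∫ w, f w * g (z - w)

/-- Convolution in the second variable. -/
def ctconv (ρ : ℝ → ℂ) (g : ℝ × ℝ → ℂ) (z : ℝ × ℝ) : ℂ := ∫ s, ρ s * g (z.1, z.2 - s)

theorem measurable_cconv {f g : ℝ × ℝ → ℂ} (hf : Measurable f) (hg : Measurable g) :
    Measurable (cconv f g) := by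
  have h : Measurable fun p : (ℝ × ℝ) × (ℝ × ℝ) ↦ f p.2 * g (p.1 - p.2) := by fun_prop
  exact h.stronglyMeasurable.integral_prod_right'.measurable

theorem measurable_ctconv {ρ : ℝ → ℂ} {g : ℝ × ℝ → ℂ} (hρ : Measurable ρ) (hg : Measurable g) :
    Measurable (ctconv ρ g) := by
  have h : Measurable fun p : (ℝ × ℝ) × ℝ ↦ ρ p.2 * g (p.1.1, p.1.2 - p.2) := by fun_prop
  exact h.stronglyMeasurable.integral_prod_right'.measurable

theorem enorm_cconv_le (f g : ℝ × ℝ → ℂ) (z : ℝ × ℝ) :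
    ‖cconv f g z‖ₑ ≤ conv (fun w ↦ ‖f w‖ₑ) (fun w ↦ ‖g w‖ₑ) z := by
  refine (enorm_integral_le_lintegral_enorm _).trans (le_of_eq ?_)
  simp_rw [enorm_mul]
  rfl

theorem enorm_ctconv_le (ρ : ℝ → ℂ) (g : ℝ × ℝ → ℂ) (z : ℝ × ℝ) :
    ‖ctconv ρ g z‖ₑ ≤ tconv (fun w ↦ ‖ρ w‖ₑ) (fun w ↦ ‖g w‖ₑ) z := by
  refine (enorm_integral_le_lintegral_enorm _).trans (le_of_eq ?_)
  simp_rw [enorm_mul]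
  rfl

theorem integrable_of_lintegral {α : Type*} [MeasureSpace α] {f : α → ℂ} (hf : Measurable f)
    (h : ∫⁻ x, ‖f x‖ₑ < ⊤) : Integrable f := ⟨hf.aestronglyMeasurable, h⟩

theorem integrable_cconv {f g : ℝ × ℝ → ℂ} (hf : Measurable f) (hg : Measurable g)
    (hf' : Integrable f) (hg' : Integrable g) : Integrable (cconv f g) := by
  refine integrable_of_lintegral (measurable_cconv hf hg) ?_
  refine (lintegral_mono (enorm_cconv_le f g)).trans_lt ?_
  rw [lintegral_conv hf.enorm hg.enorm]
  exact ENNReal.mul_lt_top hf'.2 hg'.2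

theorem integrable_ctconv {ρ : ℝ → ℂ} {g : ℝ × ℝ → ℂ} (hρ : Measurable ρ) (hg : Measurable g)
    (hρ' : Integrable ρ) (hg' : Integrable g) : Integrable (ctconv ρ g) := by
  refine integrable_of_lintegral (measurable_ctconv hρ hg) ?_
  refine (lintegral_mono (enorm_ctconv_le ρ g)).trans_lt ?_
  rw [Measure.volume_eq_prod, lintegral_prod _ (measurable_tconv hρ.enorm hg.enorm).aemeasurable]
  simp_rw [lintegral_tconv hρ.enorm hg.enorm]
  rw [lintegral_const_mul _ hg.enorm.lintegral_prod_right', ← lintegral_prod _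
    hg.enorm.aemeasurable]
  exact ENNReal.mul_lt_top hρ'.2 hg'.2

theorem ift_cconv {f g : ℝ × ℝ → ℂ} (hf : Integrable f) (hg : Integrable g) (z : ℝ × ℝ) :
    ift (cconv f g) z = ift f z * ift g z := by
  have hu : Continuous fun w : ℝ × ℝ ↦ z.1 * w.1 + z.2 * w.2 := by fun_prop
  have hf1 := integrable_ch_mul hu hf
  have hg1 := integrable_ch_mul hu hg
  have key := integral_convolution (μ := volume) (ν := volume) (ContinuousLinearMap.mul ℝ ℂ)
    hf1 hg1
  simp only [ContinuousLinearMap.mul_apply'] at key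
  unfold ift
  rw [← key]
  refine integral_congr_ae (ae_of_all _ fun w ↦ ?_)
  simp only [MeasureTheory.convolution, ContinuousLinearMap.mul_apply', cconv]
  rw [← integral_const_mul]
  refine integral_congr_ae (ae_of_all _ fun v ↦ ?_)
  simp only [Prod.fst_sub, Prod.snd_sub]
  rw [show z.1 * w.1 + z.2 * w.2 = (z.1 * v.1 + z.2 * v.2) +
    (z.1 * (w.1 - v.1) + z.2 * (w.2 - v.2)) by ring, ch_add]
  ring

theorem ift_ctconv {ρ : ℝ → ℂ} {g : ℝ × ℝ → ℂ} (hρ : Integrable ρ) (hg : Integrable g)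
    (hρm : Measurable ρ) (hgm : Measurable g) (x t : ℝ) :
    ift (ctconv ρ g) (x, t) = 𝓕⁻ ρ t * ift g (x, t) := by
  rw [fourierInv_eq_ch]
  unfold ift ctconv
  dsimp only
  have hint : Integrable (Function.uncurry fun (w : ℝ × ℝ) (s : ℝ) ↦
      ch (x * w.1 + t * w.2) * (ρ s * g (w.1, w.2 - s))) (volume.prod volume) := by
    have hm : Measurable fun p : (ℝ × ℝ) × ℝ ↦ ρ p.2 * g (p.1.1, p.1.2 - p.2) := by fun_prop
    refine integrable_ch_mul (u := fun p : (ℝ × ℝ) × ℝ ↦ x * p.1.1 + t * p.1.2) (by fun_prop)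
      ⟨hm.aestronglyMeasurable, ?_⟩
    rw [HasFiniteIntegral, lintegral_prod_symm _ hm.enorm.aemeasurable]
    have h1 : ∀ s, ∫⁻ w : ℝ × ℝ, ‖ρ s * g (w.1, w.2 - s)‖ₑ = ‖ρ s‖ₑ * ∫⁻ w, ‖g w‖ₑ := fun s ↦ by
      simp_rw [enorm_mul]
      rw [lintegral_const_mul _ (by fun_prop)]
      congr 1
      exact ((MeasurePreserving.id volume).prod
        (measurePreserving_sub_right volume s)).lintegral_comp hgm.enorm
    simp_rw [h1]
    rw [lintegral_mul_const _ hρm.enorm]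
    exact ENNReal.mul_lt_top hρ.2 hg.2
  calc ∫ w : ℝ × ℝ, ch (x * w.1 + t * w.2) * ∫ s, ρ s * g (w.1, w.2 - s)
      = ∫ w : ℝ × ℝ, ∫ s, ch (x * w.1 + t * w.2) * (ρ s * g (w.1, w.2 - s)) := by
        refine integral_congr_ae (ae_of_all _ fun w ↦ ?_)
        exact (integral_const_mul _ _).symm
    _ = ∫ s, ∫ w : ℝ × ℝ, ch (x * w.1 + t * w.2) * (ρ s * g (w.1, w.2 - s)) :=
        integral_integral_swap hint
    _ = ∫ s, (ch (t * s) * ρ s) * ∫ w : ℝ × ℝ, ch (x * w.1 + t * w.2) * g w := by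
        refine integral_congr_ae (ae_of_all _ fun s ↦ ?_)
        dsimp only
        have hmp : MeasurePreserving (fun w : ℝ × ℝ ↦ (w.1, w.2 - s)) volume volume :=
          (MeasurePreserving.id volume).prod (measurePreserving_sub_right volume s)
        have hemb : MeasurableEmbedding fun w : ℝ × ℝ ↦ (w.1, w.2 - s) :=
          ((MeasurableEquiv.refl ℝ).prodCongr (MeasurableEquiv.subRight s)).measurableEmbedding
        rw [← hmp.integral_comp hemb fun w ↦ ch (x * w.1 + t * w.2) * g w, ← integral_const_mul]
        refine integral_congr_ae (ae_of_all _ fun w ↦ ?_)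
        dsimp only
        rw [show x * w.1 + t * w.2 = t * s + (x * w.1 + t * (w.2 - s)) by ring, ch_add]
        ring
    _ = _ := integral_mul_const _ _

/-! ### Time cutoffs -/

theorem SchwartzMap.fourierInv_fourier_real (θ : 𝓢(ℝ, ℂ)) (t : ℝ) :
    ∫ s, ch (t * s) * (𝓕 θ : 𝓢(ℝ, ℂ)) s = θ t := by
  rw [← fourierInv_eq_ch, SchwartzMap.fourier_coe]
  have h := Continuous.fourierInv_fourier_eq θ.continuous θ.integrable
    (by rw [← SchwartzMap.fourier_coe]; exact (𝓕 θ : 𝓢(ℝ, ℂ)).integrable)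
  exact congrFun h t

/-- The Fourier transform of `t ↦ θ (c (t - t₁))`. -/
def bumpFourier (θ : 𝓢(ℝ, ℂ)) (c t₁ s : ℝ) : ℂ :=
  (c : ℂ)⁻¹ * (ch (-(s * t₁)) * (𝓕 θ : 𝓢(ℝ, ℂ)) (s / c))

theorem continuous_bumpFourier (θ : 𝓢(ℝ, ℂ)) (c t₁ : ℝ) : Continuous (bumpFourier θ c t₁) := by
  have := continuous_ch
  have := (𝓕 θ : 𝓢(ℝ, ℂ)).continuous
  unfold bumpFourier
  fun_prop

theorem lintegral_comp_div {c : ℝ} (hc : 0 < c) {f : ℝ → ℝ≥0∞} (hf : Measurable f) :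
    ∫⁻ s, f (s / c) = ENNReal.ofReal c * ∫⁻ s, f s := by
  have h3 := Real.map_volume_mul_left (inv_ne_zero hc.ne')
  simp_rw [div_eq_inv_mul]
  rw [← lintegral_map hf (measurable_const_mul _), h3, lintegral_smul_measure, smul_eq_mul,
    inv_inv, abs_of_pos hc]

theorem lintegral_const_mul_comp_div {c : ℝ} (hc : 0 < c) {f : ℝ → ℝ≥0∞} (hf : Measurable f)
    (a : ℝ≥0∞) : ∫⁻ s, a * f (s / c) = a * (ENNReal.ofReal c * ∫⁻ s, f s) := by
  rw [lintegral_const_mul _ (by fun_prop), lintegral_comp_div hc hf]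

theorem enorm_bumpFourier (θ : 𝓢(ℝ, ℂ)) {c : ℝ} (hc : 0 < c) (t₁ s : ℝ) :
    ‖bumpFourier θ c t₁ s‖ₑ = (ENNReal.ofReal c)⁻¹ * ‖(𝓕 θ : 𝓢(ℝ, ℂ)) (s / c)‖ₑ := by
  unfold bumpFourier
  rw [enorm_mul, enorm_ch_mul, enorm_inv (by exact_mod_cast hc.ne'), ← ofReal_norm (c : ℂ)]
  simp [abs_of_pos hc]

theorem ofReal_inv_mul_cancel {c : ℝ} (hc : 0 < c) (a : ℝ≥0∞) :
    (ENNReal.ofReal c)⁻¹ * (ENNReal.ofReal c * a) = a := by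
  rw [← mul_assoc, ENNReal.inv_mul_cancel (by simpa using hc) ENNReal.ofReal_ne_top, one_mul]

theorem lintegral_bumpFourier (θ : 𝓢(ℝ, ℂ)) {c : ℝ} (hc : 0 < c) (t₁ : ℝ) :
    ∫⁻ s, ‖bumpFourier θ c t₁ s‖ₑ = ∫⁻ s, ‖(𝓕 θ : 𝓢(ℝ, ℂ)) s‖ₑ := by
  have hm : Measurable fun s ↦ ‖(𝓕 θ : 𝓢(ℝ, ℂ)) s‖ₑ :=
    (𝓕 θ : 𝓢(ℝ, ℂ)).continuous.measurable.enorm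
  simp_rw [enorm_bumpFourier θ hc]
  rw [lintegral_const_mul_comp_div hc hm, ofReal_inv_mul_cancel hc]

theorem integrable_bumpFourier (θ : 𝓢(ℝ, ℂ)) {c : ℝ} (hc : 0 < c) (t₁ : ℝ) :
    Integrable (bumpFourier θ c t₁) := by
  refine integrable_of_lintegral (continuous_bumpFourier θ c t₁).measurable ?_
  rw [lintegral_bumpFourier θ hc]
  exact (𝓕 θ : 𝓢(ℝ, ℂ)).integrable.2

theorem fourierInv_bumpFourier (θ : 𝓢(ℝ, ℂ)) {c : ℝ} (hc : 0 < c) (t₁ t : ℝ) :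
    𝓕⁻ (bumpFourier θ c t₁) t = θ (c * (t - t₁)) := by
  rw [fourierInv_eq_ch, ← SchwartzMap.fourierInv_fourier_real]
  have h : ∀ s, ch (t * s) * bumpFourier θ c t₁ s = (c : ℂ)⁻¹ *
      (fun σ ↦ ch (c * (t - t₁) * σ) * (𝓕 θ : 𝓢(ℝ, ℂ)) σ) (s / c) := fun s ↦ by
    simp only [bumpFourier]
    rw [show c * (t - t₁) * (s / c) = t * s + -(s * t₁) by field_simp; ring, ch_add]
    ring
  have h' := Measure.integral_comp_div
    (fun σ ↦ ch (c * (t - t₁) * σ) * (𝓕 θ : 𝓢(ℝ, ℂ)) σ) c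
  simp_rw [h]
  rw [integral_const_mul, h', abs_of_pos hc, Complex.real_smul,
    ← mul_assoc, inv_mul_cancel₀ (by exact_mod_cast hc.ne'), one_mul]

/-- The transform of the rescaled cutoff has modulus `c⁻¹ |ρ(s/c)|`, whence the scaling factor. It
is used for `a = 0`, where it is the gain `c^(-1/2)`, and for an exponent `a ≤ 1/2`, where it is at
most one for `c ≥ 1`. -/
theorem n2_bumpFourier_le (θ : 𝓢(ℝ, ℂ)) {a c : ℝ} (hc : 0 < c) (t₁ : ℝ) :
    n2 (fun s ↦ ENNReal.ofReal (|2 * Real.pi * s| ^ a) * ‖bumpFourier θ c t₁ s‖ₑ) ≤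
      ENNReal.ofReal (c ^ (a - 1 / 2)) *
        n2 (fun s ↦ ENNReal.ofReal (|2 * Real.pi * s| ^ a) * ‖(𝓕 θ : 𝓢(ℝ, ℂ)) s‖ₑ) := by
  have hm : Measurable fun s ↦ ‖(𝓕 θ : 𝓢(ℝ, ℂ)) s‖ₑ :=
    (𝓕 θ : 𝓢(ℝ, ℂ)).continuous.measurable.enorm
  rw [n2_le_iff, mul_pow, n2_sq]
  have h : ∀ s, (ENNReal.ofReal (|2 * Real.pi * s| ^ a) * ‖bumpFourier θ c t₁ s‖ₑ) ^ 2 =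
      ENNReal.ofReal (c ^ (2 * a - 2)) *
      (fun σ ↦ (ENNReal.ofReal (|2 * Real.pi * σ| ^ a) * ‖(𝓕 θ : 𝓢(ℝ, ℂ)) σ‖ₑ) ^ 2) (s / c) := by
    intro s
    have e1 : |2 * Real.pi * s| ^ a = c ^ a * |2 * Real.pi * (s / c)| ^ a := by
      rw [← Real.mul_rpow hc.le (abs_nonneg _), ← abs_of_pos hc, ← abs_mul, abs_of_pos hc]
      congr 2
      field_simp
    rw [enorm_bumpFourier θ hc, e1, ENNReal.ofReal_mul (by positivity)]
    dsimp only
    have e2' : ENNReal.ofReal (c ^ (2 * a - 2)) =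
        (ENNReal.ofReal (c ^ a) * (ENNReal.ofReal c)⁻¹) ^ 2 := by
      rw [← ENNReal.ofReal_inv_of_pos hc, ← ENNReal.ofReal_mul (by positivity),
        ← ENNReal.ofReal_pow (by positivity)]
      congr 1
      rw [← Real.rpow_neg_one, ← Real.rpow_add hc, ← Real.rpow_natCast, ← Real.rpow_mul hc.le]
      push_cast
      ring_nf
    rw [e2']
    ring
  have hm2 : Measurable fun σ ↦
      (ENNReal.ofReal (|2 * Real.pi * σ| ^ a) * ‖(𝓕 θ : 𝓢(ℝ, ℂ)) σ‖ₑ) ^ 2 :=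
    (Measurable.mul (by fun_prop) hm).pow_const 2
  rw [lintegral_congr h, lintegral_const_mul_comp_div hc hm2, ← mul_assoc,
    ← ENNReal.ofReal_mul (by positivity), ← ENNReal.ofReal_pow (by positivity)]
  gcongr
  nth_rewrite 2 [← Real.rpow_one c]
  rw [← Real.rpow_add hc, ← Real.rpow_natCast, ← Real.rpow_mul hc.le]
  push_cast
  ring_nf
  rfl

theorem n2_weight_schwartz_lt_top (θ : 𝓢(ℝ, ℂ)) {a : ℝ} (ha0 : 0 ≤ a) (ha1 : a ≤ 1) :
    n2 (fun s ↦ ENNReal.ofReal (|2 * Real.pi * s| ^ a) * ‖θ s‖ₑ) < ⊤ := by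
  have h2 : MemLp (fun s : ℝ ↦ (θ s : ℂ)) 2 := θ.memLp 2
  have hid : (fun s : ℝ ↦ ((2 * Real.pi * s : ℝ) : ℂ)).HasTemperateGrowth :=
    ofReal_hasTemperateGrowth.comp
      ((Function.HasTemperateGrowth.const (2 * Real.pi)).mul Function.HasTemperateGrowth.id')
  have h3 := (SchwartzMap.smulLeftCLM ℂ (fun s : ℝ ↦ ((2 * Real.pi * s : ℝ) : ℂ)) θ).memLp 2
    (μ := (volume : Measure ℝ))
  have hm1 : Measurable fun s ↦ ‖θ s‖ₑ := θ.continuous.measurable.enorm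
  have fin : ∀ φ : 𝓢(ℝ, ℂ), n2 (fun s ↦ ‖φ s‖ₑ) < ⊤ := fun φ ↦ by
    have := (φ.memLp 2 (volume : Measure ℝ)).2
    rw [eLpNorm_eq_lintegral_rpow_enorm_toReal (by norm_num) (by norm_num)] at this
    simpa [n2] using this
  refine lt_of_le_of_lt (n2_mono (G := fun s ↦ ‖θ s‖ₑ +
    ‖SchwartzMap.smulLeftCLM ℂ (fun s : ℝ ↦ ((2 * Real.pi * s : ℝ) : ℂ)) θ s‖ₑ) fun s ↦ ?_)
    ((n2_add_le hm1 ?_).trans_lt (ENNReal.add_lt_top.mpr ⟨fin _, fin _⟩))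
  · rw [SchwartzMap.smulLeftCLM_apply_apply hid, smul_eq_mul, enorm_mul,
      ← ofReal_norm (((2 * Real.pi * s : ℝ) : ℂ)), Complex.norm_real, Real.norm_eq_abs]
    nth_rewrite 2 [← one_mul ‖θ s‖ₑ]
    rw [← add_mul]
    gcongr
    rw [← ENNReal.ofReal_one, ← ENNReal.ofReal_add (by norm_num) (by positivity)]
    refine ENNReal.ofReal_le_ofReal ?_
    rcases le_total |2 * Real.pi * s| 1 with h | h
    · linarith [Real.rpow_le_one (abs_nonneg (2 * Real.pi * s)) h ha0, abs_nonneg (2 * Real.pi * s)]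
    · have := Real.rpow_le_rpow_of_exponent_le h ha1
      rw [Real.rpow_one] at this
      linarith
  · exact (SchwartzMap.continuous _).measurable.enorm

/-! ### Control of a function under time localization -/

theorem n21_mono {F G : ℝ × ℝ → ℝ≥0∞} (h : ∀ z, F z ≤ G z) : n21 F ≤ n21 G :=
  n2_mono fun _ ↦ lintegral_mono fun _ ↦ h _

theorem dn_mono (θ : ℝ) {F G : ℝ × ℝ → ℝ≥0∞} (h : ∀ z, F z ≤ G z) : dn θ F ≤ dn θ G :=
  n2_mono fun z ↦ mul_le_mul_right (h z) _

theorem xn_mono (η : ℝ → ℝ) {F G : ℝ × ℝ → ℝ≥0∞} (h : ∀ z, F z ≤ G z) : xn η F ≤ xn η G :=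
  ENNReal.tsum_le_tsum fun _ ↦ mul_le_mul_right (n2_mono fun z ↦ mul_le_mul_right (h z) _) _

theorem IsCutoff.xn_const_mul {η : ℝ → ℝ} (hη : IsCutoff η) (c : ℝ≥0∞) {F : ℝ × ℝ → ℝ≥0∞}
    (hF : Measurable F) : xn η (fun z ↦ c * F z) = c * xn η F := by
  unfold xn
  rw [← ENNReal.tsum_mul_left]
  congr 1
  funext j
  have h := hη.measurable_eta_mu j
  have e : n2 (fun z ↦ c * (ENNReal.ofReal (etaK η j (mu z)) * F z)) =
      c * n2 fun z ↦ ENNReal.ofReal (etaK η j (mu z)) * F z := n2_const_mul _ _ (by fun_prop)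
  rw [mul_left_comm, ← e]
  congr 2
  funext z
  ring

/-- The functions with `ξ`-support in the `k`-th band and controlled by `X`. -/
structure Controlled (θ : ℝ) (k : ℕ) (X : ℝ≥0∞) (g : ℝ × ℝ → ℂ) : Prop where
  meas : Measurable g
  supp : ∀ z, g z ≠ 0 → z.1 ∈ band k
  n21_le : n21 (fun z ↦ ‖g z‖ₑ) ≤ X
  dn_le : dn θ (fun z ↦ ‖g z‖ₑ) ≤ X

theorem volume_band_lt_top (k : ℕ) : volume (band k) < ⊤ := by
  refine lt_of_le_of_lt (measure_mono (t := {ξ : ℝ | |2 * Real.pi * ξ - 0| ≤ 8 / 5 * 2 ^ k})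
    fun ξ hξ ↦ ?_) ((volume_abs_le 0 _).trans_lt ENNReal.ofReal_lt_top)
  simpa using hξ.1

theorem measurableSet_band (k : ℕ) : MeasurableSet (band k) := by
  have h1 : MeasurableSet {ξ : ℝ | |2 * Real.pi * ξ| ≤ 8 / 5 * 2 ^ k} :=
    measurableSet_le (by fun_prop) (by fun_prop)
  have h2 : MeasurableSet {ξ : ℝ | 5 / 8 * 2 ^ k ≤ |2 * Real.pi * ξ|} :=
    measurableSet_le (by fun_prop) (by fun_prop)
  by_cases hk : 1 ≤ k
  · convert h1.inter h2 using 1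
    ext ξ
    exact ⟨fun h ↦ ⟨h.1, h.2 hk⟩, fun h ↦ ⟨h.1, fun _ ↦ h.2⟩⟩
  · convert h1 using 1
    ext ξ
    exact ⟨fun h ↦ h.1, fun h ↦ ⟨h, fun h' ↦ absurd h' hk⟩⟩

/-- The band has finite measure, so Cauchy–Schwarz in `ξ` passes from `L²_ξ L¹_τ` to `L¹`. -/
theorem integrable_of_band {g : ℝ × ℝ → ℂ} (hg : Measurable g) {k : ℕ}
    (hs : ∀ z, g z ≠ 0 → z.1 ∈ band k) (h : n21 (fun z ↦ ‖g z‖ₑ) < ⊤) : Integrable g := by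
  refine integrable_of_lintegral hg ?_
  rw [Measure.volume_eq_prod, lintegral_prod _ hg.enorm.aemeasurable]
  have hm : Measurable fun ξ ↦ ∫⁻ τ, ‖g (ξ, τ)‖ₑ := hg.enorm.lintegral_prod_right'
  have hi : Measurable ((band k).indicator (1 : ℝ → ℝ≥0∞)) :=
    measurable_one.indicator (measurableSet_band k)
  calc ∫⁻ ξ, ∫⁻ τ, ‖g (ξ, τ)‖ₑ
      ≤ ∫⁻ ξ, (band k).indicator 1 ξ * ∫⁻ τ, ‖g (ξ, τ)‖ₑ := by
        refine lintegral_mono fun ξ ↦ ?_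
        by_cases hξ : ξ ∈ band k
        · simp [hξ]
        · have : ∀ τ, g (ξ, τ) = 0 := fun τ ↦ by
            by_contra hne
            exact hξ (hs _ hne)
          simp [this]
    _ ≤ n2 ((band k).indicator 1) * n21 (fun z ↦ ‖g z‖ₑ) :=
        lintegral_mul_le_n2 hi.aemeasurable hm.aemeasurable
    _ < ⊤ := by
        refine ENNReal.mul_lt_top ?_ h
        unfold n2
        refine ENNReal.rpow_lt_top_of_nonneg (by norm_num) (ne_of_lt ?_)
        refine lt_of_le_of_lt (lintegral_mono (g := (band k).indicator 1) fun ξ ↦ ?_) ?_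
        · by_cases hξ : ξ ∈ band k <;> simp [hξ]
        · rw [lintegral_indicator_one (measurableSet_band k)]
          exact volume_band_lt_top k

theorem Controlled.integrable {θ : ℝ} {k : ℕ} {X : ℝ≥0∞} {g : ℝ × ℝ → ℂ}
    (h : Controlled θ k X g) (hX : X < ⊤) : Integrable g :=
  integrable_of_band h.meas h.supp (h.n21_le.trans_lt hX)

theorem ctconv_supp {ρ : ℝ → ℂ} {g : ℝ × ℝ → ℂ} {S : Set ℝ} (h : ∀ z, g z ≠ 0 → z.1 ∈ S)
    (z : ℝ × ℝ) (hz : ctconv ρ g z ≠ 0) : z.1 ∈ S := by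
  by_contra hne
  refine hz ?_
  have : ∀ s, g (z.1, z.2 - s) = 0 := fun s ↦ by
    by_contra h0
    exact hne (h (z.1, z.2 - s) h0)
  simp [ctconv, this]

/-- The function whose inverse Fourier transform is `θ (c (t - t₁))` times that of `g`. -/
def bump (φ : 𝓢(ℝ, ℂ)) (c t₁ : ℝ) (g : ℝ × ℝ → ℂ) : ℝ × ℝ → ℂ := ctconv (bumpFourier φ c t₁) g

theorem ift_bump (φ : 𝓢(ℝ, ℂ)) {c : ℝ} (hc : 0 < c) (t₁ : ℝ) {g : ℝ × ℝ → ℂ}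
    (hgm : Measurable g) (hg : Integrable g) (x t : ℝ) :
    ift (bump φ c t₁ g) (x, t) = φ (c * (t - t₁)) * ift g (x, t) := by
  rw [bump, ift_ctconv (integrable_bumpFourier φ hc t₁) hg
    (continuous_bumpFourier φ c t₁).measurable hgm, fourierInv_bumpFourier φ hc]

theorem measurable_bump (φ : 𝓢(ℝ, ℂ)) (c t₁ : ℝ) {g : ℝ × ℝ → ℂ}
    (hgm : Measurable g) : Measurable (bump φ c t₁ g) :=
  measurable_ctconv (continuous_bumpFourier φ c t₁).measurable hgm

theorem integrable_bump (φ : 𝓢(ℝ, ℂ)) {c : ℝ} (hc : 0 < c) (t₁ : ℝ) {g : ℝ × ℝ → ℂ}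
    (hgm : Measurable g) (hg : Integrable g) : Integrable (bump φ c t₁ g) :=
  integrable_ctconv (continuous_bumpFourier φ c t₁).measurable hgm
    (integrable_bumpFourier φ hc t₁) hg

theorem exists_n2_bump_le (φ : 𝓢(ℝ, ℂ)) : ∃ C : ℝ≥0, ∀ c : ℝ, 0 < c → ∀ t₁ : ℝ,
    ∀ g : ℝ × ℝ → ℂ, Measurable g →
      n2 (fun z ↦ ‖bump φ c t₁ g z‖ₑ) ≤ C * n2 (fun z ↦ ‖g z‖ₑ) := by
  have h : ∫⁻ s, ‖(𝓕 φ : 𝓢(ℝ, ℂ)) s‖ₑ < ⊤ := (𝓕 φ : 𝓢(ℝ, ℂ)).integrable.2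
  refine ⟨(∫⁻ s, ‖(𝓕 φ : 𝓢(ℝ, ℂ)) s‖ₑ).toNNReal, fun c hc t₁ g hg ↦ ?_⟩
  rw [ENNReal.coe_toNNReal h.ne, ← lintegral_bumpFourier φ hc t₁]
  exact (n2_mono (enorm_ctconv_le _ _)).trans
    (n2_tconv_le (continuous_bumpFourier φ c t₁).measurable.enorm hg.enorm)

/-- The resonant estimate uses two norms that are stable under time cutoffs uniformly in scale and
centre, because `c^(θ - 1/2) ≤ 1`. The last bound expresses that a function bounded in time with
values in `L²`, restricted to times of length `1/c`, has space-time `L²` norm smaller by `c^(-1/2)`.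
-/
theorem exists_controlled_bump (φ : 𝓢(ℝ, ℂ)) {θ : ℝ} (h0 : 0 ≤ θ) (h1 : θ ≤ 1 / 2) :
    ∃ C : ℝ≥0, ∀ c : ℝ, 1 ≤ c → ∀ t₁ : ℝ, ∀ k : ℕ, ∀ X : ℝ≥0∞, ∀ g : ℝ × ℝ → ℂ,
      Controlled θ k X g → Controlled θ k (C * X) (bump φ c t₁ g) ∧
      n2 (fun z ↦ ‖bump φ c t₁ g z‖ₑ) ≤ ENNReal.ofReal (c ^ (-(1 / 2) : ℝ)) * (C * X) := by
  set I := ∫⁻ s, ‖(𝓕 φ : 𝓢(ℝ, ℂ)) s‖ₑ with hI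
  set A := n2 (fun s ↦ ENNReal.ofReal (|2 * Real.pi * s| ^ (0 : ℝ)) *
    ‖(𝓕 φ : 𝓢(ℝ, ℂ)) s‖ₑ) with hA
  set B := n2 (fun s ↦ ENNReal.ofReal (|2 * Real.pi * s| ^ θ) * ‖(𝓕 φ : 𝓢(ℝ, ℂ)) s‖ₑ) with hB
  have hIt : I < ⊤ := (𝓕 φ : 𝓢(ℝ, ℂ)).integrable.2
  have hAt : A < ⊤ := n2_weight_schwartz_lt_top _ le_rfl (by norm_num)
  have hBt : B < ⊤ := n2_weight_schwartz_lt_top _ h0 (by linarith)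
  have hC : I + A + B < ⊤ := ENNReal.add_lt_top.mpr ⟨ENNReal.add_lt_top.mpr ⟨hIt, hAt⟩, hBt⟩
  refine ⟨(I + A + B).toNNReal, fun c hc t₁ k X g hg ↦ ?_⟩
  rw [ENNReal.coe_toNNReal hC.ne]
  have hc0 : 0 < c := by linarith
  have hρ : Measurable fun s ↦ ‖bumpFourier φ c t₁ s‖ₑ :=
    (continuous_bumpFourier φ c t₁).measurable.enorm
  have hle := enorm_ctconv_le (bumpFourier φ c t₁) g
  refine ⟨⟨measurable_bump φ c t₁ hg.meas, ctconv_supp hg.supp, ?_, ?_⟩, ?_⟩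
  · refine (n21_mono hle).trans ?_
    rw [n21_tconv hρ hg.meas.enorm, lintegral_bumpFourier φ hc0, ← hI]
    gcongr
    · rw [add_assoc]
      exact le_self_add
    · exact hg.n21_le
  · refine (dn_mono θ hle).trans ((dn_tconv_le h0 (by linarith) hρ hg.meas.enorm).trans ?_)
    rw [lintegral_bumpFourier φ hc0, ← hI]
    have hb := n2_bumpFourier_le φ (a := θ) hc0 t₁
    rw [← hB] at hb
    have hb' : ENNReal.ofReal (c ^ (θ - 1 / 2)) * B ≤ B := by
      refine mul_le_of_le_one_left' ?_
      rw [ENNReal.ofReal_le_one]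
      exact Real.rpow_le_one_of_one_le_of_nonpos hc (by linarith)
    calc _ ≤ I * X + B * X := by
          gcongr
          · exact hg.dn_le
          · exact hb.trans hb'
          · exact hg.n21_le
      _ ≤ _ := by
          rw [← add_mul]
          gcongr
          exact le_self_add
  · refine (n2_mono hle).trans ((n2_tconv_le' hρ hg.meas.enorm).trans ?_)
    have ha := n2_bumpFourier_le φ (a := 0) hc0 t₁
    rw [← hA] at ha
    simp only [Real.rpow_zero, ENNReal.ofReal_one, one_mul, zero_sub] at ha
    rw [← mul_assoc]
    gcongr
    · refine ha.trans ?_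
      gcongr
      rw [add_right_comm, add_comm]
      exact le_self_add
    · exact hg.n21_le

/-! ### A partition of unity in time -/

/-- Half of a smooth partition of unity on the integers. -/
def chi (r : ℝ) : ℝ := Real.smoothTransition r - Real.smoothTransition (r - 1)

/-- The sum of translates telescopes; the two end terms of the smooth transition are `1` and `0`
once `|r| ≤ M - 1`. -/
theorem chi_sum (M : ℕ) {r : ℝ} (h : |r| + 1 ≤ M) :
    ∑ i ∈ Finset.range (2 * M + 1), chi (r + M - i) = 1 := by
  have := abs_le.mp (show |r| ≤ M - 1 by linarith)
  have e : ∀ i : ℕ, chi (r + M - i) = (fun i : ℕ ↦ Real.smoothTransition (r + M - i)) i -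
      (fun i : ℕ ↦ Real.smoothTransition (r + M - i)) (i + 1) := fun i ↦ by
    simp only [chi]
    push_cast
    ring_nf
  simp_rw [e]
  rw [Finset.sum_range_sub', Real.smoothTransition.one_of_one_le (by push_cast; linarith),
    Real.smoothTransition.zero_of_nonpos (by push_cast; linarith), sub_zero]

theorem chi_support {r : ℝ} (h : chi r ≠ 0) : 0 ≤ r ∧ r ≤ 2 := by
  constructor
  · by_contra! hr
    exact h (by rw [chi, Real.smoothTransition.zero_of_nonpos hr.le,
      Real.smoothTransition.zero_of_nonpos (by linarith), sub_zero])
  · by_contra! hr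
    exact h (by rw [chi, Real.smoothTransition.one_of_one_le (by linarith),
      Real.smoothTransition.one_of_one_le (by linarith), sub_self])

theorem contDiff_chi : ContDiff ℝ ∞ chi :=
  Real.smoothTransition.contDiff.sub
    (Real.smoothTransition.contDiff.comp (contDiff_id.sub contDiff_const))

theorem hasCompactSupport_ofReal {f : ℝ → ℝ} {a b : ℝ} (h : ∀ r, f r ≠ 0 → a ≤ r ∧ r ≤ b) :
    HasCompactSupport fun r ↦ (f r : ℂ) :=
  HasCompactSupport.of_support_subset_isCompact (isCompact_Icc (a := a) (b := b)) fun r hr ↦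
    h r (by simpa using hr)

/-- The cutoff `chi` as a Schwartz function. -/
def chiS : 𝓢(ℝ, ℂ) :=
  (hasCompactSupport_ofReal fun _ ↦ chi_support).toSchwartzMap
    (Complex.ofRealCLM.contDiff.comp contDiff_chi)

theorem chiS_apply (r : ℝ) : chiS r = chi r := rfl

theorem IsCutoff.support_le {η : ℝ → ℝ} (hη : IsCutoff η) (r : ℝ) (h : η r ≠ 0) :
    -(8 / 5) ≤ r ∧ r ≤ 8 / 5 := hη.support_subset h

/-- The cutoff `η` as a Schwartz function. -/
def IsCutoff.toSchwartz {η : ℝ → ℝ} (hη : IsCutoff η) : 𝓢(ℝ, ℂ) :=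
  (hasCompactSupport_ofReal hη.support_le).toSchwartzMap
    (Complex.ofRealCLM.contDiff.comp hη.smooth)

theorem IsCutoff.toSchwartz_apply {η : ℝ → ℝ} (hη : IsCutoff η) (r : ℝ) :
    hη.toSchwartz r = η r := rfl

/-- The square of the cutoff `η` as a Schwartz function. -/
def IsCutoff.toSchwartzSq {η : ℝ → ℝ} (hη : IsCutoff η) : 𝓢(ℝ, ℂ) :=
  (hasCompactSupport_ofReal (f := fun r ↦ η r ^ 2) fun r h ↦
    hη.support_le r fun h0 ↦ h (by simp [h0])).toSchwartzMap
    (Complex.ofRealCLM.contDiff.comp (hη.smooth.pow 2))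

theorem IsCutoff.toSchwartzSq_apply {η : ℝ → ℝ} (hη : IsCutoff η) (r : ℝ) :
    hη.toSchwartzSq r = ((η r ^ 2 : ℝ) : ℂ) := rfl

/-! ### Products of frequency-localized functions -/

/-- Multiplication by the symbol of `∂_x ^ a`. -/
def mulX (a : ℕ) (g : ℝ × ℝ → ℂ) (z : ℝ × ℝ) : ℂ :=
  (2 * Real.pi * Complex.I * z.1) ^ a * g z

theorem measurable_mulX (a : ℕ) {g : ℝ × ℝ → ℂ} (hg : Measurable g) : Measurable (mulX a g) := by
  unfold mulX
  fun_prop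

theorem norm_symbol (a : ℕ) (ξ : ℝ) :
    ‖(2 * Real.pi * Complex.I * ξ : ℂ) ^ a‖ = |2 * Real.pi * ξ| ^ a := by
  rw [norm_pow]
  simp [abs_mul]

theorem enorm_mulX_le {a : ℕ} (ha : a ≤ 3) {k : ℕ} {g : ℝ × ℝ → ℂ}
    (hs : ∀ z, g z ≠ 0 → z.1 ∈ band k) (z : ℝ × ℝ) :
    ‖mulX a g z‖ₑ ≤ 8 * e2 (a * k) * ‖g z‖ₑ := by
  by_cases h : g z = 0
  · simp [mulX, h]
  rw [mulX, enorm_mul]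
  gcongr
  rw [← ofReal_norm, norm_symbol]
  have h1 : |2 * Real.pi * z.1| ^ a ≤ 8 * 2 ^ (a * k : ℝ) := by
    calc |2 * Real.pi * z.1| ^ a ≤ (8 / 5 * 2 ^ k) ^ a := by
          gcongr
          exact (hs z h).1
      _ = (8 / 5) ^ a * 2 ^ (a * k : ℝ) := by
          rw [mul_pow, ← pow_mul, ← Real.rpow_natCast 2 (k * a)]
          push_cast
          rw [mul_comm (k : ℝ)]
      _ ≤ _ := by
          gcongr
          calc (8 / 5 : ℝ) ^ a ≤ (8 / 5) ^ 3 := pow_le_pow_right₀ (by norm_num) ha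
            _ ≤ 8 := by norm_num
  refine (ENNReal.ofReal_le_ofReal h1).trans (le_of_eq ?_)
  rw [ENNReal.ofReal_mul (by norm_num), ofReal_rpow_two]
  simp

theorem mulX_supp {a : ℕ} {g : ℝ × ℝ → ℂ} {S : Set ℝ} (hs : ∀ z, g z ≠ 0 → z.1 ∈ S) (z : ℝ × ℝ)
    (h : mulX a g z ≠ 0) : z.1 ∈ S :=
  hs z (right_ne_zero_of_mul h)

theorem IsCutoff.xn_mulX_le {η : ℝ → ℝ} (hη : IsCutoff η) {a : ℕ} (ha : a ≤ 3) {k : ℕ}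
    {g : ℝ × ℝ → ℂ} (hg : Measurable g) (hs : ∀ z, g z ≠ 0 → z.1 ∈ band k) :
    xn η (fun z ↦ ‖mulX a g z‖ₑ) ≤ 8 * e2 (a * k) * xn η fun z ↦ ‖g z‖ₑ :=
  (xn_mono η (enorm_mulX_le ha hs)).trans (hη.xn_const_mul _ hg.enorm).le

theorem IsCutoff.controlled_mulX {η : ℝ → ℝ} (hη : IsCutoff η) {θ : ℝ} (h0 : 0 ≤ θ)
    (h1 : θ ≤ 1 / 2) {a : ℕ} (ha : a ≤ 3) {k : ℕ} {g : ℝ × ℝ → ℂ} (hg : Measurable g)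
    (hs : ∀ z, g z ≠ 0 → z.1 ∈ band k) {x : ℝ≥0∞} (hx : xn η (fun z ↦ ‖g z‖ₑ) ≤ x) :
    Controlled θ k (16 * e2 (a * k) * x) (mulX a g) := by
  have hx' := (hη.xn_mulX_le ha hg hs).trans (mul_le_mul_right hx _)
  have hm := (measurable_mulX a hg).enorm
  refine ⟨measurable_mulX a hg, mulX_supp hs, (hη.n21_le_xn hm).trans (hx'.trans ?_),
    (hη.dn_le_xn h0 h1 hm).trans ((mul_le_mul_right hx' _).trans (le_of_eq ?_))⟩
  · gcongr
    norm_num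
  · rw [← mul_assoc, ← mul_assoc]
    norm_num

/-- Locally in time at the scale `4 ^ (-k)`, the function `P` is the `a`-th derivative of a
function with spatial frequencies in the `k`-th band and `X` norm at most `x`. -/
def LocRep (η : ℝ → ℝ) (k a : ℕ) (x : ℝ≥0∞) (P : ℝ → ℝ → ℂ) : Prop :=
  ∀ t₀ : ℝ, ∃ g : ℝ × ℝ → ℂ, Measurable g ∧ (∀ z, g z ≠ 0 → z.1 ∈ band k) ∧
    xn η (fun z ↦ ‖g z‖ₑ) ≤ x ∧
    ∀ᵐ t : ℝ, ∀ y : ℝ, (η (4 ^ k * (t - t₀)) : ℂ) * P t y = ift (mulX a g) (y, t)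

/-- The left end of the `i`-th cell of the time partition. -/
def cell (n M : ℕ) (t₀ : ℝ) (i : ℕ) : ℝ := t₀ + ((i : ℝ) - M) / 4 ^ n

/-- The middle of the `i`-th cell of the time partition. -/
def mid (n M : ℕ) (t₀ : ℝ) (i : ℕ) : ℝ := t₀ + ((i : ℝ) - M + 1) / 4 ^ n

/-- Where the cell function is nonzero, `|4^n (t - mid)| ≤ 1`, so the cutoffs at scale `4^(-n)` and
at the coarser scales of both factors equal one there. The support of `η(4^k(t - t₀))` has
half-length `8/5 · 4^(n-k)` in units of a cell, which is why `M` cells on either side suffice. The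
subtraction `n - k` is truncated, so that `M = 4` if `k ≥ n`. The cutoff at scale `4^(-n)` in front
of `q` changes no value and serves to localize the second factor. -/
theorem IsCutoff.block_sum {η : ℝ → ℝ} (hη : IsCutoff η) {n k k₁ k₂ : ℕ} (h₁ : k₁ ≤ n)
    (h₂ : k₂ ≤ n) (t₀ t : ℝ) (θ p q : ℂ) {M : ℕ} (hM : M = 2 * 4 ^ (n - k) + 2) :
    ∑ i ∈ Finset.range (2 * M + 1), (chi (4 ^ n * (t - cell n M t₀ i)) : ℂ) *
      ((η (4 ^ k * (t - t₀)) : ℂ) * (θ * (((η (4 ^ k₁ * (t - mid n M t₀ i)) : ℂ) * p) *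
        ((η (4 ^ n * (t - mid n M t₀ i)) : ℂ) * ((η (4 ^ k₂ * (t - mid n M t₀ i)) : ℂ) * q))))) =
    (η (4 ^ k * (t - t₀)) : ℂ) * θ * (p * q) := by
  have hcell : ∀ i : ℕ, (4 : ℝ) ^ n * (t - cell n M t₀ i) = 4 ^ n * (t - t₀) + M - i := fun i ↦ by
    unfold cell
    field_simp
    ring
  have hmid : ∀ i : ℕ, (4 : ℝ) ^ n * (t - mid n M t₀ i) = 4 ^ n * (t - t₀) + M - i - 1 :=
    fun i ↦ by
      unfold mid
      field_simp
      ring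
  by_cases hk : η (4 ^ k * (t - t₀)) = 0
  · simp [hk]
  have hs : |4 ^ n * (t - t₀)| + 1 ≤ M := by
    have h0 : |4 ^ k * (t - t₀)| ≤ 8 / 5 := by
      by_contra! h
      exact hk (hη.eq_zero h)
    have h4 : (4 : ℝ) ^ n ≤ 4 ^ (n - k) * 4 ^ k := by
      rw [← pow_add]
      exact pow_le_pow_right₀ (by norm_num) (by omega)
    rw [abs_mul, abs_of_pos (by positivity)] at h0 ⊢
    have h5 : (4 : ℝ) ^ n * |t - t₀| ≤ 4 ^ (n - k) * (4 ^ k * |t - t₀|) := by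
      rw [← mul_assoc]
      gcongr
    have h6 : (4 : ℝ) ^ (n - k) * (4 ^ k * |t - t₀|) ≤ 4 ^ (n - k) * (8 / 5) := by gcongr
    have h7 : (0 : ℝ) < 4 ^ (n - k) := by positivity
    rw [hM]
    push_cast
    linarith
  have hterm : ∀ i ∈ Finset.range (2 * M + 1), (chi (4 ^ n * (t - cell n M t₀ i)) : ℂ) *
      ((η (4 ^ k * (t - t₀)) : ℂ) * (θ * (((η (4 ^ k₁ * (t - mid n M t₀ i)) : ℂ) * p) *
        ((η (4 ^ n * (t - mid n M t₀ i)) : ℂ) * ((η (4 ^ k₂ * (t - mid n M t₀ i)) : ℂ) * q))))) =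
      (chi (4 ^ n * (t - t₀) + M - i) : ℂ) *
        ((η (4 ^ k * (t - t₀)) : ℂ) * θ * (p * q)) := fun i _ ↦ by
    rw [hcell]
    by_cases hc : chi (4 ^ n * (t - t₀) + M - i) = 0
    · simp [hc]
    have hc' := chi_support hc
    have hle : |4 ^ n * (t - mid n M t₀ i)| ≤ 1 := by
      rw [hmid, abs_le]
      constructor <;> linarith
    have hone : ∀ l ≤ n, η (4 ^ l * (t - mid n M t₀ i)) = 1 := fun l hl ↦ by
      refine hη.eq_one' (le_trans ?_ (hle.trans (by norm_num)))
      rw [abs_mul, abs_mul, abs_of_pos (a := (4 : ℝ) ^ l) (by positivity),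
        abs_of_pos (a := (4 : ℝ) ^ n) (by positivity)]
      gcongr
      norm_num
    rw [hone k₁ h₁, hone k₂ h₂, hone n le_rfl]
    push_cast
    ring
  rw [Finset.sum_congr rfl hterm, ← Finset.sum_mul]
  have := chi_sum M hs
  rw [← Complex.ofReal_sum, this]
  simp

theorem cell_count (n k : ℕ) : ((2 * (2 * 4 ^ (n - k) + 2) + 1 : ℕ) : ℝ≥0∞) ≤ 9 * 4 ^ (n - k) := by
  have h : 2 * (2 * 4 ^ (n - k) + 2) + 1 ≤ 9 * 4 ^ (n - k) := by
    have := Nat.one_le_pow (n - k) 4 (by norm_num)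
    omega
  exact_mod_cast h

/-! ### Time-localized products of two blocks. -/

theorem enorm_sum_le_sum {ι : Type*} (s : Finset ι) (f : ι → ℂ) :
    ‖∑ i ∈ s, f i‖ₑ ≤ ∑ i ∈ s, ‖f i‖ₑ := by
  classical
  induction s using Finset.induction_on with
  | empty => simp
  | insert a s ha ih =>
    rw [Finset.sum_insert ha, Finset.sum_insert ha]
    exact (enorm_add_le _ _).trans (by gcongr)

theorem exists_pair_ne_of_cconv {F G : ℝ × ℝ → ℂ} {z : ℝ × ℝ} (h : cconv F G z ≠ 0) :
    ∃ w, F w ≠ 0 ∧ G (z - w) ≠ 0 := by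
  by_contra! hne
  refine h ?_
  have : ∀ w, F w * G (z - w) = 0 := fun w ↦ by
    by_cases hw : F w = 0
    · simp [hw]
    · simp [hne w hw]
  simp [cconv, this]

theorem low_le {k n : ℕ} (h : k + 3 ≤ n) : (8 / 5 * 2 ^ k : ℝ) ≤ 1 / 5 * 2 ^ n := by
  have : (2 : ℝ) ^ (k + 3) ≤ 2 ^ n := pow_le_pow_right₀ (by norm_num) h
  rw [pow_add] at this
  linarith

theorem symbol_order {a b k₁ k₂ n : ℕ} (hab : a + b = 3) (h₁ : k₁ ≤ n) (h₂ : k₂ ≤ n) :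
    (a * k₁ + b * k₂ : ℝ) ≤ 3 * n := by
  have h : a * k₁ + b * k₂ ≤ 3 * n := by
    rw [← hab, add_mul]
    gcongr
  exact_mod_cast h

/-- On each cell the transversal estimate applies to the two local representatives. The time cutoffs
are convolutions in `τ` with kernels bounded in `L¹`, so they preserve both the `L²` bound and the
`ξ`-support. No gain from localization is used; the number of cells accounts for `4^(n-k)`. The free
cutoff `Θ` is later `η` or `η²`. -/
theorem IsCutoff.exists_block_transversal {η : ℝ → ℝ} (hη : IsCutoff η) (Θ : 𝓢(ℝ, ℂ)) :
    ∃ C : ℝ≥0, ∀ k k₁ k₂ n a b : ℕ, a + b = 3 → n = max k₁ k₂ → (k₁ + 3 ≤ k₂ ∨ k₂ + 3 ≤ k₁) →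
    ∀ x y : ℝ≥0∞, x < ⊤ → y < ⊤ → ∀ P Q : ℝ → ℝ → ℂ, LocRep η k₁ a x P → LocRep η k₂ b y Q →
    ∀ t₀ : ℝ, ∃ G : ℝ × ℝ → ℂ, Measurable G ∧ Integrable G ∧
      (∀ z, G z ≠ 0 → 2 / 5 * 2 ^ n ≤ |2 * Real.pi * z.1| ∧ |2 * Real.pi * z.1| ≤ 2 * 2 ^ n) ∧
      n2 (fun z ↦ ‖G z‖ₑ) ≤ C * (4 ^ (n - k) * e2 n * (x * y)) ∧
      ∀ᵐ t : ℝ, ∀ r : ℝ, (η (4 ^ k * (t - t₀)) : ℂ) * Θ t * (P t r * Q t r) = ift G (r, t) := by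
  obtain ⟨C₁, hC₁⟩ := exists_n2_bump_le chiS
  obtain ⟨C₂, hC₂⟩ := exists_n2_bump_le hη.toSchwartz
  obtain ⟨C₃, hC₃⟩ := exists_n2_bump_le Θ
  refine ⟨9 * (C₁ * (C₂ * (C₃ * (C₂ * 256)))), ?_⟩
  intro k k₁ k₂ n a b hab hn hk x y hx hy P Q hP hQ t₀
  have h₁ : k₁ ≤ n := hn ▸ le_max_left _ _
  have h₂ : k₂ ≤ n := hn ▸ le_max_right _ _
  set M : ℕ := 2 * 4 ^ (n - k) + 2 with hM
  have h4k : (0 : ℝ) < 4 ^ k := by positivity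
  have h4n : (0 : ℝ) < 4 ^ n := by positivity
  choose g hgm hgs hgx hgP using fun i ↦ hP (mid n M t₀ i)
  choose h hhm hhs hhx hhQ using fun i ↦ hQ (mid n M t₀ i)
  have gm := fun i ↦ measurable_mulX a (hgm i)
  have hm := fun i ↦ measurable_mulX b (hhm i)
  have gc := fun i ↦ hη.controlled_mulX le_rfl (by norm_num) (by omega : a ≤ 3) (hgm i) (hgs i)
    (hgx i)
  have hc := fun i ↦ hη.controlled_mulX le_rfl (by norm_num) (by omega : b ≤ 3) (hhm i) (hhs i)
    (hhx i)
  have top : ∀ (r : ℝ) (u : ℝ≥0∞), u < ⊤ → 16 * e2 r * u < ⊤ := fun r u hu ↦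
    ENNReal.mul_lt_top (ENNReal.mul_lt_top (by simp) (e2_ne_top _).lt_top) hu
  have gi := fun i ↦ (gc i).integrable (top _ _ hx)
  have hi := fun i ↦ (hc i).integrable (top _ _ hy)
  set c₀ : ℕ → ℝ × ℝ → ℂ := fun i ↦ cconv (mulX a (g i)) (mulX b (h i)) with hc₀
  have m₀ : ∀ i, Measurable (c₀ i) := fun i ↦ measurable_cconv (gm i) (hm i)
  have i₀ : ∀ i, Integrable (c₀ i) := fun i ↦ integrable_cconv (gm i) (hm i) (gi i) (hi i)
  set c₁ : ℕ → ℝ × ℝ → ℂ := fun i ↦ bump hη.toSchwartz (4 ^ n) (mid n M t₀ i) (c₀ i) with hc₁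
  have m₁ : ∀ i, Measurable (c₁ i) := fun i ↦ measurable_bump _ _ _ (m₀ i)
  have i₁ : ∀ i, Integrable (c₁ i) := fun i ↦ integrable_bump _ h4n _ (m₀ i) (i₀ i)
  set c₂ : ℕ → ℝ × ℝ → ℂ := fun i ↦ bump Θ 1 0 (c₁ i) with hc₂
  have m₂ : ∀ i, Measurable (c₂ i) := fun i ↦ measurable_bump _ _ _ (m₁ i)
  have i₂ : ∀ i, Integrable (c₂ i) := fun i ↦ integrable_bump _ one_pos _ (m₁ i) (i₁ i)
  set c₃ : ℕ → ℝ × ℝ → ℂ := fun i ↦ bump hη.toSchwartz (4 ^ k) t₀ (c₂ i) with hc₃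
  have m₃ : ∀ i, Measurable (c₃ i) := fun i ↦ measurable_bump _ _ _ (m₂ i)
  have i₃ : ∀ i, Integrable (c₃ i) := fun i ↦ integrable_bump _ h4k _ (m₂ i) (i₂ i)
  set c₄ : ℕ → ℝ × ℝ → ℂ := fun i ↦ bump chiS (4 ^ n) (cell n M t₀ i) (c₃ i) with hc₄
  have m₄ : ∀ i, Measurable (c₄ i) := fun i ↦ measurable_bump _ _ _ (m₃ i)
  have i₄ : ∀ i, Integrable (c₄ i) := fun i ↦ integrable_bump _ h4n _ (m₃ i) (i₃ i)
  have s₀ : ∀ i z, c₀ i z ≠ 0 → z.1 ∈ {ξ : ℝ | 2 / 5 * 2 ^ n ≤ |2 * Real.pi * ξ| ∧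
      |2 * Real.pi * ξ| ≤ 2 * 2 ^ n} := by
    intro i z hz
    obtain ⟨w, hw1, hw2⟩ := exists_pair_ne_of_cconv hz
    have b1 := mulX_supp (hgs i) w hw1
    have b2 := mulX_supp (hhs i) _ hw2
    have e : 2 * Real.pi * z.1 = 2 * Real.pi * w.1 + 2 * Real.pi * (z - w).1 := by
      rw [Prod.fst_sub]
      ring
    simp only [Set.mem_ofPred_eq, e]
    -- The margins are `5/8 - 1/5 > 2/5` and `8/5 + 1/5 < 2`.
    have key : ∀ {p q : ℝ}, 5 / 8 * 2 ^ n ≤ |p| → |p| ≤ 8 / 5 * 2 ^ n → |q| ≤ 1 / 5 * 2 ^ n →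
        2 / 5 * 2 ^ n ≤ |p + q| ∧ |p + q| ≤ 2 * 2 ^ n := fun {p q} h1 h2 h3 ↦ by
      have hpos : (0 : ℝ) < 2 ^ n := by positivity
      have := abs_add_le p q
      have := abs_sub_abs_le_abs_sub p (-q)
      rw [abs_neg, sub_neg_eq_add] at this
      constructor <;> linarith
    rcases hk with hk | hk
    · obtain rfl : n = k₂ := by omega
      rw [add_comm (2 * Real.pi * w.1)]
      exact key (b2.2 (by omega)) b2.1 (b1.1.trans (low_le hk))
    · obtain rfl : n = k₁ := by omega
      exact key (b1.2 (by omega)) b1.1 (b2.1.trans (low_le hk))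
  -- The derivatives cost at most `2^(3n)` and transversality gains `2^(-2n)`; the constant is `256
  -- = 4 · 8 · 8`.
  have n₀ : ∀ i, n2 (fun z ↦ ‖c₀ i z‖ₑ) ≤ 256 * (e2 n * (x * y)) := by
    intro i
    refine (n2_mono (enorm_cconv_le _ _)).trans ?_
    have hsep : n2 (conv (fun w ↦ ‖mulX a (g i) w‖ₑ) fun w ↦ ‖mulX b (h i) w‖ₑ) ≤
        4 * e2 (-2 * n) * (xn η (fun w ↦ ‖mulX a (g i) w‖ₑ) *
          xn η fun w ↦ ‖mulX b (h i) w‖ₑ) := by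
      rcases hk with hk | hk
      · obtain rfl : n = k₂ := by omega
        rw [conv_comm, mul_comm (xn η _)]
        refine hη.n2_conv_transversal n (hm i).enorm (gm i).enorm (fun z hz ↦ ?_) fun z hz ↦ ?_
        · exact (mulX_supp (hhs i) z (by simpa using hz)).2 (by omega)
        · exact (mulX_supp (hgs i) z (by simpa using hz)).1.trans (low_le hk)
      · obtain rfl : n = k₁ := by omega
        refine hη.n2_conv_transversal n (gm i).enorm (hm i).enorm (fun z hz ↦ ?_) fun z hz ↦ ?_
        · exact (mulX_supp (hgs i) z (by simpa using hz)).2 (by omega)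
        · exact (mulX_supp (hhs i) z (by simpa using hz)).1.trans (low_le hk)
    have hp := (hη.xn_mulX_le (by omega : a ≤ 3) (hgm i) (hgs i)).trans
      (mul_le_mul_right (hgx i) _)
    have hq := (hη.xn_mulX_le (by omega : b ≤ 3) (hhm i) (hhs i)).trans
      (mul_le_mul_right (hhx i) _)
    have hsum := symbol_order hab h₁ h₂
    calc _ ≤ 4 * e2 (-2 * n) * ((8 * e2 (a * k₁) * x) * (8 * e2 (b * k₂) * y)) :=
          hsep.trans (by gcongr)
      _ = 256 * (e2 (-2 * n + (a * k₁ + b * k₂)) * (x * y)) := by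
          rw [e2_add, e2_add]
          ring
      _ ≤ _ := by
          gcongr
          refine e2_mono ?_
          linarith
  have n₄ : ∀ i, n2 (fun z ↦ ‖c₄ i z‖ₑ) ≤
      C₁ * (C₂ * (C₃ * (C₂ * (256 * (e2 n * (x * y)))))) := fun i ↦ by
    refine (hC₁ _ h4n _ _ (m₃ i)).trans ?_
    gcongr
    refine (hC₂ _ h4k _ _ (m₂ i)).trans ?_
    gcongr
    refine (hC₃ _ one_pos _ _ (m₁ i)).trans ?_
    gcongr
    refine (hC₂ _ h4n _ _ (m₀ i)).trans ?_
    gcongr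
    exact n₀ i
  refine ⟨fun z ↦ ∑ i ∈ Finset.range (2 * M + 1), c₄ i z,
    Finset.measurable_fun_sum _ fun i _ ↦ m₄ i, integrable_finsetSum _ fun i _ ↦ i₄ i, ?_, ?_, ?_⟩
  · intro z hz
    obtain ⟨i, -, hi0⟩ := Finset.exists_ne_zero_of_sum_ne_zero hz
    exact ctconv_supp (ctconv_supp (ctconv_supp (ctconv_supp (s₀ i)))) z hi0
  · refine (n2_mono fun z ↦ enorm_sum_le_sum _ _).trans
      ((n2_sum_le _ fun i ↦ (m₄ i).enorm).trans
        ((Finset.sum_le_sum fun i _ ↦ n₄ i).trans ?_))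
    rw [Finset.sum_const, Finset.card_range, nsmul_eq_mul]
    refine (mul_le_mul_left (cell_count n k) _).trans (le_of_eq ?_)
    push_cast
    ring
  · have hP' := ae_all_iff.mpr hgP
    have hQ' := ae_all_iff.mpr hhQ
    filter_upwards [hP', hQ'] with t htP htQ r
    rw [← hη.block_sum h₁ h₂ t₀ t (Θ t) (P t r) (Q t r) hM, ift_sum _ i₄]
    refine Finset.sum_congr rfl fun i _ ↦ ?_
    rw [ift_bump _ h4n _ (m₃ i) (i₃ i), ift_bump _ h4k _ (m₂ i) (i₂ i),
      ift_bump _ one_pos _ (m₁ i) (i₁ i), ift_bump _ h4n _ (m₀ i) (i₀ i), hc₀,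
      ift_cconv (gi i) (hi i), ← htP, ← htQ, chiS_apply, hη.toSchwartz_apply,
      hη.toSchwartz_apply, sub_zero, one_mul]
    ring

/-- The cutoffs are distributed over the factors before convolving: the cell function, the coarse
cutoff and `Θ` go to the first one, the cutoff at scale `4^(-n)` to the second. Each factor then
carries one cutoff of length `4^(-n)` and its `L²` norm is smaller by `2^(-n)`, which is the
smallness required in `n2_conv_resonant`. -/
theorem IsCutoff.exists_block_resonant {η : ℝ → ℝ} (hη : IsCutoff η) (Θ : 𝓢(ℝ, ℂ)) {θ : ℝ}
    (h0 : 0 < θ) (h1 : θ < 1 / 2) :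
    ∃ C : ℝ≥0, ∀ k k₁ k₂ n a b : ℕ, a + b = 3 → n = max k₁ k₂ → k₁ ≤ k₂ + 2 → k₂ ≤ k₁ + 2 →
    ∀ x y : ℝ≥0∞, x < ⊤ → y < ⊤ → ∀ P Q : ℝ → ℝ → ℂ, LocRep η k₁ a x P → LocRep η k₂ b y Q →
    ∀ t₀ : ℝ, ∃ G : ℝ × ℝ → ℂ, Measurable G ∧ Integrable G ∧
      (∀ z, G z ≠ 0 → |2 * Real.pi * z.1| ≤ 16 / 5 * 2 ^ n) ∧
      (∀ R : ℝ, 0 < R → ∑' j : ℕ, e2 (-(j / 2)) *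
        n2 (fun z ↦ lowpass R z.1 * (ENNReal.ofReal (etaK η j (mu z)) * ‖G z‖ₑ)) ≤
        C * (4 ^ (n - k) * (e2 (3 * n - 6 * θ * n) * ENNReal.ofReal (R ^ (1 / 2 - θ))) *
          (x * y))) ∧
      ∀ᵐ t : ℝ, ∀ r : ℝ, (η (4 ^ k * (t - t₀)) : ℂ) * Θ t * (P t r * Q t r) = ift G (r, t) := by
  obtain ⟨C₁, hC₁⟩ := exists_controlled_bump chiS h0.le h1.le
  obtain ⟨C₂, hC₂⟩ := exists_controlled_bump hη.toSchwartz h0.le h1.le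
  obtain ⟨C₃, hC₃⟩ := exists_controlled_bump Θ h0.le h1.le
  obtain ⟨C, hC⟩ := hη.n2_conv_resonant h0 h1
  refine ⟨9 * (C * (C₁ * (C₂ * (C₃ * 16)) * (C₂ * 16))), ?_⟩
  intro k k₁ k₂ n a b hab hn hk hk' x y hx hy P Q hP hQ t₀
  have h₁ : k₁ ≤ n := hn ▸ le_max_left _ _
  have h₂ : k₂ ≤ n := hn ▸ le_max_right _ _
  set M : ℕ := 2 * 4 ^ (n - k) + 2 with hM
  have h4k : (1 : ℝ) ≤ 4 ^ k := one_le_pow₀ (by norm_num)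
  have h4n : (1 : ℝ) ≤ 4 ^ n := one_le_pow₀ (by norm_num)
  have h4k0 : (0 : ℝ) < 4 ^ k := by positivity
  have h4n0 : (0 : ℝ) < 4 ^ n := by positivity
  choose g hgm hgs hgx hgP using fun i ↦ hP (mid n M t₀ i)
  choose h hhm hhs hhx hhQ using fun i ↦ hQ (mid n M t₀ i)
  have top : ∀ (r : ℝ) (u : ℝ≥0∞), u < ⊤ → 16 * e2 r * u < ⊤ := fun r u hu ↦
    ENNReal.mul_lt_top (ENNReal.mul_lt_top (by simp) (e2_ne_top _).lt_top) hu
  set X : ℝ≥0∞ := 16 * e2 (a * k₁) * x with hX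
  set Y : ℝ≥0∞ := 16 * e2 (b * k₂) * y with hY
  have hXt : X < ⊤ := top _ _ hx
  have hYt : Y < ⊤ := top _ _ hy
  have cmul : ∀ (c : ℝ≥0) {u : ℝ≥0∞}, u < ⊤ → c * u < ⊤ := fun c u hu ↦
    ENNReal.mul_lt_top ENNReal.coe_lt_top hu
  have f₀ : ∀ i, Controlled θ k₁ X (mulX a (g i)) := fun i ↦
    hη.controlled_mulX h0.le h1.le (by omega : a ≤ 3) (hgm i) (hgs i) (hgx i)
  have e₀ : ∀ i, Controlled θ k₂ Y (mulX b (h i)) := fun i ↦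
    hη.controlled_mulX h0.le h1.le (by omega : b ≤ 3) (hhm i) (hhs i) (hhx i)
  have f₁ := fun i ↦ (hC₃ 1 le_rfl 0 k₁ X _ (f₀ i)).1
  have f₂ := fun i ↦ (hC₂ (4 ^ k) h4k t₀ k₁ _ _ (f₁ i)).1
  have f₃ := fun i ↦ hC₁ (4 ^ n) h4n (cell n M t₀ i) k₁ _ _ (f₂ i)
  have e₁ := fun i ↦ hC₂ (4 ^ n) h4n (mid n M t₀ i) k₂ Y _ (e₀ i)
  set p : ℕ → ℝ × ℝ → ℂ := fun i ↦ bump chiS (4 ^ n) (cell n M t₀ i)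
    (bump hη.toSchwartz (4 ^ k) t₀ (bump Θ 1 0 (mulX a (g i)))) with hp
  set q : ℕ → ℝ × ℝ → ℂ := fun i ↦ bump hη.toSchwartz (4 ^ n) (mid n M t₀ i) (mulX b (h i)) with hq
  have i₀ := fun i ↦ (f₀ i).integrable hXt
  have i₁ := fun i ↦ (f₁ i).integrable (cmul _ hXt)
  have i₂ := fun i ↦ (f₂ i).integrable (cmul _ (cmul _ hXt))
  have ip : ∀ i, Integrable (p i) := fun i ↦ (f₃ i).1.integrable (cmul _ (cmul _ (cmul _ hXt)))
  have j₀ := fun i ↦ (e₀ i).integrable hYt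
  have iq : ∀ i, Integrable (q i) := fun i ↦ (e₁ i).1.integrable (cmul _ hYt)
  have hscale : ENNReal.ofReal (((4 : ℝ) ^ n) ^ (-(1 / 2) : ℝ)) = e2 (-n) := by
    rw [show (4 : ℝ) = 2 ^ (2 : ℕ) by norm_num, ← pow_mul, ← Real.rpow_natCast,
      ← Real.rpow_mul (by norm_num), ofReal_rpow_two]
    congr 1
    push_cast
    ring
  refine ⟨fun z ↦ ∑ i ∈ Finset.range (2 * M + 1), cconv (p i) (q i) z,
    Finset.measurable_fun_sum _ fun i _ ↦ measurable_cconv (f₃ i).1.meas (e₁ i).1.meas,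
    integrable_finsetSum _ fun i _ ↦ integrable_cconv (f₃ i).1.meas (e₁ i).1.meas (ip i) (iq i),
    ?_, ?_, ?_⟩
  · intro z hz
    obtain ⟨i, -, hi0⟩ := Finset.exists_ne_zero_of_sum_ne_zero hz
    obtain ⟨w, hw1, hw2⟩ := exists_pair_ne_of_cconv hi0
    have b1 := ((f₃ i).1.supp w hw1).1
    have b2 := ((e₁ i).1.supp _ hw2).1
    have e : 2 * Real.pi * z.1 = 2 * Real.pi * w.1 + 2 * Real.pi * (z - w).1 := by
      rw [Prod.fst_sub]
      ring
    have p1 : (2 : ℝ) ^ k₁ ≤ 2 ^ n := pow_le_pow_right₀ (by norm_num) h₁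
    have p2 : (2 : ℝ) ^ k₂ ≤ 2 ^ n := pow_le_pow_right₀ (by norm_num) h₂
    rw [e]
    refine (abs_add_le _ _).trans ?_
    linarith
  · intro R hR
    have hmeas : ∀ (j i : ℕ), Measurable fun z : ℝ × ℝ ↦
        lowpass R z.1 * (ENNReal.ofReal (etaK η j (mu z)) *
          conv (fun w ↦ ‖p i w‖ₑ) (fun w ↦ ‖q i w‖ₑ) z) := fun j i ↦ by
      have m1 : Measurable fun z : ℝ × ℝ ↦ lowpass R z.1 :=
        (measurable_lowpass R).comp measurable_fst
      have m2 := hη.measurable_eta_mu j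
      have m3 := measurable_conv (f₃ i).1.meas.enorm (e₁ i).1.meas.enorm
      exact m1.mul (m2.mul m3)
    have hone : ∀ i, ∑' j : ℕ, e2 (-(j / 2)) * n2 (fun z ↦ lowpass R z.1 *
        (ENNReal.ofReal (etaK η j (mu z)) *
          conv (fun w ↦ ‖p i w‖ₑ) (fun w ↦ ‖q i w‖ₑ) z)) ≤ _ := fun i ↦
      hC n k₁ k₂ (by omega) (by omega) h₁ h₂ _ _ (f₃ i).1.meas.enorm (e₁ i).1.meas.enorm
        (fun z hz ↦ (f₃ i).1.supp z (by simpa using hz))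
        (fun z hz ↦ (e₁ i).1.supp z (by simpa using hz)) _ _ (f₃ i).1.n21_le (e₁ i).1.n21_le
        (f₃ i).1.dn_le (e₁ i).1.dn_le (hscale ▸ (f₃ i).2) (hscale ▸ (e₁ i).2) R hR
    calc ∑' j : ℕ, e2 (-(j / 2)) * n2 (fun z ↦ lowpass R z.1 *
          (ENNReal.ofReal (etaK η j (mu z)) *
            ‖∑ i ∈ Finset.range (2 * M + 1), cconv (p i) (q i) z‖ₑ))
        ≤ ∑' j : ℕ, ∑ i ∈ Finset.range (2 * M + 1), e2 (-(j / 2)) * n2 (fun z ↦ lowpass R z.1 *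
          (ENNReal.ofReal (etaK η j (mu z)) *
            conv (fun w ↦ ‖p i w‖ₑ) (fun w ↦ ‖q i w‖ₑ) z)) := by
          refine ENNReal.tsum_le_tsum fun j ↦ ?_
          rw [← Finset.mul_sum]
          gcongr
          refine le_trans (n2_mono fun z ↦ ?_) (n2_sum_le _ (hmeas j))
          rw [← Finset.mul_sum, ← Finset.mul_sum]
          gcongr
          exact (enorm_sum_le_sum _ _).trans (Finset.sum_le_sum fun i _ ↦ enorm_cconv_le _ _ _)
      _ = ∑ i ∈ Finset.range (2 * M + 1), ∑' j : ℕ, e2 (-(j / 2)) * n2 (fun z ↦ lowpass R z.1 *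
          (ENNReal.ofReal (etaK η j (mu z)) *
            conv (fun w ↦ ‖p i w‖ₑ) (fun w ↦ ‖q i w‖ₑ) z)) :=
          Summable.tsum_finsetSum fun _ _ ↦ ENNReal.summable
      _ ≤ _ := Finset.sum_le_sum fun i _ ↦ hone i
      _ ≤ _ := by
          rw [Finset.sum_const, Finset.card_range, nsmul_eq_mul, hX, hY]
          refine (mul_le_mul_left (cell_count n k) _).trans ?_
          have hsum := symbol_order hab h₁ h₂
          calc _ = (9 * (C * (C₁ * (C₂ * (C₃ * 16)) * (C₂ * 16)))) * (4 ^ (n - k) *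
                (e2 ((a * k₁ + b * k₂) + -6 * θ * n) * ENNReal.ofReal (R ^ (1 / 2 - θ))) *
                  (x * y)) := by
                rw [e2_add, e2_add]
                ring
            _ ≤ _ := by
                push_cast
                gcongr
                refine e2_mono ?_
                linarith
  · have hP' := ae_all_iff.mpr hgP
    have hQ' := ae_all_iff.mpr hhQ
    filter_upwards [hP', hQ'] with t htP htQ r
    rw [← hη.block_sum h₁ h₂ t₀ t (Θ t) (P t r) (Q t r) hM,
      ift_sum _ fun i ↦ integrable_cconv (f₃ i).1.meas (e₁ i).1.meas (ip i) (iq i)]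
    refine Finset.sum_congr rfl fun i _ ↦ ?_
    rw [ift_cconv (ip i) (iq i), hp, hq, ift_bump _ h4n0 _ (f₂ i).meas (i₂ i),
      ift_bump _ h4k0 _ (f₁ i).meas (i₁ i), ift_bump _ one_pos _ (f₀ i).meas (i₀ i),
      ift_bump _ h4n0 _ (e₀ i).meas (j₀ i), ← htP, ← htQ, chiS_apply, hη.toSchwartz_apply,
      hη.toSchwartz_apply, sub_zero, one_mul]
    ring

/-! ### Distributions given by functions on the plane -/

/-- The point of the plane with the given coordinates. -/
def toPlane (w : ℝ × ℝ) : Plane := !₂[w.1, w.2]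

/-- The coordinates of a point of the plane. -/
def ofPlane (z : Plane) : ℝ × ℝ := (z 0, z 1)

theorem ofPlane_toPlane (w : ℝ × ℝ) : ofPlane (toPlane w) = w := by
  simp [ofPlane, toPlane]

theorem toPlane_ofPlane (z : Plane) : toPlane (ofPlane z) = z := by
  ext i
  fin_cases i <;> simp [ofPlane, toPlane]

theorem continuous_ofPlane : Continuous ofPlane := by
  unfold ofPlane
  fun_prop

theorem continuous_toPlane : Continuous toPlane := by
  unfold toPlane
  refine (PiLp.continuous_toLp 2 _).comp ?_
  refine continuous_pi fun i ↦ ?_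
  fin_cases i
  · exact continuous_fst
  · exact continuous_snd

theorem measurePreserving_toPlane : MeasurePreserving toPlane volume volume :=
  (PiLp.volume_preserving_toLp (Fin 2)).comp ((volume_preserving_finTwoArrow ℝ).symm _)

theorem measurableEmbedding_toPlane : MeasurableEmbedding toPlane :=
  MeasurableEmbedding.of_measurable_inverse continuous_toPlane.measurable
    (by
      have : Set.range toPlane = Set.univ :=
        Set.range_eq_univ.mpr fun z ↦ ⟨ofPlane z, toPlane_ofPlane z⟩
      rw [this]
      exact MeasurableSet.univ) continuous_ofPlane.measurable ofPlane_toPlane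

theorem integral_toPlane (F : Plane → ℂ) : ∫ z, F z = ∫ w, F (toPlane w) :=
  (measurePreserving_toPlane.integral_comp measurableEmbedding_toPlane F).symm

theorem measurePreserving_ofPlane : MeasurePreserving ofPlane volume volume := by
  refine ⟨continuous_ofPlane.measurable, ?_⟩
  rw [← measurePreserving_toPlane.map_eq, Measure.map_map continuous_ofPlane.measurable
    continuous_toPlane.measurable]
  have : ofPlane ∘ toPlane = id := funext ofPlane_toPlane
  rw [this, Measure.map_id]

theorem eLpNorm_two_eq_n2 {α : Type*} [MeasureSpace α] (F : α → ℂ) :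
    eLpNorm F 2 volume = n2 fun x ↦ ‖F x‖ₑ := by
  rw [eLpNorm_eq_lintegral_rpow_enorm_toReal (by norm_num) (by norm_num)]
  simp [n2]

theorem n2_ofPlane {F : ℝ × ℝ → ℝ≥0∞} (hF : Measurable F) :
    n2 (fun z ↦ F (ofPlane z)) = n2 F := n2_comp measurePreserving_ofPlane hF

/-- The distribution given by an integrable function on the plane. -/
def distOf {G : ℝ × ℝ → ℂ} (hG : Integrable G) : 𝓢'(Plane, ℂ) :=
  ((memLp_one_iff_integrable.mpr (measurePreserving_ofPlane.integrable_comp_of_integrable hG)).toLp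
    (fun z ↦ G (ofPlane z)) : Lp ℂ 1 (volume : Measure Plane))

theorem distOf_apply {G : ℝ × ℝ → ℂ} (hG : Integrable G) (φ : 𝓢(Plane, ℂ)) :
    distOf hG φ = ∫ w, G w * φ (toPlane w) := by
  have h := memLp_one_iff_integrable.mpr (measurePreserving_ofPlane.integrable_comp_of_integrable hG)
  unfold distOf
  rw [Lp.toTemperedDistribution_apply]
  have e : ∫ z, φ z • (h.toLp (fun z ↦ G (ofPlane z)) : Lp ℂ 1 (volume : Measure Plane)) z =
      ∫ z, G (ofPlane z) * φ z := by
    refine integral_congr_ae ?_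
    filter_upwards [h.coeFn_toLp] with z hz
    rw [smul_eq_mul, mul_comm]
    congr 1
  refine e.trans ?_
  rw [integral_toPlane]
  simp_rw [ofPlane_toPlane]

/-- The distribution `f` is given by the function `F`. -/
def IsFun (f : 𝓢'(Plane, ℂ)) (F : ℝ × ℝ → ℂ) : Prop :=
  ∀ φ : 𝓢(Plane, ℂ), f φ = ∫ w, F w * φ (toPlane w)

theorem isFun_coe (g : Lp ℂ 2 (volume : Measure Plane)) :
    IsFun (g : 𝓢'(Plane, ℂ)) fun w ↦ g (toPlane w) := fun φ ↦ by
  rw [Lp.toTemperedDistribution_apply, integral_toPlane]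
  refine integral_congr_ae (ae_of_all _ fun w ↦ ?_)
  dsimp only
  rw [smul_eq_mul, mul_comm]

theorem IsFun.smulLeft {f : 𝓢'(Plane, ℂ)} {F : ℝ × ℝ → ℂ} (h : IsFun f F) {m : Plane → ℂ}
    (hm : m.HasTemperateGrowth) :
    IsFun (TemperedDistribution.smulLeftCLM ℂ m f) fun w ↦ m (toPlane w) * F w := fun φ ↦ by
  rw [TemperedDistribution.smulLeftCLM_apply_apply, h]
  refine integral_congr_ae (ae_of_all _ fun w ↦ ?_)
  dsimp only
  rw [SchwartzMap.smulLeftCLM_apply_apply hm, smul_eq_mul]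
  ring

theorem IsFun.l2Norm_le {f : 𝓢'(Plane, ℂ)} {F : ℝ × ℝ → ℂ} (h : IsFun f F) (hF : Measurable F) :
    l2Norm f ≤ n2 fun w ↦ ‖F w‖ₑ := by
  by_cases htop : n2 (fun w ↦ ‖F w‖ₑ) = ⊤
  · simp [htop]
  have hm : eLpNorm (fun z : Plane ↦ F (ofPlane z)) 2 volume = n2 fun w ↦ ‖F w‖ₑ := by
    rw [eLpNorm_two_eq_n2, ← n2_ofPlane hF.enorm]
  have hmem : MemLp (fun z : Plane ↦ F (ofPlane z)) 2 volume :=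
    ⟨(hF.comp continuous_ofPlane.measurable).aestronglyMeasurable, hm ▸ lt_top_iff_ne_top.mpr htop⟩
  have hf : ((hmem.toLp _ : Lp ℂ 2 (volume : Measure Plane)) : 𝓢'(Plane, ℂ)) = f := by
    refine DFunLike.ext _ _ fun φ ↦ ?_
    rw [h φ, Lp.toTemperedDistribution_apply]
    have : ∫ z, φ z • (hmem.toLp (fun z ↦ F (ofPlane z)) : Lp ℂ 2 (volume : Measure Plane)) z =
        ∫ z, F (ofPlane z) * φ z := by
      refine integral_congr_ae ?_
      filter_upwards [hmem.coeFn_toLp] with z hz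
      rw [smul_eq_mul, mul_comm]
      congr 1
    refine this.trans ?_
    rw [integral_toPlane]
    simp_rw [ofPlane_toPlane]
  rw [← hf, l2Norm_coe, Lp.enorm_toLp, hm]

theorem exists_isFun_of_l2Norm_lt_top {f : 𝓢'(Plane, ℂ)} (h : l2Norm f < ⊤) :
    ∃ g : Lp ℂ 2 (volume : Measure Plane), (g : 𝓢'(Plane, ℂ)) = f ∧ ‖g‖ₑ = l2Norm f := by
  unfold l2Norm at h
  obtain ⟨g, hg⟩ := iInf_lt_iff.mp h
  obtain ⟨hgf, -⟩ := iInf_lt_iff.mp hg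
  exact ⟨g, hgf, by rw [← hgf, l2Norm_coe]⟩

/-- Functions with the same integrals against test functions agree almost everywhere. -/
theorem ae_eq_of_integral_schwartz_eq {F G : ℝ × ℝ → ℂ}
    (hF : LocallyIntegrable fun z ↦ F (ofPlane z)) (hG : LocallyIntegrable fun z ↦ G (ofPlane z))
    (h : ∀ φ : 𝓢(Plane, ℂ), HasCompactSupport φ →
      ∫ w, F w * φ (toPlane w) = ∫ w, G w * φ (toPlane w)) : F =ᵐ[volume] G := by
  have key : ∀ᵐ z : Plane, F (ofPlane z) = G (ofPlane z) := by
    refine ae_eq_of_integral_contDiff_smul_eq hF hG fun g hg hgc ↦ ?_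
    have hc : HasCompactSupport fun z ↦ (g z : ℂ) := hgc.comp_left Complex.ofReal_zero
    have hk := h (hc.toSchwartzMap (Complex.ofRealCLM.contDiff.comp hg)) hc
    rw [integral_toPlane, integral_toPlane]
    simp_rw [ofPlane_toPlane, Complex.real_smul]
    simp_rw [mul_comm _ (F _), mul_comm _ (G _)]
    exact hk
  have := measurePreserving_toPlane.quasiMeasurePreserving.ae key
  filter_upwards [this] with w hw
  rwa [ofPlane_toPlane] at hw

/-! ### Sums of distributions -/

/-- The sum of the distributions `D i` in the topology of pointwise convergence is `f`. -/
def IsDistSum {ι : Type*} (D : ι → 𝓢'(Plane, ℂ)) (f : 𝓢'(Plane, ℂ)) : Prop :=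
  ∀ φ, HasSum (fun i ↦ D i φ) (f φ)

theorem summable_of_tsum_enorm_lt_top {ι E : Type*} [NormedAddCommGroup E] [CompleteSpace E]
    {g : ι → E} (h : ∑' i, ‖g i‖ₑ < ⊤) : Summable g :=
  Summable.of_nnnorm (ENNReal.tsum_coe_ne_top_iff_summable.mp h.ne)

theorem isDistSum_coe {ι : Type*} {g : ι → Lp ℂ 2 (volume : Measure Plane)}
    {G : Lp ℂ 2 (volume : Measure Plane)} (h : HasSum g G) :
    IsDistSum (fun i ↦ (g i : 𝓢'(Plane, ℂ))) (G : 𝓢'(Plane, ℂ)) := fun φ ↦ by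
  have hc := (Lp.toTemperedDistributionCLM ℂ (volume : Measure Plane) 2).continuous
  have he : Continuous fun f : 𝓢'(Plane, ℂ) ↦ f φ :=
    (PointwiseConvergenceCLM.evalCLM (RingHom.id ℂ) ℂ φ).continuous
  let L : Lp ℂ 2 (volume : Measure Plane) →+ ℂ :=
    { toFun := fun f ↦ (f : 𝓢'(Plane, ℂ)) φ
      map_zero' := by
        change (Lp.toTemperedDistributionCLM ℂ (volume : Measure Plane) 2 0) φ = 0
        rw [map_zero]
        rfl
      map_add' := fun a b ↦ by
        change (Lp.toTemperedDistributionCLM ℂ (volume : Measure Plane) 2 (a + b)) φ = _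
        rw [map_add]
        rfl }
  exact h.map L (he.comp hc)

/-- If the right-hand side is finite, the `L²` representatives form an absolutely convergent series
in `L²`, and uniqueness of the limit against each test function identifies its sum with `f`. -/
theorem IsDistSum.l2Norm_le {ι : Type*} {D : ι → 𝓢'(Plane, ℂ)} {f : 𝓢'(Plane, ℂ)}
    (h : IsDistSum D f) : l2Norm f ≤ ∑' i, l2Norm (D i) := by
  by_cases htop : ∑' i, l2Norm (D i) = ⊤
  · simp [htop]
  have hlt : ∀ i, l2Norm (D i) < ⊤ := fun i ↦
    lt_top_iff_ne_top.mpr (ENNReal.ne_top_of_tsum_ne_top htop i)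
  choose g hgD hgn using fun i ↦ exists_isFun_of_l2Norm_lt_top (hlt i)
  have hs : Summable g := summable_of_tsum_enorm_lt_top (by
    simp_rw [hgn]
    exact lt_top_iff_ne_top.mpr htop)
  have hf : ((∑' i, g i : Lp ℂ 2 (volume : Measure Plane)) : 𝓢'(Plane, ℂ)) = f := by
    refine DFunLike.ext _ _ fun φ ↦ ?_
    have h1 := isDistSum_coe hs.hasSum φ
    simp_rw [hgD] at h1
    exact h1.unique (h φ)
  rw [← hf, l2Norm_coe]
  refine enorm_tsum_le_tsum_enorm.trans (le_of_eq ?_)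
  simp_rw [hgn]

/-- The operators occurring in the norms are defined by transposition, so they pass through sums
that converge against every single test function. Countable subadditivity of `nkNorm` follows from
this. -/
theorem IsDistSum.smulLeft {ι : Type*} {D : ι → 𝓢'(Plane, ℂ)} {f : 𝓢'(Plane, ℂ)}
    (h : IsDistSum D f) (m : Plane → ℂ) :
    IsDistSum (fun i ↦ TemperedDistribution.smulLeftCLM ℂ m (D i))
      (TemperedDistribution.smulLeftCLM ℂ m f) := fun φ ↦ by
  simp only [TemperedDistribution.smulLeftCLM_apply_apply]
  exact h _

theorem IsDistSum.fourier {ι : Type*} {D : ι → 𝓢'(Plane, ℂ)} {f : 𝓢'(Plane, ℂ)}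
    (h : IsDistSum D f) : IsDistSum (fun i ↦ 𝓕 (D i)) (𝓕 f) := fun φ ↦ by
  simp only [TemperedDistribution.fourier_apply]
  exact h _

theorem IsDistSum.fourierInv {ι : Type*} {D : ι → 𝓢'(Plane, ℂ)} {f : 𝓢'(Plane, ℂ)}
    (h : IsDistSum D f) : IsDistSum (fun i ↦ 𝓕⁻ (D i)) (𝓕⁻ f) := fun φ ↦ by
  simp only [TemperedDistribution.fourierInv_apply]
  exact h _

theorem IsDistSum.projK {ι : Type*} {D : ι → 𝓢'(Plane, ℂ)} {f : 𝓢'(Plane, ℂ)}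
    (h : IsDistSum D f) (η : ℝ → ℝ) (k : ℕ) :
    IsDistSum (fun i ↦ projK η k (D i)) (projK η k f) := by
  unfold ShortTime.projK
  simp only [TemperedDistribution.fourierMultiplierCLM_apply]
  exact (h.fourier.smulLeft _).fourierInv

theorem IsDistSum.xNorm_le {ι : Type*} {D : ι → 𝓢'(Plane, ℂ)} {f : 𝓢'(Plane, ℂ)}
    (h : IsDistSum D f) (η : ℝ → ℝ) : xNorm η f ≤ ∑' i, xNorm η (D i) := by
  unfold xNorm
  rw [ENNReal.tsum_comm]
  refine ENNReal.tsum_le_tsum fun j ↦ ?_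
  rw [ENNReal.tsum_mul_left]
  gcongr
  exact (h.smulLeft _).l2Norm_le

theorem IsDistSum.nkNorm_le {ι : Type*} {D : ι → 𝓢'(Plane, ℂ)} {f : 𝓢'(Plane, ℂ)}
    (h : IsDistSum D f) (η : ℝ → ℝ) (α : ℝ) (k : ℕ) : nkNorm η α k f ≤ ∑' i, nkNorm η α k (D i) := by
  refine iSup_le fun t₀ ↦ ((((h.smulLeft _).fourier).smulLeft _).xNorm_le η).trans ?_
  exact ENNReal.tsum_le_tsum fun i ↦ le_iSup (fun t₀ ↦ xNorm η
    (TemperedDistribution.smulLeftCLM ℂ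
      (fun ζ : Plane ↦ ((modulation ζ : ℂ) + Complex.I * (((2 : ℝ) ^ (α * k) : ℝ) : ℂ))⁻¹)
      (𝓕 (timeLocalize η α k t₀ (D i))))) t₀

/-! ### Distributions with finite `X` norm -/

theorem modulation_toPlane (w : ℝ × ℝ) : modulation (toPlane w) = mu w := by
  simp [modulation, toPlane, mu]

theorem enorm_ofReal_of_nonneg {r : ℝ} (hr : 0 ≤ r) : ‖(r : ℂ)‖ₑ = ENNReal.ofReal r := by
  rw [← ofReal_norm, Complex.norm_real, Real.norm_eq_abs, abs_of_nonneg hr]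

theorem exists_eta_modulation_eq_zero {η : ℝ → ℝ} (hη : IsCutoff η) {ψ : 𝓢(Plane, ℂ)}
    (hψ : HasCompactSupport ψ) : ∃ J : ℕ, (∀ j, J ≤ j → ∀ z, etaK η j (modulation z) * ψ z = 0) ∧
      ∀ z, (∑ j ∈ Finset.range J, (etaK η j (modulation z) : ℂ)) * ψ z = ψ z := by
  have hcont : Continuous modulation := by
    unfold modulation
    fun_prop
  obtain ⟨B, hB⟩ := hψ.isCompact.exists_bound_of_continuousOn (f := modulation) hcont.continuousOn
  obtain ⟨J, hJ⟩ := pow_unbounded_of_one_lt (2 * B) (one_lt_two (α := ℝ))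
  have hz : ∀ j, J + 1 ≤ j → ∀ z, ψ z ≠ 0 → etaK η j (modulation z) = 0 := fun j hj z hz ↦ by
    by_contra hne
    have h1 := hη.etaK_lower (by omega) hne
    have h2 := hB z (subset_tsupport _ hz)
    rw [Real.norm_eq_abs] at h2
    have h3 : (2 : ℝ) ^ J ≤ 2 ^ j := pow_le_pow_right₀ (by norm_num) (by omega)
    have h4 := abs_nonneg (modulation z)
    linarith
  refine ⟨J + 1, fun j hj z ↦ ?_, fun z ↦ ?_⟩
  · by_cases h : ψ z = 0
    · simp [h]
    · simp [hz j hj z h]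
  · by_cases h : ψ z = 0
    · simp [h]
    · have h1 : HasSum (fun j ↦ etaK η j (modulation z))
          (∑ j ∈ Finset.range (J + 1), etaK η j (modulation z)) :=
        hasSum_sum_of_ne_finset_zero fun j hj ↦ hz j (by simpa using hj) z h
      rw [← Complex.ofReal_sum, h1.unique (hη.hasSum_etaK _)]
      simp

/-- The pieces `η_j f` are in `L²` with summable norms, as `2^(j/2) ≥ 1`, and their sum is the
desired function. Against a compactly supported `ψ` only finitely many modulations occur, so the sum
pairs with `ψ` as `f` does. Localizing once more identifies the `j`-th piece with `η_j` times the
function, which matches the norms. -/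
theorem exists_fun_of_xNorm_lt_top {η : ℝ → ℝ} (hη : IsCutoff η) {f : 𝓢'(Plane, ℂ)}
    (hf : xNorm η f < ⊤) : ∃ g : ℝ × ℝ → ℂ, Measurable g ∧ n2 (fun w ↦ ‖g w‖ₑ) < ⊤ ∧
      xn η (fun w ↦ ‖g w‖ₑ) ≤ xNorm η f ∧
      ∀ ψ : 𝓢(Plane, ℂ), HasCompactSupport ψ → f ψ = ∫ w, g w * ψ (toPlane w) := by
  set m : ℕ → Plane → ℂ := fun j ζ ↦ ((etaK η j (modulation ζ) : ℝ) : ℂ) with hm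
  have hmt : ∀ j, (m j).HasTemperateGrowth := xNorm_symbol_hasTemperateGrowth hη
  set d : ℕ → 𝓢'(Plane, ℂ) := fun j ↦ TemperedDistribution.smulLeftCLM ℂ (m j) f with hd
  have hle : ∑' j, l2Norm (d j) ≤ xNorm η f := by
    refine ENNReal.tsum_le_tsum fun j ↦ ?_
    refine le_mul_of_one_le_left' ?_
    have := e2_mono (show (0 : ℝ) ≤ (j : ℝ) / 2 by positivity)
    rwa [e2_zero] at this
  have hlt : ∀ j, l2Norm (d j) < ⊤ := fun j ↦ (ENNReal.le_tsum j).trans_lt (hle.trans_lt hf)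
  choose g hgd hgn using fun j ↦ exists_isFun_of_l2Norm_lt_top (hlt j)
  have hs : Summable g := summable_of_tsum_enorm_lt_top (by
    simp_rw [hgn]
    exact hle.trans_lt hf)
  set G := ∑' j, g j with hG
  have hGm : Measurable (G : Plane → ℂ) := (Lp.stronglyMeasurable G).measurable
  have hGf : ∀ ψ : 𝓢(Plane, ℂ), HasCompactSupport ψ → f ψ = (G : 𝓢'(Plane, ℂ)) ψ := fun ψ hψ ↦ by
    obtain ⟨J, hJ0, hJ1⟩ := exists_eta_modulation_eq_zero hη hψ
    have h1 := isDistSum_coe hs.hasSum ψ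
    simp_rw [hgd] at h1
    have h2 : HasSum (fun j ↦ d j ψ) (∑ j ∈ Finset.range J, d j ψ) := by
      refine hasSum_sum_of_ne_finset_zero fun j hj ↦ ?_
      have hz : SchwartzMap.smulLeftCLM ℂ (m j) ψ = 0 := by
        ext z
        rw [SchwartzMap.smulLeftCLM_apply_apply (hmt j), smul_eq_mul]
        have := hJ0 j (by simpa using hj) z
        simpa [hm] using this
      rw [hd]
      dsimp only
      rw [TemperedDistribution.smulLeftCLM_apply_apply, hz, map_zero]
    rw [h1.unique h2]
    have h3 : ∑ j ∈ Finset.range J, SchwartzMap.smulLeftCLM ℂ (m j) ψ = ψ := by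
      ext z
      rw [_root_.sum_apply]
      simp_rw [SchwartzMap.smulLeftCLM_apply_apply (hmt _), smul_eq_mul]
      rw [← Finset.sum_mul]
      exact hJ1 z
    nth_rewrite 1 [← h3]
    rw [map_sum]
    rfl
  have hcs : ∀ (j : ℕ) (ψ : 𝓢(Plane, ℂ)), HasCompactSupport ψ →
      HasCompactSupport (SchwartzMap.smulLeftCLM ℂ (m j) ψ) := fun j ψ hψ ↦ by
    have : (SchwartzMap.smulLeftCLM ℂ (m j) ψ : Plane → ℂ) = fun z ↦ m j z * ψ z := by
      funext z
      rw [SchwartzMap.smulLeftCLM_apply_apply (hmt j), smul_eq_mul]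
    rw [this]
    exact hψ.mul_left
  have hloc : ∀ h : Lp ℂ 2 (volume : Measure Plane), LocallyIntegrable (h : Plane → ℂ) volume :=
    fun h ↦ (Lp.memLp h).locallyIntegrable (by norm_num)
  have hmc : ∀ j, Continuous (m j) := fun j ↦ (hmt j).1.continuous
  have hpiece : ∀ j, (fun w ↦ g j (toPlane w)) =ᵐ[volume] fun w ↦
      m j (toPlane w) * G (toPlane w) := fun j ↦ by
    refine ae_eq_of_integral_schwartz_eq (F := fun w ↦ g j (toPlane w))
      (G := fun w ↦ m j (toPlane w) * G (toPlane w)) ?_ ?_ fun ψ hψ ↦ ?_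
    · simp only [toPlane_ofPlane]
      exact hloc _
    · simp only [toPlane_ofPlane]
      exact (hloc G).continuous_mul (hmc j)
    · have h1 := isFun_coe (g j) ψ
      rw [hgd] at h1
      rw [← h1, hd]
      dsimp only
      rw [TemperedDistribution.smulLeftCLM_apply_apply, hGf _ (hcs j ψ hψ),
        ← TemperedDistribution.smulLeftCLM_apply_apply]
      exact (isFun_coe G).smulLeft (hmt j) ψ
  have hn : ∀ h : Lp ℂ 2 (volume : Measure Plane), n2 (fun w ↦ ‖h (toPlane w)‖ₑ) = ‖h‖ₑ :=
    fun h ↦ by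
      rw [Lp.enorm_def, eLpNorm_two_eq_n2]
      exact n2_comp measurePreserving_toPlane (Lp.stronglyMeasurable h).measurable.enorm
  refine ⟨fun w ↦ G (toPlane w), hGm.comp continuous_toPlane.measurable, ?_, ?_, fun ψ hψ ↦ ?_⟩
  · rw [hn]
    exact enorm_lt_top
  · refine ENNReal.tsum_le_tsum fun j ↦ ?_
    refine mul_le_mul_right (le_of_eq ?_) _
    have e : l2Norm (d j) = n2 fun w ↦ ‖g j (toPlane w)‖ₑ := by rw [← hgn, hn]
    refine Eq.trans ?_ e.symm
    refine n2_congr_ae ?_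
    filter_upwards [hpiece j] with w hw
    rw [hw, enorm_mul, hm]
    dsimp only
    rw [modulation_toPlane, enorm_ofReal_of_nonneg (hη.etaK_nonneg _ _)]
  · rw [hGf ψ hψ]
    exact isFun_coe G ψ

/-! ### Fourier transforms of tensor products -/

theorem inner_toPlane (a b : ℝ × ℝ) :
    inner ℝ (toPlane a) (toPlane b) = b.1 * a.1 + b.2 * a.2 := by
  simp [toPlane, PiLp.inner_apply, Fin.sum_univ_two]

theorem fourierInv_toPlane (ψ : Plane → ℂ) (z : ℝ × ℝ) :
    𝓕⁻ ψ (toPlane z) = ift (fun w ↦ ψ (toPlane w)) z := by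
  rw [Real.fourierInv_eq, integral_toPlane]
  refine integral_congr_ae (ae_of_all _ fun w ↦ ?_)
  dsimp only
  rw [inner_toPlane]
  rfl

theorem fourier_toPlane (ψ : Plane → ℂ) (z : ℝ × ℝ) :
    𝓕 ψ (toPlane z) = ift (fun w ↦ ψ (toPlane w)) (-z) := by
  rw [Real.fourier_eq, integral_toPlane]
  refine integral_congr_ae (ae_of_all _ fun w ↦ ?_)
  dsimp only
  rw [inner_toPlane, Prod.fst_neg, Prod.snd_neg,
    show -z.1 * w.1 + -z.2 * w.2 = -(z.1 * w.1 + z.2 * w.2) by ring]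
  rfl

theorem ift_tensor (α β : ℝ → ℂ) (z : ℝ × ℝ) :
    ift (fun w ↦ α w.1 * β w.2) z = 𝓕⁻ α z.1 * 𝓕⁻ β z.2 := by
  rw [fourierInv_eq_ch, fourierInv_eq_ch, ← integral_prod_mul]
  refine integral_congr_ae (ae_of_all _ fun w ↦ ?_)
  dsimp only
  rw [ch_add]
  ring

theorem fourierInv_neg (f : ℝ → ℂ) (x : ℝ) : 𝓕⁻ f (-x) = 𝓕 f x := by
  rw [fourierInv_eq_ch, fourier_eq_ch]
  simp_rw [neg_mul]

theorem fourier_tensor {ψ : Plane → ℂ} {α β : ℝ → ℂ} (h : ∀ w, ψ (toPlane w) = α w.1 * β w.2)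
    (z : ℝ × ℝ) : 𝓕 ψ (toPlane z) = 𝓕 α z.1 * 𝓕 β z.2 := by
  rw [fourier_toPlane]
  simp_rw [h]
  rw [ift_tensor, Prod.fst_neg, Prod.snd_neg, fourierInv_neg, fourierInv_neg]

theorem fourierInv_tensor {ψ : Plane → ℂ} {α β : ℝ → ℂ} (h : ∀ w, ψ (toPlane w) = α w.1 * β w.2)
    (z : ℝ × ℝ) : 𝓕⁻ ψ (toPlane z) = 𝓕⁻ α z.1 * 𝓕⁻ β z.2 := by
  rw [fourierInv_toPlane]
  simp_rw [h]
  rw [ift_tensor]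

/-! ### Inversion of integrable Fourier transforms -/

theorem fubini_ch (u : ℝ) {F G : ℝ → ℂ} (hF : Integrable F) (hG : Integrable G) :
    ∫ x, F x * ∫ ξ, ch (u * (x * ξ)) * G ξ = ∫ ξ, (∫ x, ch (u * (x * ξ)) * F x) * G ξ := by
  have hint : Integrable (Function.uncurry fun x ξ : ℝ ↦ ch (u * (x * ξ)) * (F x * G ξ))
      (volume.prod volume) :=
    integrable_ch_mul (u := fun p : ℝ × ℝ ↦ u * (p.1 * p.2)) (by fun_prop) (hF.mul_prod hG)
  calc ∫ x, F x * ∫ ξ, ch (u * (x * ξ)) * G ξ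
      = ∫ x, ∫ ξ, ch (u * (x * ξ)) * (F x * G ξ) := by
        refine integral_congr_ae (ae_of_all _ fun x ↦ ?_)
        dsimp only
        rw [← integral_const_mul]
        refine integral_congr_ae (ae_of_all _ fun ξ ↦ ?_)
        dsimp only
        ring
    _ = ∫ ξ, ∫ x, ch (u * (x * ξ)) * (F x * G ξ) := integral_integral_swap hint
    _ = _ := by
        refine integral_congr_ae (ae_of_all _ fun x ↦ ?_)
        dsimp only
        rw [← integral_mul_const]
        refine integral_congr_ae (ae_of_all _ fun ξ ↦ ?_)
        dsimp only
        ring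

theorem integral_mul_fourier {F G : ℝ → ℂ} (hF : Integrable F) (hG : Integrable G) :
    ∫ x, F x * 𝓕 G x = ∫ ξ, 𝓕 F ξ * G ξ := by
  have h := fubini_ch (-1) hF hG
  simp_rw [fourier_eq_ch]
  simp only [neg_mul, one_mul] at h
  rw [h]
  simp_rw [mul_comm]

theorem integral_mul_fourierInv {F G : ℝ → ℂ} (hF : Integrable F) (hG : Integrable G) :
    ∫ x, F x * 𝓕⁻ G x = ∫ ξ, 𝓕⁻ F ξ * G ξ := by
  have h := fubini_ch 1 hF hG
  simp_rw [fourierInv_eq_ch]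
  simp only [one_mul] at h
  rw [h]
  simp_rw [mul_comm]

theorem continuous_fourierInv {F : ℝ → ℂ} (hF : Integrable F) : Continuous (𝓕⁻ F) := by
  have e : 𝓕⁻ F = fun x ↦ ∫ ξ, ch (x * ξ) * F ξ := funext (fourierInv_eq_ch F)
  rw [e]
  refine continuous_of_dominated (bound := fun w ↦ ‖F w‖) (fun z ↦ ?_)
    (fun z ↦ ae_of_all _ fun w ↦ by simp [norm_ch]) hF.norm (ae_of_all _ fun w ↦ ?_)
  · exact (integrable_ch_mul (by fun_prop) hF).aestronglyMeasurable
  · have := continuous_ch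
    fun_prop

theorem continuous_fourier {F : ℝ → ℂ} (hF : Integrable F) : Continuous (𝓕 F) := by
  have e : 𝓕 F = fun x ↦ 𝓕⁻ F (-x) := funext fun x ↦ (fourierInv_neg F x).symm
  rw [e]
  exact (continuous_fourierInv hF).comp continuous_neg

/-- A test function as a Schwartz function. -/
def testFun {E : Type*} [NormedAddCommGroup E] [NormedSpace ℝ E] {b : E → ℝ}
    (hb : ContDiff ℝ ∞ b) (hc : HasCompactSupport b) : 𝓢(E, ℂ) :=
  (show HasCompactSupport fun z ↦ (b z : ℂ) from
    hc.comp_left Complex.ofReal_zero).toSchwartzMap (Complex.ofRealCLM.contDiff.comp hb)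

/-- The hypothesis says that the transform of `F` is `γ` almost everywhere. Inversion is again
carried out by duality, writing a test function as `𝓕 (𝓕⁻ φ)`, because `F` need not be continuous.
-/
theorem ae_eq_fourierInv_of_integral {F γ : ℝ → ℂ} (hF : Integrable F) (hγ : Integrable γ)
    (h : ∀ (b : ℝ → ℝ) (hb : ContDiff ℝ ∞ b) (hc : HasCompactSupport b),
      ∫ t, F t * (𝓕 (testFun hb hc) : 𝓢(ℝ, ℂ)) t = ∫ τ, γ τ * b τ) : ∀ᵐ t, F t = 𝓕⁻ γ t := by
  have h1 : ∀ᵐ τ, 𝓕 F τ = γ τ := by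
    refine ae_eq_of_integral_contDiff_smul_eq (continuous_fourier hF).locallyIntegrable
      hγ.locallyIntegrable fun b hb hc ↦ ?_
    have h2 := h b hb hc
    rw [SchwartzMap.fourier_coe, integral_mul_fourier hF (testFun hb hc).integrable] at h2
    simp_rw [Complex.real_smul, mul_comm (Complex.ofReal _)]
    exact h2
  refine ae_eq_of_integral_contDiff_smul_eq hF.locallyIntegrable
    (continuous_fourierInv hγ).locallyIntegrable fun b hb hc ↦ ?_
  set φ := testFun hb hc with hφ
  simp_rw [Complex.real_smul, mul_comm (Complex.ofReal _)]
  have e : (fun t ↦ F t * (b t : ℂ)) = fun t ↦ F t * (𝓕 (𝓕⁻ φ : 𝓢(ℝ, ℂ)) : 𝓢(ℝ, ℂ)) t := by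
    rw [FourierTransform.fourier_fourierInv_eq]
    rfl
  rw [e, SchwartzMap.fourier_coe, integral_mul_fourier hF (𝓕⁻ φ : 𝓢(ℝ, ℂ)).integrable]
  have e2 : ∫ ξ, 𝓕⁻ γ ξ * (b ξ : ℂ) = ∫ ξ, 𝓕⁻ γ ξ * φ ξ := rfl
  rw [e2, ← integral_mul_fourierInv hγ φ.integrable, ← SchwartzMap.fourierInv_coe]
  refine integral_congr_ae ?_
  filter_upwards [h1] with τ hτ
  rw [hτ]

/-! ### Local representation of functions with finite `F_k` norm -/

theorem two_rpow_two_mul (k : ℕ) : (2 : ℝ) ^ ((2 : ℝ) * k) = 4 ^ k := by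
  rw [Real.rpow_mul (by norm_num), Real.rpow_natCast]
  norm_num

/-- Countability permits interchanging "for every test function, for almost every time" with "for
almost every time, for every test function"; density then determines an `L²` function of `ξ`. -/
theorem exists_countable_test : ∃ S : Set L2, S.Countable ∧ Dense S ∧
    ∀ f ∈ S, ∃ g : ℝ → ℂ, f =ᵐ[volume] g ∧ HasCompactSupport g ∧ ContDiff ℝ ∞ g := by
  have : Fact ((2 : ℝ≥0∞) ≠ ⊤) := ⟨by norm_num⟩
  have hd := Lp.dense_hasCompactSupport_contDiff (E := ℝ) (F := ℂ)
    (μ := (volume : Measure ℝ)) (p := 2) (by norm_num)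
  obtain ⟨t, hts, htc, htd⟩ := hd.exists_countable_dense_subset
  exact ⟨t, htc, htd, fun f hf ↦ hts hf⟩

theorem integral_mul_fourier_L2 (h : L2) (φ : 𝓢(ℝ, ℂ)) :
    ∫ x, h x * (𝓕 φ : 𝓢(ℝ, ℂ)) x = ∫ ξ, (𝓕 h : L2) ξ * φ ξ := by
  have e := DFunLike.congr_fun (Lp.fourier_toTemperedDistribution_eq h) φ
  rw [TemperedDistribution.fourier_apply, Lp.toTemperedDistribution_apply,
    Lp.toTemperedDistribution_apply] at e
  simp_rw [smul_eq_mul] at e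
  simp_rw [mul_comm (h _), mul_comm ((𝓕 h : L2) _)]
  exact e

theorem symbol_hasTemperateGrowth {η : ℝ → ℝ} (hη : IsCutoff η) (k : ℕ) :
    (fun ξ : ℝ ↦ ((etaK η k (2 * Real.pi * ξ) : ℝ) : ℂ)).HasTemperateGrowth :=
  ofReal_hasTemperateGrowth.comp ((hη.etaK_hasTemperateGrowth k).comp
    ((Function.HasTemperateGrowth.const (2 * Real.pi)).mul Function.HasTemperateGrowth.id'))

theorem time_hasTemperateGrowth {η : ℝ → ℝ} (hη : IsCutoff η) (c t₀ : ℝ) :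
    (fun t : ℝ ↦ ((η (c * (t - t₀)) : ℝ) : ℂ)).HasTemperateGrowth :=
  ofReal_hasTemperateGrowth.comp (hη.comp_mul_hasTemperateGrowth c t₀)

/-- The pairing of the spatial Fourier transform of `U t`, cut off to the `k`-th band, with a
test function. -/
def pairing (η : ℝ → ℝ) (k : ℕ) (U : ℝ → L2) (a : 𝓢(ℝ, ℂ)) (t : ℝ) : ℂ :=
  ∫ ξ, (𝓕 (U t) : L2) ξ * ((etaK η k (2 * Real.pi * ξ) : ℂ) * a ξ)

theorem pairing_eq {η : ℝ → ℝ} (hη : IsCutoff η) (k : ℕ) (U : ℝ → L2) (a : 𝓢(ℝ, ℂ)) (t : ℝ) :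
    pairing η k U a t = ∫ x, U t x * (𝓕 (SchwartzMap.smulLeftCLM ℂ
      (fun ξ : ℝ ↦ ((etaK η k (2 * Real.pi * ξ) : ℝ) : ℂ)) a) : 𝓢(ℝ, ℂ)) x := by
  rw [integral_mul_fourier_L2]
  simp_rw [SchwartzMap.smulLeftCLM_apply_apply (symbol_hasTemperateGrowth hη k), smul_eq_mul]
  rfl

theorem integrable_time_pairing {η : ℝ → ℝ} (hη : IsCutoff η) (k : ℕ) {U : ℝ → L2}
    (hU : MemLp U ⊤ volume) (a : 𝓢(ℝ, ℂ)) {c : ℝ} (hc : 0 < c) (t₀ : ℝ) :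
    Integrable fun t ↦ (η (c * (t - t₀)) : ℂ) * pairing η k U a t := by
  set φ : 𝓢(ℝ, ℂ) := 𝓕 (SchwartzMap.smulLeftCLM ℂ
      (fun ξ : ℝ ↦ ((etaK η k (2 * Real.pi * ξ) : ℝ) : ℂ)) a) with hφ
  let L : L2 →L[ℂ] ℂ := (PointwiseConvergenceCLM.evalCLM (RingHom.id ℂ) ℂ φ) ∘L
    (Lp.toTemperedDistributionCLM ℂ (volume : Measure ℝ) 2)
  have hL : ∀ t, pairing η k U a t = L (U t) := fun t ↦ by
    have : L (U t) = (U t : 𝓢'(ℝ, ℂ)) φ := rfl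
    rw [pairing_eq hη, this, Lp.toTemperedDistribution_apply]
    refine integral_congr_ae (ae_of_all _ fun x ↦ ?_)
    dsimp only
    rw [smul_eq_mul, mul_comm]
  simp_rw [hL]
  have hm : AEStronglyMeasurable (fun t ↦ L (U t)) volume :=
    L.continuous.comp_aestronglyMeasurable hU.1
  have hη1 : Integrable fun t : ℝ ↦ (η (c * (t - t₀)) : ℂ) := by
    have h0 : Integrable fun t : ℝ ↦ hη.toSchwartz (c * t) :=
      hη.toSchwartz.integrable.comp_mul_left' hc.ne'
    exact h0.comp_sub_right t₀
  have hb : ∀ᵐ t, ‖L (U t)‖ ≤ ‖L‖ * (eLpNormEssSup U volume).toReal := by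
    have h1 := ae_le_eLpNormEssSup (f := U) (μ := volume)
    have h2 : eLpNormEssSup U volume < ⊤ := by simpa using hU.2
    filter_upwards [h1] with t ht
    refine (L.le_opNorm _).trans ?_
    gcongr
    rw [← toReal_enorm]
    exact ENNReal.toReal_mono h2.ne ht
  have := hη1.bdd_mul hm hb
  refine this.congr (ae_of_all _ fun t ↦ ?_)
  dsimp only
  rw [mul_comm]

/-- On a tensor product the projection, the time cutoff and the Fourier transform each act in
separate variables, and the pairing becomes a time integral of spatial pairings. -/
theorem localized_apply_tensor {η : ℝ → ℝ} (hη : IsCutoff η) {f : 𝓢'(Plane, ℂ)} {U : ℝ → L2}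
    (hU : Represents f U) (k : ℕ) (t₀ : ℝ) {ψ : 𝓢(Plane, ℂ)} {a b : 𝓢(ℝ, ℂ)}
    (h : ∀ w, ψ (toPlane w) = a w.1 * b w.2) :
    (𝓕 (timeLocalize η 2 k t₀ (projK η k f))) ψ =
      ∫ t, (η (4 ^ k * (t - t₀)) : ℂ) * pairing η k U a t * (𝓕 b : 𝓢(ℝ, ℂ)) t := by
  set μ : ℝ → ℂ := fun ξ ↦ ((etaK η k (2 * Real.pi * ξ) : ℝ) : ℂ) with hμ
  have hμt : μ.HasTemperateGrowth := symbol_hasTemperateGrowth hη k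
  set e : ℝ → ℂ := fun t ↦ ((η (4 ^ k * (t - t₀)) : ℝ) : ℂ) with he
  have het : e.HasTemperateGrowth := time_hasTemperateGrowth hη _ _
  set a' : 𝓢(ℝ, ℂ) := SchwartzMap.smulLeftCLM ℂ μ a with ha'
  set b' : 𝓢(ℝ, ℂ) := SchwartzMap.smulLeftCLM ℂ e (𝓕 b) with hb'
  have ha1 : ∀ ξ, a' ξ = μ ξ * a ξ := fun ξ ↦ by
    rw [ha', SchwartzMap.smulLeftCLM_apply_apply hμt, smul_eq_mul]
  have hb1 : ∀ t, b' t = e t * (𝓕 b : 𝓢(ℝ, ℂ)) t := fun t ↦ by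
    rw [hb', SchwartzMap.smulLeftCLM_apply_apply het, smul_eq_mul]
  rw [TemperedDistribution.fourier_apply, timeLocalize,
    TemperedDistribution.smulLeftCLM_apply_apply, projK,
    TemperedDistribution.fourierMultiplierCLM_apply_apply, hU.2]
  refine integral_congr_ae (ae_of_all _ fun t ↦ ?_)
  dsimp only
  have h1 : ∀ w, (𝓕 ψ : 𝓢(Plane, ℂ)) (toPlane w) =
      (𝓕 a : 𝓢(ℝ, ℂ)) w.1 * (𝓕 b : 𝓢(ℝ, ℂ)) w.2 := fun w ↦ by
    simp only [SchwartzMap.fourier_coe]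
    exact fourier_tensor h w
  set ψ₁ : 𝓢(Plane, ℂ) := SchwartzMap.smulLeftCLM ℂ
    (fun z : Plane ↦ ((η ((2 : ℝ) ^ ((2 : ℝ) * k) * (z 1 - t₀)) : ℝ) : ℂ)) (𝓕 ψ) with hψ₁
  have h2 : ∀ w, ψ₁ (toPlane w) = (𝓕 a : 𝓢(ℝ, ℂ)) w.1 * b' w.2 := fun w ↦ by
    rw [hψ₁, SchwartzMap.smulLeftCLM_apply_apply (timeLocalize_symbol_hasTemperateGrowth hη _ _),
      smul_eq_mul, h1, hb1, he, two_rpow_two_mul]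
    simp only [toPlane, Matrix.cons_val_one, Matrix.cons_val_fin_one, PiLp.toLp_apply]
    ring
  have h3 : ∀ w, (𝓕⁻ ψ₁ : 𝓢(Plane, ℂ)) (toPlane w) = a w.1 * (𝓕⁻ b' : 𝓢(ℝ, ℂ)) w.2 := fun w ↦ by
    have := fourierInv_tensor h2 w
    rw [← SchwartzMap.fourierInv_coe, ← SchwartzMap.fourierInv_coe, ← SchwartzMap.fourierInv_coe,
      FourierTransform.fourierInv_fourier_eq] at this
    exact this
  set ψ₂ : 𝓢(Plane, ℂ) := SchwartzMap.smulLeftCLM ℂ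
    (fun ζ : Plane ↦ ((etaK η k (2 * Real.pi * ζ 0) : ℝ) : ℂ)) (𝓕⁻ ψ₁) with hψ₂
  have h4 : ∀ w, ψ₂ (toPlane w) = a' w.1 * (𝓕⁻ b' : 𝓢(ℝ, ℂ)) w.2 := fun w ↦ by
    rw [hψ₂, SchwartzMap.smulLeftCLM_apply_apply (projK_symbol_hasTemperateGrowth hη k),
      smul_eq_mul, h3, ha1, hμ]
    simp only [toPlane, Matrix.cons_val_zero, PiLp.toLp_apply]
    ring
  have h5 : ∀ w, (𝓕 ψ₂ : 𝓢(Plane, ℂ)) (toPlane w) = (𝓕 a' : 𝓢(ℝ, ℂ)) w.1 * b' w.2 := fun w ↦ by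
    have := fourier_tensor h4 w
    rw [← SchwartzMap.fourier_coe, ← SchwartzMap.fourier_coe, ← SchwartzMap.fourier_coe,
      FourierTransform.fourier_fourierInv_eq] at this
    exact this
  have h6 : ∀ x : ℝ, (𝓕 ψ₂ : 𝓢(Plane, ℂ)) !₂[x, t] = (𝓕 a' : 𝓢(ℝ, ℂ)) x * b' t :=
    fun x ↦ h5 (x, t)
  simp_rw [h6]
  rw [pairing_eq hη, hb1, ← hμ, ← ha', mul_right_comm, ← integral_const_mul]
  refine integral_congr_ae (ae_of_all _ fun x ↦ ?_)
  dsimp only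
  ring

theorem enorm_slice_le (g : ℝ × ℝ → ℂ) (t ξ : ℝ) : ‖slice g t ξ‖ₑ ≤ ∫⁻ τ, ‖g (ξ, τ)‖ₑ := by
  refine (enorm_integral_le_lintegral_enorm _).trans (le_of_eq ?_)
  simp_rw [enorm_ch_mul]

theorem measurable_slice {g : ℝ × ℝ → ℂ} (hg : Measurable g) (t : ℝ) : Measurable (slice g t) := by
  have hc := continuous_ch.measurable
  have h : Measurable fun p : ℝ × ℝ ↦ ch (t * p.2) * g (p.1, p.2) := by fun_prop
  exact h.stronglyMeasurable.integral_prod_right'.measurable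

theorem integrable_mul_of_n21 {g : ℝ × ℝ → ℂ} (hg : Measurable g)
    (hn : n21 (fun w ↦ ‖g w‖ₑ) < ⊤) (a : 𝓢(ℝ, ℂ)) : Integrable fun w : ℝ × ℝ ↦ g w * a w.1 := by
  have ha : Measurable a := a.continuous.measurable
  refine integrable_of_lintegral (by fun_prop) ?_
  rw [Measure.volume_eq_prod, lintegral_prod _ (by fun_prop)]
  have e : ∀ ξ, ∫⁻ τ, ‖g (ξ, τ) * a ξ‖ₑ = (∫⁻ τ, ‖g (ξ, τ)‖ₑ) * ‖a ξ‖ₑ := fun ξ ↦ by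
    simp_rw [enorm_mul]
    exact lintegral_mul_const _ (by fun_prop)
  simp_rw [e]
  have hm : Measurable fun ξ ↦ ∫⁻ τ, ‖g (ξ, τ)‖ₑ := hg.enorm.lintegral_prod_right'
  refine (lintegral_mul_le_n2 hm.aemeasurable ha.enorm.aemeasurable).trans_lt ?_
  refine ENNReal.mul_lt_top hn ?_
  rw [← eLpNorm_two_eq_n2]
  exact (a.memLp 2 volume).2

theorem eq_zero_of_integral_test {S : Set L2} (hS : Dense S) {v : ℝ → ℂ}
    (hv : MemLp v 2 volume) {r : L2 → ℝ → ℂ} (hr : ∀ f ∈ S, f =ᵐ[volume] r f)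
    (h : ∀ f ∈ S, ∫ ξ, (starRingEnd ℂ) (r f ξ) * v ξ = 0) : v =ᵐ[volume] 0 := by
  have h0 : hv.toLp v = 0 := by
    refine hS.eq_zero_of_inner_right ℂ fun f hf ↦ ?_
    rw [L2.inner_def, ← h f hf]
    refine integral_congr_ae ?_
    filter_upwards [hr f hf, hv.coeFn_toLp] with ξ h1 h2
    rw [h1, h2, RCLike.inner_apply, mul_comm]
  have := hv.coeFn_toLp
  rw [h0] at this
  exact this.symm.trans (Lp.coeFn_zero _ _ _)

theorem hasCompactSupport_tensor {α β : ℝ → ℂ} (hα : HasCompactSupport α)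
    (hβ : HasCompactSupport β) : HasCompactSupport fun z : Plane ↦ α (z 0) * β (z 1) := by
  refine HasCompactSupport.of_support_subset_isCompact
    ((hα.isCompact.prod hβ.isCompact).image continuous_toPlane) fun z hz ↦ ?_
  exact ⟨ofPlane z, ⟨subset_tsupport _ (left_ne_zero_of_mul hz),
    subset_tsupport _ (right_ne_zero_of_mul hz)⟩, toPlane_ofPlane z⟩

theorem contDiff_coord (i : Fin 2) : ContDiff ℝ ∞ fun z : Plane ↦ z i :=
  (EuclideanSpace.proj (𝕜 := ℝ) i : Plane →L[ℝ] ℝ).contDiff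

theorem memLp_of_n2_lt_top {v : ℝ → ℂ} (hv : Measurable v) (h : n2 (fun x ↦ ‖v x‖ₑ) < ⊤) :
    MemLp v 2 volume :=
  ⟨hv.aestronglyMeasurable, by rwa [eLpNorm_two_eq_n2]⟩

theorem slice_pairing {g : ℝ × ℝ → ℂ} (hg : Measurable g) (hn : n21 (fun w ↦ ‖g w‖ₑ) < ⊤)
    (a : 𝓢(ℝ, ℂ)) (t : ℝ) :
    𝓕⁻ (fun τ ↦ ∫ ξ, g (ξ, τ) * a ξ) t = ∫ ξ, a ξ * slice g t ξ := by
  have hi := integrable_mul_of_n21 hg hn a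
  have hj := integrable_ch_mul (u := fun w : ℝ × ℝ ↦ t * w.2) (by fun_prop) hi
  rw [Measure.volume_eq_prod] at hj
  rw [fourierInv_eq_ch]
  calc ∫ τ, ch (t * τ) * ∫ ξ, g (ξ, τ) * a ξ
      = ∫ τ, ∫ ξ, ch (t * τ) * (g (ξ, τ) * a ξ) := by
        refine integral_congr_ae (ae_of_all _ fun τ ↦ ?_)
        exact (integral_const_mul _ _).symm
    _ = ∫ ξ, ∫ τ, ch (t * τ) * (g (ξ, τ) * a ξ) := (integral_integral_swap hj).symm
    _ = ∫ ξ, a ξ * slice g t ξ := by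
        refine integral_congr_ae (ae_of_all _ fun ξ ↦ ?_)
        unfold slice
        dsimp only
        rw [← integral_const_mul]
        refine integral_congr_ae (ae_of_all _ fun τ ↦ ?_)
        dsimp only
        ring

theorem IsCutoff.memLp_band {η : ℝ → ℝ} (hη : IsCutoff η) (k : ℕ) (c : ℂ) (h : L2) :
    MemLp (fun ξ ↦ c * ((etaK η k (2 * Real.pi * ξ) : ℂ) * h ξ)) 2 volume := by
  have hc := hη.continuous_etaK k
  refine MemLp.const_mul ?_ c
  refine (Lp.memLp h).of_le (AEStronglyMeasurable.mul ?_ (Lp.aestronglyMeasurable h))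
    (ae_of_all _ fun ξ ↦ ?_)
  · exact (Continuous.aestronglyMeasurable (by fun_prop))
  · rw [norm_mul, Complex.norm_real, Real.norm_eq_abs, abs_of_nonneg (hη.etaK_nonneg _ _)]
    exact mul_le_of_le_one_left (norm_nonneg _) (hη.etaK_le_one _ _)

theorem integral_mul_sub {a v w : ℝ → ℂ} (ha : MemLp a 2 volume) (hv : MemLp v 2 volume)
    (hw : MemLp w 2 volume) :
    ∫ ξ, a ξ * (v ξ - w ξ) = (∫ ξ, a ξ * v ξ) - ∫ ξ, a ξ * w ξ := by
  have h := integral_sub (ha.integrable_mul hv) (ha.integrable_mul hw)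
  refine Eq.trans ?_ h
  refine integral_congr_ae (ae_of_all _ fun ξ ↦ ?_)
  exact mul_sub _ _ _

theorem integral_tensor {g : ℝ × ℝ → ℂ} {a : 𝓢(ℝ, ℂ)}
    (h : Integrable (fun w : ℝ × ℝ ↦ g w * a w.1) (volume.prod volume)) (b : 𝓢(ℝ, ℂ)) :
    ∫ τ, (∫ ξ, g (ξ, τ) * a ξ) * b τ = ∫ w : ℝ × ℝ, g w * (a w.1 * b w.2) := by
  have hj : Integrable (fun w : ℝ × ℝ ↦ b w.2 * (g w * a w.1)) (volume.prod volume) :=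
    h.bdd_mul (b.continuous.comp continuous_snd).aestronglyMeasurable
      (ae_of_all _ fun w ↦ SchwartzMap.norm_le_seminorm ℝ b _)
  calc ∫ τ, (∫ ξ, g (ξ, τ) * a ξ) * b τ = ∫ τ, ∫ ξ, b τ * (g (ξ, τ) * a ξ) := by
        refine integral_congr_ae (ae_of_all _ fun τ ↦ ?_)
        dsimp only
        rw [mul_comm, ← integral_const_mul]
    _ = ∫ w : ℝ × ℝ, b w.2 * (g w * a w.1) := by
        rw [Measure.volume_eq_prod, integral_prod_symm _ hj]
    _ = _ := by
        refine integral_congr_ae (ae_of_all _ fun w ↦ ?_)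
        dsimp only
        ring

/-- The function `g` is the one obtained from the finite `X` norm of the localized transform.
Testing with `a ⊗ b` and inverting in `τ` gives, for each `a`, equality of the pairings with `a` at
almost every time. A countable dense family of such `a` makes the exceptional set independent of
`a`. At the end `g` is restricted to the `ξ`-support of `η_k`, which is harmless since the other
side vanishes off it. -/
theorem IsCutoff.exists_slice_eq {η : ℝ → ℝ} (hη : IsCutoff η) {f : 𝓢'(Plane, ℂ)} {U : ℝ → L2}
    (hU : Represents f U) (k : ℕ) (hf : fkNorm η 2 k (projK η k f) < ⊤) (t₀ : ℝ) :
    ∃ g : ℝ × ℝ → ℂ, Measurable g ∧ (∀ z, g z ≠ 0 → etaK η k (2 * Real.pi * z.1) ≠ 0) ∧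
      xn η (fun w ↦ ‖g w‖ₑ) ≤ fkNorm η 2 k (projK η k f) ∧
      ∀ᵐ t : ℝ, ∀ᵐ ξ : ℝ, (η (4 ^ k * (t - t₀)) : ℂ) *
        ((etaK η k (2 * Real.pi * ξ) : ℂ) * (𝓕 (U t) : L2) ξ) = slice g t ξ := by
  have hle : xNorm η (𝓕 (timeLocalize η 2 k t₀ (projK η k f))) ≤ fkNorm η 2 k (projK η k f) :=
    le_iSup (fun t₀ ↦ xNorm η (𝓕 (timeLocalize η 2 k t₀ (projK η k f)))) t₀
  obtain ⟨g, hgm, -, hgx, hgψ⟩ := exists_fun_of_xNorm_lt_top hη (hle.trans_lt hf)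
  have hgx' := hgx.trans hle
  have hn : n21 (fun w ↦ ‖g w‖ₑ) < ⊤ := (hη.n21_le_xn hgm.enorm).trans_lt (hgx'.trans_lt hf)
  obtain ⟨S, hSc, hSd, hS⟩ := exists_countable_test
  have hv1 : ∀ t, MemLp (fun ξ ↦ (η (4 ^ k * (t - t₀)) : ℂ) *
      ((etaK η k (2 * Real.pi * ξ) : ℂ) * (𝓕 (U t) : L2) ξ)) 2 volume := fun t ↦
    hη.memLp_band k _ _
  have hv2 : ∀ t, MemLp (slice g t) 2 volume := fun t ↦
    memLp_of_n2_lt_top (measurable_slice hgm t) ((n2_mono (enorm_slice_le g t)).trans_lt hn)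
  have key : ∀ a : 𝓢(ℝ, ℂ), HasCompactSupport a → ∀ᵐ t : ℝ, ∫ ξ, a ξ *
      ((η (4 ^ k * (t - t₀)) : ℂ) * ((etaK η k (2 * Real.pi * ξ) : ℂ) * (𝓕 (U t) : L2) ξ) -
        slice g t ξ) = 0 := by
    intro a ha
    have hi := integrable_mul_of_n21 hgm hn a
    have hi' := hi
    rw [Measure.volume_eq_prod] at hi'
    have h1 := ae_eq_fourierInv_of_integral
      (integrable_time_pairing hη k hU.1 a (show (0 : ℝ) < 4 ^ k by positivity) t₀)
      hi'.integral_prod_right fun b hb hc ↦ ?_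
    · filter_upwards [h1] with t ht
      rw [slice_pairing hgm hn] at ht
      have ha2 : MemLp a 2 volume := a.memLp 2 volume
      rw [integral_mul_sub ha2 (hv1 t) (hv2 t), sub_eq_zero, ← ht, pairing, ← integral_const_mul]
      refine integral_congr_ae (ae_of_all _ fun ξ ↦ ?_)
      dsimp only
      ring
    · have hcs := hasCompactSupport_tensor ha (β := fun τ ↦ (b τ : ℂ))
        (hc.comp_left Complex.ofReal_zero)
      have hcd : ContDiff ℝ ∞ fun z : Plane ↦ a (z 0) * (b (z 1) : ℂ) :=
        ((a.smooth ⊤).comp (contDiff_coord 0)).mul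
          (Complex.ofRealCLM.contDiff.comp (hb.comp (contDiff_coord 1)))
      obtain ⟨ψ, hψ⟩ : ∃ ψ : 𝓢(Plane, ℂ), ∀ z : Plane, ψ z = a (z 0) * (b (z 1) : ℂ) :=
        ⟨hcs.toSchwartzMap hcd, fun z ↦ rfl⟩
      have hψc : HasCompactSupport ψ := by
        have : (ψ : Plane → ℂ) = fun z ↦ a (z 0) * (b (z 1) : ℂ) := funext hψ
        rw [this]
        exact hcs
      have hten : ∀ w, ψ (toPlane w) = a w.1 * testFun hb hc w.2 := fun w ↦ hψ _
      rw [← localized_apply_tensor hη hU k t₀ hten, hgψ _ hψc]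
      simp_rw [hten]
      exact (integral_tensor hi' (testFun hb hc)).symm
  choose! r hr hrc hrd using hS
  have hall : ∀ᵐ t : ℝ, ∀ h ∈ S, ∫ ξ, (starRingEnd ℂ) (r h ξ) *
      ((η (4 ^ k * (t - t₀)) : ℂ) * ((etaK η k (2 * Real.pi * ξ) : ℂ) * (𝓕 (U t) : L2) ξ) -
        slice g t ξ) = 0 := by
    rw [ae_ball_iff hSc]
    intro h hh
    have hc : HasCompactSupport fun ξ ↦ (starRingEnd ℂ) (r h ξ) :=
      (hrc h hh).comp_left (map_zero _)
    have hd : ContDiff ℝ ∞ fun ξ ↦ (starRingEnd ℂ) (r h ξ) :=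
      Complex.conjCLE.contDiff.comp (hrd h hh)
    exact key (hc.toSchwartzMap hd) hc
  have hpos : MeasurableSet {z : ℝ × ℝ | etaK η k (2 * Real.pi * z.1) ≠ 0} := by
    have := (hη.continuous_etaK k).measurable
    exact (measurableSet_eq_fun (f := fun z : ℝ × ℝ ↦ etaK η k (2 * Real.pi * z.1))
      (g := fun _ ↦ 0) (by fun_prop) measurable_const).compl
  refine ⟨{z : ℝ × ℝ | etaK η k (2 * Real.pi * z.1) ≠ 0}.indicator g, hgm.indicator hpos,
    fun z hz ↦ Set.mem_of_indicator_ne_zero hz, (xn_mono η fun z ↦ ?_).trans hgx', ?_⟩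
  · rw [enorm_indicator_eq_indicator_enorm]
    exact Set.indicator_le_self' (fun _ _ ↦ zero_le) z
  · filter_upwards [hall] with t ht
    have h0 := eq_zero_of_integral_test hSd ((hv1 t).sub (hv2 t)) hr ht
    filter_upwards [h0] with ξ hξ
    simp only [Pi.sub_apply, Pi.zero_apply, sub_eq_zero] at hξ
    by_cases hm : etaK η k (2 * Real.pi * ξ) = 0
    · simp [slice, hm]
    · have : ∀ τ, {z : ℝ × ℝ | etaK η k (2 * Real.pi * z.1) ≠ 0}.indicator g (ξ, τ) = g (ξ, τ) :=
        fun τ ↦ Set.indicator_of_mem (show etaK η k (2 * Real.pi * ξ) ≠ 0 from hm) _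
      rw [hξ]
      simp_rw [slice, this]

/-- The `a`-th derivative of `P_k h`. -/
def pk (η : ℝ → ℝ) (a k : ℕ) (h : L2) (y : ℝ) : ℂ :=
  𝓕⁻ (fun ξ : ℝ ↦ (2 * Real.pi * Complex.I * ξ : ℂ) ^ a *
    ((etaK η k (2 * Real.pi * ξ) : ℂ) * (𝓕 h : L2) ξ)) y

theorem slice_mulX (a : ℕ) (g : ℝ × ℝ → ℂ) (t ξ : ℝ) :
    slice (mulX a g) t ξ = (2 * Real.pi * Complex.I * ξ : ℂ) ^ a * slice g t ξ := by
  unfold slice mulX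
  rw [← integral_const_mul]
  refine integral_congr_ae (ae_of_all _ fun τ ↦ ?_)
  dsimp only
  ring

theorem IsCutoff.locRep {η : ℝ → ℝ} (hη : IsCutoff η) {f : 𝓢'(Plane, ℂ)} {U : ℝ → L2}
    (hU : Represents f U) (k : ℕ) (hf : fkNorm η 2 k (projK η k f) < ⊤) {a : ℕ} (ha : a ≤ 3) :
    LocRep η k a (fkNorm η 2 k (projK η k f)) fun t ↦ pk η a k (U t) := by
  intro t₀
  obtain ⟨g, hgm, hgs, hgx, hg⟩ := hη.exists_slice_eq hU k hf t₀
  have hgb : ∀ z, g z ≠ 0 → z.1 ∈ band k := fun z hz ↦ hη.mem_band (hgs z hz)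
  refine ⟨g, hgm, hgb, hgx, ?_⟩
  have hi : Integrable (mulX a g) :=
    (hη.controlled_mulX le_rfl (by norm_num) ha hgm hgb hgx).integrable
      (ENNReal.mul_lt_top (ENNReal.mul_lt_top (by simp) (e2_ne_top _).lt_top) hf)
  filter_upwards [hg] with t ht y
  rw [ift_eq_fourierInv_slice hi, pk, fourierInv_eq_ch, fourierInv_eq_ch, ← integral_const_mul]
  refine integral_congr_ae ?_
  filter_upwards [ht] with ξ hξ
  rw [slice_mulX, ← hξ]
  ring

/-! ### Distributions with an integrable Fourier transform -/

theorem ift_mul_duality {G : ℝ × ℝ → ℂ} (hG : Integrable G) (φ : 𝓢(Plane, ℂ)) :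
    ∫ z, ift G z * φ (toPlane z) = ∫ w, G w * (𝓕⁻ φ : 𝓢(Plane, ℂ)) (toPlane w) := by
  have hφ : Integrable fun z : ℝ × ℝ ↦ φ (toPlane z) :=
    measurePreserving_toPlane.integrable_comp_of_integrable φ.integrable
  have hint : Integrable (Function.uncurry fun z w : ℝ × ℝ ↦
      ch (z.1 * w.1 + z.2 * w.2) * (φ (toPlane z) * G w)) (volume.prod volume) :=
    integrable_ch_mul (u := fun p : (ℝ × ℝ) × (ℝ × ℝ) ↦ p.1.1 * p.2.1 + p.1.2 * p.2.2)
      (by fun_prop) (hφ.mul_prod hG)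
  calc ∫ z, ift G z * φ (toPlane z)
      = ∫ z : ℝ × ℝ, ∫ w : ℝ × ℝ, ch (z.1 * w.1 + z.2 * w.2) * (φ (toPlane z) * G w) := by
        refine integral_congr_ae (ae_of_all _ fun z ↦ ?_)
        dsimp only
        rw [ift, ← integral_mul_const]
        refine integral_congr_ae (ae_of_all _ fun w ↦ ?_)
        dsimp only
        ring
    _ = ∫ w : ℝ × ℝ, ∫ z : ℝ × ℝ, ch (z.1 * w.1 + z.2 * w.2) * (φ (toPlane z) * G w) :=
        integral_integral_swap hint
    _ = _ := by
        refine integral_congr_ae (ae_of_all _ fun w ↦ ?_)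
        dsimp only
        rw [SchwartzMap.fourierInv_coe, fourierInv_toPlane, ift, ← integral_const_mul]
        refine integral_congr_ae (ae_of_all _ fun z ↦ ?_)
        dsimp only
        rw [mul_comm z.1, mul_comm z.2]
        ring

/-- The distribution given by the inverse Fourier transform of an integrable function. -/
def iftDist {G : ℝ × ℝ → ℂ} (hG : Integrable G) : 𝓢'(Plane, ℂ) := 𝓕⁻ (distOf hG)

theorem iftDist_apply {G : ℝ × ℝ → ℂ} (hG : Integrable G) (φ : 𝓢(Plane, ℂ)) :
    iftDist hG φ = ∫ w, G w * (𝓕⁻ φ : 𝓢(Plane, ℂ)) (toPlane w) := by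
  rw [iftDist, TemperedDistribution.fourierInv_apply, distOf_apply]

theorem iftDist_apply' {G : ℝ × ℝ → ℂ} (hG : Integrable G) (φ : 𝓢(Plane, ℂ)) :
    iftDist hG φ = ∫ z, ift G z * φ (toPlane z) := by
  rw [iftDist_apply, ift_mul_duality hG]

theorem ae_eq_of_ift_eq {F G : ℝ × ℝ → ℂ} (hF : Integrable F) (hG : Integrable G)
    (h : ∀ᵐ t : ℝ, ∀ x : ℝ, ift F (x, t) = ift G (x, t)) : F =ᵐ[volume] G := by
  have hloc : ∀ {H : ℝ × ℝ → ℂ}, Integrable H → LocallyIntegrable fun z ↦ H (ofPlane z) :=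
    fun hH ↦ (measurePreserving_ofPlane.integrable_comp_of_integrable hH).locallyIntegrable
  have hz : ∀ᵐ z : ℝ × ℝ, ift F z = ift G z := by
    have h2 : ∀ᵐ z : ℝ × ℝ ∂(volume.prod volume), ∀ x : ℝ, ift F (x, z.2) = ift G (x, z.2) :=
      Measure.quasiMeasurePreserving_snd.ae h
    rw [← Measure.volume_eq_prod] at h2
    filter_upwards [h2] with z hz
    exact hz z.1
  refine ae_eq_of_integral_schwartz_eq (hloc hF) (hloc hG) fun ψ _ ↦ ?_
  have e : ∀ {H : ℝ × ℝ → ℂ}, Integrable H → ∫ w, H w * ψ (toPlane w) =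
      ∫ z, ift H z * (𝓕 ψ : 𝓢(Plane, ℂ)) (toPlane z) := fun hH ↦ by
    rw [ift_mul_duality hH, FourierTransform.fourierInv_fourier_eq]
  rw [e hF, e hG]
  refine integral_congr_ae ?_
  filter_upwards [hz] with z hz
  rw [hz]

/-- Multiplication by the symbol of `P_k`. -/
def bandMul (η : ℝ → ℝ) (k : ℕ) (G : ℝ × ℝ → ℂ) (w : ℝ × ℝ) : ℂ :=
  (etaK η k (2 * Real.pi * w.1) : ℂ) * G w

theorem IsCutoff.measurable_bandMul {η : ℝ → ℝ} (hη : IsCutoff η) (k : ℕ) {G : ℝ × ℝ → ℂ}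
    (hG : Measurable G) : Measurable (bandMul η k G) := by
  have := (hη.continuous_etaK k).measurable
  unfold bandMul
  fun_prop

theorem IsCutoff.enorm_bandMul_le {η : ℝ → ℝ} (hη : IsCutoff η) (k : ℕ) (G : ℝ × ℝ → ℂ)
    (w : ℝ × ℝ) : ‖bandMul η k G w‖ₑ ≤ ‖G w‖ₑ := by
  rw [bandMul, enorm_mul, enorm_ofReal_of_nonneg (hη.etaK_nonneg _ _)]
  exact mul_le_of_le_one_left' (hη.ofReal_etaK_le_one _ _)

theorem IsCutoff.integrable_bandMul {η : ℝ → ℝ} (hη : IsCutoff η) (k : ℕ) {G : ℝ × ℝ → ℂ}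
    (hGm : Measurable G) (hG : Integrable G) : Integrable (bandMul η k G) :=
  integrable_of_lintegral (hη.measurable_bandMul k hGm)
    ((lintegral_mono (hη.enorm_bandMul_le k G)).trans_lt hG.2)

theorem bump_bandMul (η : ℝ → ℝ) (k : ℕ) (φ : 𝓢(ℝ, ℂ)) (c t₁ : ℝ) (G : ℝ × ℝ → ℂ) :
    bump φ c t₁ (bandMul η k G) = bandMul η k (bump φ c t₁ G) := by
  funext z
  simp only [bump, ctconv, bandMul]
  rw [← integral_const_mul]
  refine integral_congr_ae (ae_of_all _ fun s ↦ ?_)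
  dsimp only
  ring

/-- `G'` is required to match the localized function only in physical space. Injectivity of the
inverse transform identifies it with the time-convolved `G`, and the multiplier in `ξ` commutes with
convolution in `τ`. The estimates can thus be made on any convenient representative, chosen anew for
each `t₀`. -/
theorem IsCutoff.isFun_localized {η : ℝ → ℝ} (hη : IsCutoff η) (k : ℕ) (t₀ : ℝ) {G G' : ℝ × ℝ → ℂ}
    (hGm : Measurable G) (hG : Integrable G) (hG' : Integrable G')
    (h : ∀ᵐ t : ℝ, ∀ x : ℝ, (η (4 ^ k * (t - t₀)) : ℂ) * ift G (x, t) = ift G' (x, t)) :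
    IsFun (𝓕 (timeLocalize η 2 k t₀ (projK η k (iftDist hG)))) (bandMul η k G') := by
  have h4 : (0 : ℝ) < 4 ^ k := by positivity
  have hae : bump hη.toSchwartz (4 ^ k) t₀ G =ᵐ[volume] G' := by
    refine ae_eq_of_ift_eq (integrable_bump _ h4 _ hGm hG) hG' ?_
    filter_upwards [h] with t ht x
    rw [ift_bump _ h4 _ hGm hG, hη.toSchwartz_apply, ht]
  have hbm := hη.measurable_bandMul k hGm
  have hbi := hη.integrable_bandMul k hGm hG
  intro ψ
  rw [TemperedDistribution.fourier_apply, timeLocalize,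
    TemperedDistribution.smulLeftCLM_apply_apply, projK,
    TemperedDistribution.fourierMultiplierCLM_apply_apply, iftDist_apply,
    FourierTransform.fourierInv_fourier_eq]
  set ψ₁ : 𝓢(Plane, ℂ) := SchwartzMap.smulLeftCLM ℂ
    (fun z : Plane ↦ ((η ((2 : ℝ) ^ ((2 : ℝ) * k) * (z 1 - t₀)) : ℝ) : ℂ)) (𝓕 ψ) with hψ₁
  calc _ = ∫ w, bandMul η k G w * (𝓕⁻ ψ₁ : 𝓢(Plane, ℂ)) (toPlane w) := by
        refine integral_congr_ae (ae_of_all _ fun w ↦ ?_)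
        dsimp only
        rw [SchwartzMap.smulLeftCLM_apply_apply (projK_symbol_hasTemperateGrowth hη k), smul_eq_mul,
          bandMul]
        simp only [toPlane, Matrix.cons_val_zero, PiLp.toLp_apply]
        ring
    _ = ∫ z, ift (bandMul η k G) z * ψ₁ (toPlane z) := (ift_mul_duality hbi _).symm
    _ = ∫ z, ift (bump hη.toSchwartz (4 ^ k) t₀ (bandMul η k G)) z *
          (𝓕 ψ : 𝓢(Plane, ℂ)) (toPlane z) := by
        refine integral_congr_ae (ae_of_all _ fun z ↦ ?_)
        dsimp only
        rw [show z = (z.1, z.2) from rfl, ift_bump _ h4 _ hbm hbi, hψ₁,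
          SchwartzMap.smulLeftCLM_apply_apply (timeLocalize_symbol_hasTemperateGrowth hη _ _),
          smul_eq_mul, two_rpow_two_mul, hη.toSchwartz_apply]
        simp only [toPlane, Matrix.cons_val_one, Matrix.cons_val_fin_one, PiLp.toLp_apply]
        ring
    _ = ∫ w, bump hη.toSchwartz (4 ^ k) t₀ (bandMul η k G) w * ψ (toPlane w) := by
        rw [ift_mul_duality (integrable_bump _ h4 _ hbm hbi),
          FourierTransform.fourierInv_fourier_eq]
    _ = _ := by
        rw [bump_bandMul]
        refine integral_congr_ae ?_
        filter_upwards [hae] with w hw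
        rw [bandMul, hw, bandMul]

/-- The resolvent weight in the `N_k` norm. -/
def res (k : ℕ) (w : ℝ × ℝ) : ℂ := ((mu w : ℂ) + Complex.I * ((4 ^ k : ℝ) : ℂ))⁻¹

theorem measurable_res (k : ℕ) : Measurable (res k) := by
  have := continuous_mu.measurable
  unfold res
  fun_prop

theorem norm_res_inv (k : ℕ) (w : ℝ × ℝ) :
    |mu w| ≤ ‖(mu w : ℂ) + Complex.I * ((4 ^ k : ℝ) : ℂ)‖ ∧
    (4 : ℝ) ^ k ≤ ‖(mu w : ℂ) + Complex.I * ((4 ^ k : ℝ) : ℂ)‖ := by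
  have hre := Complex.abs_re_le_norm ((mu w : ℂ) + Complex.I * ((4 ^ k : ℝ) : ℂ))
  have him := Complex.abs_im_le_norm ((mu w : ℂ) + Complex.I * ((4 ^ k : ℝ) : ℂ))
  simp only [Complex.add_re, Complex.ofReal_re, Complex.mul_re, Complex.I_re, Complex.I_im,
    Complex.ofReal_im, Complex.add_im, Complex.mul_im, zero_mul, one_mul, zero_add, sub_zero,
    mul_zero, add_zero] at hre him
  exact ⟨hre, (le_abs_self _).trans him⟩

theorem enorm_res_le (k : ℕ) (w : ℝ × ℝ) : ‖res k w‖ₑ ≤ e2 (-(2 * k)) := by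
  rw [← ofReal_norm, res, norm_inv, ← ofReal_rpow_two]
  refine ENNReal.ofReal_le_ofReal ?_
  rw [Real.rpow_neg (by norm_num), ← two_rpow_two_mul]
  refine inv_anti₀ (by positivity) ?_
  rw [two_rpow_two_mul]
  exact (norm_res_inv k w).2

theorem IsCutoff.eta_mul_res_le {η : ℝ → ℝ} (hη : IsCutoff η) (j k : ℕ) (w : ℝ × ℝ) :
    ENNReal.ofReal (etaK η j (mu w)) * ‖res k w‖ₑ ≤
      2 * e2 (-j) * ENNReal.ofReal (etaK η j (mu w)) := by
  by_cases h : etaK η j (mu w) = 0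
  · simp [h]
  rw [mul_comm]
  gcongr
  have h2 : (2 : ℝ≥0∞) = ENNReal.ofReal 2 := by simp
  rw [← ofReal_norm, res, norm_inv, ← ofReal_rpow_two, h2, ← ENNReal.ofReal_mul (by norm_num)]
  refine ENNReal.ofReal_le_ofReal ?_
  rw [Real.rpow_neg (by norm_num), Real.rpow_natCast]
  have hn := norm_res_inv k w
  have hk : (1 : ℝ) ≤ 4 ^ k := one_le_pow₀ (by norm_num)
  rcases Nat.eq_zero_or_pos j with rfl | hj
  · rw [pow_zero]
    have := inv_le_one_of_one_le₀ (hk.trans hn.2)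
    linarith
  · have hl := hη.etaK_lower hj h
    rw [← div_eq_mul_inv, le_div_iff₀ (by positivity), inv_mul_le_iff₀ (by linarith [hn.2])]
    linarith [hn.1, show (0 : ℝ) < 2 ^ j by positivity]

theorem IsFun.xNorm_res_le {η : ℝ → ℝ} (hη : IsCutoff η) {f : 𝓢'(Plane, ℂ)} {F : ℝ × ℝ → ℂ}
    (h : IsFun f F) (hF : Measurable F) (k : ℕ) :
    xNorm η (TemperedDistribution.smulLeftCLM ℂ
      (fun ζ : Plane ↦ ((modulation ζ : ℂ) + Complex.I * (((2 : ℝ) ^ ((2 : ℝ) * k) : ℝ) : ℂ))⁻¹) f)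
      ≤ ∑' j : ℕ, e2 (j / 2) *
        n2 fun w ↦ ENNReal.ofReal (etaK η j (mu w)) * ‖res k w‖ₑ * ‖F w‖ₑ := by
  have h1 := h.smulLeft (resolvent_symbol_hasTemperateGrowth
    (show (0 : ℝ) < (2 : ℝ) ^ ((2 : ℝ) * k) by positivity))
  refine ENNReal.tsum_le_tsum fun j ↦ ?_
  refine mul_le_mul_right ?_ _
  have h2 := h1.smulLeft (xNorm_symbol_hasTemperateGrowth hη j)
  have e : (fun w ↦ ((etaK η j (modulation (toPlane w)) : ℝ) : ℂ) *
      (((modulation (toPlane w) : ℂ) + Complex.I * (((2 : ℝ) ^ ((2 : ℝ) * k) : ℝ) : ℂ))⁻¹ * F w)) =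
      fun w ↦ ((etaK η j (mu w) : ℝ) : ℂ) * (res k w * F w) := by
    funext w
    rw [modulation_toPlane, two_rpow_two_mul, res]
  rw [e] at h2
  have hm1 := continuous_mu.measurable
  have hm2 := (hη.continuous_etaK j).measurable
  have hm3 := measurable_res k
  refine (h2.l2Norm_le (by fun_prop)).trans (n2_mono fun w ↦ ?_)
  rw [enorm_mul, enorm_mul, enorm_ofReal_of_nonneg (hη.etaK_nonneg _ _), mul_assoc]

/-! ### Summation of dyadic weights -/

/-- The sum of `2 ^ (-a |z|)` over the integers. -/
def e2Int (a : ℝ) : ℝ≥0∞ := ∑' z : ℤ, e2 (-(a * |(z : ℝ)|))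

theorem e2Int_lt_top {a : ℝ} (ha : 0 < a) : e2Int a < ⊤ := by
  have h : e2Int a = (∑' n : ℕ, e2 (-(a * n))) + ∑' n : ℕ, e2 (-(a * (n + 1 : ℕ))) := by
    refine (HasSum.of_nat_of_neg_add_one ?_ ?_).tsum_eq
    · convert ENNReal.summable.hasSum using 3 with n
      simp
    · convert ENNReal.summable.hasSum using 3 with n
      push_cast
      rw [abs_neg, abs_of_nonneg (by positivity)]
  rw [h]
  refine ENNReal.add_lt_top.mpr ⟨tsum_e2_lt_top ha, lt_of_le_of_lt ?_ (tsum_e2_lt_top ha)⟩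
  exact ENNReal.tsum_comp_le_tsum_of_injective (add_left_injective 1) fun n : ℕ ↦ e2 (-(a * n))

theorem tsum_e2_abs_le (a : ℝ) (m : ℕ) : ∑' j : ℕ, e2 (-(a * |(j : ℝ) - m|)) ≤ e2Int a := by
  have := ENNReal.tsum_comp_le_tsum_of_injective (f := fun j : ℕ ↦ (j : ℤ) - m)
    (fun i j h ↦ by simpa using h) fun z : ℤ ↦ e2 (-(a * |(z : ℝ)|))
  simpa [e2Int] using this

/-- At modulation `2^j` the resolvent is at most `min(2^(-2k), 2 · 2^(-j))`. Times `2^(j/2)` this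
peaks at `j = 2k` with a value of order `2^(-k)` and decays geometrically on both sides. -/
theorem IsCutoff.tsum_res_le {η : ℝ → ℝ} (hη : IsCutoff η) (k : ℕ) {G : ℝ × ℝ → ℂ}
    (hG : Measurable G) :
    ∑' j : ℕ, e2 (j / 2) * n2 (fun w ↦ ENNReal.ofReal (etaK η j (mu w)) * ‖res k w‖ₑ * ‖G w‖ₑ) ≤
      2 * e2Int (1 / 2) * e2 (-k) * n2 fun w ↦ ‖G w‖ₑ := by
  have h : ∀ j : ℕ, e2 (j / 2) *
      n2 (fun w ↦ ENNReal.ofReal (etaK η j (mu w)) * ‖res k w‖ₑ * ‖G w‖ₑ) ≤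
      2 * e2 (-k) * (n2 fun w ↦ ‖G w‖ₑ) * e2 (-(1 / 2 * |(j : ℝ) - (2 * k : ℕ)|)) := fun j ↦ by
    have h1 : ∀ w, ENNReal.ofReal (etaK η j (mu w)) * ‖res k w‖ₑ * ‖G w‖ₑ ≤
        2 * e2 (-k - j / 2 - 1 / 2 * |(j : ℝ) - (2 * k : ℕ)|) * ‖G w‖ₑ := fun w ↦ by
      refine mul_le_mul_left ?_ _
      push_cast
      rcases le_total (j : ℝ) (2 * k) with hj | hj
      · rw [abs_of_nonpos (by linarith)]
        refine (mul_le_mul' (hη.ofReal_etaK_le_one _ _) (enorm_res_le k w)).trans ?_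
        rw [one_mul]
        calc e2 (-(2 * k)) ≤ e2 (-k - j / 2 - 1 / 2 * -(j - 2 * k)) := e2_mono (by linarith)
          _ ≤ _ := by
            nth_rw 1 [← one_mul (e2 (-k - j / 2 - 1 / 2 * -(j - 2 * k)))]
            gcongr
            norm_num
      · rw [abs_of_nonneg (by linarith)]
        refine (hη.eta_mul_res_le j k w).trans ?_
        calc _ ≤ 2 * e2 (-j) * 1 := by
              gcongr
              exact hη.ofReal_etaK_le_one _ _
          _ = 2 * e2 (-j) := mul_one _
          _ ≤ _ := by
            gcongr
            exact e2_mono (by linarith)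
    refine (mul_le_mul_right (n2_mono h1) _).trans ?_
    rw [n2_const_mul _ _ hG.enorm]
    calc _ = 2 * (e2 (j / 2) * e2 (-k - j / 2 - 1 / 2 * |(j : ℝ) - (2 * k : ℕ)|)) *
          n2 fun w ↦ ‖G w‖ₑ := by ring
      _ = 2 * (e2 (-k) * e2 (-(1 / 2 * |(j : ℝ) - (2 * k : ℕ)|))) * n2 fun w ↦ ‖G w‖ₑ := by
          rw [← e2_add, ← e2_add]
          congr 3
          ring
      _ ≤ _ := le_of_eq (by ring)
  refine (ENNReal.tsum_le_tsum h).trans ?_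
  rw [ENNReal.tsum_mul_left]
  refine (mul_le_mul_right (tsum_e2_abs_le _ _) _).trans (le_of_eq (by ring))

/-- For resonant blocks only the decay `2^(-j)` of the resolvent is used, and the output band is
relaxed to a low-pass condition. -/
theorem IsCutoff.tsum_res_bandMul_le {η : ℝ → ℝ} (hη : IsCutoff η) (k : ℕ) {G : ℝ × ℝ → ℂ}
    (hG : Measurable G) :
    ∑' j : ℕ, e2 (j / 2) *
      n2 (fun w ↦ ENNReal.ofReal (etaK η j (mu w)) * ‖res k w‖ₑ * ‖bandMul η k G w‖ₑ) ≤
    2 * ∑' j : ℕ, e2 (-(j / 2)) * n2 (fun w ↦ lowpass (8 / 5 * 2 ^ k) w.1 *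
      (ENNReal.ofReal (etaK η j (mu w)) * ‖G w‖ₑ)) := by
  rw [← ENNReal.tsum_mul_left]
  refine ENNReal.tsum_le_tsum fun j ↦ ?_
  have hl : ∀ w, ENNReal.ofReal (etaK η j (mu w)) * ‖res k w‖ₑ * ‖bandMul η k G w‖ₑ ≤
      2 * e2 (-j) * (lowpass (8 / 5 * 2 ^ k) w.1 *
        (ENNReal.ofReal (etaK η j (mu w)) * ‖G w‖ₑ)) := fun w ↦ by
    by_cases hb : etaK η k (2 * Real.pi * w.1) = 0
    · simp [bandMul, hb]
    have hb1 : lowpass (8 / 5 * 2 ^ k) w.1 = 1 := by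
      have : w.1 ∈ {ξ : ℝ | |2 * Real.pi * ξ| ≤ 8 / 5 * 2 ^ k} := hη.etaK_upper hb
      rw [lowpass, Set.indicator_of_mem this, Pi.one_apply]
    rw [hb1, one_mul]
    calc _ ≤ 2 * e2 (-j) * ENNReal.ofReal (etaK η j (mu w)) * ‖G w‖ₑ :=
          mul_le_mul' (hη.eta_mul_res_le j k w) (hη.enorm_bandMul_le k G w)
      _ = _ := by ring
  have hm := hη.measurable_eta_mu j
  have hm2 : Measurable fun w : ℝ × ℝ ↦ lowpass (8 / 5 * 2 ^ k) w.1 :=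
    (measurable_lowpass _).comp measurable_fst
  have hm3 := hG.enorm
  refine (mul_le_mul_right (n2_mono hl) _).trans ?_
  rw [n2_const_mul _ _ (by fun_prop)]
  calc _ = 2 * (e2 (j / 2) * e2 (-j) * n2 (fun w ↦ lowpass (8 / 5 * 2 ^ k) w.1 *
        (ENNReal.ofReal (etaK η j (mu w)) * ‖G w‖ₑ))) := by ring
    _ ≤ _ := by
      rw [← e2_add]
      gcongr
      exact e2_mono (by linarith)

theorem IsCutoff.nkNorm_le_of_localized {η : ℝ → ℝ} (hη : IsCutoff η) (k : ℕ) {G : ℝ × ℝ → ℂ}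
    (hGm : Measurable G) (hG : Integrable G) {b : ℝ≥0∞}
    (h : ∀ t₀ : ℝ, ∃ G' : ℝ × ℝ → ℂ, Measurable G' ∧ Integrable G' ∧
      (∀ᵐ t : ℝ, ∀ x : ℝ, (η (4 ^ k * (t - t₀)) : ℂ) * ift G (x, t) = ift G' (x, t)) ∧
      ∑' j : ℕ, e2 (j / 2) *
        n2 (fun w ↦ ENNReal.ofReal (etaK η j (mu w)) * ‖res k w‖ₑ * ‖bandMul η k G' w‖ₑ) ≤ b) :
    nkNorm η 2 k (projK η k (iftDist hG)) ≤ b := by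
  refine iSup_le fun t₀ ↦ ?_
  obtain ⟨G', hm', hi', he, hb⟩ := h t₀
  exact ((hη.isFun_localized k t₀ hGm hG hi' he).xNorm_res_le hη (hη.measurable_bandMul k hm')
    k).trans hb

/-! ### The distribution of a product of two frequency-localized functions -/

/-- The weight of the interaction of the blocks `k₁`, `k₂` at the output frequency `k`. -/
def blockWeight (θ : ℝ) (k₁ k₂ k : ℕ) : ℝ≥0∞ :=
  if k ≤ max k₁ k₂ + 2 then
    if k₁ ≤ k₂ + 2 ∧ k₂ ≤ k₁ + 2 then
      e2 ((5 - 6 * θ) * (max k₁ k₂ : ℕ) - (3 / 2 + θ) * k)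
    else if max k₁ k₂ ≤ k + 2 then 1 else 0
  else 0

/-- The growth of the distribution of a product of two blocks. -/
def blockGrowth (θ : ℝ) (k₁ k₂ : ℕ) : ℝ≥0∞ :=
  if k₁ ≤ k₂ + 2 ∧ k₂ ≤ k₁ + 2 then e2 ((11 / 2 - 7 * θ) * (max k₁ k₂ : ℕ))
  else e2 (-(2 * (max k₁ k₂ : ℕ)))

/-- A weighted `L²` norm of test functions. -/
def testNorm (ψ : 𝓢(Plane, ℂ)) : ℝ≥0∞ :=
  n2 fun w : ℝ × ℝ ↦ ENNReal.ofReal ((1 + ‖toPlane w‖) ^ 5) * ‖ψ (toPlane w)‖ₑ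

/-- The output lives at frequencies comparable to `2^n`, so only `|k - n| ≤ 2` contributes, and
there `2^(-k) · 4^(n-k) · 2^n ≤ 64`. This explains the values `1` and `0` of the weight. -/
theorem IsCutoff.transversal_nkNorm {η : ℝ → ℝ} (hη : IsCutoff η) :
    ∃ C : ℝ≥0, ∀ k₁ k₂ a b : ℕ, a + b = 3 → (k₁ + 3 ≤ k₂ ∨ k₂ + 3 ≤ k₁) →
    ∀ x y : ℝ≥0∞, x < ⊤ → y < ⊤ → ∀ P Q : ℝ → ℝ → ℂ, LocRep η k₁ a x P → LocRep η k₂ b y Q →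
    ∀ G : ℝ × ℝ → ℂ, Measurable G → ∀ hG : Integrable G volume,
    (∀ᵐ t : ℝ, ∀ r : ℝ, ((η t ^ 2 : ℝ) : ℂ) * (P t r * Q t r) = ift G (r, t)) →
    ∀ (θ : ℝ) (k : ℕ),
      nkNorm η 2 k (projK η k (iftDist hG)) ≤ C * (blockWeight θ k₁ k₂ k * (x * y)) := by
  obtain ⟨C, hC⟩ := hη.exists_block_transversal hη.toSchwartzSq
  have hfin : 2 * e2Int (1 / 2) * (64 * C) ≠ ⊤ :=
    ENNReal.mul_ne_top (ENNReal.mul_ne_top (by simp) (e2Int_lt_top (by norm_num)).ne)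
      (ENNReal.mul_ne_top (by simp) (by simp))
  refine ⟨(2 * e2Int (1 / 2) * (64 * C)).toNNReal, ?_⟩
  rw [ENNReal.coe_toNNReal hfin]
  intro k₁ k₂ a b hab hk x y hx hy P Q hP hQ G hGm hG hrep θ k
  refine hη.nkNorm_le_of_localized k hGm hG fun t₀ ↦ ?_
  obtain ⟨G', hm', hi', hs', hn', he'⟩ := hC k k₁ k₂ _ a b hab rfl hk x y hx hy P Q hP hQ t₀
  refine ⟨G', hm', hi', ?_, ?_⟩
  · filter_upwards [hrep, he'] with t h1 h2 r
    rw [← h1 r, ← h2 r, hη.toSchwartzSq_apply, mul_assoc]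
  set n := max k₁ k₂ with hn
  have hw : blockWeight θ k₁ k₂ k = if k ≤ n + 2 ∧ n ≤ k + 2 then 1 else 0 := by
    unfold blockWeight
    rw [← hn, if_neg (by omega : ¬ (k₁ ≤ k₂ + 2 ∧ k₂ ≤ k₁ + 2))]
    split_ifs <;> first | rfl | tauto
  rw [hw]
  split_ifs with hkn
  · refine (hη.tsum_res_le k (hη.measurable_bandMul k hm')).trans ?_
    have h1 : n2 (fun w ↦ ‖bandMul η k G' w‖ₑ) ≤ C * (4 ^ (n - k) * e2 n * (x * y)) :=
      (n2_mono (hη.enorm_bandMul_le k G')).trans hn'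
    refine (mul_le_mul_right h1 _).trans ?_
    have h2 : e2 (-k) * (4 ^ (n - k) * e2 n) ≤ 64 := by
      calc e2 (-k) * (4 ^ (n - k) * e2 n) ≤ e2 (-k) * (4 ^ 2 * e2 (k + 2)) := by
            gcongr
            · norm_num
            · omega
            · exact e2_mono (by exact_mod_cast hkn.2)
        _ = 4 ^ 2 * (e2 (-k) * e2 k * (e2 (2 : ℕ))) := by rw [e2_add]; push_cast; ring
        _ = 64 := by rw [e2_neg_mul, one_mul, e2_natCast]; norm_num
    calc _ = 2 * e2Int (1 / 2) * (e2 (-k) * (4 ^ (n - k) * e2 n) * C) * (x * y) := by ring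
      _ ≤ 2 * e2Int (1 / 2) * (64 * C) * (x * y) := by gcongr
      _ = _ := by ring
  · have hz : ∀ w, bandMul η k G' w = 0 := fun w ↦ by
      by_contra hne
      have hb := hη.mem_band (k := k) (ξ := w.1) fun h0 ↦ hne (by simp [bandMul, h0])
      have hg := hs' w (right_ne_zero_of_mul hne)
      apply hkn
      constructor
      · by_contra hlt
        have h3 : (2 : ℝ) ^ (n + 3) ≤ 2 ^ k := pow_le_pow_right₀ (by norm_num) (by omega)
        have h4 := hb.2 (by omega)
        rw [pow_add] at h3
        have : (0 : ℝ) < 2 ^ n := by positivity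
        linarith
      · by_contra hlt
        have h3 : (2 : ℝ) ^ (k + 3) ≤ 2 ^ n := pow_le_pow_right₀ (by norm_num) (by omega)
        have h4 := hb.1
        rw [pow_add] at h3
        have : (0 : ℝ) < 2 ^ k := by positivity
        linarith
    simp [hz, n2_zero]

theorem rpow_mul_two_pow_le {c p : ℝ} (hc : 0 ≤ c) (hc4 : c ≤ 4) (h0 : 0 ≤ p) (h1 : p ≤ 1 / 2)
    (k : ℕ) : ENNReal.ofReal ((c * 2 ^ k) ^ p) ≤ 2 * e2 (p * k) := by
  rw [Real.mul_rpow hc (by positivity), two_pow_rpow, ENNReal.ofReal_mul (by positivity),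
    ofReal_rpow_two, mul_comm p]
  gcongr
  have : c ^ p ≤ 2 := by
    calc c ^ p ≤ 4 ^ p := Real.rpow_le_rpow hc hc4 h0
      _ ≤ 4 ^ (1 / 2 : ℝ) := Real.rpow_le_rpow_of_exponent_le (by norm_num) h1
      _ = 2 := by
          rw [show (4 : ℝ) = 2 ^ (2 : ℝ) by norm_num, ← Real.rpow_mul (by norm_num)]
          norm_num
  simpa using ENNReal.ofReal_le_ofReal this

/-- The factor `4^m` compensates for the truncated subtraction when `n < k ≤ n + m`. -/
theorem four_pow_sub_le {n k m : ℕ} (h : k ≤ n + m) :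
    (4 : ℝ≥0∞) ^ (n - k) ≤ 4 ^ m * e2 (2 * n - 2 * k) := by
  have e : ∀ j : ℕ, (4 : ℝ≥0∞) ^ j = e2 (2 * j) := fun j ↦ by
    rw [show (4 : ℝ≥0∞) = 2 ^ 2 by norm_num, ← pow_mul, ← e2_natCast]
    push_cast
    rfl
  rw [e, e, ← e2_add]
  refine e2_mono ?_
  have : ((n - k : ℕ) : ℝ) + k ≤ n + m := by exact_mod_cast (by omega : n - k + k ≤ n + m)
  linarith

/-- The output frequency may lie far below the inputs. The factors `4^(n-k)`, `2^((3-6θ)n)` and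
`2^((1/2-θ)k)` come from the number of cells, the derivatives with the resonance gain, and the `L²`
norm of the singular factor over the band. -/
theorem IsCutoff.resonant_nkNorm {η : ℝ → ℝ} (hη : IsCutoff η) {θ : ℝ} (h0 : 0 < θ)
    (h1 : θ < 1 / 2) :
    ∃ C : ℝ≥0, ∀ k₁ k₂ a b : ℕ, a + b = 3 → k₁ ≤ k₂ + 2 → k₂ ≤ k₁ + 2 →
    ∀ x y : ℝ≥0∞, x < ⊤ → y < ⊤ → ∀ P Q : ℝ → ℝ → ℂ, LocRep η k₁ a x P → LocRep η k₂ b y Q →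
    ∀ G : ℝ × ℝ → ℂ, Measurable G → ∀ hG : Integrable G volume,
    (∀ᵐ t : ℝ, ∀ r : ℝ, ((η t ^ 2 : ℝ) : ℂ) * (P t r * Q t r) = ift G (r, t)) → ∀ k : ℕ,
      nkNorm η 2 k (projK η k (iftDist hG)) ≤ C * (blockWeight θ k₁ k₂ k * (x * y)) := by
  obtain ⟨C, hC⟩ := hη.exists_block_resonant hη.toSchwartzSq h0 h1
  refine ⟨64 * C, ?_⟩
  intro k₁ k₂ a b hab hk hk' x y hx hy P Q hP hQ G hGm hG hrep k
  refine hη.nkNorm_le_of_localized k hGm hG fun t₀ ↦ ?_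
  obtain ⟨G', hm', hi', hs', hn', he'⟩ := hC k k₁ k₂ _ a b hab rfl hk hk' x y hx hy P Q hP hQ t₀
  refine ⟨G', hm', hi', ?_, ?_⟩
  · filter_upwards [hrep, he'] with t h1 h2 r
    rw [← h1 r, ← h2 r, hη.toSchwartzSq_apply, mul_assoc]
  set n := max k₁ k₂ with hn
  have hw : blockWeight θ k₁ k₂ k =
      if k ≤ n + 2 then e2 ((5 - 6 * θ) * n - (3 / 2 + θ) * k) else 0 := by
    unfold blockWeight
    rw [← hn, if_pos (⟨hk, hk'⟩ : k₁ ≤ k₂ + 2 ∧ k₂ ≤ k₁ + 2)]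
  rw [hw]
  split_ifs with hkn
  · refine (hη.tsum_res_bandMul_le k hm').trans
      ((mul_le_mul_right (hn' (8 / 5 * 2 ^ k) (by positivity)) _).trans ?_)
    calc _ ≤ 2 * (C * (4 ^ 2 * e2 (2 * n - 2 * k) * (e2 (3 * n - 6 * θ * n) *
          (2 * e2 ((1 / 2 - θ) * k))) * (x * y))) := by
          gcongr
          · exact four_pow_sub_le hkn
          · exact rpow_mul_two_pow_le (by norm_num) (by norm_num) (by linarith) (by linarith) k
      _ = 64 * C * (e2 (2 * n - 2 * k) * e2 (3 * n - 6 * θ * n) * e2 ((1 / 2 - θ) * k) *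
          (x * y)) := by ring
      _ = _ := by
          rw [← e2_add, ← e2_add]
          push_cast
          congr 3
          ring_nf
  · have hz : ∀ w, bandMul η k G' w = 0 := fun w ↦ by
      by_contra hne
      have hb := hη.mem_band (k := k) (ξ := w.1) fun h0 ↦ hne (by simp [bandMul, h0])
      have hg := hs' w (right_ne_zero_of_mul hne)
      have h3 : (2 : ℝ) ^ (n + 3) ≤ 2 ^ k := pow_le_pow_right₀ (by norm_num) (by omega)
      have h4 := hb.2 (by omega)
      rw [pow_add] at h3
      have : (0 : ℝ) < 2 ^ n := by positivity
      linarith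
    simp [hz, n2_zero]

/-! ### Growth of a single block against test functions. -/

theorem norm_fst_le_toPlane (w : ℝ × ℝ) : |w.1| ≤ ‖toPlane w‖ := by
  simpa [toPlane] using PiLp.norm_apply_le (toPlane w) 0

theorem norm_snd_le_toPlane (w : ℝ × ℝ) : |w.2| ≤ ‖toPlane w‖ := by
  simpa [toPlane] using PiLp.norm_apply_le (toPlane w) 1

theorem measurable_test (ψ : 𝓢(Plane, ℂ)) : Measurable fun w : ℝ × ℝ ↦ ‖ψ (toPlane w)‖ₑ :=
  (ψ.continuous.comp continuous_toPlane).measurable.enorm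

theorem measurable_testNorm (ψ : 𝓢(Plane, ℂ)) : Measurable fun w : ℝ × ℝ ↦
    ENNReal.ofReal ((1 + ‖toPlane w‖) ^ 5) * ‖ψ (toPlane w)‖ₑ := by
  have h := continuous_toPlane.measurable
  exact (by fun_prop : Measurable fun w : ℝ × ℝ ↦ ENNReal.ofReal ((1 + ‖toPlane w‖) ^ 5)).mul
    (measurable_test ψ)

theorem enorm_iftDist_le {G : ℝ × ℝ → ℂ} (hG : Integrable G) (φ : 𝓢(Plane, ℂ)) :
    ‖iftDist hG φ‖ₑ ≤ ∫⁻ w, ‖G w‖ₑ * ‖(𝓕⁻ φ : 𝓢(Plane, ℂ)) (toPlane w)‖ₑ := by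
  rw [iftDist_apply]
  refine (enorm_integral_le_lintegral_enorm _).trans (le_of_eq ?_)
  simp_rw [enorm_mul]

/-- The block construction with `k = 0`, `t₀ = 0` and `Θ = η` represents `η(t)²` times the product
on the whole plane. Its transform is supported where `|ξ|` is at least of order `2^n`, so the
fifth-order weight of the test norm turns the size `4^n 2^n` into `2^(-2n)`. -/
theorem IsCutoff.exists_transversal {η : ℝ → ℝ} (hη : IsCutoff η) :
    ∃ C : ℝ≥0, ∀ k₁ k₂ a b : ℕ, a + b = 3 → (k₁ + 3 ≤ k₂ ∨ k₂ + 3 ≤ k₁) →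
    ∀ x y : ℝ≥0∞, x < ⊤ → y < ⊤ → ∀ P Q : ℝ → ℝ → ℂ, LocRep η k₁ a x P → LocRep η k₂ b y Q →
    ∃ G : ℝ × ℝ → ℂ, Measurable G ∧ ∃ hG : Integrable G volume,
    (∀ᵐ t : ℝ, ∀ r : ℝ, ((η t ^ 2 : ℝ) : ℂ) * (P t r * Q t r) = ift G (r, t)) ∧
    ∀ φ : 𝓢(Plane, ℂ), ‖iftDist hG φ‖ₑ ≤
      C * (e2 (-(2 * (max k₁ k₂ : ℕ))) * (x * y) * testNorm (𝓕⁻ φ)) := by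
  obtain ⟨C, hC⟩ := hη.exists_block_transversal hη.toSchwartz
  refine ⟨2 ^ 20 * C, ?_⟩
  intro k₁ k₂ a b hab hk x y hx hy P Q hP hQ
  obtain ⟨G, hm, hi, hs, hn, he⟩ := hC 0 k₁ k₂ _ a b hab rfl hk x y hx hy P Q hP hQ 0
  set n := max k₁ k₂ with hnk
  refine ⟨G, hm, hi, ?_, fun φ ↦ ?_⟩
  · filter_upwards [he] with t ht r
    rw [← ht r, hη.toSchwartz_apply, pow_zero, one_mul, sub_zero, sq, Complex.ofReal_mul]
  set ψ : 𝓢(Plane, ℂ) := 𝓕⁻ φ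
  have h1 : ∀ w, ‖G w‖ₑ * ‖ψ (toPlane w)‖ₑ ≤ ‖G w‖ₑ * (2 ^ 20 * e2 (-(5 * n)) *
      (ENNReal.ofReal ((1 + ‖toPlane w‖) ^ 5) * ‖ψ (toPlane w)‖ₑ)) := fun w ↦ by
    by_cases h0 : G w = 0
    · simp [h0]
    have h2 := (hs w h0).1
    refine mul_le_mul_right ?_ _
    rw [← mul_assoc]
    refine le_mul_of_one_le_left' ?_
    -- The constant is `16 = (5/2) · 6.4` with `2π ≤ 6.4`; below, `16⁵ = 2²⁰`.
    have h3 : (2 : ℝ) ^ n ≤ 16 * (1 + ‖toPlane w‖) := by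
      have h4 := norm_fst_le_toPlane w
      rw [abs_mul, abs_of_pos Real.two_pi_pos] at h2
      have h5 : 2 * Real.pi * |w.1| ≤ 6.4 * ‖toPlane w‖ := by
        have := Real.pi_lt_d2
        gcongr
        linarith
      linarith
    have h5 : (2 : ℝ) ^ (5 * n) ≤ 2 ^ 20 * (1 + ‖toPlane w‖) ^ 5 := by
      calc (2 : ℝ) ^ (5 * n) = (2 ^ n) ^ 5 := by rw [mul_comm, pow_mul]
        _ ≤ (16 * (1 + ‖toPlane w‖)) ^ 5 := pow_le_pow_left₀ (by positivity) h3 5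
        _ = _ := by ring
    have h6 := ENNReal.ofReal_le_ofReal h5
    rw [ofReal_two_pow, ENNReal.ofReal_mul (by positivity)] at h6
    calc (1 : ℝ≥0∞) = e2 (-(5 * n)) * e2 (5 * n) := (e2_neg_mul _).symm
      _ ≤ e2 (-(5 * n)) * (2 ^ 20 * ENNReal.ofReal ((1 + ‖toPlane w‖) ^ 5)) := by
          gcongr
          refine le_trans (le_of_eq ?_) (h6.trans (le_of_eq ?_))
          · push_cast; rfl
          · rw [ENNReal.ofReal_pow (by norm_num)]; simp
      _ = _ := by ring
  have hmt := measurable_testNorm ψ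
  calc ‖iftDist hi φ‖ₑ ≤ _ := enorm_iftDist_le hi φ
    _ ≤ _ := lintegral_mono h1
    _ ≤ _ := lintegral_mul_le_n2 hm.enorm.aemeasurable (hmt.const_mul _).aemeasurable
    _ ≤ C * (4 ^ n * e2 n * (x * y)) * (2 ^ 20 * e2 (-(5 * n)) * testNorm ψ) := by
        rw [n2_const_mul _ _ hmt]
        exact mul_le_mul' hn le_rfl
    _ = 2 ^ 20 * C * (4 ^ n * e2 n * e2 (-(5 * n)) * (x * y) * testNorm ψ) := by ring
    _ ≤ _ := by
        have := four_pow_sub_le (n := n) (k := 0) (m := 0) (by omega)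
        simp only [Nat.sub_zero, pow_zero, one_mul, Nat.cast_zero, mul_zero, sub_zero] at this
        push_cast
        gcongr
        refine (mul_le_mul_left (mul_le_mul_left this _) _).trans ?_
        rw [← e2_add, ← e2_add]
        exact e2_mono (le_of_eq (by ring))

/-- The modulation is a polynomial of degree five, hence the order five of the weight in `testNorm`.
-/
theorem two_pow_le_of_etaK_mu {η : ℝ → ℝ} (hη : IsCutoff η) {j : ℕ} {w : ℝ × ℝ}
    (h : etaK η j (mu w) ≠ 0) : (2 : ℝ) ^ j ≤ 2 ^ 17 * (1 + ‖toPlane w‖) ^ 5 := by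
  have hr : (0 : ℝ) ≤ ‖toPlane w‖ := norm_nonneg _
  have h1 : (1 : ℝ) ≤ (1 + ‖toPlane w‖) ^ 5 := one_le_pow₀ (by linarith)
  rcases Nat.eq_zero_or_pos j with rfl | hj
  · rw [pow_zero]
    nlinarith
  have h2 := hη.etaK_lower hj h
  have hb : ∀ r : ℝ, |r| ≤ ‖toPlane w‖ → |2 * Real.pi * r| ≤ 7 * (1 + ‖toPlane w‖) := fun r hr ↦ by
    rw [abs_mul, abs_of_pos Real.two_pi_pos]
    have := Real.pi_lt_d2
    have := Real.pi_pos
    gcongr <;> linarith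
  have h3 : |mu w| ≤ 7 * (1 + ‖toPlane w‖) + (7 * (1 + ‖toPlane w‖)) ^ 5 := by
    refine (abs_sub _ _).trans (add_le_add (hb _ (norm_snd_le_toPlane w)) ?_)
    rw [abs_pow]
    exact pow_le_pow_left₀ (abs_nonneg _) (hb _ (norm_fst_le_toPlane w)) 5
  have h4 : 1 + ‖toPlane w‖ ≤ (1 + ‖toPlane w‖) ^ 5 :=
    le_self_pow₀ (by linarith) (by norm_num)
  rw [mul_pow] at h3
  nlinarith

/-- The resonant bound only controls the pieces with the factor `2^(-j/2)`. The missing `2^(j/2) ≤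
2^j` is charged to the test function through `two_pow_le_of_etaK_mu`. The exponent is `2 + (3 - 6θ)
+ (1/2 - θ)`. -/
theorem IsCutoff.exists_resonant {η : ℝ → ℝ} (hη : IsCutoff η) {θ : ℝ} (h0 : 0 < θ)
    (h1 : θ < 1 / 2) :
    ∃ C : ℝ≥0, ∀ k₁ k₂ a b : ℕ, a + b = 3 → k₁ ≤ k₂ + 2 → k₂ ≤ k₁ + 2 →
    ∀ x y : ℝ≥0∞, x < ⊤ → y < ⊤ → ∀ P Q : ℝ → ℝ → ℂ, LocRep η k₁ a x P → LocRep η k₂ b y Q →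
    ∃ G : ℝ × ℝ → ℂ, Measurable G ∧ ∃ hG : Integrable G volume,
    (∀ᵐ t : ℝ, ∀ r : ℝ, ((η t ^ 2 : ℝ) : ℂ) * (P t r * Q t r) = ift G (r, t)) ∧
    ∀ φ : 𝓢(Plane, ℂ), ‖iftDist hG φ‖ₑ ≤
      C * (e2 ((11 / 2 - 7 * θ) * (max k₁ k₂ : ℕ)) * (x * y) * testNorm (𝓕⁻ φ)) := by
  obtain ⟨C, hC⟩ := hη.exists_block_resonant hη.toSchwartz h0 h1
  refine ⟨2 ^ 18 * C, ?_⟩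
  intro k₁ k₂ a b hab hk hk' x y hx hy P Q hP hQ
  obtain ⟨G, hm, hi, hs, hn, he⟩ := hC 0 k₁ k₂ _ a b hab rfl hk hk' x y hx hy P Q hP hQ 0
  set n := max k₁ k₂ with hnk
  refine ⟨G, hm, hi, ?_, fun φ ↦ ?_⟩
  · filter_upwards [he] with t ht r
    rw [← ht r, hη.toSchwartz_apply, pow_zero, one_mul, sub_zero, sq, Complex.ofReal_mul]
  set ψ : 𝓢(Plane, ℂ) := 𝓕⁻ φ
  set L : ℝ × ℝ → ℝ≥0∞ := fun w ↦ lowpass (16 / 5 * 2 ^ n) w.1 with hL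
  have hLm : Measurable L := (measurable_lowpass _).comp measurable_fst
  have hmt := measurable_testNorm ψ
  have hmG := hm.enorm
  have hmj := fun j ↦ hη.measurable_eta_mu j
  have hpt : ∀ j w, ENNReal.ofReal (etaK η j (mu w)) * ‖G w‖ₑ * ‖ψ (toPlane w)‖ₑ ≤
      (e2 (-(j / 2)) * (L w * (ENNReal.ofReal (etaK η j (mu w)) * ‖G w‖ₑ))) *
      (2 ^ 17 * (ENNReal.ofReal ((1 + ‖toPlane w‖) ^ 5) * ‖ψ (toPlane w)‖ₑ)) := fun j w ↦ by
    by_cases hG0 : G w = 0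
    · simp [hG0]
    by_cases hη0 : etaK η j (mu w) = 0
    · simp [hη0]
    have hL1 : L w = 1 := lowpass_eq_one (hs w hG0)
    have h6 := ENNReal.ofReal_le_ofReal (two_pow_le_of_etaK_mu hη hη0)
    rw [ofReal_two_pow, ENNReal.ofReal_mul (by positivity),
      ENNReal.ofReal_pow (by norm_num : (0 : ℝ) ≤ 2), ENNReal.ofReal_ofNat] at h6
    have h7 : 1 ≤ e2 (-(j / 2)) * (2 ^ 17 * ENNReal.ofReal ((1 + ‖toPlane w‖) ^ 5)) := by
      refine le_trans ?_ (mul_le_mul_right h6 _)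
      rw [← e2_add, ← e2_zero]
      exact e2_mono (by linarith [show (0 : ℝ) ≤ j by positivity])
    rw [hL1, one_mul]
    calc _ ≤ (e2 (-(j / 2)) * (2 ^ 17 * ENNReal.ofReal ((1 + ‖toPlane w‖) ^ 5))) *
          (ENNReal.ofReal (etaK η j (mu w)) * ‖G w‖ₑ * ‖ψ (toPlane w)‖ₑ) :=
          le_mul_of_one_le_left' h7
      _ = _ := by ring
  calc ‖iftDist hi φ‖ₑ ≤ _ := enorm_iftDist_le hi φ
    _ = ∫⁻ w, ∑' j, ENNReal.ofReal (etaK η j (mu w)) * ‖G w‖ₑ * ‖ψ (toPlane w)‖ₑ := by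
        refine lintegral_congr fun w ↦ ?_
        rw [ENNReal.tsum_mul_right, hη.eta_sum_mul (fun w ↦ ‖G w‖ₑ)]
    _ = ∑' j, ∫⁻ w, ENNReal.ofReal (etaK η j (mu w)) * ‖G w‖ₑ * ‖ψ (toPlane w)‖ₑ :=
        lintegral_tsum fun j ↦ (((hmj j).mul hmG).mul (measurable_test ψ)).aemeasurable
    _ ≤ ∑' j : ℕ, e2 (-(j / 2)) * n2 (fun w ↦ L w * (ENNReal.ofReal (etaK η j (mu w)) * ‖G w‖ₑ)) *
          (2 ^ 17 * testNorm ψ) := by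
        refine ENNReal.tsum_le_tsum fun j ↦ (lintegral_mono (hpt j)).trans ?_
        have hj := hmj j
        refine (lintegral_mul_le_n2 (by fun_prop) (hmt.const_mul _).aemeasurable).trans ?_
        rw [n2_const_mul _ _ hmt, n2_const_mul _ _ (by fun_prop)]
        exact le_rfl
    _ ≤ C * (4 ^ n * (e2 (3 * n - 6 * θ * n) * (2 * e2 ((1 / 2 - θ) * n))) * (x * y)) *
          (2 ^ 17 * testNorm ψ) := by
        rw [ENNReal.tsum_mul_right]
        have := hn (16 / 5 * 2 ^ n) (by positivity)
        rw [Nat.sub_zero] at this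
        refine mul_le_mul_left (this.trans ?_) _
        gcongr
        · exact rpow_mul_two_pow_le (by norm_num) (by norm_num) (by linarith) (by linarith) n
    _ = 2 ^ 18 * C * (4 ^ n * e2 (3 * n - 6 * θ * n) * e2 ((1 / 2 - θ) * n) * (x * y) *
          testNorm ψ) := by ring
    _ ≤ _ := by
        have := four_pow_sub_le (n := n) (k := 0) (m := 0) (by omega)
        simp only [Nat.sub_zero, pow_zero, one_mul, Nat.cast_zero, mul_zero, sub_zero] at this
        push_cast
        gcongr
        refine (mul_le_mul_left (mul_le_mul_left this _) _).trans ?_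
        rw [← e2_add, ← e2_add]
        refine e2_mono (le_of_eq ?_)
        rw [hnk]
        push_cast
        ring

/-- The product of two frequency-localized functions, cut off in time, as a distribution. -/
theorem IsCutoff.exists_block {η : ℝ → ℝ} (hη : IsCutoff η) {θ : ℝ} (h0 : 0 < θ) (h1 : θ < 1 / 2) :
    ∃ C : ℝ≥0, ∀ k₁ k₂ a b : ℕ, a + b = 3 →
    ∀ x y : ℝ≥0∞, x < ⊤ → y < ⊤ → ∀ P Q : ℝ → ℝ → ℂ, LocRep η k₁ a x P → LocRep η k₂ b y Q →
    ∃ (G : ℝ × ℝ → ℂ) (hG : Integrable G volume),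
    (∀ᵐ t : ℝ, ∀ r : ℝ, ((η t ^ 2 : ℝ) : ℂ) * (P t r * Q t r) = ift G (r, t)) ∧
    (∀ k : ℕ, nkNorm η 2 k (projK η k (iftDist hG)) ≤ C * (blockWeight θ k₁ k₂ k * (x * y))) ∧
    ∀ φ : 𝓢(Plane, ℂ), ‖iftDist hG φ‖ₑ ≤
      C * (blockGrowth θ k₁ k₂ * (x * y) * testNorm (𝓕⁻ φ)) := by
  obtain ⟨C₁, hC₁⟩ := hη.transversal_nkNorm
  obtain ⟨C₂, hC₂⟩ := hη.resonant_nkNorm h0 h1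
  obtain ⟨C₃, hC₃⟩ := hη.exists_transversal
  obtain ⟨C₄, hC₄⟩ := hη.exists_resonant h0 h1
  refine ⟨C₁ + C₂ + C₃ + C₄, ?_⟩
  intro k₁ k₂ a b hab x y hx hy P Q hP hQ
  have hle : ∀ i ∈ [C₁, C₂, C₃, C₄], (i : ℝ≥0∞) ≤ (C₁ + C₂ + C₃ + C₄ : ℝ≥0) := fun i hi ↦ by
    rw [ENNReal.coe_le_coe, ← NNReal.coe_le_coe]
    have h₁ := C₁.2
    have h₂ := C₂.2
    have h₃ := C₃.2
    have h₄ := C₄.2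
    simp only [List.mem_cons, List.not_mem_nil, or_false] at hi
    push_cast
    rcases hi with h | h | h | h <;> rw [h] <;> simp only [NNReal.val_eq_coe] at * <;> linarith
  by_cases hr : k₁ ≤ k₂ + 2 ∧ k₂ ≤ k₁ + 2
  · obtain ⟨G, hm, hG, hrep, hb⟩ := hC₄ k₁ k₂ a b hab hr.1 hr.2 x y hx hy P Q hP hQ
    refine ⟨G, hG, hrep, fun k ↦ ?_, fun φ ↦ ?_⟩
    · exact (hC₂ k₁ k₂ a b hab hr.1 hr.2 x y hx hy P Q hP hQ G hm hG hrep k).trans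
        (mul_le_mul_left (hle _ (by simp)) _)
    · rw [blockGrowth, if_pos hr]
      exact (hb φ).trans (mul_le_mul_left (hle _ (by simp)) _)
  · have ht : k₁ + 3 ≤ k₂ ∨ k₂ + 3 ≤ k₁ := by omega
    obtain ⟨G, hm, hG, hrep, hb⟩ := hC₃ k₁ k₂ a b hab ht x y hx hy P Q hP hQ
    refine ⟨G, hG, hrep, fun k ↦ ?_, fun φ ↦ ?_⟩
    · exact (hC₁ k₁ k₂ a b hab ht x y hx hy P Q hP hQ G hm hG hrep θ k).trans
        (mul_le_mul_left (hle _ (by simp)) _)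
    · rw [blockGrowth, if_neg hr]
      exact (hb φ).trans (mul_le_mul_left (hle _ (by simp)) _)

/-! ### Weighted sequence norms and paraproduct sums -/

/-- The `ℓ²` norm with the weight `2 ^ (k s)`. -/
def seqNorm (s : ℝ) (X : ℕ → ℝ≥0∞) : ℝ≥0∞ := (∑' k : ℕ, e2 (2 * k * s) * X k ^ 2) ^ (1 / 2 : ℝ)

theorem seqNorm_sq (s : ℝ) (X : ℕ → ℝ≥0∞) :
    seqNorm s X ^ 2 = ∑' k : ℕ, (e2 (k * s) * X k) ^ 2 := by
  rw [seqNorm, rpow_half_sq]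
  refine tsum_congr fun k ↦ ?_
  rw [mul_pow, e2_pow]
  congr 2
  push_cast
  ring

theorem seqNorm_mono (s : ℝ) {X Y : ℕ → ℝ≥0∞} (h : ∀ k, X k ≤ Y k) : seqNorm s X ≤ seqNorm s Y :=
  ENNReal.rpow_le_rpow (ENNReal.tsum_le_tsum fun k ↦ by gcongr; exact h k) (by norm_num)

theorem seqNorm_const_mul (s : ℝ) (c : ℝ≥0∞) (X : ℕ → ℝ≥0∞) :
    seqNorm s (fun k ↦ c * X k) = c * seqNorm s X := by
  have h : ∀ k : ℕ, e2 (2 * k * s) * (c * X k) ^ 2 = c ^ 2 * (e2 (2 * k * s) * X k ^ 2) :=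
    fun k ↦ by ring
  simp_rw [seqNorm, h]
  rw [ENNReal.tsum_mul_left, ENNReal.mul_rpow_of_nonneg _ _ (by norm_num), sq_rpow_half]

theorem add_sq_le (a b : ℝ≥0∞) : (a + b) ^ 2 ≤ 4 * (a ^ 2 + b ^ 2) := by
  rcases le_total a b with h | h
  · calc (a + b) ^ 2 ≤ (b + b) ^ 2 := by gcongr
      _ = 4 * b ^ 2 := by ring
      _ ≤ _ := by gcongr; exact le_add_self
  · calc (a + b) ^ 2 ≤ (a + a) ^ 2 := by gcongr
      _ = 4 * a ^ 2 := by ring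
      _ ≤ _ := by gcongr; exact le_self_add

theorem seqNorm_add_le (s : ℝ) (X Y : ℕ → ℝ≥0∞) :
    seqNorm s (fun k ↦ X k + Y k) ≤ 2 * (seqNorm s X + seqNorm s Y) := by
  refine le_of_sq_le ?_
  calc seqNorm s (fun k ↦ X k + Y k) ^ 2
      ≤ ∑' k : ℕ, 4 * ((e2 (k * s) * X k) ^ 2 + (e2 (k * s) * Y k) ^ 2) := by
        rw [seqNorm_sq]
        refine ENNReal.tsum_le_tsum fun k ↦ ?_
        rw [mul_add]
        exact add_sq_le _ _
    _ = 4 * (seqNorm s X ^ 2 + seqNorm s Y ^ 2) := by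
        rw [ENNReal.tsum_mul_left, ENNReal.tsum_add, seqNorm_sq, seqNorm_sq]
    _ ≤ 4 * ((seqNorm s X ^ 2 + seqNorm s Y ^ 2) + 2 * seqNorm s X * seqNorm s Y) := by
        exact mul_le_mul_right le_self_add _
    _ = _ := by ring

theorem e2_mul_le_seqNorm (s : ℝ) (X : ℕ → ℝ≥0∞) (k : ℕ) : e2 (k * s) * X k ≤ seqNorm s X := by
  refine le_of_sq_le ?_
  rw [seqNorm_sq]
  exact ENNReal.le_tsum k

theorem le_e2_mul_seqNorm (s : ℝ) (X : ℕ → ℝ≥0∞) (k : ℕ) :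
    X k ≤ e2 (-(k * s)) * seqNorm s X := by
  calc X k = e2 (-(k * s)) * (e2 (k * s) * X k) := by rw [← mul_assoc, e2_neg_mul, one_mul]
    _ ≤ _ := by
      gcongr
      exact e2_mul_le_seqNorm s X k

/-! ### Schur's test and summation over pairs of blocks. -/

theorem tsum_mul_sq_le (f g : ℕ → ℝ≥0∞) :
    (∑' j, f j * g j) ^ 2 ≤ (∑' j, f j ^ 2) * ∑' j, g j ^ 2 := by
  have h := ENNReal.lintegral_mul_le_Lp_mul_Lq Measure.count Real.HolderConjugate.two_two
    (measurable_from_top (f := f)).aemeasurable (measurable_from_top (f := g)).aemeasurable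
  simp only [lintegral_count, Pi.mul_apply, ENNReal.rpow_two] at h
  calc _ ≤ _ := pow_le_pow_left' h 2
    _ = _ := by rw [mul_pow, rpow_half_sq, rpow_half_sq]

/-- Schur's test: the kernel is split into two square roots, Cauchy–Schwarz is applied in `j`, and
the row and column sums are both bounded by `e2Int a`. -/
theorem schur_tsum_le {a : ℝ} (v : ℕ → ℝ≥0∞) :
    ∑' k : ℕ, (∑' j : ℕ, e2 (-(a * |(k : ℝ) - j|)) * v j) ^ 2 ≤ e2Int a ^ 2 * ∑' j, v j ^ 2 := by
  have h1 : ∀ k : ℕ, (∑' j : ℕ, e2 (-(a * |(k : ℝ) - j|)) * v j) ^ 2 ≤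
      e2Int a * ∑' j : ℕ, e2 (-(a * |(k : ℝ) - j|)) * v j ^ 2 := fun k ↦ by
    have hs : ∀ j : ℕ, e2 (-(a * |(k : ℝ) - j|)) = e2 (-(a / 2 * |(k : ℝ) - j|)) ^ 2 := fun j ↦ by
      rw [e2_pow]
      congr 1
      push_cast
      ring
    calc _ = (∑' j : ℕ, e2 (-(a / 2 * |(k : ℝ) - j|)) *
          (e2 (-(a / 2 * |(k : ℝ) - j|)) * v j)) ^ 2 := by
          congr 1
          refine tsum_congr fun j ↦ ?_
          rw [hs]
          ring
      _ ≤ _ := tsum_mul_sq_le _ _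
      _ ≤ _ := by
          simp_rw [mul_pow, ← hs]
          gcongr
          refine le_trans (le_of_eq (tsum_congr fun j ↦ ?_)) (tsum_e2_abs_le a k)
          rw [abs_sub_comm]
  calc _ ≤ ∑' k : ℕ, e2Int a * ∑' j : ℕ, e2 (-(a * |(k : ℝ) - j|)) * v j ^ 2 :=
        ENNReal.tsum_le_tsum h1
    _ = e2Int a * ∑' j : ℕ, (∑' k : ℕ, e2 (-(a * |(k : ℝ) - j|))) * v j ^ 2 := by
        rw [ENNReal.tsum_mul_left, ENNReal.tsum_comm]
        simp_rw [ENNReal.tsum_mul_right]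
    _ ≤ e2Int a * ∑' j : ℕ, e2Int a * v j ^ 2 := by
        gcongr with j
        exact tsum_e2_abs_le a j
    _ = _ := by
        rw [ENNReal.tsum_mul_left]
        ring

theorem tsum_prod_mul (f g : ℕ → ℝ≥0∞) :
    ∑' p : ℕ × ℕ, f p.1 * g p.2 = (∑' j, f j) * ∑' j, g j := by
  rw [ENNReal.tsum_prod (f := fun i j ↦ f i * g j)]
  simp_rw [ENNReal.tsum_mul_left, ENNReal.tsum_mul_right]

/-- The pairs of frequencies in which the first one dominates. -/
def para (X Y : ℕ → ℝ≥0∞) (k₁ k₂ : ℕ) : ℝ≥0∞ := if k₂ ≤ k₁ then X k₁ * Y k₂ else 0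

theorem blockWeight_comm (θ : ℝ) (k₁ k₂ k : ℕ) : blockWeight θ k₁ k₂ k = blockWeight θ k₂ k₁ k := by
  unfold blockWeight
  simp only [max_comm k₁ k₂, and_comm]

theorem blockGrowth_comm (θ : ℝ) (k₁ k₂ : ℕ) : blockGrowth θ k₁ k₂ = blockGrowth θ k₂ k₁ := by
  unfold blockGrowth
  simp only [max_comm k₁ k₂, and_comm]

/-- For `θ = 1/2 - σ/14` the resonant weight is `2^((2 + 3σ/7)n - (2 - σ/14)k)`. After
multiplication by `2^(ks)` and by `2^(-ns)`, `2^(-n)` from the two norms, the worst output is `k =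
0` or `k ≈ n`, according to the sign of the exponent of `2^k`. There remain `2^((1 + 3σ/7 - s)n)`
and `2^((σ/2 - 1)n)`, both decaying since `σ ≤ s - 1` and `σ ≤ 1`. The surplus is spread over `k`,
`k₁`, `k₂` to allow absolute summation. The second summand is the separated case, where `k ≈ k₁` and
the low factor brings `2^(-k₂)`. -/
theorem blockWeight_para_le {s σ : ℝ} (hσ : 0 < σ) (hσ1 : σ ≤ 1) (hσs : σ ≤ s - 1)
    (X Y : ℕ → ℝ≥0∞) (k₁ k₂ k : ℕ) :
    e2 (k * s) * (blockWeight (1 / 2 - σ / 14) k₁ k₂ k * para X Y k₁ k₂) ≤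
      e2 (2 * s + 4) * (e2 (-(σ / 4 * k)) * (e2 (-(σ / 8 * k₁)) * e2 (-(σ / 8 * k₂)))) *
        (seqNorm s X * seqNorm 1 Y) +
      e2 (2 * s + 4) * (e2 (-(1 * |(k : ℝ) - k₁|)) * (e2 (k₁ * s) * X k₁)) *
        (e2 (-(1 * k₂)) * seqNorm 1 Y) := by
  have hY := le_e2_mul_seqNorm 1 Y k₂
  have hX := le_e2_mul_seqNorm s X k₁
  unfold para
  split_ifs with hk
  swap
  · simp
  unfold blockWeight
  rw [max_eq_left hk]
  have hk1 : (0 : ℝ) ≤ k₁ := by positivity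
  have hk0 : (0 : ℝ) ≤ k := by positivity
  split_ifs with h1 h2 h3
  · refine le_trans ?_ le_self_add
    have hk' : (k₂ : ℝ) ≤ k₁ := by exact_mod_cast hk
    have h1' : (k : ℝ) ≤ k₁ + 2 := by exact_mod_cast h1
    have h2' : (k₁ : ℝ) ≤ k₂ + 2 := by exact_mod_cast h2.1
    calc _ ≤ e2 (k * s) * (e2 ((5 - 6 * (1 / 2 - σ / 14)) * k₁ - (3 / 2 + (1 / 2 - σ / 14)) * k) *
          ((e2 (-(k₁ * s)) * seqNorm s X) * (e2 (-(k₂ * 1)) * seqNorm 1 Y))) := by gcongr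
      _ = e2 (k * s) * e2 ((5 - 6 * (1 / 2 - σ / 14)) * k₁ - (3 / 2 + (1 / 2 - σ / 14)) * k) *
          e2 (-(k₁ * s)) * e2 (-(k₂ * 1)) * (seqNorm s X * seqNorm 1 Y) := by ring
      _ ≤ _ := by
          refine mul_le_mul_left ?_ _
          rw [← e2_add, ← e2_add, ← e2_add, ← e2_add, ← e2_add, ← e2_add]
          refine e2_mono ?_
          have h5 : k * (s - 2 + σ / 14 + σ / 4) ≤
              k₁ * (s - 1 - 3 / 7 * σ - σ / 4) + (2 * s + 2) := by
            rcases le_total (s - 2 + σ / 14 + σ / 4) 0 with h | h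
            · have := mul_nonneg hk0 (neg_nonneg.mpr h)
              have := mul_nonneg hk1 (by linarith : 0 ≤ s - 1 - 3 / 7 * σ - σ / 4)
              linarith
            · have := mul_le_mul_of_nonneg_right h1' h
              have := mul_nonneg hk1 (by linarith : 0 ≤ 1 - σ)
              linarith
          have h6 := mul_nonneg hσ.le (by linarith : 0 ≤ (k₁ : ℝ) - k₂)
          linarith
  · refine le_trans ?_ le_add_self
    have h1' : (k : ℝ) ≤ k₁ + 2 := by exact_mod_cast h1
    have h3' : (k₁ : ℝ) ≤ k + 2 := by exact_mod_cast h3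
    calc _ ≤ e2 (k * s) * (1 * (X k₁ * (e2 (-(k₂ * 1)) * seqNorm 1 Y))) := by gcongr
      _ = e2 (k * s) * X k₁ * (e2 (-(1 * k₂)) * seqNorm 1 Y) := by rw [mul_comm (k₂ : ℝ) 1]; ring
      _ ≤ _ := by
          refine mul_le_mul_left ?_ _
          rw [← mul_assoc, ← mul_assoc, ← e2_add, ← e2_add]
          refine mul_le_mul_left ?_ _
          refine e2_mono ?_
          have h4 : |(k : ℝ) - k₁| ≤ 2 := abs_le.mpr ⟨by linarith, by linarith⟩
          have := mul_nonneg (by linarith : (0 : ℝ) ≤ k₁ + 2 - k) (by linarith : 0 ≤ s)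
          linarith
  · simp
  · simp

/-- The resonant part is summed absolutely. In the separated part the dominating factor must keep
its `ℓ²` structure, which Schur's test in `k` and `k₁` provides, while the low factor is summed in
`ℓ¹`. -/
theorem exists_seqNorm_para_le {s σ : ℝ} (hσ : 0 < σ) (hσ1 : σ ≤ 1) (hσs : σ ≤ s - 1) :
    ∃ C : ℝ≥0, ∀ X Y : ℕ → ℝ≥0∞,
      seqNorm s (fun k ↦ ∑' p : ℕ × ℕ, blockWeight (1 / 2 - σ / 14) p.1 p.2 k * para X Y p.1 p.2) ≤
        C * (seqNorm s X * seqNorm 1 Y) := by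
  set S : ℝ≥0∞ := ∑' j : ℕ, e2 (-(σ / 8 * j)) with hS
  set S' : ℝ≥0∞ := ∑' j : ℕ, e2 (-(1 * j)) with hS'
  set S'' : ℝ≥0∞ := ∑' j : ℕ, e2 (-(σ / 4 * j)) with hS''
  have hSt : S ≠ ⊤ := (tsum_e2_lt_top (by positivity)).ne
  have hSt' : S' ≠ ⊤ := (tsum_e2_lt_top (by positivity)).ne
  have hSt'' : S'' ≠ ⊤ := (tsum_e2_lt_top (by positivity)).ne
  have hIt : e2Int 1 ≠ ⊤ := (e2Int_lt_top one_pos).ne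
  have hC : 2 * e2 (2 * s + 4) * (S ^ 2 * S'' + S' * e2Int 1) ≠ ⊤ := by
    have := e2_ne_top (2 * s + 4)
    finiteness
  refine ⟨(2 * e2 (2 * s + 4) * (S ^ 2 * S'' + S' * e2Int 1)).toNNReal, fun X Y ↦ ?_⟩
  rw [ENNReal.coe_toNNReal hC]
  set A := seqNorm s X
  set B := seqNorm 1 Y
  have hk : ∀ k : ℕ, e2 (k * s) *
      ∑' p : ℕ × ℕ, blockWeight (1 / 2 - σ / 14) p.1 p.2 k * para X Y p.1 p.2 ≤
      e2 (2 * s + 4) * S ^ 2 * (A * B) * e2 (-(σ / 4 * k)) +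
      e2 (2 * s + 4) * S' * B *
        ∑' k₁ : ℕ, e2 (-(1 * |(k : ℝ) - k₁|)) * (e2 (k₁ * s) * X k₁) := fun k ↦ by
    have hp : ∀ p : ℕ × ℕ,
        e2 (k * s) * (blockWeight (1 / 2 - σ / 14) p.1 p.2 k * para X Y p.1 p.2) ≤
        e2 (2 * s + 4) * (e2 (-(σ / 4 * k)) * (e2 (-(σ / 8 * p.1)) * e2 (-(σ / 8 * p.2)))) *
          (A * B) +
        e2 (2 * s + 4) * (e2 (-(1 * |(k : ℝ) - p.1|)) * (e2 (p.1 * s) * X p.1)) *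
          (e2 (-(1 * p.2)) * B) := fun p ↦ blockWeight_para_le hσ hσ1 hσs X Y p.1 p.2 k
    rw [← ENNReal.tsum_mul_left]
    refine (ENNReal.tsum_le_tsum hp).trans ?_
    rw [ENNReal.tsum_add]
    refine le_of_eq ?_
    congr 1
    · calc _ = ∑' p : ℕ × ℕ, (e2 (2 * s + 4) * e2 (-(σ / 4 * k)) * (A * B)) *
            (e2 (-(σ / 8 * p.1)) * e2 (-(σ / 8 * p.2))) := tsum_congr fun p ↦ by ring
        _ = _ := by
            rw [ENNReal.tsum_mul_left,
              tsum_prod_mul (fun j : ℕ ↦ e2 (-(σ / 8 * j))) fun j : ℕ ↦ e2 (-(σ / 8 * j)), ← hS]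
            ring
    · calc _ = ∑' p : ℕ × ℕ, (e2 (2 * s + 4) * B) *
            ((e2 (-(1 * |(k : ℝ) - p.1|)) * (e2 (p.1 * s) * X p.1)) * e2 (-(1 * p.2))) :=
            tsum_congr fun p ↦ by ring
        _ = _ := by
            rw [ENNReal.tsum_mul_left, tsum_prod_mul
              (fun j : ℕ ↦ e2 (-(1 * |(k : ℝ) - j|)) * (e2 (j * s) * X j))
              fun j : ℕ ↦ e2 (-(1 * j)), ← hS']
            ring
  have hz : ∀ z : ℕ → ℝ≥0∞, (∑' k : ℕ, z k ^ 2) ≤ (∑' k, z k) ^ 2 := fun z ↦ by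
    rw [sq (∑' k, z k), ← ENNReal.tsum_mul_right]
    refine ENNReal.tsum_le_tsum fun k ↦ ?_
    rw [sq]
    gcongr
    exact ENNReal.le_tsum k
  refine le_of_sq_le ?_
  rw [seqNorm_sq]
  calc _ ≤ ∑' k : ℕ, 4 * ((e2 (2 * s + 4) * S ^ 2 * (A * B)) ^ 2 * e2 (-(σ / 4 * k)) ^ 2 +
        (e2 (2 * s + 4) * S' * B) ^ 2 *
          (∑' k₁ : ℕ, e2 (-(1 * |(k : ℝ) - k₁|)) * (e2 (k₁ * s) * X k₁)) ^ 2) := by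
        refine ENNReal.tsum_le_tsum fun k ↦ (pow_le_pow_left' (hk k) 2).trans ?_
        refine (add_sq_le _ _).trans (le_of_eq ?_)
        rw [mul_pow _ (e2 _), mul_pow _ (∑' k₁ : ℕ, _)]
    _ = 4 * ((e2 (2 * s + 4) * S ^ 2 * (A * B)) ^ 2 * (∑' k : ℕ, e2 (-(σ / 4 * k)) ^ 2) +
        (e2 (2 * s + 4) * S' * B) ^ 2 *
          ∑' k : ℕ, (∑' k₁ : ℕ, e2 (-(1 * |(k : ℝ) - k₁|)) * (e2 (k₁ * s) * X k₁)) ^ 2) := by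
        rw [ENNReal.tsum_mul_left, ENNReal.tsum_add, ENNReal.tsum_mul_left, ENNReal.tsum_mul_left]
    _ ≤ 4 * ((e2 (2 * s + 4) * S ^ 2 * (A * B)) ^ 2 * S'' ^ 2 +
        (e2 (2 * s + 4) * S' * B) ^ 2 * (e2Int 1 ^ 2 * A ^ 2)) := by
        gcongr
        · exact hz _
        · refine (schur_tsum_le _).trans (le_of_eq ?_)
          rw [← seqNorm_sq]
    _ = 4 * e2 (2 * s + 4) ^ 2 * (A * B) ^ 2 * ((S ^ 2 * S'') ^ 2 + (S' * e2Int 1) ^ 2) := by ring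
    _ ≤ 4 * e2 (2 * s + 4) ^ 2 * (A * B) ^ 2 * ((S ^ 2 * S'') ^ 2 + (S' * e2Int 1) ^ 2 +
          2 * (S ^ 2 * S'') * (S' * e2Int 1)) := mul_le_mul_right le_self_add _
    _ = _ := by ring

/-- The resonant growth exponent is `11/2 - 7θ = 2 + σ/2`, below the decay exponent `s + 1 ≥ 2 + σ`
of the two comparable factors. Only finiteness matters here, since it merely produces the
distribution. -/
theorem tsum_blockGrowth_para_lt_top {s σ : ℝ} (hσ : 0 < σ) (hσs : σ ≤ s - 1)
    {X Y : ℕ → ℝ≥0∞} (hX : seqNorm s X < ⊤) (hY : seqNorm 1 Y < ⊤) :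
    ∑' p : ℕ × ℕ, blockGrowth (1 / 2 - σ / 14) p.1 p.2 * para X Y p.1 p.2 < ⊤ := by
  have hp : ∀ p : ℕ × ℕ, blockGrowth (1 / 2 - σ / 14) p.1 p.2 * para X Y p.1 p.2 ≤
      (e2 2 * (seqNorm s X * seqNorm 1 Y)) * (e2 (-(σ / 4 * p.1)) * e2 (-(σ / 4 * p.2)) +
        e2 (-(1 * p.1)) * e2 (-(1 * p.2))) := fun p ↦ by
    have hY := le_e2_mul_seqNorm 1 Y p.2
    have hX := le_e2_mul_seqNorm s X p.1
    have h1 : (0 : ℝ) ≤ p.1 := by positivity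
    have h2 : (0 : ℝ) ≤ p.2 := by positivity
    have h3 := mul_nonneg h1 (by linarith : 0 ≤ s - 1 - σ)
    unfold para
    split_ifs with hk
    swap
    · simp
    unfold blockGrowth
    rw [max_eq_left hk]
    have hk' : (p.2 : ℝ) ≤ p.1 := by exact_mod_cast hk
    have h4 := mul_nonneg hσ.le (by linarith : 0 ≤ (p.1 : ℝ) - p.2)
    split_ifs with hr
    · have h2' : (p.1 : ℝ) ≤ p.2 + 2 := by exact_mod_cast hr.1
      calc _ ≤ e2 ((11 / 2 - 7 * (1 / 2 - σ / 14)) * p.1) *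
            ((e2 (-(p.1 * s)) * seqNorm s X) * (e2 (-(p.2 * 1)) * seqNorm 1 Y)) := by gcongr
        _ = e2 ((11 / 2 - 7 * (1 / 2 - σ / 14)) * p.1) * e2 (-(p.1 * s)) * e2 (-(p.2 * 1)) *
            (seqNorm s X * seqNorm 1 Y) := by ring
        _ ≤ (e2 2 * (e2 (-(σ / 4 * p.1)) * e2 (-(σ / 4 * p.2)))) * (seqNorm s X * seqNorm 1 Y) := by
            refine mul_le_mul_left ?_ _
            rw [← e2_add, ← e2_add, ← e2_add, ← e2_add]
            refine e2_mono ?_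
            linarith
        _ = (e2 2 * (seqNorm s X * seqNorm 1 Y)) * (e2 (-(σ / 4 * p.1)) * e2 (-(σ / 4 * p.2))) := by
            ring
        _ ≤ _ := mul_le_mul_right le_self_add _
    · have h5 := mul_nonneg h1 hσ.le
      calc _ ≤ e2 (-(2 * p.1)) *
            ((e2 (-(p.1 * s)) * seqNorm s X) * (e2 (-(p.2 * 1)) * seqNorm 1 Y)) := by gcongr
        _ = e2 (-(2 * p.1)) * e2 (-(p.1 * s)) * e2 (-(p.2 * 1)) *
            (seqNorm s X * seqNorm 1 Y) := by ring
        _ ≤ (e2 2 * (e2 (-(1 * p.1)) * e2 (-(1 * p.2)))) * (seqNorm s X * seqNorm 1 Y) := by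
            refine mul_le_mul_left ?_ _
            rw [← e2_add, ← e2_add, ← e2_add, ← e2_add]
            refine e2_mono ?_
            linarith
        _ = (e2 2 * (seqNorm s X * seqNorm 1 Y)) * (e2 (-(1 * p.1)) * e2 (-(1 * p.2))) := by
            ring
        _ ≤ _ := mul_le_mul_right le_add_self _
  refine (ENNReal.tsum_le_tsum hp).trans_lt ?_
  have hS := (tsum_e2_lt_top (by positivity : 0 < σ / 4)).ne
  have hS' := (tsum_e2_lt_top one_pos).ne
  have := e2_ne_top 2
  have := hX.ne
  have := hY.ne
  rw [ENNReal.tsum_mul_left, ENNReal.tsum_add,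
    tsum_prod_mul (fun j : ℕ ↦ e2 (-(σ / 4 * j))) fun j : ℕ ↦ e2 (-(σ / 4 * j)),
    tsum_prod_mul (fun j : ℕ ↦ e2 (-(1 * j))) fun j : ℕ ↦ e2 (-(1 * j))]
  finiteness

/-! ### Convergent series of distributions -/

/-- Eight powers of decay are used: five for the weight and three to make `(1 + |w|)^(-3)` square
integrable on the plane. -/
theorem exists_testNorm_le : ∃ C : ℝ≥0, ∀ ψ : 𝓢(Plane, ℂ), testNorm ψ ≤
    C * ENNReal.ofReal ((Finset.Iic ((8, 0) : ℕ × ℕ)).sup (schwartzSeminormFamily ℂ Plane ℂ) ψ) := by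
  set J : ℝ × ℝ → ℝ≥0∞ := fun w ↦ ENNReal.ofReal ((1 + ‖toPlane w‖) ^ (-3 : ℝ)) with hJ
  have htm := continuous_toPlane.measurable
  have hJm : Measurable J := by fun_prop
  have hJt : n2 J ≠ ⊤ := by
    have h1 : ∫⁻ w, J w ^ 2 = ∫⁻ z : Plane, ENNReal.ofReal ((1 + ‖z‖) ^ (-6 : ℝ)) := by
      rw [← measurePreserving_toPlane.lintegral_comp (by fun_prop)]
      refine lintegral_congr fun w ↦ ?_
      rw [hJ, ← ENNReal.ofReal_pow (by positivity), ← Real.rpow_natCast, ← Real.rpow_mul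
        (by positivity)]
      norm_num
    have h2 : ∫⁻ z : Plane, ENNReal.ofReal ((1 + ‖z‖) ^ (-6 : ℝ)) < ⊤ :=
      finite_integral_one_add_norm (by simp; norm_num)
    rw [n2, h1]
    exact ENNReal.rpow_ne_top_of_nonneg (by norm_num) h2.ne
  refine ⟨2 ^ 8 * (n2 J).toNNReal, fun ψ ↦ ?_⟩
  set q := (Finset.Iic ((8, 0) : ℕ × ℕ)).sup (schwartzSeminormFamily ℂ Plane ℂ) ψ with hq
  have hpt : ∀ w : ℝ × ℝ, ENNReal.ofReal ((1 + ‖toPlane w‖) ^ 5) * ‖ψ (toPlane w)‖ₑ ≤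
      (2 ^ 8 * ENNReal.ofReal q) * J w := fun w ↦ by
    have h := SchwartzMap.one_add_le_sup_seminorm_apply (𝕜 := ℂ) (m := (8, 0)) (k := 8) (n := 0)
      le_rfl le_rfl ψ (toPlane w)
    rw [norm_iteratedFDeriv_zero] at h
    have h' : (1 + ‖toPlane w‖) ^ 8 * ‖ψ (toPlane w)‖ ≤ 2 ^ 8 * q := h
    have hp : 0 < 1 + ‖toPlane w‖ := by positivity
    have h3 : (1 + ‖toPlane w‖) ^ 5 * ‖ψ (toPlane w)‖ ≤
        2 ^ 8 * q * (1 + ‖toPlane w‖) ^ (-3 : ℝ) := by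
      rw [Real.rpow_neg hp.le, ← div_eq_mul_inv, le_div_iff₀ (by positivity)]
      norm_cast
      calc _ = (1 + ‖toPlane w‖) ^ 8 * ‖ψ (toPlane w)‖ := by ring
        _ ≤ _ := by exact_mod_cast h'
    rw [← ofReal_norm, ← ENNReal.ofReal_mul (by positivity), hJ]
    refine (ENNReal.ofReal_le_ofReal h3).trans (le_of_eq ?_)
    rw [ENNReal.ofReal_mul (mul_nonneg (by positivity) (apply_nonneg _ _)),
      ENNReal.ofReal_mul (by positivity), ENNReal.ofReal_pow (by norm_num), ENNReal.ofReal_ofNat]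
  calc testNorm ψ ≤ _ := n2_mono hpt
    _ = 2 ^ 8 * ENNReal.ofReal q * n2 J := n2_const_mul _ _ hJm
    _ = _ := by
      rw [ENNReal.coe_mul, ENNReal.coe_toNNReal hJt]
      push_cast
      ring

/-- Continuity of the pointwise sum follows from the bound by a single Schwartz seminorm. The bound
involves `𝓕⁻ φ`, so the functional is constructed on the Fourier side and transported back. -/
theorem exists_isDistSum {ι : Type*} {D : ι → 𝓢'(Plane, ℂ)} {b : ι → ℝ≥0∞} (hb : ∑' i, b i < ⊤)
    (hD : ∀ i φ, ‖D i φ‖ₑ ≤ b i * testNorm (𝓕⁻ φ)) : ∃ f, IsDistSum D f := by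
  obtain ⟨C, hC⟩ := exists_testNorm_le
  have hle : ∀ φ, ∑' i, ‖D i φ‖ₑ ≤ (∑' i, b i) * testNorm (𝓕⁻ φ) := fun φ ↦ by
    rw [← ENNReal.tsum_mul_right]
    exact ENNReal.tsum_le_tsum fun i ↦ hD i φ
  have hlt : ∀ φ : 𝓢(Plane, ℂ), (∑' i, b i) * testNorm (𝓕⁻ φ) < ⊤ := fun φ ↦
    ENNReal.mul_lt_top hb ((hC _).trans_lt (ENNReal.mul_lt_top (by simp) (by simp)))
  have hs : ∀ φ, Summable fun i ↦ D i φ := fun φ ↦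
    summable_of_tsum_enorm_lt_top ((hle φ).trans_lt (hlt φ))
  have hs' : ∀ ψ : 𝓢(Plane, ℂ), Summable fun i ↦ D i (𝓕 ψ) := fun ψ ↦ hs _
  let L : 𝓢(Plane, ℂ) →L[ℂ] ℂ := SchwartzMap.mkCLMtoNormedSpace (𝕜 := ℂ) (𝕜' := ℂ) (σ := RingHom.id ℂ)
    (fun ψ ↦ ∑' i, D i (𝓕 ψ))
    (fun ψ₁ ψ₂ ↦ by
      rw [← (hs' ψ₁).tsum_add (hs' ψ₂)]
      refine tsum_congr fun i ↦ ?_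
      rw [FourierTransform.fourier_add, map_add])
    (fun a ψ ↦ by
      rw [RingHom.id_apply, smul_eq_mul, ← tsum_mul_left]
      refine tsum_congr fun i ↦ ?_
      rw [FourierTransform.fourier_smul, map_smul, smul_eq_mul])
    ⟨Finset.Iic (8, 0), ((∑' i, b i) * C).toReal, ENNReal.toReal_nonneg, fun ψ ↦ by
      have h1 : ‖∑' i, D i (𝓕 ψ)‖ₑ ≤ (∑' i, b i) * C * ENNReal.ofReal
          ((Finset.Iic ((8, 0) : ℕ × ℕ)).sup (schwartzSeminormFamily ℂ Plane ℂ) ψ) := by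
        refine enorm_tsum_le_tsum_enorm.trans ((hle _).trans ?_)
        rw [FourierTransform.fourierInv_fourier_eq, mul_assoc]
        gcongr
        exact hC ψ
      rw [← toReal_enorm]
      refine (ENNReal.toReal_mono (by finiteness) h1).trans (le_of_eq ?_)
      rw [ENNReal.toReal_mul, ENNReal.toReal_ofReal (apply_nonneg _ _)]⟩
  let f₀ : 𝓢'(Plane, ℂ) := ContinuousLinearMap.toPointwiseConvergenceCLM ℂ (RingHom.id ℂ) _ _ L
  refine ⟨𝓕⁻ f₀, fun φ ↦ ?_⟩
  have h2 : (𝓕⁻ f₀ : 𝓢'(Plane, ℂ)) φ = ∑' i, D i φ := by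
    rw [TemperedDistribution.fourierInv_apply]
    change ∑' i, D i (𝓕 (𝓕⁻ φ : 𝓢(Plane, ℂ))) = _
    rw [FourierTransform.fourier_fourierInv_eq]
  rw [h2]
  exact (hs φ).hasSum

theorem fNorm_eq_seqNorm (η : ℝ → ℝ) (s : ℝ) (f : 𝓢'(Plane, ℂ)) :
    fNorm η 2 s f = seqNorm s fun k ↦ fkNorm η 2 k (projK η k f) := rfl

theorem IsDistSum.nNorm_le {ι : Type*} {D : ι → 𝓢'(Plane, ℂ)} {f : 𝓢'(Plane, ℂ)}
    (h : IsDistSum D f) (η : ℝ → ℝ) (s : ℝ) :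
    nNorm η 2 s f ≤ seqNorm s fun k ↦ ∑' i, nkNorm η 2 k (ShortTime.projK η k (D i)) :=
  seqNorm_mono s fun k ↦ (h.projK η k).nkNorm_le η 2 k

theorem nNorm_add_le (η : ℝ → ℝ) (s : ℝ) (f g : 𝓢'(Plane, ℂ)) :
    nNorm η 2 s (f + g) ≤ 2 * (nNorm η 2 s f + nNorm η 2 s g) := by
  have h : IsDistSum (fun i : Bool ↦ bif i then f else g) (f + g) := fun φ ↦ by
    have := hasSum_fintype fun i : Bool ↦ (bif i then f else g : 𝓢'(Plane, ℂ)) φ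
    rw [Fintype.sum_bool] at this
    exact this
  refine (h.nNorm_le η s).trans ?_
  have e : ∀ k, ∑' i : Bool, nkNorm η 2 k (projK η k (bif i then f else g)) =
      nkNorm η 2 k (projK η k f) + nkNorm η 2 k (projK η k g) := fun k ↦ by
    rw [tsum_bool, add_comm]
    rfl
  simp_rw [e]
  exact seqNorm_add_le s _ _

/-- The sum of all interactions of frequency-localized pieces. -/
theorem IsCutoff.exists_sum_blocks {η : ℝ → ℝ} (hη : IsCutoff η) {θ : ℝ} (h0 : 0 < θ)
    (h1 : θ < 1 / 2) (s : ℝ) :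
    ∃ C : ℝ≥0, ∀ a b : ℕ, a + b = 3 → ∀ (x y Z : ℕ × ℕ → ℝ≥0∞) (P Q : ℕ × ℕ → ℝ → ℝ → ℂ),
    (∀ p, x p < ⊤) → (∀ p, y p < ⊤) → (∀ p, LocRep η p.1 a (x p) (P p)) →
    (∀ p, LocRep η p.2 b (y p) (Q p)) → (∀ p, x p * y p ≤ Z p) →
    ∑' p, blockGrowth θ p.1 p.2 * Z p < ⊤ →
    ∃ (G : ℕ × ℕ → ℝ × ℝ → ℂ) (hG : ∀ p, Integrable (G p) volume) (f : 𝓢'(Plane, ℂ)),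
      (∀ p, ∀ᵐ t : ℝ, ∀ r : ℝ, ((η t ^ 2 : ℝ) : ℂ) * (P p t r * Q p t r) = ift (G p) (r, t)) ∧
      IsDistSum (fun p ↦ iftDist (hG p)) f ∧
      nNorm η 2 s f ≤ C * seqNorm s fun k ↦ ∑' p : ℕ × ℕ, blockWeight θ p.1 p.2 k * Z p := by
  obtain ⟨C, hC⟩ := hη.exists_block h0 h1
  refine ⟨C, fun a b hab x y Z P Q hx hy hP hQ hZ hfin ↦ ?_⟩
  choose G hG hrep hnk hgr using fun p : ℕ × ℕ ↦
    hC p.1 p.2 a b hab (x p) (y p) (hx p) (hy p) (P p) (Q p) (hP p) (hQ p)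
  have hb : ∑' p : ℕ × ℕ, C * (blockGrowth θ p.1 p.2 * Z p) < ⊤ := by
    rw [ENNReal.tsum_mul_left]
    exact ENNReal.mul_lt_top (by simp) hfin
  obtain ⟨f, hf⟩ := exists_isDistSum (D := fun p ↦ iftDist (hG p)) hb fun p φ ↦ by
    refine (hgr p φ).trans ?_
    rw [mul_assoc (C : ℝ≥0∞)]
    gcongr
    exact hZ p
  refine ⟨G, hG, f, hrep, hf, (hf.nNorm_le η s).trans ?_⟩
  rw [← seqNorm_const_mul]
  refine seqNorm_mono s fun k ↦ ?_
  rw [← ENNReal.tsum_mul_left]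
  refine ENNReal.tsum_le_tsum fun p ↦ (hnk p k).trans ?_
  gcongr
  exact hZ p

/-! ### The nonlinear terms as sums over blocks -/

theorem IsCutoff.integrable_pk_symbol {η : ℝ → ℝ} (hη : IsCutoff η) (a k : ℕ) (h : L2) :
    Integrable fun ξ : ℝ ↦ (2 * Real.pi * Complex.I * ξ : ℂ) ^ a *
      ((etaK η k (2 * Real.pi * ξ) : ℂ) * h ξ) := by
  have hc := hη.continuous_etaK k
  have hcont : Continuous fun ξ : ℝ ↦ (2 * Real.pi * Complex.I * ξ : ℂ) ^ a *
      (etaK η k (2 * Real.pi * ξ) : ℂ) := by fun_prop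
  have hsupp : HasCompactSupport fun ξ : ℝ ↦ (2 * Real.pi * Complex.I * ξ : ℂ) ^ a *
      (etaK η k (2 * Real.pi * ξ) : ℂ) := by
    refine HasCompactSupport.of_support_subset_isCompact
      (isCompact_Icc (a := -(8 / 5 * 2 ^ k : ℝ)) (b := 8 / 5 * 2 ^ k)) fun ξ hξ ↦ ?_
    have hne : etaK η k (2 * Real.pi * ξ) ≠ 0 := fun h0 ↦ hξ (by simp [h0])
    have h1 := hη.etaK_upper hne
    rw [abs_mul, abs_of_pos Real.two_pi_pos] at h1
    rw [Set.mem_Icc, ← abs_le]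
    have h2 : (1 : ℝ) ≤ 2 * Real.pi := by linarith [Real.pi_gt_three]
    nlinarith [abs_nonneg ξ]
  have hm : MemLp (fun ξ : ℝ ↦ (2 * Real.pi * Complex.I * ξ : ℂ) ^ a *
      (etaK η k (2 * Real.pi * ξ) : ℂ)) 2 volume := hcont.memLp_of_hasCompactSupport hsupp
  refine (hm.integrable_mul (Lp.memLp h)).congr (ae_of_all _ fun ξ ↦ ?_)
  simp only [Pi.mul_apply, mul_assoc]

theorem IsCutoff.hasDerivAt_pk {η : ℝ → ℝ} (hη : IsCutoff η) (a k : ℕ) (h : L2) (y : ℝ) :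
    HasDerivAt (pk η a k h) (pk η (a + 1) k h y) y := by
  set F : ℝ → ℂ := fun ξ ↦ (2 * Real.pi * Complex.I * ξ : ℂ) ^ a *
    ((etaK η k (2 * Real.pi * ξ) : ℂ) * (𝓕 h : L2) ξ) with hF
  have h1 : Integrable F := hη.integrable_pk_symbol a k _
  have h2 : Integrable fun ξ : ℝ ↦ ξ • F ξ := by
    refine ((hη.integrable_pk_symbol (a + 1) k (𝓕 h : L2)).const_mul
      (2 * Real.pi * Complex.I)⁻¹).congr (ae_of_all _ fun ξ ↦ ?_)
    have : (2 * Real.pi * Complex.I : ℂ) ≠ 0 := by simp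
    simp only [hF, Complex.real_smul]
    rw [pow_succ]
    field_simp
  have h3 := (Real.hasDerivAt_fourier h1 h2 (-y)).scomp y (hasDerivAt_neg y)
  have e1 : pk η a k h = 𝓕 F ∘ Neg.neg := by
    funext x
    rw [show pk η a k h x = 𝓕⁻ F x from rfl, Real.fourierInv_eq_fourier_neg, Function.comp]
  rw [e1]
  refine h3.congr_deriv ?_
  rw [show pk η (a + 1) k h y = 𝓕⁻ (fun ξ : ℝ ↦ (2 * Real.pi * Complex.I * ξ : ℂ) ^ (a + 1) *
    ((etaK η k (2 * Real.pi * ξ) : ℂ) * (𝓕 h : L2) ξ)) y from rfl]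
  rw [Real.fourierInv_eq_fourier_neg, fourier_eq_ch, fourier_eq_ch, neg_one_smul,
    ← integral_neg]
  refine integral_congr_ae (ae_of_all _ fun ξ ↦ ?_)
  dsimp only
  rw [hF, smul_eq_mul, pow_succ]
  ring

/-- The `a`-th derivative of `P_{≤ K} h`. -/
def plow (η : ℝ → ℝ) (a K : ℕ) (h : L2) (y : ℝ) : ℂ :=
  ∑ k ∈ Finset.range (K + 1), pk η a k h y

theorem IsCutoff.hasDerivAt_plow {η : ℝ → ℝ} (hη : IsCutoff η) (a K : ℕ) (h : L2) (y : ℝ) :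
    HasDerivAt (plow η a K h) (plow η (a + 1) K h y) y := by
  have := HasDerivAt.fun_sum fun k (_ : k ∈ Finset.range (K + 1)) ↦ hη.hasDerivAt_pk a k h y
  exact this

theorem IsCutoff.projLe_eq {η : ℝ → ℝ} (hη : IsCutoff η) (K : ℕ) (h : L2) :
    projLe η K h = plow η 0 K h := by
  funext y
  unfold projLe plow pk
  simp_rw [fourierInv_eq_ch]
  rw [← integral_finsetSum]
  · refine integral_congr_ae (ae_of_all _ fun ξ ↦ ?_)
    dsimp only
    rw [etaLe, ← Finset.mul_sum]
    simp_rw [pow_zero, one_mul]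
    rw [← Finset.sum_mul]
    push_cast
    rfl
  · exact fun k _ ↦ integrable_ch_mul (by fun_prop) (hη.integrable_pk_symbol 0 k _)

theorem IsCutoff.deriv_plow {η : ℝ → ℝ} (hη : IsCutoff η) (a K : ℕ) (h : L2) :
    deriv (plow η a K h) = plow η (a + 1) K h := funext fun y ↦ (hη.hasDerivAt_plow a K h y).deriv

theorem IsCutoff.iteratedDeriv_two_projLe {η : ℝ → ℝ} (hη : IsCutoff η) (K : ℕ) (h : L2) :
    iteratedDeriv 2 (projLe η K h) = plow η 2 K h := by
  rw [iteratedDeriv_succ, iteratedDeriv_one, hη.projLe_eq, hη.deriv_plow, hη.deriv_plow]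

theorem IsCutoff.prodNonDiv_eq {η : ℝ → ℝ} (hη : IsCutoff η) (u v : ℝ → L2) (K : ℕ) (t x : ℝ) :
    prodNonDiv η u v K t x = plow η 1 K (u t) x * plow η 2 K (v t) x := by
  rw [prodNonDiv, hη.iteratedDeriv_two_projLe, hη.projLe_eq, hη.deriv_plow]

theorem IsCutoff.prodDiv_eq {η : ℝ → ℝ} (hη : IsCutoff η) (u v : ℝ → L2) (K : ℕ) (t x : ℝ) :
    prodDiv η u v K t x = plow η 1 K (u t) x * plow η 2 K (v t) x +
      plow η 0 K (u t) x * plow η 3 K (v t) x := by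
  rw [prodDiv, hη.iteratedDeriv_two_projLe, hη.projLe_eq]
  exact ((hη.hasDerivAt_plow 0 K (u t) x).mul (hη.hasDerivAt_plow 2 K (v t) x)).deriv

theorem plow_mul_plow (η : ℝ → ℝ) (a b K : ℕ) (g h : L2) (x : ℝ) :
    plow η a K g x * plow η b K h x =
      ∑ p ∈ Finset.range (K + 1) ×ˢ Finset.range (K + 1), pk η a p.1 g x * pk η b p.2 h x := by
  rw [plow, plow, Finset.sum_mul_sum, Finset.sum_product]

/-! ### The limit on the slab -/

theorem tendsto_squares : Tendsto (fun K : ℕ ↦ Finset.range (K + 1) ×ˢ Finset.range (K + 1))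
    atTop atTop := by
  refine tendsto_atTop_finset_of_monotone (fun K L h ↦ ?_) fun p ↦ ⟨max p.1 p.2, ?_⟩
  · exact Finset.product_subset_product (by simpa using h) (by simpa using h)
  · simp

theorem integral_iftDist {G : ℝ × ℝ → ℂ} (hG : Integrable G volume) (φ : 𝓢(Plane, ℂ)) :
    Integrable (fun z : ℝ × ℝ ↦ ift G z * φ (toPlane z)) volume ∧
    iftDist hG φ = ∫ t : ℝ, ∫ x : ℝ, ift G (x, t) * φ !₂[x, t] := by
  have hφ : Integrable fun z : ℝ × ℝ ↦ φ (toPlane z) :=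
    measurePreserving_toPlane.integrable_comp_of_integrable φ.integrable
  have hi : Integrable (fun z : ℝ × ℝ ↦ ift G z * φ (toPlane z)) volume :=
    hφ.bdd_mul (continuous_ift hG).aestronglyMeasurable (ae_of_all _ (norm_ift_le G))
  refine ⟨hi, ?_⟩
  rw [iftDist_apply']
  rw [Measure.volume_eq_prod] at hi ⊢
  rw [integral_prod_symm _ hi]
  rfl

/-- On the slab `η = 1` because `T ≤ 1 < 5/4`, and every chosen extension agrees with `u` or `v`.
The truncated product is thus the finite sum of blocks over a square of indices, and squares exhaust
the index set of the convergent series. The finite set `S` lists the orders of differentiation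
produced by the Leibniz rule. -/
theorem IsCutoff.isSlabLimit {η : ℝ → ℝ} (hη : IsCutoff η) {T : ℝ} (hT : T ≤ 1)
    (S : Finset (ℕ × ℕ)) {u v : ℝ → L2} {U V : ℕ × ℕ → ℝ → L2}
    (hU : ∀ p, U p =ᵐ[volume.restrict (Set.Icc (-T) T)] u)
    (hV : ∀ p, V p =ᵐ[volume.restrict (Set.Icc (-T) T)] v)
    {G : ℕ × ℕ → ℕ × ℕ → ℝ × ℝ → ℂ} (hG : ∀ c p, Integrable (G c p) volume)
    {f : ℕ × ℕ → 𝓢'(Plane, ℂ)}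
    (hrep : ∀ c ∈ S, ∀ p, ∀ᵐ t : ℝ, ∀ r : ℝ, ((η t ^ 2 : ℝ) : ℂ) *
      (pk η c.1 p.1 (U p t) r * pk η c.2 p.2 (V p t) r) = ift (G c p) (r, t))
    (hf : ∀ c ∈ S, IsDistSum (fun p ↦ iftDist (hG c p)) (f c)) :
    IsSlabLimit T (fun K t x ↦ ∑ c ∈ S, plow η c.1 K (u t) x * plow η c.2 K (v t) x)
      (∑ c ∈ S, f c) := by
  intro φ _ hφ
  have hφ0 : ∀ t, t ∉ Set.Icc (-T) T → ∀ x, φ !₂[x, t] = 0 := fun t ht x ↦ by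
    by_contra hne
    have := hφ (subset_tsupport _ hne)
    exact ht (Set.Ioo_subset_Icc_self (by simpa using this))
  have hη1 : ∀ t ∈ Set.Icc (-T) T, η t = 1 := fun t ht ↦
    hη.eq_one t ⟨by linarith [ht.1], by linarith [ht.2]⟩
  have hsum : ∀ K, ∫ t in Set.Icc (-T) T, ∫ x : ℝ,
      (∑ c ∈ S, plow η c.1 K (u t) x * plow η c.2 K (v t) x) * φ !₂[x, t] =
      ∑ c ∈ S, ∑ p ∈ Finset.range (K + 1) ×ˢ Finset.range (K + 1), iftDist (hG c p) φ := fun K ↦ by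
    set Q := Finset.range (K + 1) ×ˢ Finset.range (K + 1)
    have h1 : ∀ᵐ t ∂(volume.restrict (Set.Icc (-T) T)), ∀ x : ℝ,
        (∑ c ∈ S, plow η c.1 K (u t) x * plow η c.2 K (v t) x) * φ !₂[x, t] =
        ∑ c ∈ S, ∑ p ∈ Q, ift (G c p) (x, t) * φ !₂[x, t] := by
      have h2 : ∀ᵐ t ∂(volume.restrict (Set.Icc (-T) T)), ∀ p, U p t = u t := ae_all_iff.mpr hU
      have h3 : ∀ᵐ t ∂(volume.restrict (Set.Icc (-T) T)), ∀ p, V p t = v t := ae_all_iff.mpr hV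
      have h4 : ∀ᵐ t : ℝ, ∀ c ∈ S, ∀ p, ∀ r : ℝ, ((η t ^ 2 : ℝ) : ℂ) *
          (pk η c.1 p.1 (U p t) r * pk η c.2 p.2 (V p t) r) = ift (G c p) (r, t) :=
        (Finset.eventually_all S).mpr fun c hc ↦ ae_all_iff.mpr (hrep c hc)
      filter_upwards [h2, h3, ae_restrict_of_ae h4, ae_restrict_mem measurableSet_Icc]
        with t h2 h3 h4 ht x
      rw [Finset.sum_mul]
      refine Finset.sum_congr rfl fun c hc ↦ ?_
      rw [plow_mul_plow, Finset.sum_mul]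
      refine Finset.sum_congr rfl fun p _ ↦ ?_
      rw [← h4 c hc p x, h2, h3, hη1 t ht]
      simp
    have hint : ∀ c p, Integrable (fun z : ℝ × ℝ ↦ ift (G c p) z * φ (toPlane z)) volume :=
      fun c p ↦ (integral_iftDist (hG c p) φ).1
    have h5 : Integrable (fun z : ℝ × ℝ ↦ ∑ c ∈ S, ∑ p ∈ Q, ift (G c p) z * φ (toPlane z))
        volume := integrable_finsetSum _ fun c _ ↦ integrable_finsetSum _ fun p _ ↦ hint c p
    calc _ = ∫ t in Set.Icc (-T) T, ∫ x : ℝ, ∑ c ∈ S, ∑ p ∈ Q, ift (G c p) (x, t) * φ !₂[x, t] := by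
          refine integral_congr_ae ?_
          filter_upwards [h1] with t ht
          exact integral_congr_ae (ae_of_all _ ht)
      _ = ∫ t : ℝ, ∫ x : ℝ, ∑ c ∈ S, ∑ p ∈ Q, ift (G c p) (x, t) * φ !₂[x, t] := by
          refine setIntegral_eq_integral_of_forall_compl_eq_zero fun t ht ↦ ?_
          simp [hφ0 t ht]
      _ = ∫ z : ℝ × ℝ, ∑ c ∈ S, ∑ p ∈ Q, ift (G c p) z * φ (toPlane z) := by
          rw [Measure.volume_eq_prod] at h5 ⊢
          rw [integral_prod_symm _ h5]
          rfl
      _ = _ := by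
          rw [integral_finsetSum _ fun c _ ↦ integrable_finsetSum _ fun p _ ↦ hint c p]
          refine Finset.sum_congr rfl fun c _ ↦ ?_
          rw [integral_finsetSum _ fun p _ ↦ hint c p]
          refine Finset.sum_congr rfl fun p _ ↦ ?_
          rw [iftDist_apply']
  refine Tendsto.congr (fun K ↦ (hsum K).symm) ?_
  have hfs : (∑ c ∈ S, f c) φ = ∑ c ∈ S, f c φ := by
    exact map_sum (PointwiseConvergenceCLM.evalCLM (RingHom.id ℂ) ℂ φ) f S
  rw [hfs]
  exact tendsto_finsetSum _ fun c hc ↦ (hf c hc φ).comp tendsto_squares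

/-! ### Sums of blocks built from several extensions -/

theorem seqNorm_mono_exp {s t : ℝ} (h : s ≤ t) (X : ℕ → ℝ≥0∞) : seqNorm s X ≤ seqNorm t X := by
  refine ENNReal.rpow_le_rpow (ENNReal.tsum_le_tsum fun k ↦ ?_) (by norm_num)
  gcongr
  exact e2_mono (by gcongr)

theorem fNorm_mono {s t : ℝ} (h : s ≤ t) (η : ℝ → ℝ) (f : 𝓢'(Plane, ℂ)) :
    fNorm η 2 s f ≤ fNorm η 2 t f := seqNorm_mono_exp h _

theorem fkNorm_lt_top {η : ℝ → ℝ} {s : ℝ} {f : 𝓢'(Plane, ℂ)} (h : fNorm η 2 s f < ⊤) (k : ℕ) :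
    fkNorm η 2 k (projK η k f) < ⊤ :=
  (le_e2_mul_seqNorm s (fun k ↦ fkNorm η 2 k (projK η k f)) k).trans_lt
    (ENNReal.mul_lt_top (e2_ne_top _).lt_top h)

/-- The part of a sequence above `K`. -/
def tail (K : ℕ) (X : ℕ → ℝ≥0∞) (k : ℕ) : ℝ≥0∞ := if K < k then X k else 0

theorem tail_le (K : ℕ) (X : ℕ → ℝ≥0∞) (k : ℕ) : tail K X k ≤ X k := by
  unfold tail
  split_ifs
  · exact le_rfl
  · exact zero_le

theorem tendsto_seqNorm_tail {s : ℝ} {X : ℕ → ℝ≥0∞} (h : seqNorm s X < ⊤) :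
    Tendsto (fun K ↦ seqNorm s (tail K X)) atTop (𝓝 0) := by
  have h1 : ∑' k : ℕ, e2 (2 * k * s) * X k ^ 2 ≠ ⊤ := fun htop ↦ by
    rw [seqNorm, htop, ENNReal.top_rpow_of_pos (by norm_num)] at h
    exact lt_irrefl _ h
  have h2 := (ENNReal.tendsto_tsum_compl_atTop_zero h1).comp
    (tendsto_finset_range.comp (tendsto_add_atTop_nat 1))
  have h3 := (ENNReal.continuous_rpow_const (y := 1 / 2)).continuousAt.tendsto.comp h2
  rw [ENNReal.zero_rpow_of_pos (by norm_num)] at h3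
  refine h3.congr fun K ↦ ?_
  simp only [Function.comp, seqNorm]
  congr 1
  refine (tsum_subtype {k | k ∉ Finset.range (K + 1)} fun k : ℕ ↦ e2 (2 * k * s) * X k ^ 2).trans ?_
  refine tsum_congr fun k ↦ ?_
  by_cases hk : K < k
  · rw [Set.indicator_of_mem (by simpa using hk), tail, if_pos hk]
  · rw [Set.indicator_of_notMem (by simpa using hk), tail, if_neg hk]
    simp

theorem tsum_blockWeight_swap (θ : ℝ) (k : ℕ) (X Y : ℕ → ℝ≥0∞) :
    ∑' p : ℕ × ℕ, blockWeight θ p.1 p.2 k * para X Y p.2 p.1 =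
      ∑' p : ℕ × ℕ, blockWeight θ p.1 p.2 k * para X Y p.1 p.2 := by
  rw [← (Equiv.prodComm ℕ ℕ).tsum_eq]
  refine tsum_congr fun p ↦ ?_
  rw [blockWeight_comm]
  rfl

theorem tsum_blockGrowth_swap (θ : ℝ) (X Y : ℕ → ℝ≥0∞) :
    ∑' p : ℕ × ℕ, blockGrowth θ p.1 p.2 * para X Y p.2 p.1 =
      ∑' p : ℕ × ℕ, blockGrowth θ p.1 p.2 * para X Y p.1 p.2 := by
  rw [← (Equiv.prodComm ℕ ℕ).tsum_eq]
  refine tsum_congr fun p ↦ ?_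
  rw [blockGrowth_comm]
  rfl

/-- For each pair of frequencies up to `K` a choice depending on which one dominates, and a third
choice for the remaining pairs. -/
def pick {α : Type*} (K : ℕ) (x y z : α) (p : ℕ × ℕ) : α :=
  if p.1 ≤ K ∧ p.2 ≤ K then (if p.2 ≤ p.1 then x else y) else z

theorem pick_rec {α : Type*} {x y z : α} {C : α → Prop} (hx : C x) (hy : C y) (hz : C z) (K : ℕ)
    (p : ℕ × ℕ) : C (pick K x y z p) := by
  unfold pick
  split_ifs <;> assumption

/-- Outside the square the larger of the two indices exceeds `K`, so the dominating factor may be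
replaced by its tail. -/
theorem pick_mul_le (K : ℕ) (X₁ X₂ X₃ Y₁ Y₂ Y₃ : ℕ → ℝ≥0∞) (p : ℕ × ℕ) :
    pick K X₁ X₂ X₃ p p.1 * pick K Y₁ Y₂ Y₃ p p.2 ≤
      (para X₁ Y₁ p.1 p.2 + para Y₂ X₂ p.2 p.1) +
        (para (tail K X₃) Y₃ p.1 p.2 + para (tail K Y₃) X₃ p.2 p.1) := by
  unfold pick
  split_ifs with h1 h2
  · refine le_trans ?_ le_self_add
    refine le_trans ?_ le_self_add
    rw [para, if_pos h2]
  · refine le_trans ?_ le_self_add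
    refine le_trans ?_ le_add_self
    rw [para, if_pos (by omega), mul_comm]
  · refine le_trans ?_ le_add_self
    by_cases h : p.2 ≤ p.1
    · refine le_trans ?_ le_self_add
      rw [para, if_pos h, tail, if_pos (by omega)]
    · refine le_trans ?_ le_add_self
      rw [para, if_pos (by omega), tail, if_pos (by omega), mul_comm]

theorem exists_seqNorm_pick_le {s : ℝ} (hs : 1 < s) : ∃ θ : ℝ, 0 < θ ∧ θ < 1 / 2 ∧ ∃ C : ℝ≥0,
    ∀ (K : ℕ) (X₁ X₂ X₃ Y₁ Y₂ Y₃ : ℕ → ℝ≥0∞), seqNorm s X₁ < ⊤ → seqNorm 1 X₂ < ⊤ →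
      seqNorm s X₃ < ⊤ → seqNorm 1 Y₁ < ⊤ → seqNorm s Y₂ < ⊤ → seqNorm s Y₃ < ⊤ →
    ∃ Z : ℕ × ℕ → ℝ≥0∞,
      (∀ p, pick K X₁ X₂ X₃ p p.1 * pick K Y₁ Y₂ Y₃ p p.2 ≤ Z p) ∧
      ∑' p : ℕ × ℕ, blockGrowth θ p.1 p.2 * Z p < ⊤ ∧
      seqNorm s (fun k ↦ ∑' p : ℕ × ℕ, blockWeight θ p.1 p.2 k * Z p) ≤
        C * ((seqNorm s X₁ * seqNorm 1 Y₁ + seqNorm 1 X₂ * seqNorm s Y₂) +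
          (seqNorm s (tail K X₃) * seqNorm s Y₃ + seqNorm s X₃ * seqNorm s (tail K Y₃))) := by
  -- Both constraints on `σ` are those of the paraproduct bound; `σ ≤ 1` also keeps `θ = 1/2 - σ/14`
  -- positive.
  set σ : ℝ := min (s - 1) 1 with hσdef
  have hσ : 0 < σ := lt_min (by linarith) one_pos
  have hσ1 : σ ≤ 1 := min_le_right _ _
  have hσs : σ ≤ s - 1 := min_le_left _ _
  obtain ⟨C, hC⟩ := exists_seqNorm_para_le hσ hσ1 hσs
  refine ⟨1 / 2 - σ / 14, by linarith, by linarith, 4 * C, ?_⟩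
  intro K X₁ X₂ X₃ Y₁ Y₂ Y₃ hX₁ hX₂ hX₃ hY₁ hY₂ hY₃
  have htail : ∀ {X : ℕ → ℝ≥0∞}, seqNorm s X < ⊤ → seqNorm s (tail K X) < ⊤ := fun h ↦
    (seqNorm_mono s (tail_le K _)).trans_lt h
  have hone : ∀ X : ℕ → ℝ≥0∞, seqNorm 1 X ≤ seqNorm s X := fun X ↦ seqNorm_mono_exp hs.le X
  refine ⟨_, pick_mul_le K X₁ X₂ X₃ Y₁ Y₂ Y₃, ?_, ?_⟩
  · simp_rw [mul_add]
    rw [ENNReal.tsum_add, ENNReal.tsum_add, ENNReal.tsum_add, tsum_blockGrowth_swap,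
      tsum_blockGrowth_swap]
    refine ENNReal.add_lt_top.mpr ⟨ENNReal.add_lt_top.mpr ⟨?_, ?_⟩,
      ENNReal.add_lt_top.mpr ⟨?_, ?_⟩⟩
    · exact tsum_blockGrowth_para_lt_top hσ hσs hX₁ hY₁
    · exact tsum_blockGrowth_para_lt_top hσ hσs hY₂ hX₂
    · exact tsum_blockGrowth_para_lt_top hσ hσs (htail hX₃) ((hone _).trans_lt hY₃)
    · exact tsum_blockGrowth_para_lt_top hσ hσs (htail hY₃) ((hone _).trans_lt hX₃)
  · have e : ∀ k, ∑' p : ℕ × ℕ, blockWeight (1 / 2 - σ / 14) p.1 p.2 k *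
        ((para X₁ Y₁ p.1 p.2 + para Y₂ X₂ p.2 p.1) +
          (para (tail K X₃) Y₃ p.1 p.2 + para (tail K Y₃) X₃ p.2 p.1)) =
        ((∑' p : ℕ × ℕ, blockWeight (1 / 2 - σ / 14) p.1 p.2 k * para X₁ Y₁ p.1 p.2) +
          ∑' p : ℕ × ℕ, blockWeight (1 / 2 - σ / 14) p.1 p.2 k * para Y₂ X₂ p.1 p.2) +
        ((∑' p : ℕ × ℕ, blockWeight (1 / 2 - σ / 14) p.1 p.2 k * para (tail K X₃) Y₃ p.1 p.2) +
          ∑' p : ℕ × ℕ, blockWeight (1 / 2 - σ / 14) p.1 p.2 k * para (tail K Y₃) X₃ p.1 p.2) :=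
      fun k ↦ by
        simp_rw [mul_add]
        rw [ENNReal.tsum_add, ENNReal.tsum_add, ENNReal.tsum_add, tsum_blockWeight_swap,
          tsum_blockWeight_swap]
    simp_rw [e]
    have h1 := hC X₁ Y₁
    have h2 := hC Y₂ X₂
    have h3 := (hC (tail K X₃) Y₃).trans (mul_le_mul_right (mul_le_mul_right (hone Y₃) _) _)
    have h4 := (hC (tail K Y₃) X₃).trans (mul_le_mul_right (mul_le_mul_right (hone X₃) _) _)
    refine (seqNorm_add_le s _ _).trans ?_
    refine (mul_le_mul_right (add_le_add ((seqNorm_add_le s _ _).trans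
      (mul_le_mul_right (add_le_add h1 h2) _)) ((seqNorm_add_le s _ _).trans
      (mul_le_mul_right (add_le_add h3 h4) _))) _).trans (le_of_eq ?_)
    push_cast
    ring

/-- The product of distributions, assembled from blocks in which the factors are replaced by
various extensions. -/
theorem IsCutoff.exists_product {η : ℝ → ℝ} (hη : IsCutoff η) {s : ℝ} (hs : 1 < s) :
    ∃ C : ℝ≥0, ∀ (f₁ f₂ f₃ g₁ g₂ g₃ : 𝓢'(Plane, ℂ)) (U₁ U₂ U₃ V₁ V₂ V₃ : ℝ → L2),
    Represents f₁ U₁ → Represents f₂ U₂ → Represents f₃ U₃ →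
    Represents g₁ V₁ → Represents g₂ V₂ → Represents g₃ V₃ →
    fNorm η 2 s f₁ < ⊤ → fNorm η 2 1 f₂ < ⊤ → fNorm η 2 s f₃ < ⊤ →
    fNorm η 2 1 g₁ < ⊤ → fNorm η 2 s g₂ < ⊤ → fNorm η 2 s g₃ < ⊤ →
    ∀ ε : ℝ≥0, 0 < ε → ∃ K : ℕ, ∀ a b : ℕ, a + b = 3 →
    ∃ (G : ℕ × ℕ → ℝ × ℝ → ℂ) (hG : ∀ p, Integrable (G p) volume) (f : 𝓢'(Plane, ℂ)),
      (∀ p, ∀ᵐ t : ℝ, ∀ r : ℝ, ((η t ^ 2 : ℝ) : ℂ) *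
        (pk η a p.1 (pick K U₁ U₂ U₃ p t) r * pk η b p.2 (pick K V₁ V₂ V₃ p t) r) =
          ift (G p) (r, t)) ∧
      IsDistSum (fun p ↦ iftDist (hG p)) f ∧
      nNorm η 2 s f ≤ C * ((fNorm η 2 s f₁ * fNorm η 2 1 g₁ + fNorm η 2 1 f₂ * fNorm η 2 s g₂) +
        ε) := by
  obtain ⟨θ, h0, h1, C, hC⟩ := exists_seqNorm_pick_le hs
  obtain ⟨C', hC'⟩ := hη.exists_sum_blocks h0 h1 s
  refine ⟨C' * C, ?_⟩
  intro f₁ f₂ f₃ g₁ g₂ g₃ U₁ U₂ U₃ V₁ V₂ V₃ hU₁ hU₂ hU₃ hV₁ hV₂ hV₃ hf₁ hf₂ hf₃ hg₁ hg₂ hg₃ ε hε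
  set N : 𝓢'(Plane, ℂ) → ℕ → ℝ≥0∞ := fun f k ↦ fkNorm η 2 k (projK η k f) with hN
  -- Only finiteness of the `F^s` norms of `f₃` and `g₃` is used: their contribution involves a tail
  -- and is at most `ε` for a suitable `K`. This `K` does not depend on the orders of
  -- differentiation, so the different Leibniz terms use the same choice of extensions.
  have ht : Tendsto (fun K ↦ seqNorm s (tail K (N f₃)) * seqNorm s (N g₃) +
      seqNorm s (N f₃) * seqNorm s (tail K (N g₃))) atTop (𝓝 0) := by
    have h1 := ENNReal.Tendsto.mul_const (tendsto_seqNorm_tail (X := N f₃) hf₃)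
      (Or.inr (show seqNorm s (N g₃) ≠ ⊤ from hg₃.ne))
    have h2 := ENNReal.Tendsto.const_mul (tendsto_seqNorm_tail (X := N g₃) hg₃)
      (Or.inr (show seqNorm s (N f₃) ≠ ⊤ from hf₃.ne))
    simpa using h1.add h2
  obtain ⟨K, hK⟩ := (ht.eventually_le_const (ENNReal.coe_pos.mpr hε)).exists
  refine ⟨K, fun a b hab ↦ ?_⟩
  obtain ⟨Z, hZ, hfin, hle⟩ := hC K (N f₁) (N f₂) (N f₃) (N g₁) (N g₂) (N g₃) hf₁ hf₂ hf₃ hg₁ hg₂ hg₃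
  have hx : ∀ p : ℕ × ℕ, pick K (N f₁) (N f₂) (N f₃) p p.1 < ⊤ := fun p ↦
    pick_rec (C := fun X : ℕ → ℝ≥0∞ ↦ X p.1 < ⊤) (fkNorm_lt_top hf₁ _) (fkNorm_lt_top hf₂ _)
      (fkNorm_lt_top hf₃ _) K p
  have hy : ∀ p : ℕ × ℕ, pick K (N g₁) (N g₂) (N g₃) p p.2 < ⊤ := fun p ↦
    pick_rec (C := fun X : ℕ → ℝ≥0∞ ↦ X p.2 < ⊤) (fkNorm_lt_top hg₁ _) (fkNorm_lt_top hg₂ _)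
      (fkNorm_lt_top hg₃ _) K p
  have hP : ∀ p : ℕ × ℕ, LocRep η p.1 a (pick K (N f₁) (N f₂) (N f₃) p p.1)
      fun t ↦ pk η a p.1 (pick K U₁ U₂ U₃ p t) := fun p ↦ by
    unfold pick
    split_ifs
    · exact hη.locRep hU₁ _ (fkNorm_lt_top hf₁ _) (by omega)
    · exact hη.locRep hU₂ _ (fkNorm_lt_top hf₂ _) (by omega)
    · exact hη.locRep hU₃ _ (fkNorm_lt_top hf₃ _) (by omega)
  have hQ : ∀ p : ℕ × ℕ, LocRep η p.2 b (pick K (N g₁) (N g₂) (N g₃) p p.2)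
      fun t ↦ pk η b p.2 (pick K V₁ V₂ V₃ p t) := fun p ↦ by
    unfold pick
    split_ifs
    · exact hη.locRep hV₁ _ (fkNorm_lt_top hg₁ _) (by omega)
    · exact hη.locRep hV₂ _ (fkNorm_lt_top hg₂ _) (by omega)
    · exact hη.locRep hV₃ _ (fkNorm_lt_top hg₃ _) (by omega)
  obtain ⟨G, hG, f, hrep, hsum, hnn⟩ := hC' a b hab _ _ Z _ _ hx hy hP hQ hZ hfin
  refine ⟨G, hG, f, hrep, hsum, hnn.trans ((mul_le_mul_right hle _).trans ?_)⟩
  rw [ENNReal.coe_mul, mul_assoc]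
  exact mul_le_mul_right (mul_le_mul_right (add_le_add le_rfl hK) _) _

/-! ### The Fourier transform on `L¹` and `L²` -/

theorem ae_eq_of_integral_schwartz {f g : ℝ → ℂ} (hf : LocallyIntegrable f volume)
    (hg : LocallyIntegrable g volume) (h : ∀ φ : 𝓢(ℝ, ℂ), ∫ x, f x * φ x = ∫ x, g x * φ x) :
    f =ᵐ[volume] g := by
  refine ae_eq_of_integral_contDiff_smul_eq hf hg fun b hb hc ↦ ?_
  simp_rw [Complex.real_smul, mul_comm (Complex.ofReal _)]
  exact h (testFun hb hc)

theorem locallyIntegrable_L2 (h : L2) : LocallyIntegrable h volume :=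
  (Lp.memLp h).locallyIntegrable (by norm_num)

/-- The Fourier integral and the `L²` Fourier transform have the same transpose on Schwartz
functions. -/
theorem fourier_ae_eq {f : ℝ → ℂ} (hf : Integrable f volume) {h : L2} (hfh : f =ᵐ[volume] h) :
    𝓕 f =ᵐ[volume] (𝓕 h : L2) := by
  refine ae_eq_of_integral_schwartz (continuous_fourier hf).locallyIntegrable
    (locallyIntegrable_L2 _) fun φ ↦ ?_
  rw [← integral_mul_fourier_L2, ← integral_mul_fourier hf φ.integrable, ← SchwartzMap.fourier_coe]
  refine integral_congr_ae ?_
  filter_upwards [hfh] with x hx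
  rw [hx]

theorem ae_eq_fourier_of_fourierInv {g : ℝ → ℂ} (hg : Integrable g volume) {h : L2}
    (hgh : 𝓕⁻ g =ᵐ[volume] h) : g =ᵐ[volume] (𝓕 h : L2) := by
  refine ae_eq_of_integral_schwartz hg.locallyIntegrable (locallyIntegrable_L2 _) fun φ ↦ ?_
  rw [← integral_mul_fourier_L2]
  have e : ∫ x, h x * (𝓕 φ : 𝓢(ℝ, ℂ)) x = ∫ x, 𝓕⁻ g x * (𝓕 φ : 𝓢(ℝ, ℂ)) x := by
    refine integral_congr_ae ?_
    filter_upwards [hgh] with x hx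
    rw [hx]
  rw [e, ← integral_mul_fourierInv hg (𝓕 φ : 𝓢(ℝ, ℂ)).integrable, ← SchwartzMap.fourierInv_coe,
    FourierTransform.fourierInv_fourier_eq]

theorem fourierInv_ae_eq {g : ℝ → ℂ} (hg : Integrable g volume) {h : L2}
    (hgh : g =ᵐ[volume] h) : 𝓕⁻ g =ᵐ[volume] (𝓕⁻ h : L2) := by
  refine ae_eq_of_integral_schwartz (continuous_fourierInv hg).locallyIntegrable
    (locallyIntegrable_L2 _) fun φ ↦ ?_
  have e : φ = (𝓕 (𝓕⁻ φ : 𝓢(ℝ, ℂ)) : 𝓢(ℝ, ℂ)) := by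
    rw [FourierTransform.fourier_fourierInv_eq]
  rw [← integral_mul_fourierInv hg φ.integrable, e, integral_mul_fourier_L2,
    FourierTransform.fourier_fourierInv_eq, FourierTransform.fourier_fourierInv_eq,
    ← SchwartzMap.fourierInv_coe]
  refine integral_congr_ae ?_
  filter_upwards [hgh] with x hx
  rw [hx]

/-! ### Multiplication operators and Fourier multipliers on `L²` -/

/-- Multiplication by a bounded function. -/
def mulOp (m : Lp ℂ ⊤ (volume : Measure ℝ)) : L2 →L[ℂ] L2 :=
  (ContinuousLinearMap.mul ℂ ℂ).holderL volume ⊤ 2 2 m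

theorem mulOp_coe {m : ℝ → ℂ} (hm : MemLp m ⊤ volume) (h : L2) :
    mulOp hm.toLp h =ᵐ[volume] fun x ↦ m x * h x := by
  filter_upwards [(ContinuousLinearMap.mul ℂ ℂ).coeFn_holder (r := 2) hm.toLp h, hm.coeFn_toLp]
    with x hx hm
  rw [← hm]
  exact hx

/-- The Fourier multiplier with a bounded symbol. -/
def fourierOp (m : Lp ℂ ⊤ (volume : Measure ℝ)) : L2 →L[ℂ] L2 :=
  (FourierTransform.fourierInvCLM ℂ L2).comp ((mulOp m).comp (FourierTransform.fourierCLM ℂ L2))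

theorem fourierOp_apply (m : Lp ℂ ⊤ (volume : Measure ℝ)) (h : L2) :
    fourierOp m h = 𝓕⁻ (mulOp m (𝓕 h)) := rfl

/-- The symbol of `∂_x^a P_k`. -/
def sym (η : ℝ → ℝ) (a k : ℕ) (ξ : ℝ) : ℂ :=
  (2 * Real.pi * Complex.I * ξ : ℂ) ^ a * (etaK η k (2 * Real.pi * ξ) : ℂ)

theorem IsCutoff.continuous_sym {η : ℝ → ℝ} (hη : IsCutoff η) (a k : ℕ) :
    Continuous (sym η a k) := by
  have hc := hη.continuous_etaK k
  unfold sym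
  fun_prop

theorem IsCutoff.enorm_sym_mul_le {η : ℝ → ℝ} (hη : IsCutoff η) {a : ℕ} (ha : a ≤ 3) (k : ℕ)
    (ξ : ℝ) : ‖sym η a k ξ‖ₑ ≤
      8 * e2 (a * k) * ((band k).indicator 1 ξ * ENNReal.ofReal (etaK η k (2 * Real.pi * ξ))) := by
  by_cases h0 : etaK η k (2 * Real.pi * ξ) = 0
  · simp [sym, h0]
  have hb := hη.mem_band h0
  have h := enorm_mulX_le ha (k := k) (g := fun w ↦ (band k).indicator 1 w.1)
    (fun z hz ↦ by by_contra h1; simp [h1] at hz) (ξ, 0)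
  simp only [mulX, Set.indicator_of_mem hb, Pi.one_apply, mul_one, enorm_one] at h
  rw [sym, enorm_mul, enorm_ofReal_of_nonneg (hη.etaK_nonneg _ _), Set.indicator_of_mem hb,
    Pi.one_apply, one_mul]
  exact mul_le_mul_left h _

theorem IsCutoff.memLp_sym {η : ℝ → ℝ} (hη : IsCutoff η) {a : ℕ} (ha : a ≤ 3) (k : ℕ) :
    MemLp (sym η a k) ⊤ volume := by
  refine memLp_top_of_bound_enorm (hη.continuous_sym a k).aestronglyMeasurable
    (8 * e2 (a * k)).toNNReal (ae_of_all _ fun ξ ↦ ?_)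
  rw [ENNReal.coe_toNNReal (ENNReal.mul_ne_top (by simp) (e2_ne_top _))]
  refine (hη.enorm_sym_mul_le ha k ξ).trans (mul_le_of_le_one_right' ?_)
  refine mul_le_one' ?_ (hη.ofReal_etaK_le_one _ _)
  exact Set.indicator_le' (fun _ _ ↦ le_rfl) (fun _ _ ↦ zero_le_one) ξ

theorem pk_eq (η : ℝ → ℝ) (a k : ℕ) (h : L2) :
    pk η a k h = 𝓕⁻ fun ξ ↦ sym η a k ξ * (𝓕 h : L2) ξ := by
  funext y
  simp only [pk, sym, mul_assoc]

theorem IsCutoff.integrable_sym {η : ℝ → ℝ} (hη : IsCutoff η) (a k : ℕ) (h : L2) :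
    Integrable (fun ξ ↦ sym η a k ξ * h ξ) volume := by
  simpa only [sym, mul_assoc] using hη.integrable_pk_symbol a k h

/-- `∂_x^a P_k` on `L²`. -/
def IsCutoff.pkL2 {η : ℝ → ℝ} (hη : IsCutoff η) {a : ℕ} (ha : a ≤ 3) (k : ℕ) : L2 →L[ℂ] L2 :=
  fourierOp (hη.memLp_sym ha k).toLp

theorem IsCutoff.pkL2_coe {η : ℝ → ℝ} (hη : IsCutoff η) {a : ℕ} (ha : a ≤ 3) (k : ℕ) (h : L2) :
    pk η a k h =ᵐ[volume] hη.pkL2 ha k h := by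
  rw [pk_eq]
  exact fourierInv_ae_eq (hη.integrable_sym a k _) (mulOp_coe (hη.memLp_sym ha k) _).symm

theorem n2_band_le (k : ℕ) : n2 (fun ξ ↦ (band k).indicator 1 ξ) ≤ e2 (k / 2) := by
  rw [n2_le_iff, e2_pow, show (k / 2 * (2 : ℕ) : ℝ) = k by push_cast; ring]
  have h1 : ∀ ξ, ((band k).indicator 1 ξ : ℝ≥0∞) ^ 2 = (band k).indicator 1 ξ := fun ξ ↦ by
    by_cases h : ξ ∈ band k <;> simp [h]
  simp_rw [h1]
  rw [lintegral_indicator_one (measurableSet_band k)]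
  have h2 : band k ⊆ {ξ | |2 * Real.pi * ξ - 0| ≤ 8 / 5 * 2 ^ k} := fun ξ hξ ↦ by
    simpa using hξ.1
  refine (measure_mono h2).trans ((volume_abs_le 0 _).trans ?_)
  rw [← ofReal_two_pow]
  refine ENNReal.ofReal_le_ofReal ?_
  linarith [pow_pos (two_pos (α := ℝ)) k]

/-- The size of the `k`-th band of an `L²` function. -/
def bandNorm (η : ℝ → ℝ) (k : ℕ) (h : L2) : ℝ≥0∞ :=
  n2 fun ξ ↦ ENNReal.ofReal (etaK η k (2 * Real.pi * ξ)) * ‖(𝓕 h : L2) ξ‖ₑ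

theorem IsCutoff.measurable_etaK_freq {η : ℝ → ℝ} (hη : IsCutoff η) (k : ℕ) :
    Measurable fun ξ : ℝ ↦ ENNReal.ofReal (etaK η k (2 * Real.pi * ξ)) := by
  have := (hη.continuous_etaK k).measurable
  fun_prop

theorem n2_coe_L2 (h : L2) : n2 (fun x ↦ ‖h x‖ₑ) = ‖h‖ₑ := by
  rw [← eLpNorm_two_eq_n2, Lp.enorm_def]

theorem enorm_fourier_L2 (h : L2) : ‖(𝓕 h : L2)‖ₑ = ‖h‖ₑ := by
  rw [← ofReal_norm, ← ofReal_norm, Lp.norm_fourier_eq]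

theorem enorm_fourierInv_L2 (h : L2) : ‖(𝓕⁻ h : L2)‖ₑ = ‖h‖ₑ := by
  rw [← enorm_fourier_L2, FourierTransform.fourier_fourierInv_eq]

theorem IsCutoff.bandNorm_le {η : ℝ → ℝ} (hη : IsCutoff η) (k : ℕ) (h : L2) :
    bandNorm η k h ≤ ‖h‖ₑ := by
  rw [← enorm_fourier_L2 h, ← n2_coe_L2]
  exact n2_mono fun ξ ↦ mul_le_of_le_one_left' (hη.ofReal_etaK_le_one _ _)

/-- Bernstein's inequality: Cauchy–Schwarz on a band of measure at most `2^k`, with the symbol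
bounded by `8 · 2^(ak)`. -/
theorem IsCutoff.enorm_pk_le {η : ℝ → ℝ} (hη : IsCutoff η) {a : ℕ} (ha : a ≤ 3) (k : ℕ) (h : L2)
    (y : ℝ) : ‖pk η a k h y‖ₑ ≤ 8 * e2 (a * k + k / 2) * bandNorm η k h := by
  rw [pk_eq, fourierInv_eq_ch]
  refine (enorm_integral_le_lintegral_enorm _).trans ?_
  simp_rw [enorm_ch_mul, enorm_mul]
  have hm : AEMeasurable fun ξ : ℝ ↦
      ENNReal.ofReal (etaK η k (2 * Real.pi * ξ)) * ‖(𝓕 h : L2) ξ‖ₑ :=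
    (hη.measurable_etaK_freq k).aemeasurable.mul (Lp.aestronglyMeasurable _).enorm
  have hi : Measurable fun ξ : ℝ ↦ ((band k).indicator 1 ξ : ℝ≥0∞) :=
    measurable_one.indicator (measurableSet_band k)
  have hp : ∀ ξ, ‖sym η a k ξ‖ₑ * ‖(𝓕 h : L2) ξ‖ₑ ≤ 8 * e2 (a * k) * ((band k).indicator 1 ξ *
      (ENNReal.ofReal (etaK η k (2 * Real.pi * ξ)) * ‖(𝓕 h : L2) ξ‖ₑ)) := fun ξ ↦ by
    refine (mul_le_mul_left (hη.enorm_sym_mul_le ha k ξ) _).trans (le_of_eq (by ring))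
  refine (lintegral_mono hp).trans ?_
  rw [lintegral_const_mul' _ _ (ENNReal.mul_ne_top (by simp) (e2_ne_top _)), e2_add, mul_assoc,
    mul_assoc, mul_assoc]
  refine mul_le_mul_right (mul_le_mul_right ?_ _) _
  exact (lintegral_mul_le_n2 hi.aemeasurable hm).trans (mul_le_mul_left (n2_band_le k) _)

theorem IsCutoff.continuous_pk {η : ℝ → ℝ} (hη : IsCutoff η) (a k : ℕ) (h : L2) :
    Continuous (pk η a k h) := by
  rw [pk_eq]
  exact continuous_fourierInv (hη.integrable_sym a k _)

theorem IsCutoff.memLp_pk {η : ℝ → ℝ} (hη : IsCutoff η) {a : ℕ} (ha : a ≤ 3) (k : ℕ) (h : L2) :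
    MemLp (pk η a k h) ⊤ volume := by
  have hlt : 8 * e2 (a * k + k / 2) * bandNorm η k h ≠ ⊤ :=
    ENNReal.mul_ne_top (ENNReal.mul_ne_top (by simp) (e2_ne_top _))
      ((hη.bandNorm_le k h).trans_lt enorm_lt_top).ne
  refine memLp_top_of_bound_enorm (hη.continuous_pk a k h).aestronglyMeasurable
    (8 * e2 (a * k + k / 2) * bandNorm η k h).toNNReal (ae_of_all _ fun y ↦ ?_)
  rw [ENNReal.coe_toNNReal hlt]
  exact hη.enorm_pk_le ha k h y

theorem IsCutoff.pk_add {η : ℝ → ℝ} (hη : IsCutoff η) (a k : ℕ) (g h : L2) :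
    pk η a k (g + h) = pk η a k g + pk η a k h := by
  funext y
  rw [Pi.add_apply, pk_eq, pk_eq, pk_eq, fourierInv_eq_ch, fourierInv_eq_ch, fourierInv_eq_ch,
    ← integral_add (integrable_ch_mul (by fun_prop) (hη.integrable_sym a k _))
      (integrable_ch_mul (by fun_prop) (hη.integrable_sym a k _))]
  refine integral_congr_ae ?_
  rw [FourierTransform.fourier_add]
  filter_upwards [Lp.coeFn_add (𝓕 g : L2) (𝓕 h : L2)] with ξ hξ
  rw [hξ, Pi.add_apply]
  ring

theorem pk_smul (η : ℝ → ℝ) (a k : ℕ) (c : ℂ) (h : L2) :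
    pk η a k (c • h) = c • pk η a k h := by
  funext y
  rw [Pi.smul_apply, pk_eq, pk_eq, fourierInv_eq_ch, fourierInv_eq_ch, smul_eq_mul,
    ← integral_const_mul]
  refine integral_congr_ae ?_
  rw [FourierTransform.fourier_smul]
  filter_upwards [Lp.coeFn_smul c (𝓕 h : L2)] with ξ hξ
  rw [hξ, Pi.smul_apply, smul_eq_mul]
  ring

theorem IsCutoff.enorm_toLp_pk_le {η : ℝ → ℝ} (hη : IsCutoff η) {a : ℕ} (ha : a ≤ 3) (k : ℕ)
    (h : L2) : ‖(hη.memLp_pk ha k h).toLp‖ₑ ≤ 8 * e2 (a * k + k / 2) * bandNorm η k h := by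
  rw [Lp.enorm_toLp, eLpNorm_exponent_top]
  exact eLpNormEssSup_le_of_ae_enorm_bound (ae_of_all _ (hη.enorm_pk_le ha k h))

/-- `∂_x^a P_k` from `L²` to `L^∞`. -/
def IsCutoff.pkSup {η : ℝ → ℝ} (hη : IsCutoff η) {a : ℕ} (ha : a ≤ 3) (k : ℕ) :
    L2 →L[ℂ] Lp ℂ ⊤ (volume : Measure ℝ) :=
  LinearMap.mkContinuous
    { toFun := fun h ↦ (hη.memLp_pk ha k h).toLp
      map_add' := fun g h ↦ by
        rw [← MemLp.toLp_add]
        exact MemLp.toLp_congr _ _ (by rw [hη.pk_add])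
      map_smul' := fun c h ↦ by
        rw [RingHom.id_apply, ← MemLp.toLp_const_smul]
        exact MemLp.toLp_congr _ _ (by rw [pk_smul]) }
    (8 * e2 (a * k + k / 2)).toReal fun h ↦ by
      have h1 := (hη.enorm_toLp_pk_le ha k h).trans (mul_le_mul_right (hη.bandNorm_le k h) _)
      have h2 := ENNReal.toReal_mono (ENNReal.mul_ne_top (ENNReal.mul_ne_top (by simp)
        (e2_ne_top _)) enorm_ne_top) h1
      rwa [toReal_enorm, ENNReal.toReal_mul, toReal_enorm] at h2

theorem IsCutoff.pkSup_coe {η : ℝ → ℝ} (hη : IsCutoff η) {a : ℕ} (ha : a ≤ 3) (k : ℕ) (h : L2) :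
    hη.pkSup ha k h =ᵐ[volume] pk η a k h :=
  (hη.memLp_pk ha k h).coeFn_toLp

theorem IsCutoff.enorm_pkSup_le {η : ℝ → ℝ} (hη : IsCutoff η) {a : ℕ} (ha : a ≤ 3) (k : ℕ)
    (h : L2) : ‖hη.pkSup ha k h‖ₑ ≤ 8 * e2 (a * k + k / 2) * bandNorm η k h :=
  hη.enorm_toLp_pk_le ha k h

/-- The product of a bounded function and an `L²` function. -/
def prodL2 : Lp ℂ ⊤ (volume : Measure ℝ) →L[ℂ] L2 →L[ℂ] L2 :=
  (ContinuousLinearMap.mul ℂ ℂ).holderL volume ⊤ 2 2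

theorem prodL2_coe (f : Lp ℂ ⊤ (volume : Measure ℝ)) (g : L2) :
    prodL2 f g =ᵐ[volume] fun x ↦ f x * g x :=
  (ContinuousLinearMap.mul ℂ ℂ).coeFn_holder (r := 2) f g

theorem enorm_prodL2_le (f : Lp ℂ ⊤ (volume : Measure ℝ)) (g : L2) :
    ‖prodL2 f g‖ₑ ≤ ‖f‖ₑ * ‖g‖ₑ := by
  have h := (ContinuousLinearMap.mul ℂ ℂ).nnnorm_holder_apply_apply_le (r := 2) f g
  have h1 : ‖ContinuousLinearMap.mul ℂ ℂ‖₊ = 1 := by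
    ext; simp
  rw [h1, one_mul] at h
  exact ENNReal.coe_le_coe.mpr h

/-- The product of the frequency blocks `∂_x^a P_k g` and `∂_x^b P_l h`. -/
def IsCutoff.blockL2 {η : ℝ → ℝ} (hη : IsCutoff η) {a b : ℕ} (ha : a ≤ 3) (hb : b ≤ 3) (k l : ℕ) :
    L2 →L[ℂ] L2 →L[ℂ] L2 :=
  prodL2.bilinearComp (hη.pkSup ha k) (hη.pkL2 hb l)

theorem IsCutoff.blockL2_coe {η : ℝ → ℝ} (hη : IsCutoff η) {a b : ℕ} (ha : a ≤ 3) (hb : b ≤ 3)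
    (k l : ℕ) (g h : L2) :
    hη.blockL2 ha hb k l g h =ᵐ[volume] fun x ↦ pk η a k g x * pk η b l h x := by
  filter_upwards [prodL2_coe (hη.pkSup ha k g) (hη.pkL2 hb l h), hη.pkSup_coe ha k g,
    hη.pkL2_coe hb l h] with x h1 h2 h3
  rw [h3, ← h2]
  exact h1

/-! ### Convergence of the truncated products in `L²` -/

theorem coeFn_sum_L2 {ι : Type*} (s : Finset ι) {f : ι → L2} {F : ι → ℝ → ℂ}
    (h : ∀ i, f i =ᵐ[volume] F i) : (∑ i ∈ s, f i : L2) =ᵐ[volume] fun x ↦ ∑ i ∈ s, F i x := by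
  classical
  induction s using Finset.induction_on with
  | empty =>
    simp only [Finset.sum_empty]
    exact Lp.coeFn_zero ℂ 2 volume
  | insert i s hi ih =>
    rw [Finset.sum_insert hi]
    filter_upwards [Lp.coeFn_add (f i) (∑ i ∈ s, f i), ih, h i] with x h1 h2 h3
    rw [h1, Pi.add_apply, h2, h3, Finset.sum_insert hi]

theorem IsCutoff.one_le_tsum_sq {η : ℝ → ℝ} (hη : IsCutoff η) (r : ℝ) :
    1 ≤ 3 * ∑' k, ENNReal.ofReal (etaK η k r) ^ 2 := by
  obtain ⟨K, hK⟩ := (hη.etaLe_eventually r).exists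
  have h := hη.etaLe_sq_le K r
  rw [hK, one_pow] at h
  have h1 := ENNReal.ofReal_le_ofReal h
  rw [ENNReal.ofReal_one, ENNReal.ofReal_mul (by norm_num),
    ENNReal.ofReal_sum_of_nonneg fun k _ ↦ sq_nonneg _] at h1
  simp_rw [ENNReal.ofReal_pow (hη.etaK_nonneg _ _)] at h1
  refine h1.trans ?_
  rw [show ENNReal.ofReal 3 = 3 by simp]
  exact mul_le_mul_right (ENNReal.sum_le_tsum _) _

theorem IsCutoff.ofReal_freq_mul_le {η : ℝ → ℝ} (hη : IsCutoff η) (k : ℕ) (ξ : ℝ) :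
    ENNReal.ofReal (|2 * Real.pi * ξ| ^ 2) ^ 2 * ENNReal.ofReal (etaK η k (2 * Real.pi * ξ)) ^ 2 ≤
      8 * (e2 (k * 2) * ENNReal.ofReal (etaK η k (2 * Real.pi * ξ))) ^ 2 := by
  by_cases h0 : etaK η k (2 * Real.pi * ξ) = 0
  · simp [h0]
  rw [mul_pow, ← mul_assoc]
  refine mul_le_mul_left ?_ _
  have h1 : |2 * Real.pi * ξ| ^ 4 ≤ (8 / 5 * 2 ^ k) ^ 4 :=
    pow_le_pow_left₀ (abs_nonneg _) (hη.etaK_upper h0) 4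
  rw [e2_pow, show ((k : ℝ) * 2 * (2 : ℕ)) = ((k * 4 : ℕ) : ℝ) by push_cast; ring,
    ← ofReal_two_pow, show (8 : ℝ≥0∞) = ENNReal.ofReal 8 by simp,
    ← ENNReal.ofReal_mul (by norm_num), ← ENNReal.ofReal_pow (by positivity)]
  refine ENNReal.ofReal_le_ofReal ?_
  calc (|2 * Real.pi * ξ| ^ 2) ^ 2 = |2 * Real.pi * ξ| ^ 4 := by ring
    _ ≤ (8 / 5 * 2 ^ k) ^ 4 := h1
    _ = 4096 / 625 * 2 ^ (k * 4) := by rw [mul_pow, ← pow_mul]; norm_num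
    _ ≤ _ := by gcongr; norm_num

/-- The second derivative of an `L²` function, on the Fourier side. -/
theorem IsCutoff.exists_second_derivative {η : ℝ → ℝ} (hη : IsCutoff η) (h : L2)
    (hh : seqNorm 2 (fun k ↦ bandNorm η k h) < ⊤) :
    ∃ w : L2, (w =ᵐ[volume] fun ξ ↦ (2 * Real.pi * Complex.I * ξ : ℂ) ^ 2 * (𝓕 h : L2) ξ) ∧
      ‖w‖ₑ ≤ 5 * seqNorm 2 fun k ↦ bandNorm η k h := by
  set F : ℝ → ℂ := fun ξ ↦ (2 * Real.pi * Complex.I * ξ : ℂ) ^ 2 * (𝓕 h : L2) ξ with hF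
  have hFm : AEStronglyMeasurable F volume :=
    (Continuous.aestronglyMeasurable (by fun_prop)).mul (Lp.aestronglyMeasurable _)
  have hm : ∀ k, AEMeasurable (fun ξ : ℝ ↦
      ENNReal.ofReal (etaK η k (2 * Real.pi * ξ)) * ‖(𝓕 h : L2) ξ‖ₑ) volume := fun k ↦
    (hη.measurable_etaK_freq k).aemeasurable.mul (Lp.aestronglyMeasurable _).enorm
  have hp : ∀ ξ, ‖F ξ‖ₑ ^ 2 ≤ 24 * ∑' k : ℕ, (e2 (k * 2) *
      (ENNReal.ofReal (etaK η k (2 * Real.pi * ξ)) * ‖(𝓕 h : L2) ξ‖ₑ)) ^ 2 := fun ξ ↦ by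
    have e : ‖F ξ‖ₑ = ENNReal.ofReal (|2 * Real.pi * ξ| ^ 2) * ‖(𝓕 h : L2) ξ‖ₑ := by
      rw [hF, enorm_mul, ← ofReal_norm, norm_symbol]
    have hk : ∀ k : ℕ, ENNReal.ofReal (|2 * Real.pi * ξ| ^ 2) ^ 2 * ‖(𝓕 h : L2) ξ‖ₑ ^ 2 *
        ENNReal.ofReal (etaK η k (2 * Real.pi * ξ)) ^ 2 ≤ 8 * (e2 (k * 2) *
      (ENNReal.ofReal (etaK η k (2 * Real.pi * ξ)) * ‖(𝓕 h : L2) ξ‖ₑ)) ^ 2 := fun k ↦ by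
      refine le_trans (le_of_eq ?_) ((mul_le_mul_left (hη.ofReal_freq_mul_le k ξ)
        (‖(𝓕 h : L2) ξ‖ₑ ^ 2)).trans (le_of_eq ?_)) <;> ring
    rw [e, mul_pow]
    calc _ ≤ ENNReal.ofReal (|2 * Real.pi * ξ| ^ 2) ^ 2 * ‖(𝓕 h : L2) ξ‖ₑ ^ 2 *
          (3 * ∑' k, ENNReal.ofReal (etaK η k (2 * Real.pi * ξ)) ^ 2) :=
          le_mul_of_one_le_right' (hη.one_le_tsum_sq _)
      _ = 3 * ∑' k, ENNReal.ofReal (|2 * Real.pi * ξ| ^ 2) ^ 2 * ‖(𝓕 h : L2) ξ‖ₑ ^ 2 *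
          ENNReal.ofReal (etaK η k (2 * Real.pi * ξ)) ^ 2 := by
          rw [ENNReal.tsum_mul_left]; ring
      _ ≤ 3 * (8 * ∑' k : ℕ, (e2 (k * 2) *
          (ENNReal.ofReal (etaK η k (2 * Real.pi * ξ)) * ‖(𝓕 h : L2) ξ‖ₑ)) ^ 2) := by
          rw [← ENNReal.tsum_mul_left (a := 8)]
          exact mul_le_mul_right (ENNReal.tsum_le_tsum hk) _
      _ = _ := by rw [← mul_assoc]; norm_num
  have hn : n2 (fun ξ ↦ ‖F ξ‖ₑ) ≤ 5 * seqNorm 2 fun k ↦ bandNorm η k h := by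
    rw [n2_le_iff]
    refine (lintegral_mono hp).trans ?_
    rw [lintegral_const_mul' _ _ (by simp),
      lintegral_tsum fun k ↦ ((hm k).const_mul _).pow_const 2, mul_pow, seqNorm_sq]
    have hk : ∀ k : ℕ, ∫⁻ ξ, (e2 (k * 2) * (ENNReal.ofReal (etaK η k (2 * Real.pi * ξ)) *
        ‖(𝓕 h : L2) ξ‖ₑ)) ^ 2 ≤ (e2 (k * 2) * bandNorm η k h) ^ 2 := fun k ↦ by
      rw [mul_pow, bandNorm, n2_sq, ← lintegral_const_mul' _ _ (ENNReal.pow_ne_top (e2_ne_top _))]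
      simp_rw [mul_pow]
      exact le_rfl
    exact mul_le_mul' (by norm_num) (ENNReal.tsum_le_tsum hk)
  have hF2 : MemLp F 2 volume := ⟨hFm, by
    rw [eLpNorm_two_eq_n2]
    exact hn.trans_lt (ENNReal.mul_lt_top (by simp) hh)⟩
  refine ⟨hF2.toLp, hF2.coeFn_toLp, ?_⟩
  rw [Lp.enorm_toLp, eLpNorm_two_eq_n2]
  exact hn

/-- Two derivatives exhaust the weight `2^(2k)`, so the blocks cannot be summed absolutely. On the
Fourier side the truncation is multiplication by a symbol in `[0, 1]` that is eventually one at each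
frequency, and dominated convergence gives the limit. -/
theorem IsCutoff.exists_tendsto_second_derivative {η : ℝ → ℝ} (hη : IsCutoff η) (h : L2)
    (hh : seqNorm 2 (fun k ↦ bandNorm η k h) < ⊤) :
    ∃ g : L2, Tendsto (fun K : ℕ ↦ ∑ l ∈ Finset.range (K + 1),
      hη.pkL2 (show 2 ≤ 3 by norm_num) l h) atTop (𝓝 g) ∧
      ∀ K : ℕ, ‖∑ l ∈ Finset.range (K + 1), hη.pkL2 (show 2 ≤ 3 by norm_num) l h‖ₑ ≤
        5 * seqNorm 2 fun k ↦ bandNorm η k h := by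
  obtain ⟨w, hw, hwn⟩ := hη.exists_second_derivative h hh
  set A : ℕ → L2 := fun K ↦ ∑ l ∈ Finset.range (K + 1),
    mulOp (hη.memLp_sym (show 2 ≤ 3 by norm_num) l).toLp (𝓕 h) with hA
  have hAw : ∀ K, A K =ᵐ[volume] fun ξ ↦ (etaLe η K (2 * Real.pi * ξ) : ℂ) * w ξ := fun K ↦ by
    filter_upwards [coeFn_sum_L2 (Finset.range (K + 1)) fun l ↦
      mulOp_coe (hη.memLp_sym (show 2 ≤ 3 by norm_num) l) (𝓕 h), hw] with ξ h1 h2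
    rw [h1, h2, etaLe]
    push_cast
    rw [Finset.sum_mul]
    refine Finset.sum_congr rfl fun l _ ↦ ?_
    rw [sym]
    ring
  have hsum : ∀ K, ∑ l ∈ Finset.range (K + 1), hη.pkL2 (show 2 ≤ 3 by norm_num) l h =
      FourierTransform.fourierInvCLM ℂ L2 (A K) := fun K ↦ by
    rw [hA, map_sum]
    rfl
  have hlim : Tendsto A atTop (𝓝 w) := by
    rw [tendsto_iff_edist_tendsto_0]
    have e : ∀ K, edist (A K) w ^ 2 =
        ∫⁻ ξ, ‖((etaLe η K (2 * Real.pi * ξ) : ℂ) - 1) * w ξ‖ₑ ^ 2 := fun K ↦ by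
      rw [edist_eq_enorm_sub, ← n2_coe_L2, n2_sq]
      refine lintegral_congr_ae ?_
      filter_upwards [Lp.coeFn_sub (A K) w, hAw K] with ξ h1 h2
      rw [h1, Pi.sub_apply, h2, sub_mul, one_mul]
    have hwi : ∫⁻ ξ, ‖w ξ‖ₑ ^ 2 ≠ ⊤ := by
      rw [← n2_sq, n2_coe_L2]
      exact ENNReal.pow_ne_top enorm_ne_top
    have hl : Tendsto (fun K ↦ edist (A K) w ^ 2) atTop (𝓝 0) := by
      simp_rw [e]
      rw [← lintegral_zero]
      refine tendsto_lintegral_of_dominated_convergence' (fun ξ ↦ ‖w ξ‖ₑ ^ 2) (fun K ↦ ?_)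
        (fun K ↦ ae_of_all _ fun ξ ↦ ?_) hwi (ae_of_all _ fun ξ ↦ ?_)
      · have hc : Continuous fun ξ : ℝ ↦ (etaLe η K (2 * Real.pi * ξ) : ℂ) - 1 := by
          have := fun k ↦ hη.continuous_etaK k
          unfold etaLe
          fun_prop
        exact ((hc.aestronglyMeasurable.mul (Lp.aestronglyMeasurable w)).enorm).pow_const 2
      · dsimp only
        rw [enorm_mul]
        refine pow_le_pow_left' (mul_le_of_le_one_left' ?_) 2
        have hmem := hη.etaLe_mem K (2 * Real.pi * ξ)
        rw [← Complex.ofReal_one, ← Complex.ofReal_sub, ← ofReal_norm, Complex.norm_real,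
          ← ENNReal.ofReal_one]
        refine ENNReal.ofReal_le_ofReal ?_
        rw [Real.norm_eq_abs, abs_le]
        exact ⟨by linarith [hmem.1], by linarith [hmem.2]⟩
      · refine tendsto_const_nhds.congr' ?_
        filter_upwards [hη.etaLe_eventually (2 * Real.pi * ξ)] with K hK
        simp [hK]
    have h2 := (ENNReal.continuous_rpow_const (y := (1 / 2 : ℝ))).continuousAt.tendsto.comp hl
    simp only [Function.comp_def, sq_rpow_half] at h2
    rwa [ENNReal.zero_rpow_of_pos (by norm_num)] at h2
  refine ⟨FourierTransform.fourierInvCLM ℂ L2 w, ?_, fun K ↦ ?_⟩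
  · simp_rw [hsum]
    exact ((FourierTransform.fourierInvCLM ℂ L2).continuous.tendsto w).comp hlim
  · rw [hsum, FourierTransform.fourierInvCLM_apply, enorm_fourierInv_L2, ← n2_coe_L2]
    refine le_trans (n2_mono_ae ?_) ((n2_coe_L2 w).le.trans hwn)
    filter_upwards [hAw K] with ξ hξ
    have hmem := hη.etaLe_mem K (2 * Real.pi * ξ)
    rw [hξ, enorm_mul, enorm_ofReal_of_nonneg hmem.1]
    refine mul_le_of_le_one_left' ?_
    rw [← ENNReal.ofReal_one]
    exact ENNReal.ofReal_le_ofReal hmem.2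

/-- For at most one derivative Bernstein's inequality costs `2^(3k/2)`, so against the weight
`2^(2k)` the blocks are absolutely summable in `L^∞`. -/
theorem IsCutoff.exists_tendsto_low_derivative {η : ℝ → ℝ} (hη : IsCutoff η) :
    ∃ C : ℝ≥0, ∀ (a : ℕ) (ha : a ≤ 1) (h : L2), seqNorm 2 (fun k ↦ bandNorm η k h) < ⊤ →
    ∃ g, Tendsto (fun K : ℕ ↦ ∑ l ∈ Finset.range (K + 1),
      hη.pkSup (ha.trans (show 1 ≤ 3 by norm_num)) l h) atTop (𝓝 g) ∧
      ∀ K : ℕ, ‖∑ l ∈ Finset.range (K + 1), hη.pkSup (ha.trans (show 1 ≤ 3 by norm_num)) l h‖ₑ ≤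
        C * seqNorm 2 fun k ↦ bandNorm η k h := by
  have hS := tsum_e2_lt_top (a := 1 / 2) (by norm_num)
  refine ⟨(8 * ∑' j : ℕ, e2 (-(1 / 2 * j))).toNNReal, fun a ha h hh ↦ ?_⟩
  rw [ENNReal.coe_toNNReal (ENNReal.mul_ne_top (by simp) hS.ne)]
  have hk : ∀ k, ‖hη.pkSup (ha.trans (show 1 ≤ 3 by norm_num)) k h‖ₑ ≤
      8 * e2 (-(1 / 2 * k)) * seqNorm 2 fun k ↦ bandNorm η k h := fun k ↦ by
    refine (hη.enorm_pkSup_le _ k h).trans ?_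
    refine (mul_le_mul_right (le_e2_mul_seqNorm 2 (fun k ↦ bandNorm η k h) k) _).trans ?_
    rw [← mul_assoc, mul_assoc 8, ← e2_add]
    refine mul_le_mul_left (mul_le_mul_right (e2_mono ?_) _) _
    have h1 : (a : ℝ) * k ≤ 1 * k := by gcongr; exact_mod_cast ha
    linarith
  have htot : ∑' k, ‖hη.pkSup (ha.trans (show 1 ≤ 3 by norm_num)) k h‖ₑ ≤
      (8 * ∑' j : ℕ, e2 (-(1 / 2 * j))) * seqNorm 2 fun k ↦ bandNorm η k h := by
    refine (ENNReal.tsum_le_tsum hk).trans ?_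
    rw [ENNReal.tsum_mul_right, ENNReal.tsum_mul_left]
  have hs := summable_of_tsum_enorm_lt_top
    (htot.trans_lt (ENNReal.mul_lt_top (ENNReal.mul_lt_top (by simp) hS) hh))
  refine ⟨_, hs.hasSum.tendsto_sum_nat.comp (tendsto_add_atTop_nat 1), fun K ↦ ?_⟩
  exact (enorm_sum_le _ _).trans ((ENNReal.sum_le_tsum _).trans htot)

theorem tendsto_bilinear {E F G : Type*} [NormedAddCommGroup E] [NormedSpace ℂ E]
    [NormedAddCommGroup F] [NormedSpace ℂ F] [NormedAddCommGroup G] [NormedSpace ℂ G]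
    (B : E →L[ℂ] F →L[ℂ] G) {f : ℕ → E} {g : ℕ → F} {x : E} {y : F}
    (hf : Tendsto f atTop (𝓝 x)) (hg : Tendsto g atTop (𝓝 y)) :
    Tendsto (fun K ↦ B (f K) (g K)) atTop (𝓝 (B x y)) :=
  (B.isBoundedBilinearMap.continuous.tendsto (x, y)).comp (hf.prodMk_nhds hg)

theorem IsCutoff.exists_tendsto_blocks {η : ℝ → ℝ} (hη : IsCutoff η) :
    ∃ C : ℝ≥0, ∀ (a : ℕ) (ha : a ≤ 1) (g h : L2), seqNorm 2 (fun k ↦ bandNorm η k g) < ⊤ →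
    seqNorm 2 (fun k ↦ bandNorm η k h) < ⊤ →
    ∃ w, Tendsto (fun K : ℕ ↦ ∑ p ∈ Finset.range (K + 1) ×ˢ Finset.range (K + 1),
      hη.blockL2 (ha.trans (show 1 ≤ 3 by norm_num)) (show 2 ≤ 3 by norm_num) p.1 p.2 g h)
        atTop (𝓝 w) ∧
      ∀ K : ℕ, ‖∑ p ∈ Finset.range (K + 1) ×ˢ Finset.range (K + 1),
        hη.blockL2 (ha.trans (show 1 ≤ 3 by norm_num)) (show 2 ≤ 3 by norm_num) p.1 p.2 g h‖ₑ ≤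
        C * ((seqNorm 2 fun k ↦ bandNorm η k g) * seqNorm 2 fun k ↦ bandNorm η k h) := by
  obtain ⟨C, hC⟩ := hη.exists_tendsto_low_derivative
  refine ⟨C * 5, fun a ha g h hg hh ↦ ?_⟩
  obtain ⟨x, hx, hxn⟩ := hC a ha g hg
  obtain ⟨y, hy, hyn⟩ := hη.exists_tendsto_second_derivative h hh
  have e : ∀ K : ℕ, ∑ p ∈ Finset.range (K + 1) ×ˢ Finset.range (K + 1),
      hη.blockL2 (ha.trans (show 1 ≤ 3 by norm_num)) (show 2 ≤ 3 by norm_num) p.1 p.2 g h =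
      prodL2 (∑ l ∈ Finset.range (K + 1), hη.pkSup (ha.trans (show 1 ≤ 3 by norm_num)) l g)
        (∑ l ∈ Finset.range (K + 1), hη.pkL2 (show 2 ≤ 3 by norm_num) l h) := fun K ↦ by
    rw [Finset.sum_product, map_sum prodL2, sum_apply]
    refine Finset.sum_congr rfl fun k _ ↦ ?_
    rw [map_sum]
    rfl
  refine ⟨prodL2 x y, ?_, fun K ↦ ?_⟩
  · simp_rw [e]
    exact tendsto_bilinear prodL2 hx hy
  · rw [e]
    refine (enorm_prodL2_le _ _).trans ((mul_le_mul' (hxn K) (hyn K)).trans (le_of_eq ?_))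
    rw [mul_mul_mul_comm, ENNReal.coe_mul, ENNReal.coe_ofNat]

/-! ### Frequency blocks of the time slices -/

/-- The value at a time `t` is dominated by the `L¹_τ` norm of the transform, hence by the `X` norm
of a localization equal to one at `t`. The countably many centres `n / 4^k` are enough to reach
almost every `t`. -/
theorem IsCutoff.ae_bandNorm_le {η : ℝ → ℝ} (hη : IsCutoff η) {f : 𝓢'(Plane, ℂ)} {U : ℝ → L2}
    (hU : Represents f U) (k : ℕ) (hf : fkNorm η 2 k (projK η k f) < ⊤) :
    ∀ᵐ t : ℝ, bandNorm η k (U t) ≤ fkNorm η 2 k (projK η k f) := by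
  have key : ∀ n : ℤ, ∀ᵐ t : ℝ, η (4 ^ k * (t - n / 4 ^ k)) = 1 →
      bandNorm η k (U t) ≤ fkNorm η 2 k (projK η k f) := fun n ↦ by
    obtain ⟨g, hgm, -, hgx, hg⟩ := hη.exists_slice_eq hU k hf (n / 4 ^ k)
    filter_upwards [hg] with t ht h1
    refine le_trans (n2_mono_ae ?_) ((hη.n21_le_xn hgm.enorm).trans hgx)
    filter_upwards [ht] with ξ hξ
    rw [h1, Complex.ofReal_one, one_mul] at hξ
    rw [← enorm_ofReal_of_nonneg (hη.etaK_nonneg _ _), ← enorm_mul, hξ]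
    exact enorm_slice_le g t ξ
  filter_upwards [ae_all_iff.2 key] with t ht
  refine ht ⌊4 ^ k * t⌋ (hη.eq_one' ?_)
  have h4 : (4 : ℝ) ^ k ≠ 0 := by positivity
  rw [mul_sub, mul_div_cancel₀ _ h4, abs_le]
  constructor <;> linarith [Int.floor_le ((4 : ℝ) ^ k * t), Int.lt_floor_add_one ((4 : ℝ) ^ k * t)]

theorem IsCutoff.ae_seqNorm_bandNorm_le {η : ℝ → ℝ} (hη : IsCutoff η) {f : 𝓢'(Plane, ℂ)}
    {U : ℝ → L2} (hU : Represents f U) {s : ℝ} (hf : fNorm η 2 s f < ⊤) :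
    ∀ᵐ t : ℝ, seqNorm s (fun k ↦ bandNorm η k (U t)) ≤ fNorm η 2 s f := by
  filter_upwards [ae_all_iff.2 fun k ↦ hη.ae_bandNorm_le hU k (fkNorm_lt_top hf k)] with t ht
  rw [fNorm_eq_seqNorm]
  exact seqNorm_mono s ht

/-! ### Pairing the time slices with test functions -/

theorem memLp_one_add_norm_inv : MemLp (fun x : ℝ ↦ (1 + ‖x‖)⁻¹) 2 volume := by
  have hm : AEStronglyMeasurable (fun x : ℝ ↦ (1 + ‖x‖)⁻¹) volume :=
    Measurable.aestronglyMeasurable (by fun_prop)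
  rw [memLp_two_iff_integrable_sq hm]
  refine (integrable_one_add_norm (E := ℝ) (μ := volume) (r := 2) (by simp)).congr
    (ae_of_all _ fun x ↦ ?_)
  dsimp only
  rw [Real.rpow_neg (by positivity), inv_pow]
  norm_cast

/-- Slices in time of a Schwartz function are functionals on `L²` whose norms are integrable in
time; this is the dominating function for limits under the time integral. -/
theorem exists_testPairing (φ : 𝓢(Plane, ℂ)) : ∃ (b : ℝ → ℝ) (L : ℝ → L2 →L[ℂ] ℂ),
    Integrable b volume ∧ (∀ t, ‖L t‖ ≤ b t) ∧ ∀ t w, L t w = ∫ x : ℝ, w x * φ !₂[x, t] := by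
  set q := (Finset.Iic ((3, 0) : ℕ × ℕ)).sup (schwartzSeminormFamily ℂ Plane ℂ) φ with hq
  have hpt : ∀ t x : ℝ, ‖φ !₂[x, t]‖ ≤ (2 ^ 3 * q * (1 + ‖t‖) ^ (-2 : ℝ)) * ‖(1 + ‖x‖)⁻¹‖ :=
    fun t x ↦ by
    have h := SchwartzMap.one_add_le_sup_seminorm_apply (𝕜 := ℂ) (m := (3, 0)) (k := 3) (n := 0)
      le_rfl le_rfl φ !₂[x, t]
    rw [norm_iteratedFDeriv_zero] at h
    have h' : (1 + ‖(!₂[x, t] : Plane)‖) ^ 3 * ‖φ !₂[x, t]‖ ≤ 2 ^ 3 * q := h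
    have hx : |x| ≤ ‖(!₂[x, t] : Plane)‖ := norm_fst_le_toPlane (x, t)
    have ht : |t| ≤ ‖(!₂[x, t] : Plane)‖ := norm_snd_le_toPlane (x, t)
    have h1 : (1 + ‖t‖) ^ 2 * (1 + ‖x‖) ≤ (1 + ‖(!₂[x, t] : Plane)‖) ^ 3 := by
      rw [pow_succ _ 2, Real.norm_eq_abs, Real.norm_eq_abs]
      gcongr
    have h2 : (1 + ‖t‖) ^ 2 * (1 + ‖x‖) * ‖φ !₂[x, t]‖ ≤ 2 ^ 3 * q :=
      (mul_le_mul_of_nonneg_right h1 (norm_nonneg _)).trans h'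
    have h3 : ‖(1 + ‖x‖)⁻¹‖ = (1 + ‖x‖)⁻¹ := Real.norm_of_nonneg (by positivity)
    rw [Real.rpow_neg (by positivity), h3,
      show (1 + ‖t‖) ^ (2 : ℝ) = (1 + ‖t‖) ^ 2 by norm_cast, ← div_eq_mul_inv, ← div_eq_mul_inv,
      div_div, le_div_iff₀ (by positivity)]
    linarith
  have hc : ∀ t, Continuous fun x : ℝ ↦ φ !₂[x, t] := fun t ↦
    φ.continuous.comp (continuous_toPlane.comp (by fun_prop : Continuous fun x : ℝ ↦ (x, t)))
  have hm : ∀ t, MemLp (fun x : ℝ ↦ φ !₂[x, t]) 2 volume := fun t ↦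
    memLp_one_add_norm_inv.of_le_mul (hc t).aestronglyMeasurable (ae_of_all _ (hpt t))
  set B := (ContinuousLinearMap.mul ℂ ℂ).lpPairing (volume : Measure ℝ) 2 2 with hB
  refine ⟨fun t ↦ ‖B‖ * ((2 ^ 3 * q * ‖memLp_one_add_norm_inv.toLp‖) * (1 + ‖t‖) ^ (-2 : ℝ)),
    fun t ↦ B (hm t).toLp, ?_, fun t ↦ (B.le_opNorm _).trans ?_, fun t w ↦ ?_⟩
  · exact ((integrable_one_add_norm (E := ℝ) (μ := volume) (r := 2) (by simp)).const_mul
      _).const_mul _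
  · refine mul_le_mul_of_nonneg_left ?_ (norm_nonneg _)
    refine (Lp.norm_le_mul_norm_of_ae_le_mul (c := 2 ^ 3 * q * (1 + ‖t‖) ^ (-2 : ℝ))
      (g := memLp_one_add_norm_inv.toLp) ?_).trans (le_of_eq (by ring))
    filter_upwards [(hm t).coeFn_toLp, memLp_one_add_norm_inv.coeFn_toLp] with x h1 h2
    rw [h1, h2]
    exact hpt t x
  · rw [hB, ContinuousLinearMap.lpPairing_eq_integral]
    refine integral_congr_ae ?_
    filter_upwards [(hm t).coeFn_toLp] with x h1
    rw [h1, ContinuousLinearMap.mul_apply', mul_comm]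

/-! ### The Bessel potential -/

/-- The symbol of `J_x⁻¹`. -/
def besselSym (ξ : ℝ) : ℂ := (((1 + (2 * Real.pi * ξ) ^ 2) ^ (-(1 / 2) : ℝ) : ℝ) : ℂ)

theorem norm_besselSym (ξ : ℝ) : ‖besselSym ξ‖ = (√(1 + (2 * Real.pi * ξ) ^ 2))⁻¹ := by
  rw [besselSym, Complex.norm_real, Real.norm_of_nonneg (by positivity),
    Real.rpow_neg (by positivity), ← Real.sqrt_eq_rpow]

theorem norm_besselSym_le (ξ : ℝ) : ‖besselSym ξ‖ ≤ 1 := by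
  rw [norm_besselSym]
  refine inv_le_one_of_one_le₀ (Real.one_le_sqrt.2 ?_)
  linarith [sq_nonneg (2 * Real.pi * ξ)]

theorem norm_besselSym_mul_le (ξ : ℝ) : ‖besselSym ξ * (2 * Real.pi * Complex.I * ξ : ℂ)‖ ≤ 1 := by
  have h := norm_symbol 1 ξ
  rw [pow_one, pow_one] at h
  rw [norm_mul, norm_besselSym, h, inv_mul_le_one₀ (by positivity)]
  exact Real.abs_le_sqrt (by linarith)

theorem continuous_besselSym : Continuous besselSym := by
  unfold besselSym
  refine Complex.continuous_ofReal.comp (Continuous.rpow_const (by fun_prop) fun ξ ↦ Or.inl ?_)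
  positivity

theorem memLp_besselSym : MemLp besselSym ⊤ volume :=
  memLp_top_of_bound continuous_besselSym.aestronglyMeasurable 1 (ae_of_all _ norm_besselSym_le)

theorem memLp_besselSym_mul :
    MemLp (fun ξ : ℝ ↦ besselSym ξ * (2 * Real.pi * Complex.I * ξ : ℂ)) ⊤ volume :=
  memLp_top_of_bound (continuous_besselSym.mul (by fun_prop)).aestronglyMeasurable 1
    (ae_of_all _ norm_besselSym_mul_le)

/-- The operator `J_x⁻¹` on tempered distributions of `(x, t)`. -/
def bessel : 𝓢'(Plane, ℂ) →L[ℂ] 𝓢'(Plane, ℂ) :=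
  TemperedDistribution.fourierMultiplierCLM ℂ
    (fun ζ : Plane ↦ (((1 + (2 * Real.pi * ζ 0) ^ 2) ^ (-(1 / 2) : ℝ) : ℝ) : ℂ))

theorem integrable_bessel_mul {G : ℝ × ℝ → ℂ} (hG : Integrable G volume) :
    Integrable (fun w : ℝ × ℝ ↦ besselSym w.1 * G w) volume :=
  hG.bdd_mul (continuous_besselSym.comp continuous_fst).aestronglyMeasurable
    (ae_of_all _ fun w ↦ norm_besselSym_le w.1)

theorem bessel_iftDist {G : ℝ × ℝ → ℂ} (hG : Integrable G volume) :
    bessel (iftDist hG) = iftDist (integrable_bessel_mul hG) := by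
  refine DFunLike.ext _ _ fun φ ↦ ?_
  rw [bessel, TemperedDistribution.fourierMultiplierCLM_apply_apply, iftDist_apply, iftDist_apply,
    FourierTransform.fourierInv_fourier_eq]
  refine integral_congr_ae (ae_of_all _ fun w ↦ ?_)
  dsimp only
  rw [SchwartzMap.smulLeftCLM_apply_apply LinftyHm1_symbol_hasTemperateGrowth, smul_eq_mul,
    besselSym]
  simp only [toPlane, Matrix.cons_val_zero, PiLp.toLp_apply]
  ring

theorem slice_bessel_mul (G : ℝ × ℝ → ℂ) (t ξ : ℝ) :
    slice (fun w ↦ besselSym w.1 * G w) t ξ = besselSym ξ * slice G t ξ := by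
  unfold slice
  rw [← integral_const_mul]
  refine integral_congr_ae (ae_of_all _ fun τ ↦ ?_)
  dsimp only
  ring

/-- `J_x⁻¹` on `L²`. -/
def besselL2 : L2 →L[ℂ] L2 := fourierOp memLp_besselSym.toLp

/-- A multiplier in `ξ` acts on an inverse Fourier integral slice by slice in time. Thus `J⁻¹` of
the distribution is given at almost every time by `J⁻¹` of an `L²` function. -/
theorem IsCutoff.bessel_block {η : ℝ → ℝ} (hη : IsCutoff η) {a b : ℕ} (ha : a ≤ 3) (hb : b ≤ 3)
    (k l : ℕ) {U V : ℝ → L2} {G : ℝ × ℝ → ℂ} (hG : Integrable G volume)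
    (hrep : ∀ᵐ t : ℝ, ∀ r : ℝ, ((η t ^ 2 : ℝ) : ℂ) * (pk η a k (U t) r * pk η b l (V t) r) =
      ift G (r, t)) (φ : 𝓢(Plane, ℂ)) :
    Integrable (fun t ↦ ∫ x : ℝ, besselL2 (((η t ^ 2 : ℝ) : ℂ) •
      hη.blockL2 ha hb k l (U t) (V t)) x * φ !₂[x, t]) volume ∧
    bessel (iftDist hG) φ = ∫ t, ∫ x : ℝ, besselL2 (((η t ^ 2 : ℝ) : ℂ) •
      hη.blockL2 ha hb k l (U t) (V t)) x * φ !₂[x, t] := by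
  have hG' := integrable_bessel_mul hG
  have hae : ∀ᵐ t : ℝ, ∫ x : ℝ, ift (fun w ↦ besselSym w.1 * G w) (x, t) * φ !₂[x, t] =
      ∫ x : ℝ, besselL2 (((η t ^ 2 : ℝ) : ℂ) • hη.blockL2 ha hb k l (U t) (V t)) x *
        φ !₂[x, t] := by
    filter_upwards [hrep] with t ht
    set w : L2 := ((η t ^ 2 : ℝ) : ℂ) • hη.blockL2 ha hb k l (U t) (V t) with hw
    have h1 : 𝓕⁻ (slice G t) =ᵐ[volume] w := by
      filter_upwards [Lp.coeFn_smul ((η t ^ 2 : ℝ) : ℂ) (hη.blockL2 ha hb k l (U t) (V t)),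
        hη.blockL2_coe ha hb k l (U t) (V t)] with x h2 h3
      rw [← ift_eq_fourierInv_slice hG, ← ht x, h2, Pi.smul_apply, h3, smul_eq_mul]
    have h2 := ae_eq_fourier_of_fourierInv (integrable_slice hG t) h1
    have h3 : slice (fun w ↦ besselSym w.1 * G w) t =ᵐ[volume]
        mulOp memLp_besselSym.toLp (𝓕 w) := by
      filter_upwards [mulOp_coe memLp_besselSym (𝓕 w), h2] with ξ h4 h5
      rw [slice_bessel_mul, h4, h5]
    have h4 := fourierInv_ae_eq (integrable_slice hG' t) h3
    refine integral_congr_ae ?_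
    filter_upwards [h4] with x hx
    rw [ift_eq_fourierInv_slice hG', hx]
    rfl
  obtain ⟨h1, h2⟩ := integral_iftDist hG' φ
  rw [Measure.volume_eq_prod] at h1
  refine ⟨h1.integral_prod_right.congr hae, ?_⟩
  rw [bessel_iftDist, h2]
  exact integral_congr_ae hae

/-- The limits of the slices form a bounded measurable function with values in `L²`, and dominated
convergence in time identifies it with `J⁻¹ f`. The uniform bound is needed only from `K₀` on, since
the first partial sums mix several extensions. -/
theorem mem_LinftyHm1_of_tendsto {D : ℕ × ℕ → 𝓢'(Plane, ℂ)} {f : 𝓢'(Plane, ℂ)}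
    (hD : IsDistSum D f) {B : ℕ × ℕ → ℝ → L2} (hBm : ∀ p, AEStronglyMeasurable (B p) volume)
    (hB : ∀ p φ, Integrable (fun t ↦ ∫ x : ℝ, B p t x * φ !₂[x, t]) volume ∧
      bessel (D p) φ = ∫ t, ∫ x : ℝ, B p t x * φ !₂[x, t]) {M : ℝ} {K₀ : ℕ}
    (hbd : ∀ᵐ t : ℝ, ∀ K, K₀ ≤ K →
      ‖∑ p ∈ Finset.range (K + 1) ×ˢ Finset.range (K + 1), B p t‖ ≤ M)
    (hconv : ∀ᵐ t : ℝ, ∃ w, Tendsto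
      (fun K : ℕ ↦ ∑ p ∈ Finset.range (K + 1) ×ˢ Finset.range (K + 1), B p t) atTop (𝓝 w)) :
    f ∈ LinftyHm1 := by
  set S : ℕ → Finset (ℕ × ℕ) := fun K ↦ Finset.range (K + 1) ×ˢ Finset.range (K + 1) with hS
  set W : ℕ → ℝ → L2 := fun K t ↦ ∑ p ∈ S K, B p t with hW
  set U : ℝ → L2 := fun t ↦ limUnder atTop fun K ↦ W K t with hU
  have hlim : ∀ᵐ t : ℝ, Tendsto (fun K ↦ W K t) atTop (𝓝 (U t)) := by
    filter_upwards [hconv] with t ht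
    exact tendsto_nhds_limUnder ht
  have hWm : ∀ K, AEStronglyMeasurable (W K) volume := fun K ↦
    Finset.aestronglyMeasurable_fun_sum _ fun p _ ↦ hBm p
  have hUm : AEStronglyMeasurable U volume := aestronglyMeasurable_of_tendsto_ae atTop hWm hlim
  have hUb : ∀ᵐ t : ℝ, ‖U t‖ ≤ M := by
    filter_upwards [hlim, hbd] with t h1 h2
    exact le_of_tendsto h1.norm (eventually_atTop.2 ⟨K₀, h2⟩)
  refine ⟨U, memLp_top_of_bound hUm M hUb, fun φ ↦ ?_⟩
  obtain ⟨b, L, hb, hLb, hL⟩ := exists_testPairing φ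
  change bessel f φ = _
  have hJ : HasSum (fun p ↦ bessel (D p) φ) (bessel f φ) := by
    simp_rw [bessel, TemperedDistribution.fourierMultiplierCLM_apply_apply]
    exact hD _
  have h1 := hJ.comp tendsto_squares
  have h2 : ∀ K, ∑ p ∈ S K, bessel (D p) φ = ∫ t, L t (W K t) := fun K ↦ by
    simp_rw [hW, map_sum, hL]
    rw [integral_finsetSum _ fun p _ ↦ (hB p φ).1]
    exact Finset.sum_congr rfl fun p _ ↦ (hB p φ).2
  have hLm : ∀ K, AEStronglyMeasurable (fun t ↦ L t (W K t)) volume := fun K ↦ by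
    simp_rw [hW, map_sum, hL]
    exact Finset.aestronglyMeasurable_fun_sum _ fun p _ ↦ (hB p φ).1.1
  have h3 : Tendsto (fun K ↦ ∫ t, L t (W (K + K₀) t)) atTop (𝓝 (∫ t, L t (U t))) := by
    refine tendsto_integral_of_dominated_convergence (fun t ↦ b t * M) (fun K ↦ hLm _)
      (hb.mul_const M) (fun K ↦ ?_) ?_
    · filter_upwards [hbd] with t ht
      refine ((L t).le_opNorm _).trans ?_
      exact mul_le_mul (hLb t) (ht _ (Nat.le_add_left _ _)) (norm_nonneg _)
        ((norm_nonneg _).trans (hLb t))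
    · filter_upwards [hlim] with t ht
      exact ((L t).continuous.tendsto _).comp (ht.comp (tendsto_add_atTop_nat K₀))
  have h4 : Tendsto (fun K ↦ ∑ p ∈ S (K + K₀), bessel (D p) φ) atTop (𝓝 (bessel f φ)) :=
    h1.comp (tendsto_add_atTop_nat K₀)
  simp_rw [h2] at h4
  rw [tendsto_nhds_unique h4 h3]
  simp_rw [hL]

/-! ### Products in `L^∞(ℝ; H⁻¹)` -/

theorem MemLp.exists_ae_norm_le {U : ℝ → L2} (hU : MemLp U ⊤ volume) :
    ∃ c : ℝ, 0 ≤ c ∧ ∀ᵐ t : ℝ, ‖U t‖ ≤ c := by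
  refine ⟨(eLpNormEssSup U volume).toReal, ENNReal.toReal_nonneg, ?_⟩
  have hlt : eLpNormEssSup U volume ≠ ⊤ := by
    rw [← eLpNorm_exponent_top]
    exact hU.2.ne
  filter_upwards [enorm_ae_le_eLpNormEssSup U volume] with t ht
  rw [← toReal_enorm]
  exact ENNReal.toReal_mono hlt ht

theorem IsCutoff.memLp_block {η : ℝ → ℝ} (hη : IsCutoff η) {a b : ℕ} (ha : a ≤ 3) (hb : b ≤ 3)
    (k l : ℕ) {U V : ℝ → L2} (hU : MemLp U ⊤ volume) (hV : MemLp V ⊤ volume) :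
    MemLp (fun t ↦ hη.blockL2 ha hb k l (U t) (V t)) ⊤ volume :=
  (hη.blockL2 ha hb k l).memLp_of_bilin ⊤ hU hV

/-- From `K₀` on, the partial sums differ from those of the single pair `U₀`, `V₀` by the fixed
finite sum `E`, which is bounded in time because every block is a bounded bilinear map on `L²`. For
`U₀`, `V₀` the slices are bounded in the `H²` scale, so the partial sums converge and stay bounded.
The operator `R` is `J⁻¹` or `J⁻¹∂_x`. -/
theorem IsCutoff.mem_LinftyHm1_of_blocks {η : ℝ → ℝ} (hη : IsCutoff η) {a : ℕ} (ha : a ≤ 1)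
    (R : L2 →L[ℂ] L2) {K₀ : ℕ} {f₀ g₀ : 𝓢'(Plane, ℂ)} {U₀ V₀ : ℝ → L2} (hf₀ : Represents f₀ U₀)
    (hg₀ : Represents g₀ V₀) (hf : fNorm η 2 2 f₀ < ⊤) (hg : fNorm η 2 2 g₀ < ⊤)
    {U V : ℕ × ℕ → ℝ → L2} (hU : ∀ p, MemLp (U p) ⊤ volume) (hV : ∀ p, MemLp (V p) ⊤ volume)
    (hU₀ : ∀ p : ℕ × ℕ, ¬ (p.1 ≤ K₀ ∧ p.2 ≤ K₀) → U p = U₀)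
    (hV₀ : ∀ p : ℕ × ℕ, ¬ (p.1 ≤ K₀ ∧ p.2 ≤ K₀) → V p = V₀)
    {D : ℕ × ℕ → 𝓢'(Plane, ℂ)} {f : 𝓢'(Plane, ℂ)} (hD : IsDistSum D f)
    (hB : ∀ (p : ℕ × ℕ) (φ : 𝓢(Plane, ℂ)), Integrable (fun t ↦ ∫ x : ℝ,
        R (((η t ^ 2 : ℝ) : ℂ) • hη.blockL2 (ha.trans (show 1 ≤ 3 by norm_num))
          (show 2 ≤ 3 by norm_num) p.1 p.2 (U p t) (V p t)) x * φ !₂[x, t]) volume ∧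
      bessel (D p) φ = ∫ t, ∫ x : ℝ,
        R (((η t ^ 2 : ℝ) : ℂ) • hη.blockL2 (ha.trans (show 1 ≤ 3 by norm_num))
          (show 2 ≤ 3 by norm_num) p.1 p.2 (U p t) (V p t)) x * φ !₂[x, t]) :
    f ∈ LinftyHm1 := by
  obtain ⟨C, hC⟩ := hη.exists_tendsto_blocks
  set β : ℕ × ℕ → L2 → L2 → L2 := fun p g h ↦ hη.blockL2 (ha.trans (show 1 ≤ 3 by norm_num))
    (show 2 ≤ 3 by norm_num) p.1 p.2 g h with hβ
  set S : ℕ → Finset (ℕ × ℕ) := fun K ↦ Finset.range (K + 1) ×ˢ Finset.range (K + 1) with hS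
  have hβU : ∀ p, MemLp (fun t ↦ β p (U p t) (V p t)) ⊤ volume := fun p ↦
    hη.memLp_block _ _ p.1 p.2 (hU p) (hV p)
  have hβ₀ : ∀ p, MemLp (fun t ↦ β p (U₀ t) (V₀ t)) ⊤ volume := fun p ↦
    hη.memLp_block _ _ p.1 p.2 hf₀.1 hg₀.1
  set E : ℝ → L2 := fun t ↦ ∑ p ∈ S K₀, (β p (U p t) (V p t) - β p (U₀ t) (V₀ t)) with hE
  have hEm : MemLp E ⊤ volume := memLp_finsetSum _ fun p _ ↦ (hβU p).sub (hβ₀ p)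
  obtain ⟨c, hc0, hc⟩ := MemLp.exists_ae_norm_le hEm
  have hη0 : Continuous η := hη.smooth.continuous
  have hηc : Continuous fun t : ℝ ↦ ((η t ^ 2 : ℝ) : ℂ) := by fun_prop
  have hηn : ∀ t, ‖((η t ^ 2 : ℝ) : ℂ)‖ ≤ 1 := fun t ↦ by
    have h := hη.mem_Icc t
    rw [Complex.norm_real, Real.norm_of_nonneg (sq_nonneg _)]
    exact pow_le_one₀ h.1 h.2
  have hsum : ∀ K, K₀ ≤ K → ∀ t, ∑ p ∈ S K, R (((η t ^ 2 : ℝ) : ℂ) • β p (U p t) (V p t)) =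
      R (((η t ^ 2 : ℝ) : ℂ) • (∑ p ∈ S K, β p (U₀ t) (V₀ t) + E t)) := fun K hK t ↦ by
    rw [← map_sum, ← Finset.smul_sum]
    have hsub : S K₀ ⊆ S K := by
      intro p hp
      simp only [hS, Finset.mem_product, Finset.mem_range] at hp ⊢
      omega
    have h1 : ∑ p ∈ S K, (β p (U p t) (V p t) - β p (U₀ t) (V₀ t)) = E t := by
      refine (Finset.sum_subset hsub fun p _ hp ↦ ?_).symm
      have hp' : ¬ (p.1 ≤ K₀ ∧ p.2 ≤ K₀) := fun h ↦ hp (by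
        simp only [hS, Finset.mem_product, Finset.mem_range]
        omega)
      rw [hU₀ p hp', hV₀ p hp', sub_self]
    rw [← h1, Finset.sum_sub_distrib, add_sub_cancel]
  set X := fNorm η 2 2 f₀ with hX
  set Y := fNorm η 2 2 g₀ with hY
  have hXY : ((C : ℝ≥0∞) * (X * Y)) ≠ ⊤ :=
    ENNReal.mul_ne_top ENNReal.coe_ne_top (ENNReal.mul_ne_top hf.ne hg.ne)
  refine mem_LinftyHm1_of_tendsto hD (fun p ↦ ?_) hB
    (M := ‖R‖ * (((C : ℝ≥0∞) * (X * Y)).toReal + c)) (K₀ := K₀) ?_ ?_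
  · exact R.continuous.comp_aestronglyMeasurable
      (hηc.aestronglyMeasurable.smul (hβU p).1)
  · filter_upwards [hη.ae_seqNorm_bandNorm_le hf₀ hf, hη.ae_seqNorm_bandNorm_le hg₀ hg, hc]
      with t h1 h2 h3 K hK
    obtain ⟨-, -, hw⟩ := hC a ha (U₀ t) (V₀ t) (h1.trans_lt hf) (h2.trans_lt hg)
    have h4 := (hw K).trans (mul_le_mul_right (mul_le_mul' h1 h2) _)
    have h5 := ENNReal.toReal_mono hXY h4
    rw [toReal_enorm] at h5
    rw [hsum K hK t]
    refine (R.le_opNorm _).trans (mul_le_mul_of_nonneg_left ?_ (norm_nonneg _))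
    rw [norm_smul]
    refine (mul_le_of_le_one_left (norm_nonneg _) (hηn t)).trans ?_
    exact (norm_add_le _ _).trans (add_le_add h5 h3)
  · filter_upwards [hη.ae_seqNorm_bandNorm_le hf₀ hf, hη.ae_seqNorm_bandNorm_le hg₀ hg]
      with t h1 h2
    obtain ⟨w, hw, -⟩ := hC a ha (U₀ t) (V₀ t) (h1.trans_lt hf) (h2.trans_lt hg)
    refine ⟨R (((η t ^ 2 : ℝ) : ℂ) • (w + E t)), ?_⟩
    have h3 := (R.continuous.tendsto _).comp
      ((hw.add_const (E t)).const_smul ((η t ^ 2 : ℝ) : ℂ))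
    refine h3.congr' ?_
    filter_upwards [eventually_ge_atTop K₀] with K hK
    exact (hsum K hK t).symm

theorem IsCutoff.memLp_two_pk {η : ℝ → ℝ} (hη : IsCutoff η) {a : ℕ} (ha : a ≤ 3) (k : ℕ) (h : L2) :
    MemLp (pk η a k h) 2 volume :=
  (Lp.memLp _).ae_eq (hη.pkL2_coe ha k h).symm

/-- `J_x⁻¹ ∂_x` on `L²`. -/
def besselDerivL2 : L2 →L[ℂ] L2 := fourierOp memLp_besselSym_mul.toLp

/-- By the Leibniz rule the two blocks add up to the derivative of the third, and the derivative is
absorbed into the bounded symbol of `J⁻¹∂_x`. This is done block by block because the sum of the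
terms with a third derivative is not controlled in `L²` by `H²` norms. -/
theorem IsCutoff.bessel_deriv_block {η : ℝ → ℝ} (hη : IsCutoff η) (k l : ℕ) (g h : L2) :
    besselL2 (hη.blockL2 (show 1 ≤ 3 by norm_num) (show 2 ≤ 3 by norm_num) k l g h +
      hη.blockL2 (show 0 ≤ 3 by norm_num) (show 3 ≤ 3 by norm_num) k l g h) =
    besselDerivL2 (hη.blockL2 (show 0 ≤ 3 by norm_num) (show 2 ≤ 3 by norm_num) k l g h) := by
  set w₁ := hη.blockL2 (show 1 ≤ 3 by norm_num) (show 2 ≤ 3 by norm_num) k l g h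
  set w₂ := hη.blockL2 (show 0 ≤ 3 by norm_num) (show 3 ≤ 3 by norm_num) k l g h
  set w := hη.blockL2 (show 0 ≤ 3 by norm_num) (show 2 ≤ 3 by norm_num) k l g h
  have hd : ∀ x, HasDerivAt (fun x ↦ pk η 0 k g x * pk η 2 l h x)
      (pk η 1 k g x * pk η 2 l h x + pk η 0 k g x * pk η 3 l h x) x := fun x ↦
    (hη.hasDerivAt_pk 0 k g x).mul (hη.hasDerivAt_pk 2 l h x)
  have hd' : deriv (fun x ↦ pk η 0 k g x * pk η 2 l h x) =
      fun x ↦ pk η 1 k g x * pk η 2 l h x + pk η 0 k g x * pk η 3 l h x :=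
    funext fun x ↦ (hd x).deriv
  have hi : ∀ a b : ℕ, a ≤ 3 → b ≤ 3 → Integrable (fun x ↦ pk η a k g x * pk η b l h x) volume :=
    fun a b ha hb ↦ (hη.memLp_two_pk ha k g).integrable_mul (hη.memLp_two_pk hb l h)
  have hi' : Integrable (deriv fun x ↦ pk η 0 k g x * pk η 2 l h x) volume := by
    rw [hd']
    exact (hi 1 2 (by norm_num) (by norm_num)).add (hi 0 3 (by norm_num) (by norm_num))
  have h1 := Real.fourier_deriv (hi 0 2 (by norm_num) (by norm_num))
    (fun x ↦ (hd x).differentiableAt) hi'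
  have h2 : 𝓕 (deriv fun x ↦ pk η 0 k g x * pk η 2 l h x) =ᵐ[volume] (𝓕 (w₁ + w₂) : L2) := by
    refine fourier_ae_eq hi' ?_
    rw [hd']
    filter_upwards [Lp.coeFn_add w₁ w₂,
      hη.blockL2_coe (show 1 ≤ 3 by norm_num) (show 2 ≤ 3 by norm_num) k l g h,
      hη.blockL2_coe (show 0 ≤ 3 by norm_num) (show 3 ≤ 3 by norm_num) k l g h] with x e1 e2 e3
    rw [e1, Pi.add_apply, e2, e3]
  have h3 := fourier_ae_eq (hi 0 2 (by norm_num) (by norm_num))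
    (hη.blockL2_coe (show 0 ≤ 3 by norm_num) (show 2 ≤ 3 by norm_num) k l g h).symm
  rw [h1] at h2
  rw [besselL2, besselDerivL2, fourierOp_apply, fourierOp_apply]
  congr 1
  refine Lp.ext ?_
  filter_upwards [mulOp_coe memLp_besselSym (𝓕 (w₁ + w₂) : L2),
    mulOp_coe memLp_besselSym_mul (𝓕 w : L2), h2, h3] with ξ e1 e2 e3 e4
  rw [e1, e2, ← e3, ← e4, smul_eq_mul]
  ring

theorem IsDistSum.add {ι : Type*} {D E : ι → 𝓢'(Plane, ℂ)} {f g : 𝓢'(Plane, ℂ)}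
    (hD : IsDistSum D f) (hE : IsDistSum E g) : IsDistSum (fun i ↦ D i + E i) (f + g) :=
  fun φ ↦ (hD φ).add (hE φ)

theorem IsCutoff.bessel_deriv_blocks {η : ℝ → ℝ} (hη : IsCutoff η) (k l : ℕ) {U V : ℝ → L2}
    {G G' : ℝ × ℝ → ℂ} (hG : Integrable G volume) (hG' : Integrable G' volume)
    (hrep : ∀ᵐ t : ℝ, ∀ r : ℝ, ((η t ^ 2 : ℝ) : ℂ) * (pk η 1 k (U t) r * pk η 2 l (V t) r) =
      ift G (r, t))
    (hrep' : ∀ᵐ t : ℝ, ∀ r : ℝ, ((η t ^ 2 : ℝ) : ℂ) * (pk η 0 k (U t) r * pk η 3 l (V t) r) =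
      ift G' (r, t)) (φ : 𝓢(Plane, ℂ)) :
    Integrable (fun t ↦ ∫ x : ℝ, besselDerivL2 (((η t ^ 2 : ℝ) : ℂ) •
      hη.blockL2 (show 0 ≤ 3 by norm_num) (show 2 ≤ 3 by norm_num) k l (U t) (V t)) x *
        φ !₂[x, t]) volume ∧
    bessel (iftDist hG + iftDist hG') φ = ∫ t, ∫ x : ℝ, besselDerivL2 (((η t ^ 2 : ℝ) : ℂ) •
      hη.blockL2 (show 0 ≤ 3 by norm_num) (show 2 ≤ 3 by norm_num) k l (U t) (V t)) x *
        φ !₂[x, t] := by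
  obtain ⟨h1, h2⟩ := hη.bessel_block (show 1 ≤ 3 by norm_num) (show 2 ≤ 3 by norm_num) k l hG hrep φ
  obtain ⟨h3, h4⟩ := hη.bessel_block (show 0 ≤ 3 by norm_num) (show 3 ≤ 3 by norm_num) k l hG'
    hrep' φ
  obtain ⟨-, L, -, -, hL⟩ := exists_testPairing φ
  simp_rw [← hL] at h1 h2 h3 h4 ⊢
  have e : ∀ t, L t (besselDerivL2 (((η t ^ 2 : ℝ) : ℂ) •
      hη.blockL2 (show 0 ≤ 3 by norm_num) (show 2 ≤ 3 by norm_num) k l (U t) (V t))) =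
      L t (besselL2 (((η t ^ 2 : ℝ) : ℂ) •
        hη.blockL2 (show 1 ≤ 3 by norm_num) (show 2 ≤ 3 by norm_num) k l (U t) (V t))) +
      L t (besselL2 (((η t ^ 2 : ℝ) : ℂ) •
        hη.blockL2 (show 0 ≤ 3 by norm_num) (show 3 ≤ 3 by norm_num) k l (U t) (V t))) :=
    fun t ↦ by
      rw [← map_add, ← map_add, ← smul_add, map_smul besselL2, hη.bessel_deriv_block, map_smul]
  simp_rw [e]
  refine ⟨h1.add h3, ?_⟩
  rw [integral_add h1 h3, ← h2, ← h4, map_add]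
  rfl

/-! ### The bilinear estimate on a time slab -/

theorem pick_of_not {α : Type*} {K : ℕ} {x y z : α} {p : ℕ × ℕ} (h : ¬ (p.1 ≤ K ∧ p.2 ≤ K)) :
    pick K x y z p = z := if_neg h

theorem IsCutoff.exists_slab_products {η : ℝ → ℝ} (hη : IsCutoff η) {s : ℝ} (hs : 1 < s) :
    ∃ C : ℝ≥0, ∀ T : ℝ, T ≤ 1 → ∀ u v : ℝ → L2,
    ∀ (f₁ f₂ f₃ g₁ g₂ g₃ : 𝓢'(Plane, ℂ)) (U₁ U₂ U₃ V₁ V₂ V₃ : ℝ → L2),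
    Represents f₁ U₁ → Represents f₂ U₂ → Represents f₃ U₃ →
    Represents g₁ V₁ → Represents g₂ V₂ → Represents g₃ V₃ →
    U₁ =ᵐ[volume.restrict (Set.Icc (-T) T)] u → U₂ =ᵐ[volume.restrict (Set.Icc (-T) T)] u →
    U₃ =ᵐ[volume.restrict (Set.Icc (-T) T)] u → V₁ =ᵐ[volume.restrict (Set.Icc (-T) T)] v →
    V₂ =ᵐ[volume.restrict (Set.Icc (-T) T)] v → V₃ =ᵐ[volume.restrict (Set.Icc (-T) T)] v →
    fNorm η 2 s f₁ < ⊤ → fNorm η 2 1 f₂ < ⊤ → fNorm η 2 s f₃ < ⊤ →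
    fNorm η 2 1 g₁ < ⊤ → fNorm η 2 s g₂ < ⊤ → fNorm η 2 s g₃ < ⊤ →
    ∀ ε : ℝ≥0, 0 < ε → ∃ f g : 𝓢'(Plane, ℂ),
      (IsSlabLimit T (prodDiv η u v) f ∧ IsSlabLimit T (prodNonDiv η u v) g) ∧
      (nNorm η 2 s f ≤ C * ((fNorm η 2 s f₁ * fNorm η 2 1 g₁ + fNorm η 2 1 f₂ * fNorm η 2 s g₂) +
        ε) ∧
      nNorm η 2 s g ≤ C * ((fNorm η 2 s f₁ * fNorm η 2 1 g₁ + fNorm η 2 1 f₂ * fNorm η 2 s g₂) +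
        ε)) ∧
      (fNorm η 2 2 f₃ < ⊤ → fNorm η 2 2 g₃ < ⊤ → f ∈ LinftyHm1 ∧ g ∈ LinftyHm1) := by
  obtain ⟨C, hC⟩ := hη.exists_product hs
  refine ⟨4 * C, fun T hT u v f₁ f₂ f₃ g₁ g₂ g₃ U₁ U₂ U₃ V₁ V₂ V₃ hf₁ hf₂ hf₃ hg₁ hg₂ hg₃
    hU₁ hU₂ hU₃ hV₁ hV₂ hV₃ nf₁ nf₂ nf₃ ng₁ ng₂ ng₃ ε hε ↦ ?_⟩
  obtain ⟨K, hK⟩ := hC f₁ f₂ f₃ g₁ g₂ g₃ U₁ U₂ U₃ V₁ V₂ V₃ hf₁ hf₂ hf₃ hg₁ hg₂ hg₃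
    nf₁ nf₂ nf₃ ng₁ ng₂ ng₃ ε hε
  set Q := (fNorm η 2 s f₁ * fNorm η 2 1 g₁ + fNorm η 2 1 f₂ * fNorm η 2 s g₂) + (ε : ℝ≥0∞) with hQ
  -- The data are chosen for all pairs of orders, trivially when the sum is not three, so that they
  -- form a total family; only `(1, 2)` and `(0, 3)` are used.
  have hex : ∀ c : ℕ × ℕ, ∃ (G : ℕ × ℕ → ℝ × ℝ → ℂ) (hG : ∀ p, Integrable (G p) volume)
      (f : 𝓢'(Plane, ℂ)), c.1 + c.2 = 3 →
      (∀ p, ∀ᵐ t : ℝ, ∀ r : ℝ, ((η t ^ 2 : ℝ) : ℂ) *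
        (pk η c.1 p.1 (pick K U₁ U₂ U₃ p t) r * pk η c.2 p.2 (pick K V₁ V₂ V₃ p t) r) =
          ift (G p) (r, t)) ∧
      IsDistSum (fun p ↦ iftDist (hG p)) f ∧ nNorm η 2 s f ≤ C * Q := fun c ↦ by
    by_cases h : c.1 + c.2 = 3
    · obtain ⟨G, hG, f, hf⟩ := hK c.1 c.2 h
      exact ⟨G, hG, f, fun _ ↦ hf⟩
    · exact ⟨fun _ _ ↦ 0, fun _ ↦ integrable_zero _ _ _, 0, fun h' ↦ absurd h' h⟩
  choose G hG f hf using hex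
  have hU : ∀ p, pick K U₁ U₂ U₃ p =ᵐ[volume.restrict (Set.Icc (-T) T)] u :=
    pick_rec (C := fun U ↦ U =ᵐ[volume.restrict (Set.Icc (-T) T)] u) hU₁ hU₂ hU₃ K
  have hV : ∀ p, pick K V₁ V₂ V₃ p =ᵐ[volume.restrict (Set.Icc (-T) T)] v :=
    pick_rec (C := fun V ↦ V =ᵐ[volume.restrict (Set.Icc (-T) T)] v) hV₁ hV₂ hV₃ K
  have hUm : ∀ p, MemLp (pick K U₁ U₂ U₃ p) ⊤ volume :=
    pick_rec (C := fun U ↦ MemLp U ⊤ volume) hf₁.1 hf₂.1 hf₃.1 K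
  have hVm : ∀ p, MemLp (pick K V₁ V₂ V₃ p) ⊤ volume :=
    pick_rec (C := fun V ↦ MemLp V ⊤ volume) hg₁.1 hg₂.1 hg₃.1 K
  have h12 := hf (1, 2) rfl
  have h03 := hf (0, 3) rfl
  have hC4 : (C : ℝ≥0∞) * Q ≤ (4 * C : ℝ≥0) * Q := by
    refine mul_le_mul_left ?_ _
    exact_mod_cast le_mul_of_one_le_left' (show (1 : ℝ≥0) ≤ 4 by norm_num)
  refine ⟨f (1, 2) + f (0, 3), f (1, 2), ⟨?_, ?_⟩, ⟨?_, h12.2.2.trans hC4⟩, fun hf2 hg2 ↦ ⟨?_, ?_⟩⟩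
  · have h := hη.isSlabLimit hT {(1, 2), (0, 3)} hU hV hG (f := f) (fun c hc ↦ (hf c ?_).1)
      fun c hc ↦ (hf c ?_).2.1
    · rw [Finset.sum_pair (by simp)] at h
      convert h using 4 with K t x
      rw [hη.prodDiv_eq, Finset.sum_pair (by simp)]
    all_goals
      simp only [Finset.mem_insert, Finset.mem_singleton] at hc
      rcases hc with rfl | rfl <;> rfl
  · have h := hη.isSlabLimit hT {(1, 2)} hU hV hG (f := f) (fun c hc ↦ (hf c ?_).1)
      fun c hc ↦ (hf c ?_).2.1
    · rw [Finset.sum_singleton] at h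
      convert h using 4 with K t x
      rw [hη.prodNonDiv_eq, Finset.sum_singleton]
    all_goals
      rw [Finset.mem_singleton] at hc
      simp [hc]
  -- The factor `4` consists of the quasi-triangle constant `2` and the two Leibniz terms.
  · refine (nNorm_add_le η s _ _).trans ?_
    refine (mul_le_mul_right (add_le_add h12.2.2 h03.2.2) _).trans (le_of_eq ?_)
    rw [← two_mul, ← mul_assoc, ENNReal.coe_mul, ← mul_assoc]
    norm_num
  · refine hη.mem_LinftyHm1_of_blocks zero_le_one besselDerivL2 hf₃ hg₃ hf2 hg2 hUm hVm
      (fun p hp ↦ pick_of_not hp) (fun p hp ↦ pick_of_not hp) (h12.2.1.add h03.2.1) fun p φ ↦ ?_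
    exact hη.bessel_deriv_blocks p.1 p.2 (hG (1, 2) p) (hG (0, 3) p) (h12.1 p) (h03.1 p) φ
  · refine hη.mem_LinftyHm1_of_blocks le_rfl besselL2 hf₃ hg₃ hf2 hg2 hUm hVm
      (fun p hp ↦ pick_of_not hp) (fun p hp ↦ pick_of_not hp) h12.2.1 fun p φ ↦ ?_
    exact hη.bessel_block _ _ p.1 p.2 (hG (1, 2) p) (h12.1 p) φ

/-! ### Passing to the infimum over the extensions -/

theorem exists_extension {η : ℝ → ℝ} {s T : ℝ} {u : ℝ → L2} {c : ℝ≥0∞}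
    (h : fNormT η 2 s T u < c) : ∃ (f : 𝓢'(Plane, ℂ)) (U : ℝ → L2), Represents f U ∧
      U =ᵐ[volume.restrict (Set.Icc (-T) T)] u ∧ fNorm η 2 s f < c := by
  simp only [fNormT, iInf_lt_iff] at h
  obtain ⟨f, ⟨U, hU, hUu⟩, hf⟩ := h
  exact ⟨f, U, hU, hUu, hf⟩

theorem fNormT_mono {s t : ℝ} (h : s ≤ t) (η : ℝ → ℝ) (T : ℝ) (u : ℝ → L2) :
    fNormT η 2 s T u ≤ fNormT η 2 t T u :=
  iInf₂_mono fun f _ ↦ fNorm_mono h η f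

theorem le_of_forall_pos_perturb {N : ℝ≥0∞} {C : ℝ≥0} {x y z w : ℝ≥0∞} (hx : x < ⊤) (hy : y < ⊤)
    (hz : z < ⊤) (hw : w < ⊤)
    (h : ∀ δ : ℝ≥0, 0 < δ → N ≤ C * (((x + δ) * (y + δ) + (z + δ) * (w + δ)) + δ)) :
    N ≤ C * (x * y + z * w) := by
  lift x to ℝ≥0 using hx.ne
  lift y to ℝ≥0 using hy.ne
  lift z to ℝ≥0 using hz.ne
  lift w to ℝ≥0 using hw.ne
  have hc : Continuous fun δ : ℝ≥0 ↦
      ((C * (((x + δ) * (y + δ) + (z + δ) * (w + δ)) + δ) : ℝ≥0) : ℝ≥0∞) :=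
    ENNReal.continuous_coe.comp (by fun_prop)
  have ht := (hc.tendsto 0).mono_left (nhdsWithin_le_nhds (s := Set.Ioi 0))
  simp only [add_zero] at ht
  have h1 : N ≤ ((C * (x * y + z * w) : ℝ≥0) : ℝ≥0∞) := by
    refine ge_of_tendsto ht ?_
    filter_upwards [self_mem_nhdsWithin] with δ hδ
    exact_mod_cast h δ hδ
  exact_mod_cast h1

/-- The extensions `f₁`, `f₂`, `g₁`, `g₂` are nearly optimal up to `δ`, which tends to zero at the
end. The third pair is fixed beforehand and needs only finite norms, so its size does not enter the
constant. When membership in `LinftyHm1` is demanded it must be of finite `F^2` norm. -/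
theorem IsCutoff.exists_nNormT_le {η : ℝ → ℝ} (hη : IsCutoff η) {s : ℝ} (hs : 1 < s) :
    ∃ C : ℝ≥0, ∀ T : ℝ, T ≤ 1 → ∀ u v : ℝ → L2, MemFT η 2 s T u → MemFT η 2 s T v →
    ∀ A : Set 𝓢'(Plane, ℂ), (A = Set.univ ∨ A = LinftyHm1 ∧ MemFT η 2 2 T u ∧ MemFT η 2 2 T v) →
      nNormT η 2 s T A (prodDiv η u v) ≤ C * (fNormT η 2 s T u * fNormT η 2 1 T v +
        fNormT η 2 1 T u * fNormT η 2 s T v) ∧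
      nNormT η 2 s T A (prodNonDiv η u v) ≤ C * (fNormT η 2 s T u * fNormT η 2 1 T v +
        fNormT η 2 1 T u * fNormT η 2 s T v) := by
  obtain ⟨C, hC⟩ := hη.exists_slab_products hs
  refine ⟨C, fun T hT u v hu hv A hA ↦ ?_⟩
  have hu1 := (fNormT_mono hs.le η T u).trans_lt hu.2
  have hv1 := (fNormT_mono hs.le η T v).trans_lt hv.2
  have hbase : ∀ w : ℝ → L2, MemFT η 2 s T w → (A = LinftyHm1 → A ≠ Set.univ → MemFT η 2 2 T w) →
      ∃ (f : 𝓢'(Plane, ℂ)) (W : ℝ → L2), Represents f W ∧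
        W =ᵐ[volume.restrict (Set.Icc (-T) T)] w ∧ fNorm η 2 s f < ⊤ ∧
        (A ≠ Set.univ → fNorm η 2 2 f < ⊤) := fun w hw hw2 ↦ by
    -- An extension in the stronger of the two spaces `F^s` and `F^2` serves for both.
    by_cases h : A ≠ Set.univ ∧ s ≤ 2
    · have hA2 : A = LinftyHm1 := by
        rcases hA with h' | h'
        · exact absurd h' h.1
        · exact h'.1
      obtain ⟨f, W, h1, h2, h3⟩ := exists_extension (hw2 hA2 h.1).2
      exact ⟨f, W, h1, h2, (fNorm_mono h.2 η f).trans_lt h3, fun _ ↦ h3⟩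
    · obtain ⟨f, W, h1, h2, h3⟩ := exists_extension hw.2
      refine ⟨f, W, h1, h2, h3, fun hA' ↦ (fNorm_mono ?_ η f).trans_lt h3⟩
      by_contra hlt
      exact h ⟨hA', (not_le.1 hlt).le⟩
  obtain ⟨f₃, U₃, hf₃, hU₃, nf₃, nf₃'⟩ := hbase u hu fun _ h ↦ by
    rcases hA with h' | h'
    · exact absurd h' h
    · exact h'.2.1
  obtain ⟨g₃, V₃, hg₃, hV₃, ng₃, ng₃'⟩ := hbase v hv fun _ h ↦ by
    rcases hA with h' | h'
    · exact absurd h' h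
    · exact h'.2.2
  have key : ∀ δ : ℝ≥0, 0 < δ → ∃ f g : 𝓢'(Plane, ℂ), (f ∈ A ∧ IsSlabLimit T (prodDiv η u v) f) ∧
      (g ∈ A ∧ IsSlabLimit T (prodNonDiv η u v) g) ∧
      nNorm η 2 s f ≤ C * (((fNormT η 2 s T u + δ) * (fNormT η 2 1 T v + δ) +
        (fNormT η 2 1 T u + δ) * (fNormT η 2 s T v + δ)) + δ) ∧
      nNorm η 2 s g ≤ C * (((fNormT η 2 s T u + δ) * (fNormT η 2 1 T v + δ) +
        (fNormT η 2 1 T u + δ) * (fNormT η 2 s T v + δ)) + δ) := fun δ hδ ↦ by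
    have hδ' : (δ : ℝ≥0∞) ≠ 0 := by exact_mod_cast hδ.ne'
    obtain ⟨f₁, U₁, hf₁, hU₁, nf₁⟩ := exists_extension (ENNReal.lt_add_right hu.2.ne hδ')
    obtain ⟨f₂, U₂, hf₂, hU₂, nf₂⟩ := exists_extension (ENNReal.lt_add_right hu1.ne hδ')
    obtain ⟨g₁, V₁, hg₁, hV₁, ng₁⟩ := exists_extension (ENNReal.lt_add_right hv1.ne hδ')
    obtain ⟨g₂, V₂, hg₂, hV₂, ng₂⟩ := exists_extension (ENNReal.lt_add_right hv.2.ne hδ')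
    obtain ⟨f, g, ⟨hfl, hgl⟩, ⟨hfn, hgn⟩, hmem⟩ := hC T hT u v f₁ f₂ f₃ g₁ g₂ g₃ U₁ U₂ U₃ V₁ V₂ V₃
      hf₁ hf₂ hf₃ hg₁ hg₂ hg₃ hU₁ hU₂ hU₃ hV₁ hV₂ hV₃ (nf₁.trans_le le_top) (nf₂.trans_le le_top)
      nf₃ (ng₁.trans_le le_top) (ng₂.trans_le le_top) ng₃ δ hδ
    have hA' : f ∈ A ∧ g ∈ A := by
      by_cases h : A = Set.univ
      · rw [h]
        exact ⟨trivial, trivial⟩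
      · rcases hA with h' | h'
        · exact absurd h' h
        · rw [h'.1]
          exact hmem (nf₃' h) (ng₃' h)
    have hle : (C : ℝ≥0∞) * ((fNorm η 2 s f₁ * fNorm η 2 1 g₁ + fNorm η 2 1 f₂ * fNorm η 2 s g₂) +
        δ) ≤ C * (((fNormT η 2 s T u + δ) * (fNormT η 2 1 T v + δ) +
        (fNormT η 2 1 T u + δ) * (fNormT η 2 s T v + δ)) + δ) := by
      refine mul_le_mul_right (add_le_add (add_le_add ?_ ?_) le_rfl) _
      · exact mul_le_mul' nf₁.le ng₁.le
      · exact mul_le_mul' nf₂.le ng₂.le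
    exact ⟨f, g, ⟨hA'.1, hfl⟩, ⟨hA'.2, hgl⟩, hfn.trans hle, hgn.trans hle⟩
  constructor
  · refine le_of_forall_pos_perturb hu.2 hv1 hu1 hv.2 fun δ hδ ↦ ?_
    obtain ⟨f, -, hf, -, hn, -⟩ := key δ hδ
    exact (iInf₂_le f hf).trans hn
  · refine le_of_forall_pos_perturb hu.2 hv1 hu1 hv.2 fun δ hδ ↦ ?_
    obtain ⟨-, g, -, hg, -, hn⟩ := key δ hδ
    exact (iInf₂_le g hg).trans hn

end ShortTime

end

theorem proposition4p1 (η : ℝ → ℝ) (hη : ShortTime.IsCutoff η) (s : ℝ) (hs : 1 < s) :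
    ∃ C : ℝ≥0, ∀ T : ℝ, 0 < T → T ≤ 1 → ∀ u v : ℝ → ShortTime.L2,
      ShortTime.MemFT η 2 s T u → ShortTime.MemFT η 2 s T v →
      (ShortTime.nNormT η 2 s T Set.univ (ShortTime.prodDiv η u v) ≤
          C * (ShortTime.fNormT η 2 s T u * ShortTime.fNormT η 2 1 T v +
            ShortTime.fNormT η 2 1 T u * ShortTime.fNormT η 2 s T v) ∧
        ShortTime.nNormT η 2 s T Set.univ (ShortTime.prodNonDiv η u v) ≤
          C * (ShortTime.fNormT η 2 s T u * ShortTime.fNormT η 2 1 T v +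
            ShortTime.fNormT η 2 1 T u * ShortTime.fNormT η 2 s T v)) ∧
      (ShortTime.MemFT η 2 2 T u → ShortTime.MemFT η 2 2 T v →
        ShortTime.nNormT η 2 s T ShortTime.LinftyHm1 (ShortTime.prodDiv η u v) ≤
          C * (ShortTime.fNormT η 2 s T u * ShortTime.fNormT η 2 1 T v +
            ShortTime.fNormT η 2 1 T u * ShortTime.fNormT η 2 s T v) ∧
        ShortTime.nNormT η 2 s T ShortTime.LinftyHm1 (ShortTime.prodNonDiv η u v) ≤
          C * (ShortTime.fNormT η 2 s T u * ShortTime.fNormT η 2 1 T v +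
            ShortTime.fNormT η 2 1 T u * ShortTime.fNormT η 2 s T v)) := by
  obtain ⟨C, hC⟩ := hη.exists_nNormT_le hs
  refine ⟨C, fun T _ hT u v hu hv ↦ ⟨?_, fun hu2 hv2 ↦ ?_⟩⟩
  · exact hC T hT u v hu hv Set.univ (Or.inl rfl)
  · exact hC T hT u v hu hv ShortTime.LinftyHm1 (Or.inr ⟨rfl, hu2, hv2⟩)
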